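/- Conventions. All rings are commutative. A $\mathbb Z$-graded super line over $R$ is an invertible $R$-module $\mathcal L$ with a locally constant degree $v:\operatorname{Spec}R\to\mathbb Z$; such lines are multiplied by tensoring the modules and adding the degrees, the unit is $1_R=(R,0)$, isomorphisms are $R$-linear and preserve degrees, and the commutativity constraint $\mathcal L\cdot\mathcal L'\cong\mathcal L'\cdot\mathcal L$ is $a\otimes b\mapsto(-1)^{v v'}\,b\otimes a$. Write $\mathcal L/\mathcal L'=\mathcal L\otimes\mathcal L'^{-1}$. For a projective $R$-module $M$ of finite rank (i.e. finitely generated), $\det M$ is its top exterior power, placed in degree $\operatorname{rk}M$. For projective $R$-modules $M,N$, not necessarily finitely generated, an asymptotic morphism $f^\infty:N\to M$ is the class of an $R$-linear map $f:N\to M$ modulo the maps whose image is contained in a finitely generated submodule of $M$; asymptotic morphisms can be composed, and added by direct sum, and invertibility is meant with respect to this composition. **Proposition 2.7.** There is a structure, unique up to a unique isomorphism, consisting of the following data for all commutative rings $R$: (i) for all projective $R$-modules $M,N$ and every invertible asymptotic morphism $f^\infty:N\to M$, a $\mathbb Z$-graded super line $\det(M,N,f^\infty)$, together with associative composition isomorphisms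 $$\det(L,M,g^\infty)\cdot\det(M,N,f^\infty)\xrightarrow{\sim}\det(L,N,g^\infty f^\infty);$$ (ii) for every isomorphism $f:N\xrightarrow{\sim}M$ of projective modules, a trivialization $\det f:1_R\xrightarrow{\sim}\det(M,N,f^\infty)$, compatible with the composition of isomorphisms via (i); (iii) isomorphisms $$\det(M_1,N_1,f_1^\infty)\cdot\det(M_2,N_2,f_2^\infty)\xrightarrow{\sim}\det(M_1\oplus M_2,N_1\oplus N_2,f_1^\infty\oplus f_2^\infty),$$ compatible with the associativity, commutativity and unit constraints (so that they extend to all finite families, including the empty one) and with the isomorphisms in (i) and (ii); (iv) for $M,N$ projective of finite rank, an isomorphism of $\mathbb Z$-graded super lines $\det(M,N,f^\infty)\cong\det M/\det N$, under which (i) becomes the cancellation $(\det L/\det M)\cdot(\det M/\det N)\cong\det L/\det N$, the trivialization in (ii) becomes the usual determinant $\det f:\det N\xrightarrow{\sim}\det M$ of an isomorphism, and (iii) becomes the isomorphism induced by $\det M_1\cdot\det M_2\cong\det(M_1\oplus M_2)$, $a\otimes b\mapsto a\wedge b$, and the commutativity constraint; (v) for every ring homomorphism $R\to R'$, base change isomorphisms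 $$R'\otimes_R\det(M,N,f^\infty)\xrightarrow{\sim}\det(R'\otimes_RM,\,R'\otimes_RN,\,R'\otimes_Rf^\infty),$$ transitive in $R\to R'\to R''$ and compatible with (i)–(iv). Uniqueness means: for any two such structures there is exactly one family of isomorphisms of $\mathbb Z$-graded super lines between their lines $\det(M,N,f^\infty)$ which is compatible with all the isomorphisms in (i)–(v). -/

import Mathlib

open scoped TensorProduct

universe u

noncomputable section

namespace RelDet

/-! ### Projective modules and asymptotic morphisms -/

/-- A projective module over `R` (of arbitrary, possibly infinite, rank). -/
structure ProjMod (R : Type u) [CommRing R] where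
  carrier : Type u
  [addCommGroup : AddCommGroup carrier]
  [module : Module R carrier]
  [projective : Module.Projective R carrier]

attribute [instance] ProjMod.addCommGroup ProjMod.module ProjMod.projective

instance {R : Type u} [CommRing R] : CoeSort (ProjMod R) (Type u) := ⟨ProjMod.carrier⟩

/-- The direct sum of two projective modules. -/
abbrev ProjMod.prod {R : Type u} [CommRing R] (M N : ProjMod R) : ProjMod R :=
  { carrier := M × N }

/-- The zero module. -/
abbrev ProjMod.zero (R : Type u) [CommRing R] : ProjMod R :=
  { carrier := PUnit.{u + 1} }

/-- The base change of a projective module along `R → R'`. -/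
abbrev ProjMod.baseChange {R : Type u} [CommRing R] (R' : Type u) [CommRing R'] [Algebra R R']
    (M : ProjMod R) : ProjMod R' :=
  { carrier := R' ⊗[R] M }

section Asymptotic

variable {R : Type u} [CommRing R]

/-- The morphisms whose image is contained in a finitely generated submodule. -/
def finiteHom (N M : ProjMod R) : Submodule R (N →ₗ[R] M) where
  carrier := {f | ∃ T : Submodule R M, T.FG ∧ LinearMap.range f ≤ T}
  zero_mem' := ⟨⊥, Submodule.fg_bot, by simp⟩
  add_mem' := by
    rintro f g ⟨T, hT, hf⟩ ⟨T', hT', hg⟩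
    refine ⟨T ⊔ T', hT.sup hT', ?_⟩
    rintro _ ⟨x, rfl⟩
    exact Submodule.add_mem_sup (hf ⟨x, rfl⟩) (hg ⟨x, rfl⟩)
  smul_mem' := by
    rintro r f ⟨T, hT, hf⟩
    refine ⟨T, hT, ?_⟩
    rintro _ ⟨x, rfl⟩
    exact T.smul_mem r (hf ⟨x, rfl⟩)

/-- Asymptotic morphisms `N → M`: morphisms modulo those with image in a finitely generated
submodule. -/
abbrev AsymHom (N M : ProjMod R) : Type u := (N →ₗ[R] M) ⧸ finiteHom N M

/-- The asymptotic morphism `f^∞` of a morphism `f`. -/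
abbrev AsymHom.mk {N M : ProjMod R} (f : N →ₗ[R] M) : AsymHom N M := Submodule.Quotient.mk f

lemma AsymHom.mk_eq {N M : ProjMod R} {f g : N →ₗ[R] M} :
    AsymHom.mk f = AsymHom.mk g ↔ f - g ∈ finiteHom N M :=
  Submodule.Quotient.eq _

lemma finiteHom_comp_left {N M L : ProjMod R} {f : N →ₗ[R] M} (hf : f ∈ finiteHom N M)
    (g : M →ₗ[R] L) : g ∘ₗ f ∈ finiteHom N L := by
  obtain ⟨T, hT, hf⟩ := hf
  refine ⟨T.map g, hT.map g, ?_⟩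
  rw [LinearMap.range_comp]
  exact Submodule.map_mono hf

lemma finiteHom_comp_right {N M L : ProjMod R} {g : M →ₗ[R] L} (hg : g ∈ finiteHom M L)
    (f : N →ₗ[R] M) : g ∘ₗ f ∈ finiteHom N L := by
  obtain ⟨T, hT, hg⟩ := hg
  exact ⟨T, hT, (LinearMap.range_comp_le_range f g).trans hg⟩

lemma finiteHom_prodMap {N₁ M₁ N₂ M₂ : ProjMod R} {f₁ : N₁ →ₗ[R] M₁} {f₂ : N₂ →ₗ[R] M₂}
    (h₁ : f₁ ∈ finiteHom N₁ M₁) (h₂ : f₂ ∈ finiteHom N₂ M₂) :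
    (f₁.prodMap f₂ : N₁.prod N₂ →ₗ[R] M₁.prod M₂) ∈ finiteHom (N₁.prod N₂) (M₁.prod M₂) := by
  obtain ⟨T₁, hT₁, h₁⟩ := h₁
  obtain ⟨T₂, hT₂, h₂⟩ := h₂
  refine ⟨T₁.prod T₂, hT₁.prod hT₂, ?_⟩
  rintro _ ⟨x, rfl⟩
  exact ⟨h₁ ⟨x.1, rfl⟩, h₂ ⟨x.2, rfl⟩⟩

lemma finiteHom_baseChange (R' : Type u) [CommRing R'] [Algebra R R'] {N M : ProjMod R}
    {f : N →ₗ[R] M} (hf : f ∈ finiteHom N M) :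
    (f.baseChange R' : N.baseChange R' →ₗ[R'] M.baseChange R') ∈
      finiteHom (N.baseChange R') (M.baseChange R') := by
  obtain ⟨T, hT, hf⟩ := hf
  have hT' : (T.baseChange R').FG := by
    classical
    obtain ⟨S, rfl⟩ := hT
    exact ⟨S.image (TensorProduct.mk R R' M 1), by simp [Submodule.baseChange_span]⟩
  refine ⟨T.baseChange R', hT', ?_⟩
  rintro _ ⟨x, rfl⟩
  induction x using TensorProduct.induction_on with
  | zero => simp
  | tmul r x =>
    rw [LinearMap.baseChange_tmul]
    exact Submodule.tmul_mem_baseChange_of_mem r (hf ⟨x, rfl⟩)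
  | add x y hx hy => rw [map_add]; exact add_mem hx hy

/-- Composition of asymptotic morphisms. -/
def AsymHom.comp {N M L : ProjMod R} (g : AsymHom M L) (f : AsymHom N M) : AsymHom N L :=
  Quotient.liftOn₂ g f (fun g f => AsymHom.mk (g ∘ₗ f)) (by
    intro g f g' f' hg hf
    rw [← Quotient.eq_iff_equiv] at hg hf
    have hg : g - g' ∈ finiteHom M L := AsymHom.mk_eq.1 hg
    have hf : f - f' ∈ finiteHom N M := AsymHom.mk_eq.1 hf
    refine AsymHom.mk_eq.2 ?_
    have : g ∘ₗ f - g' ∘ₗ f' = (g - g') ∘ₗ f + g' ∘ₗ (f - f') := by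
      ext x; simp
    rw [this]
    exact add_mem (finiteHom_comp_right hg f) (finiteHom_comp_left hf g'))

/-- The direct sum of asymptotic morphisms. -/
def AsymHom.prod {N₁ M₁ N₂ M₂ : ProjMod R} (f₁ : AsymHom N₁ M₁) (f₂ : AsymHom N₂ M₂) :
    AsymHom (N₁.prod N₂) (M₁.prod M₂) :=
  Quotient.liftOn₂ f₁ f₂
    (fun f₁ f₂ => AsymHom.mk (N := N₁.prod N₂) (M := M₁.prod M₂) (f₁.prodMap f₂)) (by
    intro g f g' f' hg hf
    rw [← Quotient.eq_iff_equiv] at hg hf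
    have hg : g - g' ∈ finiteHom N₁ M₁ := AsymHom.mk_eq.1 hg
    have hf : f - f' ∈ finiteHom N₂ M₂ := AsymHom.mk_eq.1 hf
    exact AsymHom.mk_eq.2 (finiteHom_prodMap hg hf))

/-- The base change of an asymptotic morphism. -/
def AsymHom.baseChange (R' : Type u) [CommRing R'] [Algebra R R'] {N M : ProjMod R}
    (f : AsymHom N M) : AsymHom (N.baseChange R') (M.baseChange R') :=
  Quotient.liftOn f
    (fun f => AsymHom.mk (N := N.baseChange R') (M := M.baseChange R') (f.baseChange R')) (by
    intro f f' hf
    rw [← Quotient.eq_iff_equiv] at hf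
    have hf : f - f' ∈ finiteHom N M := AsymHom.mk_eq.1 hf
    refine AsymHom.mk_eq.2 ?_
    rw [← LinearMap.baseChange_sub]
    exact finiteHom_baseChange R' hf)

/-- An invertible asymptotic morphism `N → M`. -/
@[ext]
structure AsympIso (N M : ProjMod R) where
  hom : AsymHom N M
  exists_inv : ∃ g : AsymHom M N,
    g.comp hom = AsymHom.mk LinearMap.id ∧ hom.comp g = AsymHom.mk LinearMap.id

lemma AsymHom.comp_assoc {N M L K : ProjMod R} (h : AsymHom L K) (g : AsymHom M L)
    (f : AsymHom N M) : (h.comp g).comp f = h.comp (g.comp f) := by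
  induction h using Quotient.inductionOn
  induction g using Quotient.inductionOn
  induction f using Quotient.inductionOn
  rfl

lemma AsymHom.id_comp {N M : ProjMod R} (f : AsymHom N M) :
    AsymHom.comp (AsymHom.mk LinearMap.id) f = f := by
  induction f using Quotient.inductionOn
  rfl

lemma AsymHom.prod_comp {N₁ M₁ L₁ N₂ M₂ L₂ : ProjMod R} (g₁ : AsymHom M₁ L₁) (f₁ : AsymHom N₁ M₁)
    (g₂ : AsymHom M₂ L₂) (f₂ : AsymHom N₂ M₂) :
    (g₁.comp f₁).prod (g₂.comp f₂) = (g₁.prod g₂).comp (f₁.prod f₂) := by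
  induction g₁ using Quotient.inductionOn
  induction f₁ using Quotient.inductionOn
  induction g₂ using Quotient.inductionOn
  induction f₂ using Quotient.inductionOn
  rfl

lemma AsymHom.baseChange_comp (R' : Type u) [CommRing R'] [Algebra R R'] {N M L : ProjMod R}
    (g : AsymHom M L) (f : AsymHom N M) :
    (g.comp f).baseChange R' = (g.baseChange R').comp (f.baseChange R') := by
  induction g using Quotient.inductionOn with | _ g
  induction f using Quotient.inductionOn with | _ f
  exact congrArg (AsymHom.mk (N := N.baseChange R') (M := L.baseChange R'))
    (LinearMap.baseChange_comp f g)

/-- The invertible asymptotic morphism of a genuine isomorphism. -/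
def AsympIso.ofEquiv {N M : ProjMod R} (e : N ≃ₗ[R] M) : AsympIso N M where
  hom := AsymHom.mk e.toLinearMap
  exists_inv := ⟨AsymHom.mk e.symm.toLinearMap,
    congrArg AsymHom.mk (by ext; simp), congrArg AsymHom.mk (by ext; simp)⟩

/-- Composition of invertible asymptotic morphisms. -/
def AsympIso.comp {N M L : ProjMod R} (g : AsympIso M L) (f : AsympIso N M) : AsympIso N L where
  hom := g.hom.comp f.hom
  exists_inv := by
    obtain ⟨g', hg, hg'⟩ := g.exists_inv
    obtain ⟨f', hf, hf'⟩ := f.exists_inv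
    refine ⟨f'.comp g', ?_, ?_⟩
    · rw [AsymHom.comp_assoc, ← AsymHom.comp_assoc g', hg, AsymHom.id_comp, hf]
    · rw [AsymHom.comp_assoc, ← AsymHom.comp_assoc f.hom, hf', AsymHom.id_comp, hg']

/-- Direct sum of invertible asymptotic morphisms. -/
def AsympIso.prod {N₁ M₁ N₂ M₂ : ProjMod R} (f₁ : AsympIso N₁ M₁) (f₂ : AsympIso N₂ M₂) :
    AsympIso (N₁.prod N₂) (M₁.prod M₂) where
  hom := f₁.hom.prod f₂.hom
  exists_inv := by
    obtain ⟨g₁, h₁, h₁'⟩ := f₁.exists_inv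
    obtain ⟨g₂, h₂, h₂'⟩ := f₂.exists_inv
    refine ⟨g₁.prod g₂, ?_, ?_⟩
    · rw [← AsymHom.prod_comp, h₁, h₂]; rfl
    · rw [← AsymHom.prod_comp, h₁', h₂']; rfl

/-- Base change of an invertible asymptotic morphism. -/
def AsympIso.baseChange (R' : Type u) [CommRing R'] [Algebra R R'] {N M : ProjMod R}
    (f : AsympIso N M) : AsympIso (N.baseChange R') (M.baseChange R') where
  hom := f.hom.baseChange R'
  exists_inv := by
    obtain ⟨g, h, h'⟩ := f.exists_inv
    refine ⟨g.baseChange R', ?_, ?_⟩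
    · rw [← AsymHom.baseChange_comp, h]
      exact congrArg AsymHom.mk (LinearMap.baseChange_id)
    · rw [← AsymHom.baseChange_comp, h']
      exact congrArg AsymHom.mk (LinearMap.baseChange_id)

lemma AsympIso.comp_assoc {N M L K : ProjMod R} (h : AsympIso L K) (g : AsympIso M L)
    (f : AsympIso N M) : h.comp (g.comp f) = (h.comp g).comp f :=
  AsympIso.ext (AsymHom.comp_assoc _ _ _).symm

lemma AsympIso.ofEquiv_trans {N M L : ProjMod R} (e : N ≃ₗ[R] M) (e' : M ≃ₗ[R] L) :
    AsympIso.ofEquiv (e.trans e') = (AsympIso.ofEquiv e').comp (AsympIso.ofEquiv e) := rfl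

lemma AsympIso.prod_comp {N₁ M₁ L₁ N₂ M₂ L₂ : ProjMod R} (g₁ : AsympIso M₁ L₁)
    (f₁ : AsympIso N₁ M₁) (g₂ : AsympIso M₂ L₂) (f₂ : AsympIso N₂ M₂) :
    (g₁.comp f₁).prod (g₂.comp f₂) = (g₁.prod g₂).comp (f₁.prod f₂) :=
  AsympIso.ext (AsymHom.prod_comp _ _ _ _)

lemma AsympIso.prod_ofEquiv {N₁ M₁ N₂ M₂ : ProjMod R} (e₁ : N₁ ≃ₗ[R] M₁) (e₂ : N₂ ≃ₗ[R] M₂) :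
    (AsympIso.ofEquiv e₁).prod (AsympIso.ofEquiv e₂) =
      AsympIso.ofEquiv (N := N₁.prod N₂) (M := M₁.prod M₂) (e₁.prodCongr e₂) := rfl

lemma AsympIso.baseChange_comp (R' : Type u) [CommRing R'] [Algebra R R'] {N M L : ProjMod R}
    (g : AsympIso M L) (f : AsympIso N M) :
    (g.comp f).baseChange R' = (g.baseChange R').comp (f.baseChange R') :=
  AsympIso.ext (AsymHom.baseChange_comp R' _ _)

lemma AsympIso.baseChange_ofEquiv (R' : Type u) [CommRing R'] [Algebra R R'] {N M : ProjMod R}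
    (e : N ≃ₗ[R] M) :
    (AsympIso.ofEquiv e).baseChange R' =
      AsympIso.ofEquiv (N := N.baseChange R') (M := M.baseChange R') (e.baseChange R R' N M) :=
  rfl

end Asymptotic

/-! ### `ℤ`-graded super lines -/

/-- The idempotent of `R` equal to `1` on the clopen set `U` and to `0` off it. -/
def idem {R : Type u} [CommRing R] (U : TopologicalSpace.Clopens (PrimeSpectrum R)) : R :=
  (PrimeSpectrum.isIdempotentElemEquivClopens.symm U).1

lemma basicOpen_idem {R : Type u} [CommRing R] (U : TopologicalSpace.Clopens (PrimeSpectrum R)) :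
    PrimeSpectrum.basicOpen (idem U) = U.toOpens :=
  PrimeSpectrum.basicOpen_isIdempotentElemEquivClopens_symm U

lemma mem_clopen_iff {R : Type u} [CommRing R]
    (U : TopologicalSpace.Clopens (PrimeSpectrum R)) (p : PrimeSpectrum R) :
    p ∈ U ↔ idem U ∉ p.asIdeal := by
  rw [← PrimeSpectrum.mem_basicOpen, basicOpen_idem]
  rfl

lemma isIdempotentElem_idem {R : Type u} [CommRing R]
    (U : TopologicalSpace.Clopens (PrimeSpectrum R)) : IsIdempotentElem (idem U) :=
  (PrimeSpectrum.isIdempotentElemEquivClopens.symm U).2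

/-- An idempotent is determined by its support. -/
lemma eq_idem {R : Type u} [CommRing R] {e : R} (he : IsIdempotentElem e)
    (U : TopologicalSpace.Clopens (PrimeSpectrum R)) (h : ∀ p, p ∈ U ↔ e ∉ p.asIdeal) :
    e = idem U := by
  have : PrimeSpectrum.isIdempotentElemEquivClopens.symm U = ⟨e, he⟩ := by
    rw [OrderIso.symm_apply_eq]
    ext p
    exact h p
  rw [idem, this]

/-- The clopen set on which a locally constant function takes values in `s`. -/
def clopenOf {R : Type u} [CommRing R] (v : LocallyConstant (PrimeSpectrum R) ℤ) (s : Set ℤ) :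
    TopologicalSpace.Clopens (PrimeSpectrum R) :=
  ⟨v ⁻¹' s, ⟨⟨v.isLocallyConstant sᶜ⟩, v.isLocallyConstant s⟩⟩

/-- The sign `(-1)^v ∈ R` of a locally constant function `v : Spec R → ℤ`: it is `-1` where `v`
is odd and `1` where `v` is even. -/
def sgn {R : Type u} [CommRing R] (v : LocallyConstant (PrimeSpectrum R) ℤ) : R :=
  1 - 2 * idem (clopenOf v {n | Odd n})

/-- A `ℤ`-graded super line over `R`: an invertible `R`-module with a locally constant degree
`Spec R → ℤ`. Its parity is the degree modulo 2, so that the commutativity constraint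
`L ⊗ L' ≅ L' ⊗ L` is `x ⊗ y ↦ sgn (L.deg * L'.deg) • (y ⊗ x)`. -/
structure ZLine (R : Type u) [CommRing R] where
  carrier : Type u
  [addCommGroup : AddCommGroup carrier]
  [module : Module R carrier]
  [invertible : Module.Invertible R carrier]
  deg : LocallyConstant (PrimeSpectrum R) ℤ

attribute [instance] ZLine.addCommGroup ZLine.module ZLine.invertible

instance {R : Type u} [CommRing R] : CoeSort (ZLine R) (Type u) := ⟨ZLine.carrier⟩

/-- The unit object `1_R`. -/
abbrev ZLine.unit (R : Type u) [CommRing R] : ZLine R where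
  carrier := R
  deg := 0

/-- The product `L · L'`. -/
abbrev ZLine.tensor {R : Type u} [CommRing R] (L L' : ZLine R) : ZLine R where
  carrier := L ⊗[R] L'
  deg := L.deg + L'.deg

/-- The pullback of a locally constant function along `Spec R' → Spec R`. -/
def pullback {R : Type u} [CommRing R] (R' : Type u) [CommRing R'] [Algebra R R']
    (v : LocallyConstant (PrimeSpectrum R) ℤ) : LocallyConstant (PrimeSpectrum R') ℤ :=
  v.comap ⟨PrimeSpectrum.comap (algebraMap R R'), PrimeSpectrum.continuous_comap _⟩

/-- The base change of a `ℤ`-graded super line. -/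
abbrev ZLine.baseChange {R : Type u} [CommRing R] (R' : Type u) [CommRing R'] [Algebra R R']
    (L : ZLine R) : ZLine R' where
  carrier := R' ⊗[R] L
  deg := pullback R' L.deg

/-- Isomorphisms of `ℤ`-graded super lines. -/
@[ext]
structure ZLine.Iso {R : Type u} [CommRing R] (L L' : ZLine R) where
  toEquiv : L ≃ₗ[R] L'
  deg_eq : L.deg = L'.deg

instance {R : Type u} [CommRing R] (L L' : ZLine R) :
    CoeFun (ZLine.Iso L L') (fun _ => L → L') := ⟨fun e => e.toEquiv⟩

/-! ### Determinants of projective modules of finite rank -/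

section FiniteDet

variable {R : Type u} [CommRing R]

/-- The rank of a finitely generated projective module, as a locally constant function. -/
def rk (M : ProjMod R) [Module.Finite R M] : LocallyConstant (PrimeSpectrum R) ℤ where
  toFun p := (Module.rankAtStalk (R := R) M p : ℤ)
  isLocallyConstant :=
    haveI := Module.finitePresentation_of_projective R M
    (Module.isLocallyConstant_rankAtStalk (R := R) (M := M)).comp (fun n : ℕ => (n : ℤ))

lemma map_mem_exteriorPower {M N : Type u} [AddCommGroup M] [Module R M] [AddCommGroup N]
    [Module R N] (f : M →ₗ[R] N) {n : ℕ} {ω : ExteriorAlgebra R M} (h : ω ∈ ⋀[R]^n M) :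
    ExteriorAlgebra.map f ω ∈ ⋀[R]^n N := by
  rw [← ExteriorAlgebra.ιMulti_span_fixedDegree] at h
  induction h using Submodule.span_induction with
  | mem x hx =>
    obtain ⟨v, rfl⟩ := hx
    rw [ExteriorAlgebra.map_apply_ιMulti]
    exact ExteriorAlgebra.ιMulti_range R n ⟨_, rfl⟩
  | zero => simp
  | add x y _ _ hx hy => rw [map_add]; exact add_mem hx hy
  | smul r x _ hx => rw [map_smul]; exact Submodule.smul_mem _ r hx

/-- The ring map `⋀ M → ⋀ (R' ⊗ M)` of exterior algebras over `R` and `R'`, induced by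
`m ↦ 1 ⊗ m`. -/
def extBaseChange (R' : Type u) [CommRing R'] [Algebra R R'] (M : Type u) [AddCommGroup M]
    [Module R M] : ExteriorAlgebra R M →ₐ[R] ExteriorAlgebra R' (R' ⊗[R] M) :=
  ExteriorAlgebra.lift R
    ⟨((ExteriorAlgebra.ι R').restrictScalars R) ∘ₗ TensorProduct.mk R R' M 1, by simp⟩

lemma extBaseChange_ι (R' : Type u) [CommRing R'] [Algebra R R'] (M : Type u) [AddCommGroup M]
    [Module R M] (m : M) :
    extBaseChange R' M (ExteriorAlgebra.ι R m) = ExteriorAlgebra.ι R' ((1 : R') ⊗ₜ[R] m) := by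
  rw [extBaseChange, ExteriorAlgebra.lift_ι_apply]
  rfl

lemma extBaseChange_mem (R' : Type u) [CommRing R'] [Algebra R R'] {M : Type u} [AddCommGroup M]
    [Module R M] {n : ℕ} {ω : ExteriorAlgebra R M} (h : ω ∈ ⋀[R]^n M) :
    extBaseChange R' M ω ∈ ⋀[R']^n (R' ⊗[R] M) := by
  rw [← ExteriorAlgebra.ιMulti_span_fixedDegree] at h
  induction h using Submodule.span_induction with
  | mem x hx =>
    obtain ⟨v, rfl⟩ := hx
    refine ExteriorAlgebra.ιMulti_range R' n ⟨fun i => 1 ⊗ₜ v i, ?_⟩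
    rw [ExteriorAlgebra.ιMulti_apply, ExteriorAlgebra.ιMulti_apply, map_list_prod, List.map_ofFn]
    congr 2
    funext i
    exact (extBaseChange_ι R' M (v i)).symm
  | zero => simp
  | add x y _ _ hx hy => rw [map_add]; exact add_mem hx hy
  | smul r x _ hx =>
    rw [map_smul, ← algebraMap_smul R' r]
    exact Submodule.smul_mem _ _ hx

/-- The top exterior power of a finitely generated projective module `M`: those `ω` in the exterior
algebra whose restriction to the locus where `M` has rank `n` lies in the `n`-th exterior power,
for every `n`. -/
def detTop (M : ProjMod R) [Module.Finite R M] : Submodule R (ExteriorAlgebra R M) where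
  carrier := {ω | ∀ n : ℕ, idem (clopenOf (rk M) {(n : ℤ)}) • ω ∈ ⋀[R]^n M}
  zero_mem' n := by simp
  add_mem' := by
    intro a b ha hb n
    rw [smul_add]
    exact add_mem (ha n) (hb n)
  smul_mem' := by
    intro r a ha n
    rw [smul_comm]
    exact Submodule.smul_mem _ r (ha n)

/-- The isomorphism `det N → det M` induced by an isomorphism `N → M`. -/
def detMap {N M : ProjMod R} [Module.Finite R N] [Module.Finite R M] (e : N ≃ₗ[R] M) :
    detTop N →ₗ[R] detTop M :=
  (ExteriorAlgebra.map e.toLinearMap).toLinearMap.restrict (by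
    intro ω hω n
    have hrk : rk M = rk N := by
      ext p
      exact congrArg (fun k : ℕ => (k : ℤ)) (congrFun (Module.rankAtStalk_eq_of_equiv e.symm) p)
    rw [hrk, ← map_smul]
    exact map_mem_exteriorPower _ (hω n))

/-- The natural map `det M → det (R' ⊗ M)`. -/
def detBaseChange (R' : Type u) [CommRing R'] [Algebra R R'] (M : ProjMod R) [Module.Finite R M] :
    detTop M →ₗ[R] (detTop (M.baseChange R')).restrictScalars R :=
  (extBaseChange R' M).toLinearMap.restrict (by
    intro ω hω n
    have he : idem (clopenOf (rk (M.baseChange R')) {(n : ℤ)}) =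
        algebraMap R R' (idem (clopenOf (rk M) {(n : ℤ)})) := by
      refine (eq_idem ((isIdempotentElem_idem _).map _) _ fun p => ?_).symm
      have h := mem_clopen_iff (clopenOf (rk M) {(n : ℤ)}) (p.comap (algebraMap R R'))
      refine Iff.trans ?_ h
      change rk (M.baseChange R') p = n ↔ rk M (p.comap (algebraMap R R')) = n
      have : rk (M.baseChange R') p = rk M (p.comap (algebraMap R R')) :=
        congrArg (fun k : ℕ => (k : ℤ)) (Module.rankAtStalk_baseChange p)
      rw [this]
    rw [he, algebraMap_smul]
    exact (map_smul (extBaseChange R' M) _ ω).symm ▸ extBaseChange_mem R' (hω n))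

lemma wedge_mem {M₁ M₂ : ProjMod R} [Module.Finite R M₁] [Module.Finite R M₂]
    {a : ExteriorAlgebra R M₁} {b : ExteriorAlgebra R M₂} (ha : a ∈ detTop M₁)
    (hb : b ∈ detTop M₂) :
    ExteriorAlgebra.map (LinearMap.inl R M₁ M₂) a * ExteriorAlgebra.map (LinearMap.inr R M₁ M₂) b ∈
      detTop (M₁.prod M₂) := by
  intro n
  set y := ExteriorAlgebra.map (LinearMap.inl R M₁ M₂) a *
    ExteriorAlgebra.map (LinearMap.inr R M₁ M₂) b with hy
  set e := idem (clopenOf (rk (M₁.prod M₂)) {(n : ℤ)}) with he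
  have hrk : ∀ p, rk (M₁.prod M₂) p = rk M₁ p + rk M₂ p := fun p =>
    (congrArg (fun k : ℕ => (k : ℤ)) (congrFun (Module.rankAtStalk_prod (R := R) M₁ M₂) p)).trans
      (Nat.cast_add _ _)
  let S : Submodule R (ExteriorAlgebra R (M₁ × M₂)) := ⋀[R]^n (M₁ × M₂)
  let I : Ideal R := S.comap (LinearMap.toSpanSingleton R _ (e • y))
  suffices h : (1 : R) ∈ I by simpa [I] using h
  suffices h : I = ⊤ by rw [h]; trivial
  by_contra hI
  obtain ⟨m, hm, hIm⟩ := Ideal.exists_le_maximal I hI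
  let p : PrimeSpectrum R := ⟨m, hm.isPrime⟩
  let i := Module.rankAtStalk (R := R) M₁ p
  let j := Module.rankAtStalk (R := R) M₂ p
  let f := idem (clopenOf (rk M₁) {(i : ℤ)})
  let g := idem (clopenOf (rk M₂) {(j : ℤ)})
  have hf : f ∉ m := (mem_clopen_iff _ p).1 rfl
  have hg : g ∉ m := (mem_clopen_iff _ p).1 rfl
  refine hm.isPrime.mul_notMem hf hg (hIm ?_)
  change (f * g) • e • y ∈ S
  by_cases hij : i + j = n
  · rw [smul_comm]
    refine S.smul_mem e ?_
    have : (f * g) • y = ExteriorAlgebra.map (LinearMap.inl R M₁ M₂) (f • a) *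
        ExteriorAlgebra.map (LinearMap.inr R M₁ M₂) (g • b) := by
      rw [map_smul, map_smul, smul_mul_smul_comm]
    rw [this]
    have h₁ := map_mem_exteriorPower (LinearMap.inl R M₁ M₂) (ha i)
    have h₂ := map_mem_exteriorPower (LinearMap.inr R M₁ M₂) (hb j)
    have h₃ := Submodule.mul_mem_mul h₁ h₂
    rw [← pow_add, hij] at h₃
    exact h₃
  · have h0 : f * g * e = 0 := by
      have h1 : f * g * e = idem ⊥ := by
        refine eq_idem (((isIdempotentElem_idem _).mul (isIdempotentElem_idem _)).mul
          (isIdempotentElem_idem _)) _ fun q => ?_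
        refine ⟨fun h => absurd h (by exact id), fun h => ?_⟩
        exfalso
        have h1 : f ∉ q.asIdeal := fun h' =>
          h (Ideal.mul_mem_right _ _ (Ideal.mul_mem_right _ _ h'))
        have h2 : g ∉ q.asIdeal := fun h' =>
          h (Ideal.mul_mem_right _ _ (Ideal.mul_mem_left _ _ h'))
        have h3 : e ∉ q.asIdeal := fun h' => h (Ideal.mul_mem_left _ _ h')
        have h1 : rk M₁ q = i := (mem_clopen_iff _ q).2 h1
        have h2 : rk M₂ q = j := (mem_clopen_iff _ q).2 h2
        have h3 : rk (M₁.prod M₂) q = n := (mem_clopen_iff _ q).2 h3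
        rw [hrk, h1, h2] at h3
        exact hij (by exact_mod_cast h3)
      rw [h1, idem, PrimeSpectrum.isIdempotentElemEquivClopens_symm_bot]
    rw [smul_smul, h0, zero_smul]
    exact S.zero_mem

/-- The exterior product `det M₁ × det M₂ → det (M₁ ⊕ M₂)`. -/
def wedge {M₁ M₂ : ProjMod R} [Module.Finite R M₁] [Module.Finite R M₂]
    (a : detTop M₁) (b : detTop M₂) : detTop (M₁.prod M₂) :=
  ⟨ExteriorAlgebra.map (LinearMap.inl R M₁ M₂) a.1 * ExteriorAlgebra.map (LinearMap.inr R M₁ M₂) b.1,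
    by
    intro n
    exact wedge_mem a.2 b.2 n⟩

/-- The ratio `A / B = A ⊗ B⁻¹`. -/
abbrev Ratio (A B : Type u) [AddCommGroup A] [Module R A] [AddCommGroup B] [Module R B] : Type u :=
  A ⊗[R] Module.Dual R B

/-- Contraction with `B`: the canonical map `A / B → Hom(B, A)`,
`a ⊗ l ↦ (b ↦ l b • a)`. It is an isomorphism when `A` and `B` are lines. -/
def contract {A B : Type u} [AddCommGroup A] [Module R A] [AddCommGroup B] [Module R B] :
    Ratio (R := R) A B →ₗ[R] B →ₗ[R] A :=
  dualTensorHom R B A ∘ₗ (TensorProduct.comm R A (Module.Dual R B)).toLinearMap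

end FiniteDet

/-! ### Relative determinant lines -/

/-- The data of a theory of relative determinant lines, over all commutative rings. -/
structure DetData where
  /-- The `ℤ`-graded super line `det (M, N, f)` of an invertible asymptotic morphism `f : N → M`. -/
  line : ∀ {R : Type u} [CommRing R] {N M : ProjMod R}, AsympIso N M → ZLine R
  /-- The composition isomorphism `det (L, M, g) · det (M, N, f) ≅ det (L, N, g f)`. -/
  comp : ∀ {R : Type u} [CommRing R] {N M L : ProjMod R} {g : AsympIso M L} {f : AsympIso N M}
    {h : AsympIso N L}, h = g.comp f → ZLine.Iso ((line g).tensor (line f)) (line h)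
  /-- The trivialization `det e : 1 ≅ det (M, N, e^∞)` of a genuine isomorphism `e : N ≅ M`. -/
  triv : ∀ {R : Type u} [CommRing R] {N M : ProjMod R} (e : N ≃ₗ[R] M) {f : AsympIso N M},
    f = AsympIso.ofEquiv e → ZLine.Iso (ZLine.unit R) (line f)
  /-- The isomorphism
  `det (M₁, N₁, f₁) · det (M₂, N₂, f₂) ≅ det (M₁ ⊕ M₂, N₁ ⊕ N₂, f₁ ⊕ f₂)`. -/
  sum : ∀ {R : Type u} [CommRing R] {N₁ M₁ N₂ M₂ : ProjMod R} (f₁ : AsympIso N₁ M₁)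
    (f₂ : AsympIso N₂ M₂), ZLine.Iso ((line f₁).tensor (line f₂)) (line (f₁.prod f₂))
  /-- For `M`, `N` of finite rank, the isomorphism `det (M, N, f) ≅ det M / det N`; that it respects
  the degrees is the next field. -/
  fin : ∀ {R : Type u} [CommRing R] {N M : ProjMod R} [Module.Finite R N] [Module.Finite R M]
    (f : AsympIso N M), line f ≃ₗ[R] Ratio (R := R) (detTop M) (detTop N)
  fin_deg : ∀ {R : Type u} [CommRing R] {N M : ProjMod R} [Module.Finite R N] [Module.Finite R M]
    (f : AsympIso N M), (line f).deg = rk M - rk N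
  /-- The base change isomorphism `R' ⊗ det (M, N, f) ≅ det (R' ⊗ M, R' ⊗ N, R' ⊗ f)`. -/
  baseChange : ∀ {R : Type u} [CommRing R] (R' : Type u) [CommRing R'] [Algebra R R']
    {N M : ProjMod R} (f : AsympIso N M),
    ZLine.Iso ((line f).baseChange R') (line (f.baseChange R'))

namespace DetData

/-- `x ∈ det (M, N, f)` corresponds to `x' ∈ det (M', N', f')` under the identification of these
lines given by isomorphisms `α : M ≅ M'` and `β : N ≅ N'` with `α f = f' β`, that is
`det α · x = x' · det β` in `det (M', N, α f)`. -/
def Transports (D : DetData.{u}) {R : Type u} [CommRing R] {N M N' M' : ProjMod R}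
    (α : M ≃ₗ[R] M') (β : N ≃ₗ[R] N') {f : AsympIso N M} {f' : AsympIso N' M'}
    (x : D.line f) (x' : D.line f') : Prop :=
  ∃ h : (AsympIso.ofEquiv α).comp f = f'.comp (AsympIso.ofEquiv β),
    D.comp rfl (D.triv α rfl 1 ⊗ₜ x) = D.comp h (x' ⊗ₜ D.triv β rfl 1)

/-- The compatibilities required of relative determinant lines. -/
structure IsDet (D : DetData.{u}) : Prop where
  /-- Composition is associative. -/
  comp_assoc : ∀ {R : Type u} [CommRing R] {N M L K : ProjMod R} (h : AsympIso L K)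
    (g : AsympIso M L) (f : AsympIso N M) (z : D.line h) (y : D.line g) (x : D.line f),
    D.comp (AsympIso.comp_assoc h g f) (D.comp rfl (z ⊗ₜ y) ⊗ₜ x) =
      D.comp rfl (z ⊗ₜ D.comp rfl (y ⊗ₜ x))
  /-- The trivializations are compatible with composition. -/
  comp_triv : ∀ {R : Type u} [CommRing R] {N M L : ProjMod R} (e : N ≃ₗ[R] M) (e' : M ≃ₗ[R] L),
    D.comp (AsympIso.ofEquiv_trans e e') (D.triv e' rfl 1 ⊗ₜ D.triv e rfl 1) =
      D.triv (e.trans e') rfl 1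
  /-- Sums are compatible with the associativity constraint. -/
  sum_assoc : ∀ {R : Type u} [CommRing R] {N₁ M₁ N₂ M₂ N₃ M₃ : ProjMod R} (f₁ : AsympIso N₁ M₁)
    (f₂ : AsympIso N₂ M₂) (f₃ : AsympIso N₃ M₃) (x : D.line f₁) (y : D.line f₂) (z : D.line f₃),
    D.Transports (M := (M₁.prod M₂).prod M₃) (M' := M₁.prod (M₂.prod M₃))
      (N := (N₁.prod N₂).prod N₃) (N' := N₁.prod (N₂.prod N₃))
      (LinearEquiv.prodAssoc R M₁ M₂ M₃) (LinearEquiv.prodAssoc R N₁ N₂ N₃)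
      (D.sum (f₁.prod f₂) f₃ (D.sum f₁ f₂ (x ⊗ₜ y) ⊗ₜ z))
      (D.sum f₁ (f₂.prod f₃) (x ⊗ₜ D.sum f₂ f₃ (y ⊗ₜ z)))
  /-- Sums are compatible with the commutativity constraint (of super lines). -/
  sum_comm : ∀ {R : Type u} [CommRing R] {N₁ M₁ N₂ M₂ : ProjMod R} (f₁ : AsympIso N₁ M₁)
    (f₂ : AsympIso N₂ M₂) (x : D.line f₁) (y : D.line f₂),
    D.Transports (M := M₁.prod M₂) (M' := M₂.prod M₁) (N := N₁.prod N₂) (N' := N₂.prod N₁)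
      (LinearEquiv.prodComm R M₁ M₂) (LinearEquiv.prodComm R N₁ N₂)
      (D.sum f₁ f₂ (x ⊗ₜ y))
      (sgn ((D.line f₁).deg * (D.line f₂).deg) • D.sum f₂ f₁ (y ⊗ₜ x))
  /-- Sums are compatible with the unit constraint: the empty sum is `1 ≅ det (0, 0, 0)`. -/
  sum_zero : ∀ {R : Type u} [CommRing R] {N M : ProjMod R} (f : AsympIso N M) (x : D.line f),
    D.Transports (M := M.prod (ProjMod.zero R)) (M' := M) (N := N.prod (ProjMod.zero R)) (N' := N)
      LinearEquiv.prodUnique LinearEquiv.prodUnique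
      (D.sum f (AsympIso.ofEquiv (LinearEquiv.refl R (ProjMod.zero R)))
        (x ⊗ₜ D.triv (LinearEquiv.refl R (ProjMod.zero R)) rfl 1))
      x
  /-- Sums are compatible with composition. The sign is that of the commutativity constraint
  `det g₂ · det f₁ ≅ det f₁ · det g₂`. -/
  sum_comp : ∀ {R : Type u} [CommRing R] {N₁ M₁ L₁ N₂ M₂ L₂ : ProjMod R} (g₁ : AsympIso M₁ L₁)
    (f₁ : AsympIso N₁ M₁) (g₂ : AsympIso M₂ L₂) (f₂ : AsympIso N₂ M₂)
    (y₁ : D.line g₁) (x₁ : D.line f₁) (y₂ : D.line g₂) (x₂ : D.line f₂),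
    D.comp (AsympIso.prod_comp g₁ f₁ g₂ f₂) (D.sum g₁ g₂ (y₁ ⊗ₜ y₂) ⊗ₜ D.sum f₁ f₂ (x₁ ⊗ₜ x₂)) =
      sgn ((D.line g₂).deg * (D.line f₁).deg) •
        D.sum (g₁.comp f₁) (g₂.comp f₂) (D.comp rfl (y₁ ⊗ₜ x₁) ⊗ₜ D.comp rfl (y₂ ⊗ₜ x₂))
  /-- Sums are compatible with the trivializations. -/
  sum_triv : ∀ {R : Type u} [CommRing R] {N₁ M₁ N₂ M₂ : ProjMod R} (e₁ : N₁ ≃ₗ[R] M₁)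
    (e₂ : N₂ ≃ₗ[R] M₂),
    D.sum (AsympIso.ofEquiv e₁) (AsympIso.ofEquiv e₂) (D.triv e₁ rfl 1 ⊗ₜ D.triv e₂ rfl 1) =
      D.triv (N := N₁.prod N₂) (M := M₁.prod M₂) (e₁.prodCongr e₂)
        (AsympIso.prod_ofEquiv e₁ e₂) 1
  /-- In finite rank, composition is the cancellation
  `(det L / det M) · (det M / det N) ≅ det L / det N`, that is composition of homomorphisms. -/
  fin_comp : ∀ {R : Type u} [CommRing R] {N M L : ProjMod R} [Module.Finite R N]
    [Module.Finite R M] [Module.Finite R L] (g : AsympIso M L) (f : AsympIso N M)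
    (y : D.line g) (x : D.line f),
    contract (D.fin (g.comp f) (D.comp rfl (y ⊗ₜ x))) =
      contract (D.fin g y) ∘ₗ contract (D.fin f x)
  /-- In finite rank, the trivialization of an isomorphism is its usual determinant. -/
  fin_triv : ∀ {R : Type u} [CommRing R] {N M : ProjMod R} [Module.Finite R N]
    [Module.Finite R M] (e : N ≃ₗ[R] M),
    contract (D.fin (AsympIso.ofEquiv e) (D.triv e rfl 1)) = detMap e
  /-- In finite rank, sums are given by the isomorphism `det M₁ · det M₂ ≅ det (M₁ ⊕ M₂)`,
  `a ⊗ b ↦ a ∧ b`. The sign is that of the commutativity constraint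
  `(det M₂ / det N₂) · det N₁ ≅ det N₁ · (det M₂ / det N₂)`. -/
  fin_sum : ∀ {R : Type u} [CommRing R] {N₁ M₁ N₂ M₂ : ProjMod R} [Module.Finite R N₁]
    [Module.Finite R M₁] [Module.Finite R N₂] [Module.Finite R M₂] (f₁ : AsympIso N₁ M₁)
    (f₂ : AsympIso N₂ M₂) (x : D.line f₁) (y : D.line f₂) (a : detTop N₁) (b : detTop N₂),
    contract (D.fin (f₁.prod f₂) (D.sum f₁ f₂ (x ⊗ₜ y))) (wedge a b) =
      sgn ((rk M₂ - rk N₂) * rk N₁) •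
        wedge (contract (D.fin f₁ x) a) (contract (D.fin f₂ y) b)
  /-- Base change is compatible with composition. -/
  baseChange_comp : ∀ {R : Type u} [CommRing R] (R' : Type u) [CommRing R'] [Algebra R R']
    {N M L : ProjMod R} (g : AsympIso M L) (f : AsympIso N M) (y : D.line g) (x : D.line f),
    D.baseChange R' (g.comp f) (1 ⊗ₜ D.comp rfl (y ⊗ₜ x)) =
      D.comp (AsympIso.baseChange_comp R' g f)
        (D.baseChange R' g (1 ⊗ₜ y) ⊗ₜ D.baseChange R' f (1 ⊗ₜ x))
  /-- Base change is compatible with the trivializations. -/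
  baseChange_triv : ∀ {R : Type u} [CommRing R] (R' : Type u) [CommRing R'] [Algebra R R']
    {N M : ProjMod R} (e : N ≃ₗ[R] M),
    D.baseChange R' (AsympIso.ofEquiv e) (1 ⊗ₜ D.triv e rfl 1) =
      D.triv (N := N.baseChange R') (M := M.baseChange R') (e.baseChange R R' N M)
        (AsympIso.baseChange_ofEquiv R' e) 1
  /-- Base change is compatible with sums. -/
  baseChange_sum : ∀ {R : Type u} [CommRing R] (R' : Type u) [CommRing R'] [Algebra R R']
    {N₁ M₁ N₂ M₂ : ProjMod R} (f₁ : AsympIso N₁ M₁) (f₂ : AsympIso N₂ M₂)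
    (x : D.line f₁) (y : D.line f₂),
    D.Transports (M := (M₁.prod M₂).baseChange R')
      (M' := (M₁.baseChange R').prod (M₂.baseChange R'))
      (N := (N₁.prod N₂).baseChange R') (N' := (N₁.baseChange R').prod (N₂.baseChange R'))
      (TensorProduct.prodRight R R' R' M₁ M₂) (TensorProduct.prodRight R R' R' N₁ N₂)
      (D.baseChange R' (f₁.prod f₂) (1 ⊗ₜ D.sum f₁ f₂ (x ⊗ₜ y)))
      (D.sum (f₁.baseChange R') (f₂.baseChange R')
        (D.baseChange R' f₁ (1 ⊗ₜ x) ⊗ₜ D.baseChange R' f₂ (1 ⊗ₜ y)))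
  /-- In finite rank, base change is the usual base change of `det M / det N`. -/
  baseChange_fin : ∀ {R : Type u} [CommRing R] (R' : Type u) [CommRing R'] [Algebra R R']
    {N M : ProjMod R} [Module.Finite R N] [Module.Finite R M] (f : AsympIso N M)
    (x : D.line f) (a : detTop N),
    contract (D.fin (f.baseChange R') (D.baseChange R' f (1 ⊗ₜ x))) (detBaseChange R' N a) =
      detBaseChange R' M (contract (D.fin f x) a)
  /-- Base change is transitive. -/
  baseChange_trans : ∀ {R : Type u} [CommRing R] (R' : Type u) [CommRing R'] [Algebra R R']
    (R'' : Type u) [CommRing R''] [Algebra R R''] [Algebra R' R''] [IsScalarTower R R' R'']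
    {N M : ProjMod R} (f : AsympIso N M) (x : D.line f),
    D.Transports (M := (M.baseChange R').baseChange R'') (M' := M.baseChange R'')
      (N := (N.baseChange R').baseChange R'') (N' := N.baseChange R'')
      (TensorProduct.AlgebraTensorModule.cancelBaseChange R R' R'' R'' M)
      (TensorProduct.AlgebraTensorModule.cancelBaseChange R R' R'' R'' N)
      (D.baseChange R'' (f.baseChange R') (1 ⊗ₜ D.baseChange R' f (1 ⊗ₜ x)))
      (D.baseChange R'' f (1 ⊗ₜ x))

/-- Isomorphisms between two theories of relative determinant lines: isomorphisms of all lines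
`det (M, N, f)`, compatible with all the data. -/
structure Iso (D D' : DetData.{u}) where
  iso : ∀ {R : Type u} [CommRing R] {N M : ProjMod R} (f : AsympIso N M),
    ZLine.Iso (D.line f) (D'.line f)
  iso_comp : ∀ {R : Type u} [CommRing R] {N M L : ProjMod R} (g : AsympIso M L)
    (f : AsympIso N M) (y : D.line g) (x : D.line f),
    iso (g.comp f) (D.comp rfl (y ⊗ₜ x)) = D'.comp rfl (iso g y ⊗ₜ iso f x)
  iso_triv : ∀ {R : Type u} [CommRing R] {N M : ProjMod R} (e : N ≃ₗ[R] M),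
    iso (AsympIso.ofEquiv e) (D.triv e rfl 1) = D'.triv e rfl 1
  iso_sum : ∀ {R : Type u} [CommRing R] {N₁ M₁ N₂ M₂ : ProjMod R} (f₁ : AsympIso N₁ M₁)
    (f₂ : AsympIso N₂ M₂) (x : D.line f₁) (y : D.line f₂),
    iso (f₁.prod f₂) (D.sum f₁ f₂ (x ⊗ₜ y)) = D'.sum f₁ f₂ (iso f₁ x ⊗ₜ iso f₂ y)
  iso_fin : ∀ {R : Type u} [CommRing R] {N M : ProjMod R} [Module.Finite R N]
    [Module.Finite R M] (f : AsympIso N M) (x : D.line f), D'.fin f (iso f x) = D.fin f x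
  iso_baseChange : ∀ {R : Type u} [CommRing R] (R' : Type u) [CommRing R'] [Algebra R R']
    {N M : ProjMod R} (f : AsympIso N M) (x : D.line f),
    iso (f.baseChange R') (D.baseChange R' f (1 ⊗ₜ x)) = D'.baseChange R' f (1 ⊗ₜ iso f x)

end DetData

end RelDet

end

/-!
The line of an invertible asymptotic morphism `f : N → M` is computed from a *resolution*: an
isomorphism `e : N × A ≃ M × B`, with `A` and `B` projective of finite rank, whose component `N → M`
represents `f` (`IsRes`, `exists_isRes`). It is `det A / det B`, realized as `Hom (det B, det A)`. If
`N` and `M` have finite rank themselves, `det N ⊗ det A ≅ det M ⊗ det B` turns it into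
`det M / det N`, up to a sign (`finHom_spec`).

For this to be independent of the resolution, one compares two resolutions. After adding finite rank
modules to both, they differ by an isomorphism `w : M × P ≃ M × Q` which is the identity of `M` up
to a map whose image lies in a finitely generated submodule (`IsFred`, `conn`). Such a `w` has a
determinant `fdet w : det P → det Q`. Indeed, the difference factors through a module `F` of finite
rank, and compressing `w` to `F` gives an isomorphism `F × P ≃ F × Q`, whose determinant is the
identity of `det F` tensored with a map `det P → det Q`; two choices of `F` give conjugate maps after
further enlargement (`hasRelDet_cmp_of_le`). As `fdet` is multiplicative, compatible with direct
sums, and unchanged by conjugation, the lines of all resolutions are identified (`ev`), and whatever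
is compatible with stabilization, with such maps `w`, and with isomorphisms of `A` can be computed in
any resolution (`res_connect`). So composition is composition of maps of determinants, for
resolutions that can be composed (`ev_detComp`), direct sums are external products (`ev_detSum`),
base change is base change of maps (`ev_detBC`), and all compatibilities are checked in resolutions
chosen conveniently (`isDet_detData`).

For uniqueness, let an arbitrary theory of determinant lines be given. Pairs of an asymptotic
isomorphism and an element of its line can be composed and added (`Mor`). A resolution `e` of `f`
relates `X` in the line of `f` to `ξ : det B → det A` if `X ⊕ 1_A = (1_M ⊕ ξ) ∘ det e`, where `ξ` is
regarded as an element of the line of the zero map `B → A`. This is a bijection (`Mor.Rel`,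
`Mor.relEquiv`), formulated only in terms of the structure. The point is that it is compatible with
the change of resolutions, namely that the determinant of `w` above is `1_M ⊕ fdet w` in every theory
(`Mor.triv_eq_of_isFred`). Compressing `w` reduces this to the finite rank case and to the assertion
that shears `(m, k) ↦ (m, k + t m)` of `M × K` have determinant `1`. For the latter, let the
determinant of the shear be `r`. The shears of `M × K × K` by `(t, 0)`, `(0, t)` and `(t, t)` are
conjugate, so they all have determinant `r`, while the last is the composite of the other two, whence
`r = r²` (`Mor.triv_shear`). Two theories are therefore identified through the bijections with
`Hom (det B, det A)` (`DetData.compareIso`), and since every isomorphism of theories preserves the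
relation, there is no other one (`DetData.eq_compareIso`).
-/

noncomputable section

namespace RelDet

/-! ### Exterior algebras of direct sums, locally on `Spec R` -/

section Local

variable {R : Type u} [CommRing R]

/-- Membership in a submodule can be checked locally on `Spec R`. -/
lemma mem_of_forall_prime {V : Type*} [AddCommGroup V] [Module R V] {S : Submodule R V} {x : V}
    (h : ∀ p : PrimeSpectrum R, ∃ f ∉ p.asIdeal, f • x ∈ S) : x ∈ S := by
  let I : Ideal R := S.comap (LinearMap.toSpanSingleton R V x)
  have hI : I = ⊤ := by
    by_contra hne
    obtain ⟨m, hm, hIm⟩ := Ideal.exists_le_maximal I hne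
    obtain ⟨f, hf, hfx⟩ := h ⟨m, hm.isPrime⟩
    exact hf (hIm hfx)
  have h1 : (1 : R) ∈ I := hI ▸ Submodule.mem_top
  simpa [I] using h1

lemma eq_of_forall_prime {V : Type*} [AddCommGroup V] [Module R V] {x y : V}
    (h : ∀ p : PrimeSpectrum R, ∃ f ∉ p.asIdeal, f • x = f • y) : x = y := by
  rw [← sub_eq_zero, ← Submodule.mem_bot R]
  refine mem_of_forall_prime fun p => ?_
  obtain ⟨f, hf, hfx⟩ := h p
  exact ⟨f, hf, by rw [Submodule.mem_bot, smul_sub, hfx, sub_self]⟩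

lemma idem_eq_one {U : TopologicalSpace.Clopens (PrimeSpectrum R)} (h : ∀ p, p ∈ U) :
    idem U = 1 := by
  refine (eq_idem IsIdempotentElem.one U fun p => ?_).symm
  exact iff_of_true (h p) fun h1 => p.isPrime.ne_top ((Ideal.eq_top_iff_one _).2 h1)

lemma idem_eq_zero {U : TopologicalSpace.Clopens (PrimeSpectrum R)} (h : ∀ p, p ∉ U) :
    idem U = 0 := by
  refine (eq_idem IsIdempotentElem.zero U fun p => ?_).symm
  exact iff_of_false (h p) fun h1 => h1 p.asIdeal.zero_mem

lemma idem_mul_idem (U V : TopologicalSpace.Clopens (PrimeSpectrum R)) :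
    idem U * idem V = idem (U ⊓ V) := by
  refine eq_idem ((isIdempotentElem_idem U).mul (isIdempotentElem_idem V)) _ fun p => ?_
  change p ∈ U ∧ p ∈ V ↔ _
  rw [mem_clopen_iff, mem_clopen_iff, p.isPrime.mul_mem_iff_mem_or_mem, not_or]

lemma idem_mul_idem_of_disjoint {U V : TopologicalSpace.Clopens (PrimeSpectrum R)}
    (h : ∀ p, p ∈ U → p ∉ V) : idem U * idem V = 0 := by
  rw [idem_mul_idem]
  exact idem_eq_zero fun p hp => h p hp.1 hp.2

lemma idem_mul_idem_of_le {U V : TopologicalSpace.Clopens (PrimeSpectrum R)}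
    (h : ∀ p, p ∈ U → p ∈ V) : idem U * idem V = idem U := by
  rw [idem_mul_idem, inf_eq_left.2 h]

/-- The idempotent of `R` cutting out the locus where `v` takes the value `n`. -/
abbrev locus (v : LocallyConstant (PrimeSpectrum R) ℤ) (n : ℤ) : R := idem (clopenOf v {n})

lemma locus_notMem (v : LocallyConstant (PrimeSpectrum R) ℤ) (p : PrimeSpectrum R) :
    locus v (v p) ∉ p.asIdeal := (mem_clopen_iff _ p).1 rfl

lemma locus_mul_locus_of_ne (v : LocallyConstant (PrimeSpectrum R) ℤ) {m n : ℤ} (h : m ≠ n) :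
    locus v m * locus v n = 0 :=
  idem_mul_idem_of_disjoint fun p (hm : v p = m) (hn : v p = n) => h (hm.symm.trans hn)

lemma locus_mul_self (v : LocallyConstant (PrimeSpectrum R) ℤ) (n : ℤ) :
    locus v n * locus v n = locus v n := isIdempotentElem_idem _

/-- If `u = i` and `v = j` imply `w = k`, the idempotent of the locus `w = k` can be dropped next to
those of `u = i` and `v = j`. -/
lemma locus_mul_locus_mul_locus {u v w : LocallyConstant (PrimeSpectrum R) ℤ} {i j k : ℤ}
    (h : ∀ p, u p = i → v p = j → w p = k) :
    locus u i * locus v j * locus w k = locus u i * locus v j := by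
  rw [idem_mul_idem]
  exact idem_mul_idem_of_le fun p hp => h p hp.1 hp.2

/-- To prove `x = y` it suffices to do so on the locus where `u` and `v` are constant. -/
lemma eq_of_locus {V : Type*} [AddCommGroup V] [Module R V] {x y : V}
    (u v : LocallyConstant (PrimeSpectrum R) ℤ)
    (h : ∀ p, (locus u (u p) * locus v (v p)) • x = (locus u (u p) * locus v (v p)) • y) :
    x = y :=
  eq_of_forall_prime fun p => ⟨_, p.isPrime.mul_notMem (locus_notMem u p) (locus_notMem v p), h p⟩

/-! ### Signs of locally constant functions -/

lemma sgn_of_even {u : LocallyConstant (PrimeSpectrum R) ℤ} (h : ∀ p, Even (u p)) :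
    sgn u = 1 := by
  rw [sgn, idem_eq_zero fun p hp => Int.not_odd_iff_even.2 (h p) hp, mul_zero, sub_zero]

lemma idem_mul_sgn_of_odd {U : TopologicalSpace.Clopens (PrimeSpectrum R)}
    {u : LocallyConstant (PrimeSpectrum R) ℤ} (h : ∀ p ∈ U, Odd (u p)) :
    idem U * sgn u = -idem U := by
  rw [sgn, mul_sub, mul_left_comm, idem_mul_idem_of_le h]
  ring

lemma idem_mul_sgn_of_even {U : TopologicalSpace.Clopens (PrimeSpectrum R)}
    {u : LocallyConstant (PrimeSpectrum R) ℤ} (h : ∀ p ∈ U, Even (u p)) :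
    idem U * sgn u = idem U := by
  rw [sgn, mul_sub, mul_left_comm,
    idem_mul_idem_of_disjoint fun p hp => Int.not_odd_iff_even.2 (h p hp)]
  ring

lemma locus_mul_sgn (u : LocallyConstant (PrimeSpectrum R) ℤ) (n : ℤ) :
    locus u n * sgn u = ((n.negOnePow : ℤˣ) : ℤ) • locus u n := by
  rcases Int.even_or_odd n with h | h
  · rw [idem_mul_sgn_of_even fun p (hp : u p = n) => hp ▸ h, Int.negOnePow_even n h]
    simp
  · rw [idem_mul_sgn_of_odd fun p (hp : u p = n) => hp ▸ h, Int.negOnePow_odd n h]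
    simp

lemma sgn_add (u v : LocallyConstant (PrimeSpectrum R) ℤ) : sgn (u + v) = sgn u * sgn v := by
  refine eq_of_locus u v fun p => ?_
  have h : locus u (u p) * locus v (v p) * locus (u + v) (u p + v p) =
      locus u (u p) * locus v (v p) :=
    locus_mul_locus_mul_locus fun q hu hv => by rw [← hu, ← hv]; rfl
  have h1 := locus_mul_sgn (u + v) (u p + v p)
  rw [Int.negOnePow_add] at h1
  rw [smul_eq_mul, smul_eq_mul, mul_mul_mul_comm, locus_mul_sgn, locus_mul_sgn, ← h, mul_assoc, h1]
  push_cast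
  simp only [zsmul_eq_mul]
  push_cast
  linear_combination ((Int.negOnePow (u p) : ℤ) : R) * ((Int.negOnePow (v p) : ℤ) : R) * h

lemma sgn_mul_self (u : LocallyConstant (PrimeSpectrum R) ℤ) : sgn u * sgn u = 1 := by
  rw [← sgn_add]
  exact sgn_of_even fun p => ⟨u p, rfl⟩

lemma sgn_smul_smul {V : Type*} [AddCommGroup V] [Module R V]
    (u : LocallyConstant (PrimeSpectrum R) ℤ) (x : V) : sgn u • sgn u • x = x := by
  rw [smul_smul, sgn_mul_self, one_smul]

lemma sgn_zero : sgn (0 : LocallyConstant (PrimeSpectrum R) ℤ) = 1 :=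
  sgn_of_even fun _ => Even.zero

lemma algebraMap_sgn (R' : Type u) [CommRing R'] [Algebra R R']
    (u : LocallyConstant (PrimeSpectrum R) ℤ) : algebraMap R R' (sgn u) = sgn (pullback R' u) := by
  rw [sgn, sgn, map_sub, map_mul, map_one, map_ofNat]
  congr 2
  refine eq_idem ((isIdempotentElem_idem _).map _) _ fun p => ?_
  exact mem_clopen_iff (clopenOf u {n | Odd n}) (p.comap (algebraMap R R'))

end Local

section Exterior

variable {R : Type u} [CommRing R]

lemma extMap_comp {M N L : Type u} [AddCommGroup M] [Module R M] [AddCommGroup N] [Module R N]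
    [AddCommGroup L] [Module R L] (g : N →ₗ[R] L) (f : M →ₗ[R] N) (ω : ExteriorAlgebra R M) :
    ExteriorAlgebra.map g (ExteriorAlgebra.map f ω) = ExteriorAlgebra.map (g ∘ₗ f) ω :=
  DFunLike.congr_fun (ExteriorAlgebra.map_comp_map f g) ω

lemma mem_evenOdd_of_mem_exteriorPower {M : Type u} [AddCommGroup M] [Module R M] {n : ℕ}
    {ω : ExteriorAlgebra R M} (h : ω ∈ ⋀[R]^n M) :
    ω ∈ CliffordAlgebra.evenOdd (0 : QuadraticForm R M) (n : ZMod 2) :=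
  Submodule.mem_iSup_of_mem ⟨n, rfl⟩ h

/-- Graded commutativity between the images of two homogeneous elements. -/
lemma extMap_mul_extMap_comm {M₁ M₂ N : Type u} [AddCommGroup M₁] [Module R M₁] [AddCommGroup M₂]
    [Module R M₂] [AddCommGroup N] [Module R N] (f₁ : M₁ →ₗ[R] N) (f₂ : M₂ →ₗ[R] N) {i j : ℕ}
    {a : ExteriorAlgebra R M₁} {b : ExteriorAlgebra R M₂} (ha : a ∈ ⋀[R]^i M₁)
    (hb : b ∈ ⋀[R]^j M₂) :
    ExteriorAlgebra.map f₁ a * ExteriorAlgebra.map f₂ b =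
      ((-1 : ℤ) ^ (i * j)) • (ExteriorAlgebra.map f₂ b * ExteriorAlgebra.map f₁ a) := by
  have h := CliffordAlgebra.map_mul_map_of_isOrtho_of_mem_evenOdd
    (Q₁ := (0 : QuadraticForm R M₁)) (Q₂ := (0 : QuadraticForm R M₂))
    (Qₙ := (0 : QuadraticForm R N)) { f₁ with map_app' := fun _ => rfl }
    { f₂ with map_app' := fun _ => rfl } (fun _ _ => QuadraticMap.IsOrtho.all _ _) a b
    (mem_evenOdd_of_mem_exteriorPower ha) (mem_evenOdd_of_mem_exteriorPower hb)
  refine h.trans ?_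
  have h2 : ((-1 : ℤˣ) ^ ((j : ZMod 2) * (i : ZMod 2)) : ℤˣ) = (-1) ^ (i * j) := by
    rw [← Nat.cast_mul, mul_comm j i]
    exact uzpow_natCast _ _
  rw [h2, Units.smul_def]
  push_cast
  rfl

/-- The multiplication map `⋀ M₁ ⊗ ⋀ M₂ → ⋀ (M₁ × M₂)`. -/
def extProd (M₁ M₂ : Type u) [AddCommGroup M₁] [Module R M₁] [AddCommGroup M₂] [Module R M₂] :
    ExteriorAlgebra R M₁ ⊗[R] ExteriorAlgebra R M₂ →ₗ[R] ExteriorAlgebra R (M₁ × M₂) :=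
  TensorProduct.lift ((LinearMap.mul R (ExteriorAlgebra R (M₁ × M₂))).compl₁₂
    (ExteriorAlgebra.map (LinearMap.inl R M₁ M₂)).toLinearMap
    (ExteriorAlgebra.map (LinearMap.inr R M₁ M₂)).toLinearMap)

lemma extProd_tmul {M₁ M₂ : Type u} [AddCommGroup M₁] [Module R M₁] [AddCommGroup M₂]
    [Module R M₂] (a : ExteriorAlgebra R M₁) (b : ExteriorAlgebra R M₂) :
    extProd M₁ M₂ (a ⊗ₜ[R] b) = ExteriorAlgebra.map (LinearMap.inl R M₁ M₂) a *
      ExteriorAlgebra.map (LinearMap.inr R M₁ M₂) b := rfl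

/-- The exterior algebra of a direct sum contains the tensor product of the exterior algebras: a
left inverse is read off from the description of Clifford algebras of orthogonal sums. -/
lemma extProd_injective (M₁ M₂ : Type u) [AddCommGroup M₁] [Module R M₁] [AddCommGroup M₂]
    [Module R M₂] : Function.Injective (extProd (R := R) M₁ M₂) := by
  let Q₁ : QuadraticForm R M₁ := 0
  let Q₂ : QuadraticForm R M₂ := 0
  have hQ : ∀ x, (Q₁.prod Q₂) x = 0 := fun x => by simp [Q₁, Q₂]
  let ψ : (0 : QuadraticForm R (M₁ × M₂)) →qᵢ Q₁.prod Q₂ :=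
    { (LinearMap.id : M₁ × M₂ →ₗ[R] M₁ × M₂) with map_app' := fun x => hQ x }
  let l : ExteriorAlgebra R (M₁ × M₂) →ₗ[R] ExteriorAlgebra R M₁ ⊗[R] ExteriorAlgebra R M₂ :=
    (GradedTensorProduct.of R (CliffordAlgebra.evenOdd Q₁)
      (CliffordAlgebra.evenOdd Q₂)).symm.toLinearMap ∘ₗ
      ((CliffordAlgebra.ofProd Q₁ Q₂).comp (CliffordAlgebra.map ψ)).toLinearMap
  have hl : l ∘ₗ extProd M₁ M₂ = LinearMap.id := by
    refine TensorProduct.ext' fun a b => ?_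
    have h1 : CliffordAlgebra.map ψ (extProd M₁ M₂ (a ⊗ₜ b)) =
        CliffordAlgebra.toProd Q₁ Q₂ (GradedTensorProduct.tmul R a b) := by
      rw [extProd_tmul, map_mul, CliffordAlgebra.toProd, GradedTensorProduct.lift_tmul]
      congr 1
      · exact DFunLike.congr_fun (CliffordAlgebra.map_comp_map ψ _) a
      · exact DFunLike.congr_fun (CliffordAlgebra.map_comp_map ψ _) b
    change (GradedTensorProduct.of R _ _).symm (CliffordAlgebra.ofProd Q₁ Q₂
      (CliffordAlgebra.map ψ (extProd M₁ M₂ (a ⊗ₜ b)))) = a ⊗ₜ b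
    rw [h1]
    have h2 := DFunLike.congr_fun (CliffordAlgebra.ofProd_comp_toProd Q₁ Q₂)
      (GradedTensorProduct.tmul R a b)
    exact congrArg (GradedTensorProduct.of R _ _).symm h2
  exact Function.LeftInverse.injective (g := l) fun x => DFunLike.congr_fun hl x

/-- `⋀ⁿ (M₁ × M₂)` is spanned by the products of `⋀ⁱ M₁` and `⋀ʲ M₂` with `i + j = n`. -/
lemma exteriorPower_prod_le {M₁ M₂ : Type u} [AddCommGroup M₁] [Module R M₁] [AddCommGroup M₂]
    [Module R M₂] (S : Submodule R (ExteriorAlgebra R (M₁ × M₂))) (n : ℕ)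
    (h : ∀ i j, i + j = n → ∀ a ∈ ⋀[R]^i M₁, ∀ b ∈ ⋀[R]^j M₂,
      ExteriorAlgebra.map (LinearMap.inl R M₁ M₂) a *
        ExteriorAlgebra.map (LinearMap.inr R M₁ M₂) b ∈ S) :
    ⋀[R]^n (M₁ × M₂) ≤ S := by
  induction n generalizing S with
  | zero =>
    have h0 := h 0 0 rfl 1 (by simp) 1 (by simp)
    rw [map_one, map_one, mul_one] at h0
    rw [ExteriorAlgebra.exteriorPower, pow_zero]
    exact Submodule.one_le.2 h0
  | succ n ih =>
    rw [ExteriorAlgebra.exteriorPower, pow_succ', Submodule.mul_le]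
    rintro _ ⟨⟨m₁, m₂⟩, rfl⟩ y hy
    refine ih (S.comap (LinearMap.mulLeft R (ExteriorAlgebra.ι R (m₁, m₂)))) ?_ hy
    intro i j hij a ha b hb
    have hm : ExteriorAlgebra.ι R (m₁, m₂) =
        ExteriorAlgebra.map (LinearMap.inl R M₁ M₂) (ExteriorAlgebra.ι R m₁) +
          ExteriorAlgebra.map (LinearMap.inr R M₁ M₂) (ExteriorAlgebra.ι R m₂) := by
      rw [ExteriorAlgebra.map_apply_ι, ExteriorAlgebra.map_apply_ι, ← map_add]
      simp
    change ExteriorAlgebra.ι R (m₁, m₂) * (_ * _) ∈ S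
    have hι : ∀ {M : Type u} [AddCommGroup M] [Module R M] (m : M),
        ExteriorAlgebra.ι R m ∈ ⋀[R]^1 M := fun m => by
      rw [ExteriorAlgebra.exteriorPower, pow_one]; exact ⟨m, rfl⟩
    rw [hm, add_mul]
    refine S.add_mem ?_ ?_
    · rw [← mul_assoc, ← map_mul]
      refine h (i + 1) j (by omega) _ ?_ b hb
      rw [add_comm, ExteriorAlgebra.exteriorPower, pow_add]
      exact Submodule.mul_mem_mul (hι m₁) ha
    · rw [← mul_assoc, extMap_mul_extMap_comm _ _ (hι m₂) ha, smul_mul_assoc, mul_assoc, ← map_mul]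
      refine zsmul_mem (h i (j + 1) (by omega) a ha _ ?_) _
      rw [add_comm, ExteriorAlgebra.exteriorPower, pow_add]
      exact Submodule.mul_mem_mul (hι m₂) hb

/-- If `f M` lies in a submodule generated by `n` elements, then a power of `f` kills all exterior
powers beyond the `n`-th. -/
lemma exteriorPower_eq_zero_of_span {M : Type u} [AddCommGroup M] [Module R M] {n k : ℕ}
    (hk : n < k) (g : Fin n → M) (f : R) (hg : ∀ m : M, f • m ∈ Submodule.span R (Set.range g))
    {ω : ExteriorAlgebra R M} (hω : ω ∈ ⋀[R]^k M) : f ^ k • ω = 0 := by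
  rw [← ExteriorAlgebra.ιMulti_span_fixedDegree] at hω
  induction hω using Submodule.span_induction with
  | mem x hx =>
    obtain ⟨v, rfl⟩ := hx
    have h1 := (ExteriorAlgebra.ιMulti R k (M := M)).map_smul_univ (fun _ => f) v
    rw [Finset.prod_const, Finset.card_univ, Fintype.card_fin] at h1
    rw [← h1]
    have hv : ∀ i, ∃ c : Fin n → R, f • v i = ∑ j, c j • g j := fun i => by
      obtain ⟨c, hc⟩ := (Submodule.mem_span_range_iff_exists_fun R).1 (hg (v i))
      exact ⟨c, hc.symm⟩
    choose c hc using hv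
    simp_rw [hc]
    have h2 := (ExteriorAlgebra.ιMulti R k (M := M)).toMultilinearMap.map_sum
      (fun (i : Fin k) (j : Fin n) => c i j • g j)
    refine h2.trans (Finset.sum_eq_zero fun r _ => ?_)
    refine ((ExteriorAlgebra.ιMulti R k (M := M)).map_smul_univ _ _).trans ?_
    have h3 : ExteriorAlgebra.ιMulti R k (fun i => g (r i)) = 0 := by
      apply ExteriorAlgebra.ιMulti_eq_zero_of_not_inj
      intro hinj
      have := Fintype.card_le_of_injective r fun a b hab => hinj (congrArg g hab)
      simp at this
      omega
    rw [h3, smul_zero]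
  | zero => simp
  | add x y _ _ hx hy => rw [smul_add, hx, hy, add_zero]
  | smul r x _ hx => rw [smul_comm, hx, smul_zero]

/-- Near a prime `p` where it has rank `n`, a finitely generated projective module is generated by
`n` elements: some `f ∉ p` multiplies `M` into the span of lifts of a basis at `p`. -/
lemma exists_generators (M : ProjMod R) [Module.Finite R M] (p : PrimeSpectrum R) :
    ∃ (g : Fin (Module.rankAtStalk (R := R) M p) → M) (f : R), f ∉ p.asIdeal ∧
      ∀ m : M, f • m ∈ Submodule.span R (Set.range g) := by
  classical
  let S := p.asIdeal.primeCompl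
  let Rp := Localization.AtPrime p.asIdeal
  let Mp := LocalizedModule S M
  have : Module.Free Rp Mp := Module.free_of_flat_of_isLocalRing
  let b := Module.finBasis Rp Mp
  have hb : ∀ i, ∃ x : M × S, IsLocalizedModule.mk' (LocalizedModule.mkLinearMap S M) x.1 x.2
      = b i := fun i => by
    obtain ⟨⟨m, s⟩, h⟩ := IsLocalizedModule.mk'_surjective S (LocalizedModule.mkLinearMap S M) (b i)
    exact ⟨⟨m, s⟩, h⟩
  choose x hx using hb
  let g : Fin (Module.rankAtStalk (R := R) M p) → M := fun i => (x i).1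
  have key : ∀ m : M, ∃ f : S, f • m ∈ Submodule.span R (Set.range g) := by
    intro m
    let N := Submodule.span R (Set.range g)
    have hN : LocalizedModule.mkLinearMap S M m ∈
        N.localized' Rp S (LocalizedModule.mkLinearMap S M) := by
      have htop : N.localized' Rp S (LocalizedModule.mkLinearMap S M) = ⊤ := by
        rw [eq_top_iff, ← b.span_eq, Submodule.span_le]
        rintro _ ⟨i, rfl⟩
        exact (Submodule.mem_localized' _ _ _ _ _).2
          ⟨g i, Submodule.subset_span ⟨i, rfl⟩, (x i).2, hx i⟩
      rw [htop]; trivial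
    obtain ⟨y, hy, s, hys⟩ := (Submodule.mem_localized' _ _ _ _ _).1 hN
    rw [IsLocalizedModule.mk'_eq_iff, Submonoid.smul_def, ← map_smul,
      IsLocalizedModule.eq_iff_exists S] at hys
    obtain ⟨c, hc⟩ := hys
    refine ⟨c * s, ?_⟩
    rw [mul_smul]
    change c • ((s : R) • m) ∈ N
    rw [← hc]
    exact N.smul_mem _ hy
  -- a common denominator for a finite set of generators of `M`
  obtain ⟨T, hT⟩ := Module.Finite.fg_top (R := R) (M := M)
  choose f hf using key
  refine ⟨g, ((∏ m ∈ T, f m : S) : R), (∏ m ∈ T, f m : S).2, fun m => ?_⟩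
  have hm : m ∈ Submodule.span R (T : Set M) := hT ▸ Submodule.mem_top
  induction hm using Submodule.span_induction with
  | mem y hy =>
    rw [← Finset.prod_erase_mul T f hy, Submonoid.coe_mul, mul_smul]
    exact Submodule.smul_mem _ _ (hf y)
  | zero => simp
  | add a b _ _ ha hb => rw [smul_add]; exact add_mem ha hb
  | smul r a _ ha => rw [smul_comm]; exact Submodule.smul_mem _ r ha

/-- On the locus where `M` has rank `n`, its exterior powers beyond the `n`-th vanish. -/
lemma locus_smul_exteriorPower_eq_zero (M : ProjMod R) [Module.Finite R M] {n k : ℕ} (hk : n < k)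
    {ω : ExteriorAlgebra R M} (hω : ω ∈ ⋀[R]^k M) : locus (rk M) n • ω = 0 := by
  refine eq_of_forall_prime (R := R) fun p => ?_
  by_cases hp : rk M p = n
  · have hp' : Module.rankAtStalk (R := R) M p = n := Int.natCast_inj.1 hp
    obtain ⟨g, f, hf, hg⟩ := exists_generators M p
    refine ⟨f ^ k, fun h => hf (p.isPrime.mem_of_pow_mem k h), ?_⟩
    rw [smul_comm, exteriorPower_eq_zero_of_span (hp' ▸ hk) g f hg hω, smul_zero, smul_zero]
  · refine ⟨_, locus_notMem (rk M) p, ?_⟩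
    rw [smul_smul, locus_mul_locus_of_ne _ hp, zero_smul, smul_zero]

end Exterior

/-! ### Determinants of direct sums -/

section DetTop

variable {R : Type u} [CommRing R]

lemma rk_prod (A B : ProjMod R) [Module.Finite R A] [Module.Finite R B] :
    rk (A.prod B) = rk A + rk B := by
  ext p
  exact (congrArg (fun k : ℕ => (k : ℤ)) (congrFun (Module.rankAtStalk_prod (R := R) A B) p)).trans
    (Nat.cast_add _ _)

lemma rk_congr {A B : ProjMod R} [Module.Finite R A] [Module.Finite R B] (e : A ≃ₗ[R] B) :
    rk A = rk B := by
  ext p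
  exact congrArg (fun k : ℕ => (k : ℤ)) (congrFun (Module.rankAtStalk_eq_of_equiv e) p)

lemma rk_baseChange (R' : Type u) [CommRing R'] [Algebra R R'] (A : ProjMod R)
    [Module.Finite R A] : rk (A.baseChange R') = pullback R' (rk A) := by
  ext p
  exact congrArg (fun k : ℕ => (k : ℤ)) (Module.rankAtStalk_baseChange p)

/-- The locus where a finitely generated projective module has the same rank as at `p`. -/
abbrev rkLocus (A : ProjMod R) [Module.Finite R A] (p : PrimeSpectrum R) : R :=
  locus (rk A) (Module.rankAtStalk (R := R) A p : ℕ)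

lemma rkLocus_notMem (A : ProjMod R) [Module.Finite R A] (p : PrimeSpectrum R) :
    rkLocus A p ∉ p.asIdeal := locus_notMem (rk A) p

lemma locus_smul_mem_detTop (A : ProjMod R) [Module.Finite R A] {n : ℕ} {ω : ExteriorAlgebra R A}
    (hω : ω ∈ ⋀[R]^n A) : locus (rk A) n • ω ∈ detTop A := by
  intro m
  rw [smul_smul]
  by_cases hmn : m = n
  · subst hmn
    exact Submodule.smul_mem _ _ hω
  · rw [locus_mul_locus_of_ne _ (by exact_mod_cast hmn), zero_smul]
    exact Submodule.zero_mem _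

/-- The projection of `⋀ A` to the top exterior power over the locus where `A` has rank `n`. -/
def detProj (A : ProjMod R) [Module.Finite R A] (n : ℕ) : ExteriorAlgebra R A →ₗ[R] detTop A :=
  (locus (rk A) (n : ℤ) • GradedAlgebra.proj (fun i : ℕ => ⋀[R]^i A) n).codRestrict (detTop A)
    fun ω => by
      rw [LinearMap.smul_apply, GradedAlgebra.proj_apply]
      exact locus_smul_mem_detTop A (SetLike.coe_mem _)

lemma detProj_coe (A : ProjMod R) [Module.Finite R A] (n : ℕ) (a : detTop A) :
    detProj A n a = locus (rk A) (n : ℤ) • a := by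
  ext
  change locus (rk A) (n : ℤ) • GradedAlgebra.proj (fun i : ℕ => ⋀[R]^i A) n a.1 = _
  rw [← map_smul, GradedAlgebra.proj_apply]
  exact DirectSum.decompose_of_mem_same _ (a.2 n)

/-- The exterior product as a linear map on the tensor product. -/
def wedgeLin (A B : ProjMod R) [Module.Finite R A] [Module.Finite R B] :
    detTop A ⊗[R] detTop B →ₗ[R] detTop (A.prod B) :=
  (extProd (R := R) A B ∘ₗ TensorProduct.map (detTop A).subtype (detTop B).subtype).codRestrict
    (detTop (A.prod B)) fun x => by
      induction x using TensorProduct.induction_on with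
      | zero => rw [map_zero]; exact Submodule.zero_mem _
      | tmul a b => exact wedge_mem a.2 b.2
      | add x y hx hy => rw [map_add]; exact Submodule.add_mem _ hx hy

/-- The map into the tensor product of the whole exterior algebras is injective, and locally on
`Spec R` the projections `detProj` recover the top exterior powers there. -/
lemma wedgeLin_injective (A B : ProjMod R) [Module.Finite R A] [Module.Finite R B] :
    Function.Injective (wedgeLin A B) := by
  refine (injective_iff_map_eq_zero _).2 fun x hx => ?_
  have h0 : TensorProduct.map (detTop A).subtype (detTop B).subtype x = 0 := by
    apply extProd_injective (R := R) A B
    rw [map_zero]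
    exact congrArg Subtype.val hx
  refine eq_of_forall_prime (R := R) fun p => ⟨_, p.isPrime.mul_notMem (rkLocus_notMem A p)
    (rkLocus_notMem B p), ?_⟩
  have h1 : TensorProduct.map (detProj A (Module.rankAtStalk (R := R) A p))
      (detProj B (Module.rankAtStalk (R := R) B p))
      (TensorProduct.map (detTop A).subtype (detTop B).subtype x) =
        (rkLocus A p * rkLocus B p) • x := by
    clear h0 hx
    induction x using TensorProduct.induction_on with
    | zero => simp
    | tmul a b =>
      rw [TensorProduct.map_tmul, TensorProduct.map_tmul, Submodule.subtype_apply,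
        Submodule.subtype_apply, detProj_coe, detProj_coe, TensorProduct.smul_tmul_smul]
    | add x y hx hy => rw [map_add, map_add, hx, hy, smul_add]
  rw [← h1, h0, map_zero, smul_zero]

/-- On the locus where `A` and `B` have ranks `i` and `j`, every summand of `⋀ (A × B)` of degree `i
+ j` other than `⋀ⁱ A ⊗ ⋀ʲ B` has a vanishing factor. -/
lemma wedgeLin_surjective (A B : ProjMod R) [Module.Finite R A] [Module.Finite R B] :
    Function.Surjective (wedgeLin A B) := by
  intro ω
  let S : Submodule R (ExteriorAlgebra R (A × B)) :=
    (LinearMap.range (wedgeLin A B)).map (detTop (A.prod B)).subtype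
  suffices h : ω.1 ∈ S by
    obtain ⟨_, ⟨x, rfl⟩, hx⟩ := h
    exact ⟨x, Subtype.ext hx⟩
  refine mem_of_forall_prime fun p => ?_
  let i := Module.rankAtStalk (R := R) A p
  let j := Module.rankAtStalk (R := R) B p
  refine ⟨_, p.isPrime.mul_notMem (p.isPrime.mul_notMem (rkLocus_notMem A p) (rkLocus_notMem B p))
    (rkLocus_notMem (A.prod B) p), ?_⟩
  rw [mul_smul]
  have hn : Module.rankAtStalk (R := R) (A.prod B) p = i + j :=
    congrFun (Module.rankAtStalk_prod (R := R) A B) p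
  have hω := ω.2 (Module.rankAtStalk (R := R) (A.prod B) p)
  refine (exteriorPower_prod_le (S.comap (LinearMap.lsmul R _ (rkLocus A p * rkLocus B p))) _ ?_) hω
  intro k l hkl a ha b hb
  change (rkLocus A p * rkLocus B p) • (_ * _) ∈ S
  rw [← smul_mul_smul_comm, ← map_smul, ← map_smul]
  by_cases hk : i < k
  · rw [locus_smul_exteriorPower_eq_zero A hk ha, map_zero, zero_mul]
    exact S.zero_mem
  by_cases hl : j < l
  · rw [locus_smul_exteriorPower_eq_zero B hl hb, map_zero, mul_zero]
    exact S.zero_mem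
  obtain rfl : k = i := by omega
  obtain rfl : l = j := by omega
  exact ⟨_, ⟨⟨_, locus_smul_mem_detTop A ha⟩ ⊗ₜ ⟨_, locus_smul_mem_detTop B hb⟩, rfl⟩, rfl⟩

/-- The isomorphism `det A ⊗ det B ≃ det (A ⊕ B)`. -/
def wedgeEquiv (A B : ProjMod R) [Module.Finite R A] [Module.Finite R B] :
    detTop A ⊗[R] detTop B ≃ₗ[R] detTop (A.prod B) :=
  LinearEquiv.ofBijective (wedgeLin A B) ⟨wedgeLin_injective A B, wedgeLin_surjective A B⟩

lemma wedgeEquiv_tmul {A B : ProjMod R} [Module.Finite R A] [Module.Finite R B] (a : detTop A)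
    (b : detTop B) : wedgeEquiv A B (a ⊗ₜ b) = wedge a b := rfl

lemma detTop_hom_ext {A B : ProjMod R} [Module.Finite R A] [Module.Finite R B] {V : Type*}
    [AddCommGroup V] [Module R V] {f g : detTop (A.prod B) →ₗ[R] V}
    (h : ∀ a b, f (wedge a b) = g (wedge a b)) : f = g := by
  have : f ∘ₗ (wedgeEquiv A B).toLinearMap = g ∘ₗ (wedgeEquiv A B).toLinearMap :=
    TensorProduct.ext' fun a b => h a b
  ext x
  obtain ⟨y, rfl⟩ := (wedgeEquiv A B).surjective x
  exact DFunLike.congr_fun this y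

lemma wedge_induction {A B : ProjMod R} [Module.Finite R A] [Module.Finite R B]
    {P : detTop (A.prod B) → Prop} (h : ∀ a b, P (wedge a b)) (hadd : ∀ x y, P x → P y → P (x + y))
    (x : detTop (A.prod B)) : P x := by
  obtain ⟨y, rfl⟩ := (wedgeEquiv A B).surjective x
  induction y using TensorProduct.induction_on with
  | zero =>
    have := h 0 0
    rwa [← wedgeEquiv_tmul, TensorProduct.zero_tmul] at this
  | tmul a b => exact h a b
  | add x y hx hy => rw [map_add]; exact hadd _ _ hx hy

lemma wedge_smul_left {A B : ProjMod R} [Module.Finite R A] [Module.Finite R B] (r : R)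
    (a : detTop A) (b : detTop B) : wedge (r • a) b = r • wedge a b := by
  rw [← wedgeEquiv_tmul, ← wedgeEquiv_tmul, ← map_smul, TensorProduct.smul_tmul']

lemma wedge_smul_right {A B : ProjMod R} [Module.Finite R A] [Module.Finite R B] (r : R)
    (a : detTop A) (b : detTop B) : wedge a (r • b) = r • wedge a b := by
  rw [← wedgeEquiv_tmul, ← wedgeEquiv_tmul, ← map_smul, TensorProduct.tmul_smul]

lemma wedge_add_left {A B : ProjMod R} [Module.Finite R A] [Module.Finite R B]
    (a a' : detTop A) (b : detTop B) : wedge (a + a') b = wedge a b + wedge a' b := by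
  simp only [← wedgeEquiv_tmul, ← map_add, TensorProduct.add_tmul]

lemma wedge_add_right {A B : ProjMod R} [Module.Finite R A] [Module.Finite R B]
    (a : detTop A) (b b' : detTop B) : wedge a (b + b') = wedge a b + wedge a b' := by
  simp only [← wedgeEquiv_tmul, ← map_add, TensorProduct.tmul_add]

/-- The free module of rank `n`. -/
abbrev freeMod (R : Type u) [CommRing R] (n : ℕ) : ProjMod R := { carrier := Fin n → R }

/-- The determinant of a free module is free of rank one. -/
lemma nonempty_detTop_freeMod_equiv (n : ℕ) : Nonempty (detTop (freeMod R n) ≃ₗ[R] R) := by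
  rcases subsingleton_or_nontrivial R with hR | hR
  · have := Module.subsingleton R (detTop (freeMod R n))
    exact ⟨{ (0 : detTop (freeMod R n) →ₗ[R] R) with
      invFun := 0, left_inv := fun _ => Subsingleton.elim _ _,
      right_inv := fun _ => Subsingleton.elim _ _ }⟩
  · have hrk : ∀ p, rk (freeMod R n) p = n := fun p => by
      change ((Module.rankAtStalk (R := R) (Fin n → R) p : ℕ) : ℤ) = n
      rw [Module.rankAtStalk_eq_finrank_of_free]
      simp
    have h1 : locus (rk (freeMod R n)) n = 1 := idem_eq_one hrk
    have htop : detTop (freeMod R n) = ⋀[R]^n (Fin n → R) := by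
      ext ω
      refine ⟨fun h => ?_, fun h => ?_⟩
      · have := h n
        rwa [show idem (clopenOf (rk (freeMod R n)) {(n : ℤ)}) = 1 from h1, one_smul] at this
      · have := locus_smul_mem_detTop (freeMod R n) h
        rwa [h1, one_smul] at this
    have hfin : Module.finrank R (⋀[R]^n (Fin n → R)) = 1 := by
      rw [exteriorPower.finrank_eq]
      simp
    exact ⟨(LinearEquiv.ofEq _ _ htop).trans
      ((LinearEquiv.ofFinrankEq _ _ (hfin.trans (Module.finrank_self R).symm)))⟩

/-- A finitely generated projective module is a direct summand of a free module of finite rank. -/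
lemma exists_complement (A : ProjMod R) [Module.Finite R A] :
    ∃ (B : ProjMod R) (_ : Module.Finite R B) (n : ℕ), Nonempty ((A.prod B) ≃ₗ[R] freeMod R n) := by
  obtain ⟨n, f, hf⟩ := Module.Finite.exists_fin' R A
  obtain ⟨s, hs⟩ := Module.projective_lifting_property f LinearMap.id hf
  have hs' : ∀ a, f (s a) = a := fun a => DFunLike.congr_fun hs a
  let π : (Fin n → R) →ₗ[R] LinearMap.ker f :=
    (LinearMap.id - s ∘ₗ f).codRestrict _ fun x => by simp [hs']
  have hπ : ∀ x : LinearMap.ker f, π x = x := fun x => by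
    ext1
    simp [π, LinearMap.mem_ker.1 x.2]
  have : Module.Projective R (LinearMap.ker f) :=
    Module.Projective.of_split (LinearMap.ker f).subtype π (LinearMap.ext hπ)
  let B : ProjMod R := { carrier := LinearMap.ker f }
  refine ⟨B, Module.Finite.of_surjective π fun x => ⟨x, hπ x⟩, n, ⟨?_⟩⟩
  refine LinearEquiv.ofLinearMap (LinearMap.coprod s (LinearMap.ker f).subtype) (f.prod π) ?_ ?_
  · refine LinearMap.ext fun x => ?_
    change s (f x) + (x - s (f x)) = x
    abel
  · refine LinearMap.ext fun x => Prod.ext ?_ ?_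
    · change f (s x.1 + x.2) = x.1
      rw [map_add, hs', LinearMap.mem_ker.1 x.2.2, add_zero]
    · change π (s x.1 + x.2) = x.2
      rw [map_add, hπ]
      have : π (s x.1) = 0 := by
        ext1
        simp [π, hs']
      rw [this, zero_add]

/-! ### Functoriality of determinants -/

lemma detMap_coe {A B : ProjMod R} [Module.Finite R A] [Module.Finite R B] (e : A ≃ₗ[R] B)
    (a : detTop A) : (detMap e a : ExteriorAlgebra R B) = ExteriorAlgebra.map e.toLinearMap a.1 :=
  rfl

lemma detMap_refl (A : ProjMod R) [Module.Finite R A] :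
    detMap (LinearEquiv.refl R A) = LinearMap.id := by
  ext a : 2
  exact DFunLike.congr_fun (ExteriorAlgebra.map_id (R := R) (M := A)) a.1

lemma detMap_trans_apply {A B C : ProjMod R} [Module.Finite R A] [Module.Finite R B]
    [Module.Finite R C] (e : A ≃ₗ[R] B) (e' : B ≃ₗ[R] C) (a : detTop A) :
    detMap (e.trans e') a = detMap e' (detMap e a) := by
  ext1
  exact (extMap_comp e'.toLinearMap e.toLinearMap a.1).symm

lemma detMap_symm_apply_detMap {A B : ProjMod R} [Module.Finite R A] [Module.Finite R B]
    (e : A ≃ₗ[R] B) (a : detTop A) : detMap e.symm (detMap e a) = a := by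
  rw [← detMap_trans_apply, LinearEquiv.self_trans_symm, detMap_refl]
  rfl

lemma detMap_detMap_symm_apply {A B : ProjMod R} [Module.Finite R A] [Module.Finite R B]
    (e : A ≃ₗ[R] B) (b : detTop B) : detMap e (detMap e.symm b) = b :=
  detMap_symm_apply_detMap e.symm b

/-- The isomorphism of determinants induced by an isomorphism. -/
def detCongr {A B : ProjMod R} [Module.Finite R A] [Module.Finite R B] (e : A ≃ₗ[R] B) :
    detTop A ≃ₗ[R] detTop B :=
  LinearEquiv.ofLinearMap (detMap e) (detMap e.symm) (LinearMap.ext (detMap_detMap_symm_apply e))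
    (LinearMap.ext (detMap_symm_apply_detMap e))

/-- With a complement `B` such that `A ⊕ B` is free of finite rank, `det B` is an inverse of `det
A`. -/
instance detTop_invertible (A : ProjMod R) [Module.Finite R A] :
    Module.Invertible R (detTop A) := by
  obtain ⟨B, _, n, ⟨e⟩⟩ := exists_complement A
  obtain ⟨d⟩ := nonempty_detTop_freeMod_equiv (R := R) n
  exact Module.Invertible.left ((wedgeEquiv A B).trans ((detCongr e).trans d))

lemma coe_wedge {A B : ProjMod R} [Module.Finite R A] [Module.Finite R B] (a : detTop A)
    (b : detTop B) : ((wedge a b : detTop (A.prod B)) : ExteriorAlgebra R (A × B)) =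
      ExteriorAlgebra.map (LinearMap.inl R A B) a * ExteriorAlgebra.map (LinearMap.inr R A B) b :=
  rfl

lemma detMap_prodCongr_wedge {A A' B B' : ProjMod R} [Module.Finite R A] [Module.Finite R B]
    [Module.Finite R A'] [Module.Finite R B'] (e : A ≃ₗ[R] A') (e' : B ≃ₗ[R] B') (a : detTop A)
    (b : detTop B) :
    detMap (N := A.prod B) (M := A'.prod B') (e.prodCongr e') (wedge a b) =
      wedge (detMap e a) (detMap e' b) := by
  ext1
  rw [coe_wedge, detMap_coe, detMap_coe, detMap_coe, coe_wedge, map_mul]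
  simp only [extMap_comp]
  congr 3 <;> ext <;> simp

lemma detMap_prodAssoc_wedge {A B C : ProjMod R} [Module.Finite R A] [Module.Finite R B]
    [Module.Finite R C] (a : detTop A) (b : detTop B) (c : detTop C) :
    detMap (N := (A.prod B).prod C) (M := A.prod (B.prod C)) (LinearEquiv.prodAssoc R A B C)
      (wedge (wedge a b) c) = wedge a (wedge b c) := by
  ext1
  rw [detMap_coe, coe_wedge, coe_wedge, coe_wedge, coe_wedge]
  simp only [map_mul, extMap_comp, mul_assoc]
  congr 3

lemma detMap_prodAssoc_symm_wedge {A B C : ProjMod R} [Module.Finite R A] [Module.Finite R B]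
    [Module.Finite R C] (a : detTop A) (b : detTop B) (c : detTop C) :
    detMap (N := A.prod (B.prod C)) (M := (A.prod B).prod C) (LinearEquiv.prodAssoc R A B C).symm
      (wedge a (wedge b c)) = wedge (wedge a b) c := by
  rw [← detMap_prodAssoc_wedge]
  exact detMap_symm_apply_detMap (A := (A.prod B).prod C) (B := A.prod (B.prod C)) _ _

lemma locus_smul_mem {A : ProjMod R} [Module.Finite R A] (p : PrimeSpectrum R) (a : detTop A) :
    rkLocus A p • a.1 ∈ ⋀[R]^(Module.rankAtStalk (R := R) A p) A := a.2 _

/-- The commutativity constraint of determinants: exchanging the summands costs the sign `(-1) ^ (rk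
A * rk B)`. -/
lemma detMap_prodComm_wedge {A B : ProjMod R} [Module.Finite R A] [Module.Finite R B]
    (a : detTop A) (b : detTop B) :
    detMap (N := A.prod B) (M := B.prod A) (LinearEquiv.prodComm R A B) (wedge a b) =
      sgn (rk A * rk B) • wedge b a := by
  refine eq_of_locus (rk A) (rk B) fun p => ?_
  ext1
  have hs : (rkLocus A p * rkLocus B p) * sgn (rk A * rk B) =
      ((-1 : ℤ) ^ (Module.rankAtStalk (R := R) A p * Module.rankAtStalk (R := R) B p)) •
        (rkLocus A p * rkLocus B p) := by
    have h1 := locus_mul_sgn (rk A * rk B) (rk A p * rk B p)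
    have h2 : locus (rk A) (rk A p) * locus (rk B) (rk B p) *
        locus (rk A * rk B) (rk A p * rk B p) = locus (rk A) (rk A p) * locus (rk B) (rk B p) :=
      locus_mul_locus_mul_locus fun q hu hv => by rw [← hu, ← hv]; rfl
    have h3 : (((rk A p * rk B p).negOnePow : ℤˣ) : ℤ) =
        (-1 : ℤ) ^ (Module.rankAtStalk (R := R) A p * Module.rankAtStalk (R := R) B p) := by
      change ((((Module.rankAtStalk (R := R) A p : ℕ) : ℤ) *
        ((Module.rankAtStalk (R := R) B p : ℕ) : ℤ)).negOnePow : ℤ) = _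
      rw [← Nat.cast_mul, Int.negOnePow_def, zpow_natCast]
      push_cast
      rfl
    change (locus (rk A) (rk A p) * locus (rk B) (rk B p)) * sgn (rk A * rk B) =
      _ • (locus (rk A) (rk A p) * locus (rk B) (rk B p))
    rw [← h3, ← h2, mul_assoc, h1, mul_smul_comm]
  have h := extMap_mul_extMap_comm (LinearMap.inr R B A) (LinearMap.inl R B A)
    (locus_smul_mem p a) (locus_smul_mem p b)
  rw [map_smul, map_smul, smul_mul_smul_comm, smul_mul_smul_comm] at h
  change (rkLocus A p * rkLocus B p) • ExteriorAlgebra.map (LinearEquiv.prodComm R A B).toLinearMap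
      (ExteriorAlgebra.map _ a.1 * ExteriorAlgebra.map _ b.1) =
    (rkLocus A p * rkLocus B p) • sgn (rk A * rk B) •
      (ExteriorAlgebra.map _ b.1 * ExteriorAlgebra.map _ a.1)
  rw [smul_smul, hs, map_mul, extMap_comp, extMap_comp]
  refine Eq.trans ?_ (h.trans ?_)
  · congr 3
  · rw [smul_assoc, mul_comm (rkLocus A p)]

end DetTop

/-! ### Triangular isomorphisms, maps between determinants, and base change -/

section Triangular

variable {R : Type u} [CommRing R]

lemma detTop_sgn_smul_smul {A : ProjMod R} [Module.Finite R A]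
    (u : LocallyConstant (PrimeSpectrum R) ℤ) (a : detTop A) : sgn u • sgn u • a = a :=
  sgn_smul_smul u a

lemma locus_smul_mul_ι (A : ProjMod R) [Module.Finite R A] (p : PrimeSpectrum R) (a : detTop A)
    (x : A) : (rkLocus A p • a.1) * ExteriorAlgebra.ι R x = 0 := by
  have h : (rkLocus A p • a.1) * ExteriorAlgebra.ι R x ∈
      ⋀[R]^(Module.rankAtStalk (R := R) A p + 1) A := by
    rw [ExteriorAlgebra.exteriorPower, pow_succ]
    exact Submodule.mul_mem_mul (locus_smul_mem p a) ⟨x, rfl⟩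
  have h1 := locus_smul_exteriorPower_eq_zero A (Nat.lt_succ_self _) h
  rwa [smul_mul_assoc, smul_smul, locus_mul_self, ← smul_mul_assoc] at h1

/-- A top form on `A` absorbs the `A`-component of whatever is multiplied with it. -/
lemma extMap_inl_mul_extMap {A : ProjMod R} [Module.Finite R A] {B B' : Type u} [AddCommGroup B]
    [Module R B] [AddCommGroup B'] [Module R B'] (a : detTop A) (t : B →ₗ[R] A)
    (v : B →ₗ[R] B') (b : ExteriorAlgebra R B) :
    ExteriorAlgebra.map (LinearMap.inl R A B') a.1 *
        ExteriorAlgebra.map (LinearMap.inl R A B' ∘ₗ t + LinearMap.inr R A B' ∘ₗ v) b =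
      ExteriorAlgebra.map (LinearMap.inl R A B') a.1 *
        ExteriorAlgebra.map (LinearMap.inr R A B' ∘ₗ v) b := by
  -- on the locus where `A` has rank `n`, a top form lies in `⋀ⁿ A` and is killed by `A`
  refine eq_of_forall_prime (R := R) fun p => ⟨rkLocus A p, rkLocus_notMem A p, ?_⟩
  simp only [← smul_mul_assoc, ← map_smul]
  have ha := locus_smul_mem p a
  have ha0 := locus_smul_mul_ι A p a
  generalize rkLocus A p • a.1 = a' at ha ha0
  induction b using CliffordAlgebra.left_induction with
  | algebraMap r => simp
  | add x y hx hy => rw [map_add, map_add, mul_add, mul_add, hx, hy]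
  | ι_mul y x ih =>
    have h1 : ∀ z, ExteriorAlgebra.map (LinearMap.inl R A B') a' *
        (ExteriorAlgebra.ι R (LinearMap.inr R A B' (v x)) * z) = ((-1 : ℤ) ^
          (Module.rankAtStalk (R := R) A p * 1)) • (ExteriorAlgebra.ι R (LinearMap.inr R A B' (v x)) *
            (ExteriorAlgebra.map (LinearMap.inl R A B') a' * z)) := fun z => by
      have h2 := extMap_mul_extMap_comm (LinearMap.inl R A B') (LinearMap.inr R A B') (j := 1) ha
        (b := ExteriorAlgebra.ι R (v x)) (by
          rw [ExteriorAlgebra.exteriorPower, pow_one]; exact ⟨v x, rfl⟩)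
      rw [ExteriorAlgebra.map_apply_ι] at h2
      rw [← mul_assoc, h2, smul_mul_assoc, mul_assoc]
    have h3 : ∀ z, ExteriorAlgebra.map (LinearMap.inl R A B') a' *
        (ExteriorAlgebra.ι R (LinearMap.inl R A B' (t x)) * z) = 0 := fun z => by
      rw [← mul_assoc, ← ExteriorAlgebra.map_apply_ι, ← map_mul, ha0, map_zero, zero_mul]
    rw [map_mul, map_mul]
    change _ * (ExteriorAlgebra.map _ (ExteriorAlgebra.ι R x) * _) =
      _ * (ExteriorAlgebra.map _ (ExteriorAlgebra.ι R x) * _)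
    rw [ExteriorAlgebra.map_apply_ι, ExteriorAlgebra.map_apply_ι, LinearMap.add_apply, map_add,
      add_mul, mul_add]
    simp only [LinearMap.comp_apply]
    rw [h1, h1, h3, zero_add, ih]

/-- The determinant of a block upper triangular isomorphism. -/
lemma detMap_wedge_of_upper {A A' B B' : ProjMod R} [Module.Finite R A] [Module.Finite R B]
    [Module.Finite R A'] [Module.Finite R B'] (e : (A.prod B) ≃ₗ[R] (A'.prod B'))
    (e₁ : A ≃ₗ[R] A') (e₂ : B ≃ₗ[R] B') (t : B →ₗ[R] A')
    (h : ∀ x, e x = (e₁ x.1 + t x.2, e₂ x.2)) (a : detTop A) (b : detTop B) :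
    detMap e (wedge a b) = wedge (detMap e₁ a) (detMap e₂ b) := by
  ext1
  rw [coe_wedge, detMap_coe, coe_wedge, map_mul, extMap_comp, extMap_comp, detMap_coe e₂,
    extMap_comp, ← extMap_inl_mul_extMap (detMap e₁ a) t, detMap_coe, extMap_comp]
  congr 3
  · ext x <;> simp [h]
  · ext x <;> simp [h]

/-- The determinant of a block lower triangular isomorphism. -/
lemma detMap_wedge_of_lower {A A' B B' : ProjMod R} [Module.Finite R A] [Module.Finite R B]
    [Module.Finite R A'] [Module.Finite R B'] (e : (A.prod B) ≃ₗ[R] (A'.prod B'))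
    (e₁ : A ≃ₗ[R] A') (e₂ : B ≃ₗ[R] B') (t : A →ₗ[R] B')
    (h : ∀ x, e x = (e₁ x.1, e₂ x.2 + t x.1)) (a : detTop A) (b : detTop B) :
    detMap e (wedge a b) = wedge (detMap e₁ a) (detMap e₂ b) := by
  have h1 := detMap_wedge_of_upper (A := B) (A' := B') (B := A) (B' := A')
    (((LinearEquiv.prodComm R B A).trans e).trans (LinearEquiv.prodComm R A' B')) e₂ e₁ t
    (fun x => by
      change ((e (x.2, x.1)).2, (e (x.2, x.1)).1) = _
      rw [h]) b a
  have h2 : e = (LinearEquiv.prodComm R A B).trans (((((LinearEquiv.prodComm R B A).trans e).trans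
      (LinearEquiv.prodComm R A' B'))).trans (LinearEquiv.prodComm R B' A')) := by
    ext x <;> rfl
  rw [h2]
  rw [detMap_trans_apply (A := A.prod B) (B := B.prod A) (C := A'.prod B'),
    detMap_trans_apply (A := B.prod A) (B := B'.prod A') (C := A'.prod B'),
    detMap_prodComm_wedge, map_smul, h1, map_smul, detMap_prodComm_wedge, rk_congr e₁, rk_congr e₂,
    mul_comm (rk B'), detTop_sgn_smul_smul]

end Triangular

section Lines

variable {R : Type u} [CommRing R]

lemma wedge_left_cancel {A B : ProjMod R} [Module.Finite R A] [Module.Finite R B]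
    {b b' : detTop B} (h : ∀ a : detTop A, wedge a b = wedge a b') : b = b' := by
  have h1 : ∀ x : Module.Dual R (detTop A) ⊗[R] detTop A, contractLeft R (detTop A) x • b =
      contractLeft R (detTop A) x • b' := fun x => by
    induction x using TensorProduct.induction_on with
    | zero => simp
    | tmul l a =>
      have h2 : a ⊗ₜ[R] b = a ⊗ₜ[R] b' := (wedgeEquiv A B).injective (h a)
      have h3 := congrArg (TensorProduct.lid R (detTop B) ∘ l.rTensor (detTop B)) h2
      simpa using h3
    | add x y hx hy => simp only [map_add, add_smul, hx, hy]
  obtain ⟨x, hx⟩ := (Module.Invertible.bijective (R := R) (M := detTop A)).2 1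
  simpa [hx] using h1 x

lemma wedge_right_cancel {A B : ProjMod R} [Module.Finite R A] [Module.Finite R B]
    {a a' : detTop A} (h : ∀ b : detTop B, wedge a b = wedge a' b) : a = a' := by
  refine wedge_left_cancel (A := B) fun b => ?_
  have h1 := congrArg (detMap (N := A.prod B) (M := B.prod A) (LinearEquiv.prodComm R A B)) (h b)
  rw [detMap_prodComm_wedge, detMap_prodComm_wedge] at h1
  rw [← detTop_sgn_smul_smul (rk A * rk B) (wedge b a), h1, detTop_sgn_smul_smul]

/-- Tensoring a map `det B → det A` on the right with the identity of `det C`. -/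
def rstab {A B : ProjMod R} [Module.Finite R A] [Module.Finite R B] (C : ProjMod R)
    [Module.Finite R C] :
    (detTop B →ₗ[R] detTop A) ≃ₗ[R] (detTop (B.prod C) →ₗ[R] detTop (A.prod C)) :=
  (Module.Invertible.rTensorEquiv (detTop B) (detTop A)
    (TensorProduct.comm R (detTop C) (Module.Dual R (detTop C)) ≪≫ₗ
      Module.Invertible.linearEquiv R (detTop C))).trans
    ((wedgeEquiv B C).arrowCongr (wedgeEquiv A C))

lemma rstab_wedge {A B : ProjMod R} [Module.Finite R A] [Module.Finite R B] {C : ProjMod R}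
    [Module.Finite R C] (ξ : detTop B →ₗ[R] detTop A) (b : detTop B) (c : detTop C) :
    rstab C ξ (wedge b c) = wedge (ξ b) c := by
  rw [← wedgeEquiv_tmul, rstab, LinearEquiv.trans_apply, LinearEquiv.arrowCongr_apply,
    LinearEquiv.symm_apply_apply]
  rfl

lemma rstab_comp {A B B' : ProjMod R} [Module.Finite R A] [Module.Finite R B]
    [Module.Finite R B'] (C : ProjMod R) [Module.Finite R C] (ξ : detTop B' →ₗ[R] detTop A)
    (η : detTop B →ₗ[R] detTop B') : rstab C (ξ ∘ₗ η) = rstab C ξ ∘ₗ rstab C η :=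
  detTop_hom_ext fun b c => by
    rw [rstab_wedge, LinearMap.comp_apply, LinearMap.comp_apply, rstab_wedge, rstab_wedge]

lemma rstab_id (A C : ProjMod R) [Module.Finite R A] [Module.Finite R C] :
    rstab C (LinearMap.id : detTop A →ₗ[R] detTop A) = LinearMap.id :=
  detTop_hom_ext fun b c => by rw [rstab_wedge, LinearMap.id_apply, LinearMap.id_apply]

/-- Tensoring a map `det B → det A` on the left with the identity of `det C`, without the sign that
would be introduced by moving the map past `det C`. -/
def lstab {A B : ProjMod R} [Module.Finite R A] [Module.Finite R B] (C : ProjMod R)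
    [Module.Finite R C] :
    (detTop B →ₗ[R] detTop A) →ₗ[R] (detTop (C.prod B) →ₗ[R] detTop (C.prod A)) :=
  ((wedgeEquiv C B).arrowCongr (wedgeEquiv C A)).toLinearMap ∘ₗ LinearMap.lTensorHom (detTop C)

lemma lstab_wedge {A B : ProjMod R} [Module.Finite R A] [Module.Finite R B] {C : ProjMod R}
    [Module.Finite R C] (ξ : detTop B →ₗ[R] detTop A) (c : detTop C) (b : detTop B) :
    lstab C ξ (wedge c b) = wedge c (ξ b) := by
  rw [← wedgeEquiv_tmul, lstab, LinearMap.comp_apply, LinearEquiv.coe_coe,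
    LinearEquiv.arrowCongr_apply, LinearEquiv.symm_apply_apply]
  rfl

lemma lstab_injective {A B : ProjMod R} [Module.Finite R A] [Module.Finite R B] (C : ProjMod R)
    [Module.Finite R C] :
    Function.Injective (lstab (A := A) (B := B) C) := fun ξ η h => by
  ext1 b
  refine wedge_left_cancel (A := C) fun c => ?_
  rw [← lstab_wedge, ← lstab_wedge, h]

lemma contract_tmul {P Q : Type u} [AddCommGroup P] [Module R P] [AddCommGroup Q] [Module R Q]
    (a : P) (l : Module.Dual R Q) (b : Q) : contract (R := R) (a ⊗ₜ[R] l) b = l b • a := rfl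

/-- `contract` as an isomorphism, for finitely generated projective modules. -/
def contractEquiv (A B : Type u) [AddCommGroup A] [Module R A] [AddCommGroup B] [Module R B]
    [Module.Finite R B] [Module.Projective R A] [Module.Projective R B] :
    Ratio (R := R) A B ≃ₗ[R] (B →ₗ[R] A) :=
  (TensorProduct.comm R A (Module.Dual R B)).trans (dualTensorHomEquiv R B A)

lemma contractEquiv_apply {A B : Type u} [AddCommGroup A] [Module R A] [AddCommGroup B]
    [Module R B] [Module.Finite R B] [Module.Projective R A] [Module.Projective R B]
    (x : Ratio (R := R) A B) : contractEquiv A B x = contract x := rfl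

instance hom_invertible (P Q : Type u) [AddCommGroup P] [Module R P] [AddCommGroup Q] [Module R Q]
    [Module.Invertible R P] [Module.Invertible R Q] : Module.Invertible R (P →ₗ[R] Q) :=
  Module.Invertible.congr (contractEquiv Q P)

lemma exists_sum_dual_eq_one (P : Type u) [AddCommGroup P] [Module R P] [Module.Invertible R P] :
    ∃ x : Module.Dual R P ⊗[R] P, contractLeft R P x = 1 :=
  (Module.Invertible.bijective (R := R) (M := P)).2 1

/-- Composition of homomorphisms between lines. -/
def lineComp (P Q S : Type u) [AddCommGroup P] [Module R P] [AddCommGroup Q] [Module R Q]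
    [AddCommGroup S] [Module R S] : (Q →ₗ[R] S) ⊗[R] (P →ₗ[R] Q) →ₗ[R] (P →ₗ[R] S) :=
  TensorProduct.lift (LinearMap.llcomp R P Q S)

lemma lineComp_tmul {P Q S : Type u} [AddCommGroup P] [Module R P] [AddCommGroup Q] [Module R Q]
    [AddCommGroup S] [Module R S] (g : Q →ₗ[R] S) (f : P →ₗ[R] Q) :
    lineComp P Q S (g ⊗ₜ f) = g ∘ₗ f := rfl

/-- For lines `P`, `Q`, `S`, composition is an isomorphism `Hom (Q, S) ⊗ Hom (P, Q) ≃ Hom (P,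
S)`. -/
lemma lineComp_bijective (P Q S : Type u) [AddCommGroup P] [Module R P] [AddCommGroup Q]
    [Module R Q] [AddCommGroup S] [Module R S] [Module.Invertible R P] [Module.Invertible R Q]
    [Module.Invertible R S] : Function.Bijective (lineComp (R := R) P Q S) := by
  refine Module.Invertible.bijective_of_surjective fun h => ?_
  obtain ⟨x, hx⟩ := exists_sum_dual_eq_one (R := R) Q
  -- with `∑ lᵢ(qᵢ) = 1`, a map `l : P → S` is the sum of the composites `P → Q → S`
  suffices hs : ∀ x : Module.Dual R Q ⊗[R] Q, ∃ y, lineComp P Q S y = contractLeft R Q x • h by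
    obtain ⟨y, hy⟩ := hs x
    exact ⟨y, by rw [hy, hx, one_smul]⟩
  clear hx x
  intro x
  suffices hs : ∀ t : S ⊗[R] Module.Dual R P, ∃ y, lineComp P Q S y =
      contractLeft R Q x • contract t by
    obtain ⟨t, rfl⟩ := (contractEquiv (R := R) S P).surjective h
    exact hs t
  intro t
  induction x using TensorProduct.induction_on with
  | zero => exact ⟨0, by simp⟩
  | add x x' hx hx' =>
    obtain ⟨y, hy⟩ := hx
    obtain ⟨y', hy'⟩ := hx'
    exact ⟨y + y', by rw [map_add, hy, hy', map_add, add_smul]⟩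
  | tmul l q =>
    induction t using TensorProduct.induction_on with
    | zero => exact ⟨0, by simp⟩
    | add t t' ht ht' =>
      obtain ⟨y, hy⟩ := ht
      obtain ⟨y', hy'⟩ := ht'
      exact ⟨y + y', by rw [map_add, hy, hy', map_add, smul_add]⟩
    | tmul s m =>
      refine ⟨contract (s ⊗ₜ l) ⊗ₜ contract (q ⊗ₜ m), ?_⟩
      ext z
      rw [lineComp_tmul, LinearMap.comp_apply, contract_tmul q m z, map_smul, contract_tmul s l q,
        LinearMap.smul_apply, contract_tmul s m z, contractLeft_apply, smul_comm]

end Lines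

section BaseChange

variable {R : Type u} [CommRing R] (R' : Type u) [CommRing R'] [Algebra R R']

/-- The natural map `det A → det (R' ⊗ A)`, with target the determinant itself. -/
def bcDet (A : ProjMod R) [Module.Finite R A] : detTop A →ₗ[R] detTop (A.baseChange R') :=
  detBaseChange R' A

lemma coe_bcDet (A : ProjMod R) [Module.Finite R A] (a : detTop A) :
    (bcDet R' A a : ExteriorAlgebra R' (R' ⊗[R] A)) = extBaseChange R' A a.1 := rfl

/-- The base change `R' ⊗ det A → det (R' ⊗ A)`. -/
def bcLin (A : ProjMod R) [Module.Finite R A] :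
    R' ⊗[R] detTop A →ₗ[R'] detTop (A.baseChange R') :=
  (bcDet R' A).liftBaseChange R'

lemma bcLin_tmul (A : ProjMod R) [Module.Finite R A] (r : R') (a : detTop A) :
    bcLin R' A (r ⊗ₜ a) = r • bcDet R' A a := rfl

lemma locus_baseChange (A : ProjMod R) [Module.Finite R A] (n : ℤ) :
    locus (rk (A.baseChange R')) n = algebraMap R R' (locus (rk A) n) := by
  refine (eq_idem ((isIdempotentElem_idem _).map _) _ fun p => ?_).symm
  rw [rk_baseChange]
  exact mem_clopen_iff (clopenOf (rk A) {n}) (p.comap (algebraMap R R'))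

lemma exteriorPower_baseChange_le (M : Type u) [AddCommGroup M] [Module R M] (n : ℕ) :
    ⋀[R']^n (R' ⊗[R] M) ≤ Submodule.span R' (extBaseChange R' M '' (⋀[R]^n M : Set _)) := by
  induction n with
  | zero =>
    rw [ExteriorAlgebra.exteriorPower, pow_zero, Submodule.one_le]
    exact Submodule.subset_span ⟨1, by simp, map_one _⟩
  | succ n ih =>
    rw [ExteriorAlgebra.exteriorPower, pow_succ', Submodule.mul_le]
    rintro _ ⟨x, rfl⟩ y hy
    replace hy := ih hy
    induction x using TensorProduct.induction_on with
    | zero => rw [map_zero, zero_mul]; exact Submodule.zero_mem _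
    | add x x' hx hx' => rw [map_add, add_mul]; exact Submodule.add_mem _ hx hx'
    | tmul r m =>
      have hr : r ⊗ₜ[R] m = r • ((1 : R') ⊗ₜ[R] m) := by
        rw [TensorProduct.smul_tmul', smul_eq_mul, mul_one]
      rw [hr, map_smul, smul_mul_assoc]
      refine Submodule.smul_mem _ _ ?_
      induction hy using Submodule.span_induction with
      | zero => rw [mul_zero]; exact Submodule.zero_mem _
      | add a b _ _ ha hb => rw [mul_add]; exact Submodule.add_mem _ ha hb
      | smul r a _ ha => rw [mul_smul_comm]; exact Submodule.smul_mem _ _ ha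
      | mem a ha =>
        obtain ⟨ω, hω, rfl⟩ := ha
        rw [← extBaseChange_ι, ← map_mul]
        refine Submodule.subset_span ⟨_, ?_, rfl⟩
        rw [SetLike.mem_coe, ExteriorAlgebra.exteriorPower, pow_succ']
        exact Submodule.mul_mem_mul ⟨m, rfl⟩ hω

/-- Surjectivity suffices for bijectivity, as both sides are invertible modules. -/
lemma bcLin_surjective (A : ProjMod R) [Module.Finite R A] : Function.Surjective (bcLin R' A) := by
  intro ω
  let S : Submodule R' (ExteriorAlgebra R' (R' ⊗[R] A)) :=
    (LinearMap.range (bcLin R' A)).map (detTop (A.baseChange R')).subtype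
  suffices h : ω.1 ∈ S by
    obtain ⟨_, ⟨x, rfl⟩, hx⟩ := h
    exact ⟨x, Subtype.ext hx⟩
  refine mem_of_forall_prime fun p => ⟨_, rkLocus_notMem (A.baseChange R') p, ?_⟩
  rw [show rkLocus (A.baseChange R') p = _ from (locus_mul_self (rk (A.baseChange R')) _).symm,
    mul_smul]
  have h1 := exteriorPower_baseChange_le R' _ _ (locus_smul_mem p ω)
  generalize rkLocus (A.baseChange R') p • ω.1 = y at h1
  induction h1 using Submodule.span_induction with
  | zero => rw [smul_zero]; exact Submodule.zero_mem _
  | add a b _ _ ha hb => rw [smul_add]; exact Submodule.add_mem _ ha hb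
  | smul r a _ ha => rw [smul_comm]; exact Submodule.smul_mem _ _ ha
  | mem a ha =>
    obtain ⟨ω', hω', rfl⟩ := ha
    rw [locus_baseChange, algebraMap_smul, ← map_smul]
    exact ⟨_, ⟨1 ⊗ₜ ⟨_, locus_smul_mem_detTop A hω'⟩,
      (bcLin_tmul R' A 1 _).trans (one_smul _ _)⟩, rfl⟩

instance detTop_baseChange_invertible (A : ProjMod R) [Module.Finite R A] :
    Module.Invertible R' (detTop (A.baseChange R')) :=
  detTop_invertible (A.baseChange R')

/-- The isomorphism `R' ⊗ det A ≃ det (R' ⊗ A)`. -/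
def bcEquiv (A : ProjMod R) [Module.Finite R A] :
    R' ⊗[R] detTop A ≃ₗ[R'] detTop (A.baseChange R') :=
  LinearEquiv.ofBijective (bcLin R' A)
    (Module.Invertible.bijective_of_surjective (bcLin_surjective R' A))

lemma bcEquiv_one_tmul (A : ProjMod R) [Module.Finite R A] (a : detTop A) :
    bcEquiv R' A (1 ⊗ₜ a) = bcDet R' A a := (bcLin_tmul R' A 1 a).trans (one_smul _ _)

/-- The elements coming from `det A` generate `det (R' ⊗ A)`. -/
lemma bcDet_hom_ext {A : ProjMod R} [Module.Finite R A] {V : Type*} [AddCommGroup V] [Module R' V]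
    {f g : detTop (A.baseChange R') →ₗ[R'] V} (h : ∀ a, f (bcDet R' A a) = g (bcDet R' A a)) :
    f = g := by
  have h1 : f ∘ₗ (bcEquiv R' A).toLinearMap = g ∘ₗ (bcEquiv R' A).toLinearMap := by
    refine LinearMap.ext fun x => ?_
    induction x using TensorProduct.induction_on with
    | zero => simp
    | add x y hx hy => rw [map_add, map_add, hx, hy]
    | tmul r a =>
      have hr : r ⊗ₜ[R] a = r • ((1 : R') ⊗ₜ[R] a) := by
        rw [TensorProduct.smul_tmul', smul_eq_mul, mul_one]
      rw [hr, map_smul, map_smul]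
      change r • f (bcEquiv R' A (1 ⊗ₜ a)) = r • g (bcEquiv R' A (1 ⊗ₜ a))
      rw [bcEquiv_one_tmul, h]
  ext x
  obtain ⟨y, rfl⟩ := (bcEquiv R' A).surjective x
  exact DFunLike.congr_fun h1 y

/-- The base change of a map between determinants. -/
def bcHom {A B : ProjMod R} [Module.Finite R A] [Module.Finite R B] :
    (detTop B →ₗ[R] detTop A) →ₗ[R]
      (detTop (B.baseChange R') →ₗ[R'] detTop (A.baseChange R')) where
  toFun ξ := (bcEquiv R' A).toLinearMap ∘ₗ ξ.baseChange R' ∘ₗ (bcEquiv R' B).symm.toLinearMap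
  map_add' ξ η := by
    rw [LinearMap.baseChange_add, LinearMap.add_comp, LinearMap.comp_add]
  map_smul' r ξ := by
    rw [LinearMap.baseChange_smul, LinearMap.smul_comp]
    ext x : 1
    change bcEquiv R' A (r • _) = r • bcEquiv R' A _
    rw [← algebraMap_smul R' r, map_smul, algebraMap_smul]

lemma bcHom_bcDet {A B : ProjMod R} [Module.Finite R A] [Module.Finite R B]
    (ξ : detTop B →ₗ[R] detTop A) (b : detTop B) :
    bcHom R' ξ (bcDet R' B b) = bcDet R' A (ξ b) := by
  rw [← bcEquiv_one_tmul, ← bcEquiv_one_tmul]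
  change bcEquiv R' A (ξ.baseChange R' ((bcEquiv R' B).symm (bcEquiv R' B (1 ⊗ₜ b)))) = _
  rw [LinearEquiv.symm_apply_apply, LinearMap.baseChange_tmul]

lemma bcHom_lift_bijective (A B : ProjMod R) [Module.Finite R A] [Module.Finite R B] :
    Function.Bijective ((bcHom R' (A := A) (B := B)).liftBaseChange R') := by
  refine Module.Invertible.bijective_of_surjective ?_
  rw [← Module.Invertible.rTensor_surjective_iff (M := detTop (B.baseChange R'))]
  -- compare with the evaluation map `Hom (det B', det A') ⊗ det B' → det A'`
  let ev : (detTop (B.baseChange R') →ₗ[R'] detTop (A.baseChange R')) ⊗[R']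
      detTop (B.baseChange R') →ₗ[R'] detTop (A.baseChange R') := TensorProduct.lift LinearMap.id
  have key : Function.Surjective (ev ∘ₗ LinearMap.rTensor (detTop (B.baseChange R'))
      ((bcHom R' (A := A) (B := B)).liftBaseChange R')) := by
    rw [← LinearMap.range_eq_top, eq_top_iff]
    rintro x -
    obtain ⟨y, rfl⟩ := (bcEquiv R' A).surjective x
    induction y using TensorProduct.induction_on with
    | zero => rw [map_zero]; exact Submodule.zero_mem _
    | add x y hx hy => rw [map_add]; exact Submodule.add_mem _ hx hy
    | tmul r a =>
      have hr : r ⊗ₜ[R] a = r • ((1 : R') ⊗ₜ[R] a) := by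
        rw [TensorProduct.smul_tmul', smul_eq_mul, mul_one]
      rw [hr, map_smul]
      refine Submodule.smul_mem _ _ ?_
      rw [bcEquiv_one_tmul]
      obtain ⟨x, hx⟩ := exists_sum_dual_eq_one (R := R) (detTop B)
      rw [← one_smul R a, ← hx, map_smul]
      clear hx hr
      induction x using TensorProduct.induction_on with
      | zero => rw [map_zero, zero_smul]; exact Submodule.zero_mem _
      | add x y hx hy => rw [map_add, add_smul]; exact Submodule.add_mem _ hx hy
      | tmul l b =>
        refine ⟨(1 ⊗ₜ contract (a ⊗ₜ l)) ⊗ₜ bcDet R' B b, ?_⟩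
        change ((1 : R') • bcHom R' (contract (a ⊗ₜ l))) (bcDet R' B b) = _
        rw [one_smul, bcHom_bcDet, contract_tmul, map_smul, contractLeft_apply]
  have hev : Function.Bijective ev := Module.Invertible.bijective_of_surjective
    (Function.Surjective.of_comp (g := LinearMap.rTensor (detTop (B.baseChange R'))
      ((bcHom R' (A := A) (B := B)).liftBaseChange R')) key)
  intro y
  obtain ⟨x, hx⟩ := key (ev y)
  exact ⟨x, hev.1 hx⟩

lemma extBaseChange_map {M N : Type u} [AddCommGroup M] [Module R M] [AddCommGroup N] [Module R N]
    (f : M →ₗ[R] N) (ω : ExteriorAlgebra R M) :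
    extBaseChange R' N (ExteriorAlgebra.map f ω) =
      ExteriorAlgebra.map (f.baseChange R') (extBaseChange R' M ω) := by
  have h : (extBaseChange R' N).comp (ExteriorAlgebra.map f) =
      ((ExteriorAlgebra.map (f.baseChange R')).restrictScalars R).comp (extBaseChange R' M) := by
    refine ExteriorAlgebra.hom_ext (LinearMap.ext fun m => ?_)
    change extBaseChange R' N (ExteriorAlgebra.map f (ExteriorAlgebra.ι R m)) =
      ExteriorAlgebra.map (f.baseChange R') (extBaseChange R' M (ExteriorAlgebra.ι R m))
    rw [ExteriorAlgebra.map_apply_ι, extBaseChange_ι, extBaseChange_ι, ExteriorAlgebra.map_apply_ι,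
      LinearMap.baseChange_tmul]
  exact DFunLike.congr_fun h ω

lemma bcDet_detMap {A B : ProjMod R} [Module.Finite R A] [Module.Finite R B] (e : A ≃ₗ[R] B)
    (a : detTop A) : bcDet R' B (detMap e a) =
      detMap (N := A.baseChange R') (M := B.baseChange R') (e.baseChange R R' A B)
        (bcDet R' A a) := by
  ext1
  exact extBaseChange_map R' e.toLinearMap a.1

lemma bcDet_wedge {A B : ProjMod R} [Module.Finite R A] [Module.Finite R B] (a : detTop A)
    (b : detTop B) :
    detMap (N := (A.prod B).baseChange R') (M := (A.baseChange R').prod (B.baseChange R'))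
      (TensorProduct.prodRight R R' R' A B) (bcDet R' (A.prod B) (wedge a b)) =
        wedge (bcDet R' A a) (bcDet R' B b) := by
  ext1
  rw [detMap_coe, coe_bcDet, coe_wedge, coe_wedge, map_mul, map_mul, coe_bcDet, coe_bcDet]
  rw [extBaseChange_map, extBaseChange_map, extMap_comp, extMap_comp]
  congr 3 <;> ext <;> simp

lemma bcDet_trans (R'' : Type u) [CommRing R''] [Algebra R R''] [Algebra R' R'']
    [IsScalarTower R R' R''] (A : ProjMod R) [Module.Finite R A] (a : detTop A) :
    detMap (N := (A.baseChange R').baseChange R'') (M := A.baseChange R'')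
      (TensorProduct.AlgebraTensorModule.cancelBaseChange R R' R'' R'' A)
      (bcDet R'' (A.baseChange R') (bcDet R' A a)) = bcDet R'' A a := by
  ext1
  rw [detMap_coe, coe_bcDet, coe_bcDet, coe_bcDet]
  have h : ((ExteriorAlgebra.map (TensorProduct.AlgebraTensorModule.cancelBaseChange R R' R'' R''
      A).toLinearMap).restrictScalars R).comp
      (((extBaseChange R'' (R' ⊗[R] A)).restrictScalars R).comp (extBaseChange R' A)) =
      extBaseChange R'' A := by
    refine ExteriorAlgebra.hom_ext (LinearMap.ext fun m => ?_)
    change ExteriorAlgebra.map _ (extBaseChange R'' (R' ⊗[R] A)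
      (extBaseChange R' A (ExteriorAlgebra.ι R m))) = extBaseChange R'' A (ExteriorAlgebra.ι R m)
    rw [extBaseChange_ι, extBaseChange_ι, extBaseChange_ι, ExteriorAlgebra.map_apply_ι]
    simp
  exact DFunLike.congr_fun h a.1

end BaseChange

/-! ### Determinants of isomorphisms close to the identity -/

section Lines

variable {R : Type u} [CommRing R]

/-- Bijectivity is deduced from that of `rstab` by exchanging the two factors. -/
lemma lstab_bijective {A B : ProjMod R} [Module.Finite R A] [Module.Finite R B] (C : ProjMod R)
    [Module.Finite R C] : Function.Bijective (lstab (A := A) (B := B) C) := by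
  refine ⟨lstab_injective C, fun η => ?_⟩
  let η' : detTop (B.prod C) →ₗ[R] detTop (A.prod C) :=
    detMap (N := C.prod A) (M := A.prod C) (LinearEquiv.prodComm R C A) ∘ₗ η ∘ₗ
      detMap (N := B.prod C) (M := C.prod B) (LinearEquiv.prodComm R B C)
  obtain ⟨ξ, hξ⟩ := (rstab (A := A) (B := B) C).surjective η'
  refine ⟨(sgn (rk C * rk A) * sgn (rk B * rk C)) • ξ, detTop_hom_ext fun c b => ?_⟩
  have h1 := DFunLike.congr_fun hξ (wedge b c)
  rw [rstab_wedge] at h1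
  change wedge (ξ b) c = detMap _ (η (detMap _ (wedge b c))) at h1
  rw [detMap_prodComm_wedge, map_smul, map_smul] at h1
  have h2 := congrArg (detMap (N := A.prod C) (M := C.prod A) (LinearEquiv.prodComm R A C)) h1
  rw [detMap_prodComm_wedge, map_smul] at h2
  have h3 : ∀ z, detMap (N := A.prod C) (M := C.prod A) (LinearEquiv.prodComm R A C)
      (detMap (N := C.prod A) (M := A.prod C) (LinearEquiv.prodComm R C A) z) = z :=
    detMap_symm_apply_detMap (A := C.prod A) (B := A.prod C) (LinearEquiv.prodComm R C A)
  rw [h3] at h2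
  rw [lstab_wedge, LinearMap.smul_apply, wedge_smul_right, mul_comm (sgn (rk C * rk A)), mul_smul,
    mul_comm (rk C), h2]
  exact detTop_sgn_smul_smul (A := C.prod A) _ _

end Lines

section Fred

variable {R : Type u} [CommRing R]

/-- An isomorphism `M × P ≃ M × Q` that differs from the identity of `M` by a map with image in a
finitely generated submodule. For `P`, `Q` of finite rank such maps have a determinant
`det P → det Q`. -/
def IsFred {M P Q : ProjMod R} (w : (M.prod P) ≃ₗ[R] (M.prod Q)) : Prop :=
  ∃ T : Submodule R M, T.FG ∧ ∀ x, (w x).1 - x.1 ∈ T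

lemma IsFred.symm {M P Q : ProjMod R} {w : (M.prod P) ≃ₗ[R] (M.prod Q)} (hw : IsFred w) :
    IsFred (M := M) (P := Q) (Q := P) w.symm := by
  obtain ⟨T, hT, h⟩ := hw
  refine ⟨T, hT, fun x => ?_⟩
  have := h (w.symm x)
  rw [LinearEquiv.apply_symm_apply] at this
  rw [← neg_sub]
  exact T.neg_mem this

lemma IsFred.trans {M P Q S : ProjMod R} {w : (M.prod P) ≃ₗ[R] (M.prod Q)}
    {w' : (M.prod Q) ≃ₗ[R] (M.prod S)} (hw : IsFred w) (hw' : IsFred w') :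
    IsFred (M := M) (P := P) (Q := S) (w.trans w') := by
  obtain ⟨T, hT, h⟩ := hw
  obtain ⟨T', hT', h'⟩ := hw'
  refine ⟨T ⊔ T', hT.sup hT', fun x => ?_⟩
  have := Submodule.add_mem_sup (h x) (h' (w x))
  rw [add_comm, sub_add_sub_cancel] at this
  exact this

lemma IsFred.of_fst_eq {M P Q : ProjMod R} {w : (M.prod P) ≃ₗ[R] (M.prod Q)}
    (h : ∀ x, (w x).1 = x.1) : IsFred w :=
  ⟨⊥, Submodule.fg_bot, fun x => by rw [h, sub_self]; exact Submodule.zero_mem _⟩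

/-- `w` is the identity of `M` up to a map whose image is fixed by `s ∘ p`, for maps `p : M → F` and
`s : F → M`. -/
def Good {M P Q F : ProjMod R} (w : (M.prod P) ≃ₗ[R] (M.prod Q)) (p : M →ₗ[R] F) (s : F →ₗ[R] M) :
    Prop :=
  ∀ x, s (p ((w x).1 - x.1)) = (w x).1 - x.1

/-- Every finitely generated submodule of a projective module is fixed by an endomorphism that
factors through a free module of finite rank. -/
lemma exists_factor (M : ProjMod R) {T : Submodule R M} (hT : T.FG) :
    ∃ (F : ProjMod R) (_ : Module.Finite R F) (p : M →ₗ[R] F) (s : F →ₗ[R] M),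
      ∀ t ∈ T, s (p t) = t := by
  classical
  obtain ⟨i, hi⟩ := Module.projective_def'.1 M.projective
  obtain ⟨S, rfl⟩ := hT
  let J : Finset M := S.biUnion fun t => (i t).support
  let F : ProjMod R := { carrier := J → R }
  let p : M →ₗ[R] F := LinearMap.pi fun j => Finsupp.lapply (j : M) ∘ₗ i
  let s : F →ₗ[R] M := Fintype.linearCombination R (fun j : J => (j : M))
  refine ⟨F, inferInstanceAs (Module.Finite R (J → R)), p, s, fun t ht => ?_⟩
  have h : ∀ t ∈ S, (s ∘ₗ p) t = LinearMap.id (R := R) t := fun t ht => by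
    have h1 : Finsupp.linearCombination R id (i t) = t := DFunLike.congr_fun hi t
    have h2 : (i t).support ⊆ J := Finset.subset_biUnion_of_mem (fun t => (i t).support) ht
    have h3 : s (p t) = ∑ j : J, (i t) j • (j : M) := by
      exact Fintype.linearCombination_apply ..
    rw [LinearMap.comp_apply, LinearMap.id_apply, h3, Finset.sum_coe_sort J fun j => (i t) j • j]
    rw [Finsupp.linearCombination_apply] at h1
    rw [Finsupp.sum_of_support_subset _ h2 _ (by simp)] at h1
    exact h1
  exact LinearMap.eqOn_span (f := s ∘ₗ p) (g := LinearMap.id) (s := (S : Set M)) h ht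

lemma IsFred.exists_good {M P Q : ProjMod R} {w : (M.prod P) ≃ₗ[R] (M.prod Q)} (hw : IsFred w) :
    ∃ (F : ProjMod R) (_ : Module.Finite R F) (p : M →ₗ[R] F) (s : F →ₗ[R] M), Good w p s := by
  obtain ⟨T, hT, h⟩ := hw
  obtain ⟨F, hF, p, s, hps⟩ := exists_factor M hT
  exact ⟨F, hF, p, s, fun x => hps _ (h x)⟩

lemma Good.symm {M P Q F : ProjMod R} {w : (M.prod P) ≃ₗ[R] (M.prod Q)} {p : M →ₗ[R] F}
    {s : F →ₗ[R] M} (h : Good w p s) : Good (M := M) (P := Q) (Q := P) w.symm p s := fun x => by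
  have := h (w.symm x)
  rw [LinearEquiv.apply_symm_apply] at this
  rw [← neg_sub, map_neg, map_neg, this]

/-- The compression of `w` to `F`. It commutes with `s` up to `w`. -/
def cmpLin {M P Q F : ProjMod R} (w : (M.prod P) ≃ₗ[R] (M.prod Q)) (p : M →ₗ[R] F)
    (s : F →ₗ[R] M) : (F.prod P) →ₗ[R] (F.prod Q) :=
  (LinearMap.fst R F P + p ∘ₗ (LinearMap.fst R M Q ∘ₗ w.toLinearMap ∘ₗ s.prodMap LinearMap.id -
    s ∘ₗ LinearMap.fst R F P)).prod
      (LinearMap.snd R M Q ∘ₗ w.toLinearMap ∘ₗ s.prodMap LinearMap.id)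

lemma cmpLin_apply {M P Q F : ProjMod R} (w : (M.prod P) ≃ₗ[R] (M.prod Q)) (p : M →ₗ[R] F)
    (s : F →ₗ[R] M) (x : F.prod P) : cmpLin w p s x =
      (x.1 + p ((w (s x.1, x.2)).1 - s x.1), (w (s x.1, x.2)).2) := rfl

lemma Good.section_cmpLin {M P Q F : ProjMod R} {w : (M.prod P) ≃ₗ[R] (M.prod Q)} {p : M →ₗ[R] F}
    {s : F →ₗ[R] M} (h : Good w p s) (x : F.prod P) :
    (s (cmpLin w p s x).1, (cmpLin w p s x).2) = w (s x.1, x.2) := by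
  rw [cmpLin_apply]
  refine Prod.ext ?_ rfl
  have := h (s x.1, x.2)
  change s (x.1 + p ((w (s x.1, x.2)).1 - s x.1)) = _
  rw [map_add, this]
  exact add_sub_cancel _ _

lemma Good.cmpLin_cmpLin {M P Q S F : ProjMod R} {w : (M.prod P) ≃ₗ[R] (M.prod Q)}
    {p : M →ₗ[R] F} {s : F →ₗ[R] M} (h : Good w p s) (w' : (M.prod Q) ≃ₗ[R] (M.prod S))
    (x : F.prod P) : cmpLin w' p s (cmpLin w p s x) =
      cmpLin (M := M) (P := P) (Q := S) (w.trans w') p s x := by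
  have h1 := h.section_cmpLin x
  rw [cmpLin_apply w', h1, cmpLin_apply (M := M) (P := P) (Q := S)]
  refine Prod.ext ?_ rfl
  have h2 : s (cmpLin w p s x).1 = (w (s x.1, x.2)).1 := congrArg Prod.fst h1
  change (cmpLin w p s x).1 + p ((w' (w (s x.1, x.2))).1 - s (cmpLin w p s x).1) =
    x.1 + p ((w' (w (s x.1, x.2))).1 - s x.1)
  rw [h2, cmpLin_apply]
  change x.1 + p ((w (s x.1, x.2)).1 - s x.1) + _ = _
  simp only [map_sub]
  abel

lemma cmpLin_refl {M P F : ProjMod R} (p : M →ₗ[R] F) (s : F →ₗ[R] M) (x : F.prod P) :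
    cmpLin (LinearEquiv.refl R (M.prod P)) p s x = x := by
  rw [cmpLin_apply]
  refine Prod.ext ?_ rfl
  change x.1 + p (s x.1 - s x.1) = x.1
  rw [sub_self, map_zero, add_zero]

/-- The compression as an isomorphism. -/
def cmp {M P Q F : ProjMod R} {w : (M.prod P) ≃ₗ[R] (M.prod Q)} {p : M →ₗ[R] F} {s : F →ₗ[R] M}
    (h : Good w p s) : (F.prod P) ≃ₗ[R] (F.prod Q) :=
  LinearEquiv.ofLinearMap (cmpLin w p s) (cmpLin (M := M) (P := Q) (Q := P) w.symm p s)
    (LinearMap.ext fun x => by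
      rw [LinearMap.comp_apply, h.symm.cmpLin_cmpLin, LinearEquiv.symm_trans_self, cmpLin_refl]
      rfl)
    (LinearMap.ext fun x => by
      rw [LinearMap.comp_apply, h.cmpLin_cmpLin, LinearEquiv.self_trans_symm, cmpLin_refl]
      rfl)

lemma cmp_apply {M P Q F : ProjMod R} {w : (M.prod P) ≃ₗ[R] (M.prod Q)} {p : M →ₗ[R] F}
    {s : F →ₗ[R] M} (h : Good w p s) (x : F.prod P) : cmp h x = cmpLin w p s x := rfl

lemma detMap_comp_of_eq {A B C : ProjMod R} [Module.Finite R A] [Module.Finite R B]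
    [Module.Finite R C] {e : A ≃ₗ[R] B} {e' : B ≃ₗ[R] C} {e'' : A ≃ₗ[R] C}
    (h : ∀ x, e'' x = e' (e x)) (a : detTop A) : detMap e'' a = detMap e' (detMap e a) := by
  rw [← detMap_trans_apply]
  exact congrArg (fun e => detMap e a) (LinearEquiv.ext h)

lemma detMap_comp_eq_comp {A B B' C : ProjMod R} [Module.Finite R A] [Module.Finite R B]
    [Module.Finite R B'] [Module.Finite R C] {e₁ : A ≃ₗ[R] B} {e₂ : B ≃ₗ[R] C} {e₃ : A ≃ₗ[R] B'}
    {e₄ : B' ≃ₗ[R] C} (h : ∀ x, e₂ (e₁ x) = e₄ (e₃ x)) (a : detTop A) :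
    detMap e₂ (detMap e₁ a) = detMap e₄ (detMap e₃ a) := by
  rw [← detMap_comp_of_eq (e := e₃) (e' := e₄) (e'' := e₁.trans e₂) h, detMap_trans_apply]

/-- `e : F × P ≃ F × Q` has determinant `ξ` relative to `F`: its determinant is the identity of `det
F` tensored with `ξ`. -/
def HasRelDet {F P Q : ProjMod R} [Module.Finite R F] [Module.Finite R P] [Module.Finite R Q]
    (e : (F.prod P) ≃ₗ[R] (F.prod Q)) (ξ : detTop P →ₗ[R] detTop Q) : Prop :=
  ∀ φ a, detMap e (wedge φ a) = wedge φ (ξ a)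

lemma HasRelDet.unique {F P Q : ProjMod R} [Module.Finite R F] [Module.Finite R P]
    [Module.Finite R Q] {e : (F.prod P) ≃ₗ[R] (F.prod Q)} {ξ ξ' : detTop P →ₗ[R] detTop Q}
    (h : HasRelDet e ξ) (h' : HasRelDet e ξ') : ξ = ξ' :=
  LinearMap.ext fun a => wedge_left_cancel fun φ => by rw [← h, ← h']

lemma HasRelDet.congr {F P Q : ProjMod R} [Module.Finite R F] [Module.Finite R P]
    [Module.Finite R Q] {e e' : (F.prod P) ≃ₗ[R] (F.prod Q)} {ξ : detTop P →ₗ[R] detTop Q}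
    (h : HasRelDet e ξ) (hee' : ∀ x, e x = e' x) : HasRelDet e' ξ := by
  obtain rfl : e = e' := LinearEquiv.ext hee'
  exact h

lemma exists_hasRelDet {F P Q : ProjMod R} [Module.Finite R F] [Module.Finite R P]
    [Module.Finite R Q] (e : (F.prod P) ≃ₗ[R] (F.prod Q)) : ∃ ξ, HasRelDet e ξ := by
  obtain ⟨ξ, hξ⟩ := (lstab_bijective F).2 (detMap e)
  exact ⟨ξ, fun φ a => by rw [← hξ, lstab_wedge]⟩

lemma HasRelDet.comp {F P Q S : ProjMod R} [Module.Finite R F] [Module.Finite R P]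
    [Module.Finite R Q] [Module.Finite R S] {e : (F.prod P) ≃ₗ[R] (F.prod Q)}
    {e' : (F.prod Q) ≃ₗ[R] (F.prod S)} {e'' : (F.prod P) ≃ₗ[R] (F.prod S)}
    {ξ : detTop P →ₗ[R] detTop Q} {η : detTop Q →ₗ[R] detTop S}
    (h : HasRelDet e ξ) (h' : HasRelDet e' η) (hc : ∀ x, e'' x = e' (e x)) :
    HasRelDet e'' (η ∘ₗ ξ) := fun φ a => by
  rw [detMap_comp_of_eq hc, h, h', LinearMap.comp_apply]

/-- Relative determinants do not change under conjugation with isomorphisms of `F`. -/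
lemma HasRelDet.conj {F F' P Q : ProjMod R} [Module.Finite R F] [Module.Finite R F']
    [Module.Finite R P] [Module.Finite R Q] {e : (F.prod P) ≃ₗ[R] (F.prod Q)}
    {e' : (F'.prod P) ≃ₗ[R] (F'.prod Q)} {ξ : detTop P →ₗ[R] detTop Q} (h : HasRelDet e ξ)
    (U : F ≃ₗ[R] F') (hU : ∀ x, e' (U x.1, x.2) = (U (e x).1, (e x).2)) : HasRelDet e' ξ := by
  intro φ a
  obtain ⟨φ, rfl⟩ := (detCongr U).surjective φ
  change detMap e' (wedge (detMap U φ) a) = wedge (detMap U φ) (ξ a)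
  have h1 := detMap_comp_eq_comp (A := F.prod P) (B := F'.prod P) (B' := F.prod Q)
    (C := F'.prod Q) (e₁ := U.prodCongr (LinearEquiv.refl R P)) (e₂ := e') (e₃ := e)
    (e₄ := U.prodCongr (LinearEquiv.refl R Q)) hU (wedge φ a)
  rw [detMap_prodCongr_wedge, h, detMap_prodCongr_wedge, detMap_refl, detMap_refl] at h1
  exact h1

/-- A relative determinant over `F₂` is one over `F₁ × F₂` as well, also after adding to `e` a map
`t` defined on `F₁`: such an isomorphism is block triangular. -/
lemma HasRelDet.of_right {F₁ F₂ P Q : ProjMod R} [Module.Finite R F₁] [Module.Finite R F₂]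
    [Module.Finite R P] [Module.Finite R Q] {e : (F₂.prod P) ≃ₗ[R] (F₂.prod Q)}
    {e' : ((F₁.prod F₂).prod P) ≃ₗ[R] ((F₁.prod F₂).prod Q)} {ξ : detTop P →ₗ[R] detTop Q}
    (h : HasRelDet e ξ) (t : F₁ →ₗ[R] F₂.prod Q)
    (he : ∀ x, e' x = ((x.1.1, (e (x.1.2, x.2) + t x.1.1).1), (e (x.1.2, x.2) + t x.1.1).2)) :
    HasRelDet e' ξ := by
  intro φ a
  induction φ using wedge_induction with
  | hadd x y hx hy =>
    rw [wedge_add_left, map_add, hx, hy, wedge_add_left]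
  | h φ₁ φ₂ =>
    let E : (F₁.prod (F₂.prod P)) ≃ₗ[R] (F₁.prod (F₂.prod Q)) :=
      ((LinearEquiv.prodAssoc R F₁ F₂ P).symm.trans e').trans (LinearEquiv.prodAssoc R F₁ F₂ Q)
    have h1 := detMap_wedge_of_lower (A := F₁) (A' := F₁) (B := F₂.prod P) (B' := F₂.prod Q) E
      (LinearEquiv.refl R F₁) e t (fun x => by
        change ((e' ((x.1, x.2.1), x.2.2)).1.1, ((e' ((x.1, x.2.1), x.2.2)).1.2,
          (e' ((x.1, x.2.1), x.2.2)).2)) = _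
        rw [he]
        rfl) φ₁ (wedge φ₂ a)
    rw [detMap_refl, h, LinearMap.id_apply] at h1
    have h2 := detMap_comp_of_eq (A := F₁.prod (F₂.prod P)) (B := (F₁.prod F₂).prod P)
      (C := (F₁.prod F₂).prod Q) (e := (LinearEquiv.prodAssoc R F₁ F₂ P).symm) (e' := e')
      (e'' := ((LinearEquiv.prodAssoc R F₁ F₂ P).symm.trans e')) (fun x => rfl)
      (wedge φ₁ (wedge φ₂ a))
    have h3 := detMap_comp_of_eq (A := F₁.prod (F₂.prod P)) (B := F₁.prod (F₂.prod Q))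
      (C := (F₁.prod F₂).prod Q) (e := E) (e' := (LinearEquiv.prodAssoc R F₁ F₂ Q).symm)
      (e'' := ((LinearEquiv.prodAssoc R F₁ F₂ P).symm.trans e')) (fun x => rfl)
      (wedge φ₁ (wedge φ₂ a))
    rw [h2, detMap_prodAssoc_symm_wedge, h1, detMap_prodAssoc_symm_wedge] at h3
    exact h3

/-- Compressions to `F` and to a larger `F'` have the same relative determinant: on `F' × F` the
compression of `w` to `F` is conjugate to the compression of `w` to `F'`. -/
lemma hasRelDet_cmp_of_le {M P Q F F' : ProjMod R} [Module.Finite R F] [Module.Finite R F']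
    [Module.Finite R P] [Module.Finite R Q] {w : (M.prod P) ≃ₗ[R] (M.prod Q)}
    {p : M →ₗ[R] F} {s : F →ₗ[R] M} {p' : M →ₗ[R] F'} {s' : F' →ₗ[R] M} (h : Good w p s)
    (h' : Good w p' s') (hs : ∀ x, s' (p' (s x)) = s x) {ξ : detTop P →ₗ[R] detTop Q}
    (hξ : HasRelDet (cmp h) ξ) : HasRelDet (cmp h') ξ := by
  have hs' : ∀ x, s' (p' (s x)) = s x := hs
  -- `U` conjugates `W`, which is the compression to `F'` on `F' × P` and the identity on `F`, into
  -- `V`, which is the compression to `F` up to a map defined on `F'`.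
  let U : (F'.prod F) ≃ₗ[R] (F.prod F') := LinearEquiv.ofLinearMap
    ((LinearMap.snd R F' F - p ∘ₗ s' ∘ₗ (LinearMap.fst R F' F + p' ∘ₗ s ∘ₗ LinearMap.snd R F' F)).prod
      (LinearMap.fst R F' F + p' ∘ₗ s ∘ₗ LinearMap.snd R F' F))
    ((LinearMap.snd R F F' - p' ∘ₗ s ∘ₗ (LinearMap.fst R F F' + p ∘ₗ s' ∘ₗ LinearMap.snd R F F')).prod
      (LinearMap.fst R F F' + p ∘ₗ s' ∘ₗ LinearMap.snd R F F'))
    (by ext <;> simp) (by ext <;> simp)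
  have hU : ∀ y, U y = (y.2 - p (s' (y.1 + p' (s y.2))), y.1 + p' (s y.2)) := fun y => rfl
  let W : ((F.prod F').prod P) ≃ₗ[R] ((F.prod F').prod Q) :=
    ((LinearEquiv.prodAssoc R F F' P).trans ((LinearEquiv.refl R F).prodCongr (cmp h'))).trans
      (LinearEquiv.prodAssoc R F F' Q).symm
  let V : ((F'.prod F).prod P) ≃ₗ[R] ((F'.prod F).prod Q) :=
    ((U.prodCongr (LinearEquiv.refl R P)).trans W).trans
      (U.symm.prodCongr (LinearEquiv.refl R Q))
  have hW : ∀ x, W x = ((x.1.1, (cmpLin w p' s' (x.1.2, x.2)).1), (cmpLin w p' s' (x.1.2, x.2)).2) :=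
    fun x => rfl
  have hVW : ∀ x y, W (U x.1, x.2) = (U y.1, y.2) → V x = y := fun x y hxy => by
    change (U.symm (W (U x.1, x.2)).1, (W (U x.1, x.2)).2) = y
    rw [hxy, LinearEquiv.symm_apply_apply]
  have hVdet : HasRelDet V ξ := by
    refine HasRelDet.of_right (F₁ := F') (F₂ := F) hξ
      ((p ∘ₗ (LinearMap.fst R M Q ∘ₗ w.toLinearMap ∘ₗ LinearMap.inl R M P ∘ₗ s' - s')).prod
        (LinearMap.snd R M Q ∘ₗ w.toLinearMap ∘ₗ LinearMap.inl R M P ∘ₗ s'))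
      fun x => hVW x _ ?_
    obtain ⟨⟨φ', φ⟩, a⟩ := x
    have hw : w (s φ + s' φ', a) = w (s φ, a) + w (s' φ', 0) := by
      rw [← map_add]; simp
    have e₁ : s' (φ' + p' (s φ)) = s φ + s' φ' := by rw [map_add, hs', add_comm]
    -- `δ` is fixed both by `s ∘ p` and by `s' ∘ p'`, whence `U` intertwines `V` and `W`
    set δ : M := (w (s φ + s' φ', a)).1 - (s φ + s' φ') with hδ
    have hδ₁ : s (p δ) = δ := h (s φ + s' φ', a)
    have hδ₂ : s' (p' δ) = δ := h' (s φ + s' φ', a)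
    have hφ : φ + p ((w (s φ, a)).1 - s φ) + p ((w (s' φ', 0)).1 - s' φ') = φ + p δ := by
      rw [add_assoc, ← map_add, hδ, hw, Prod.fst_add]
      congr 2
      abel
    change W (U (φ', φ), a) = (U (φ', φ + p ((w (s φ, a)).1 - s φ) + p ((w (s' φ', 0)).1 - s' φ')),
      (w (s φ, a)).2 + (w (s' φ', 0)).2)
    have e₂ : φ' + p' (s (φ + p δ)) = φ' + p' (s φ) + p' δ := by
      rw [map_add, hδ₁, map_add, add_assoc]
    rw [hφ, hU, hU, hW]
    refine Prod.ext (Prod.ext ?_ ?_) ?_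
    · change φ - p (s' (φ' + p' (s φ))) = φ + p δ - p (s' (φ' + p' (s (φ + p δ))))
      rw [e₂, map_add s' (φ' + p' (s φ)), hδ₂, map_add p]
      abel
    · change φ' + p' (s φ) + p' ((w (s' (φ' + p' (s φ)), a)).1 - s' (φ' + p' (s φ))) =
        φ' + p' (s (φ + p δ))
      rw [e₁, e₂]
    · change (w (s' (φ' + p' (s φ)), a)).2 = (w (s φ, a)).2 + (w (s' φ', 0)).2
      rw [e₁, hw, Prod.snd_add]
  obtain ⟨ξ', hξ'⟩ := exists_hasRelDet (cmp h')
  have hWdet : HasRelDet W ξ' := HasRelDet.of_right (F₁ := F) (F₂ := F') hξ' 0 fun x => by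
    rw [hW]
    simp only [LinearMap.zero_apply, add_zero]
    rfl
  have hWdet' : HasRelDet W ξ := HasRelDet.conj hVdet U fun x => by
    change _ = (U (U.symm _), _)
    rw [LinearEquiv.apply_symm_apply]
    rfl
  rwa [hWdet'.unique hWdet]

lemma exists_fdet {M P Q : ProjMod R} [Module.Finite R P] [Module.Finite R Q]
    {w : (M.prod P) ≃ₗ[R] (M.prod Q)} (hw : IsFred w) :
    ∃ ξ : detTop P →ₗ[R] detTop Q, ∀ (F : ProjMod R) [Module.Finite R F] (p : M →ₗ[R] F)
      (s : F →ₗ[R] M) (h : Good w p s), HasRelDet (cmp h) ξ := by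
  obtain ⟨F, _, p, s, h⟩ := hw.exists_good
  obtain ⟨ξ, hξ⟩ := exists_hasRelDet (cmp h)
  refine ⟨ξ, fun F₁ _ p₁ s₁ h₁ => ?_⟩
  -- both compressions are compared with the compression to a module containing the two images
  obtain ⟨F', _, p', s', hps⟩ := exists_factor M (T := LinearMap.range s ⊔ LinearMap.range s₁)
    ((Module.Finite.iff_fg.1 inferInstance).sup (Module.Finite.iff_fg.1 inferInstance))
  have hs : ∀ x, s' (p' (s x)) = s x := fun x => hps _ (Submodule.mem_sup_left ⟨x, rfl⟩)
  have hs₁ : ∀ x, s' (p' (s₁ x)) = s₁ x := fun x => hps _ (Submodule.mem_sup_right ⟨x, rfl⟩)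
  have h' : Good w p' s' := fun x => by rw [← h x, hs]
  obtain ⟨ξ₁, hξ₁⟩ := exists_hasRelDet (cmp h₁)
  rwa [(hasRelDet_cmp_of_le h h' hs hξ).unique (hasRelDet_cmp_of_le h₁ h' hs₁ hξ₁)]

open Classical in
/-- The determinant `det P → det Q` of an isomorphism `w : M × P ≃ M × Q` that differs from the
identity of `M` by a map with image in a finitely generated submodule; it is `0` for other `w`. -/
def fdet {M P Q : ProjMod R} [Module.Finite R P] [Module.Finite R Q]
    (w : (M.prod P) ≃ₗ[R] (M.prod Q)) : detTop P →ₗ[R] detTop Q :=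
  if hw : IsFred w then (exists_fdet hw).choose else 0

lemma hasRelDet_cmp {M P Q F : ProjMod R} [Module.Finite R P] [Module.Finite R Q]
    [Module.Finite R F] {w : (M.prod P) ≃ₗ[R] (M.prod Q)} (hw : IsFred w) {p : M →ₗ[R] F}
    {s : F →ₗ[R] M} (h : Good w p s) : HasRelDet (cmp h) (fdet w) := by
  rw [fdet, dif_pos hw]
  exact (exists_fdet hw).choose_spec F p s h

lemma HasRelDet.fdet_eq {M P Q F : ProjMod R} [Module.Finite R P] [Module.Finite R Q]
    [Module.Finite R F] {w : (M.prod P) ≃ₗ[R] (M.prod Q)} (hw : IsFred w) {p : M →ₗ[R] F}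
    {s : F →ₗ[R] M} (h : Good w p s) {ξ : detTop P →ₗ[R] detTop Q} (hξ : HasRelDet (cmp h) ξ) :
    fdet w = ξ := (hasRelDet_cmp hw h).unique hξ

lemma HasRelDet.fdet_eq' {M P Q F : ProjMod R} [Module.Finite R P] [Module.Finite R Q]
    [Module.Finite R F] {w : (M.prod P) ≃ₗ[R] (M.prod Q)} (hw : IsFred w) {p : M →ₗ[R] F}
    {s : F →ₗ[R] M} (h : Good w p s) {E : (F.prod P) ≃ₗ[R] (F.prod Q)}
    {ξ : detTop P →ₗ[R] detTop Q} (hξ : HasRelDet E ξ) (hE : ∀ x, E x = cmpLin w p s x) :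
    fdet w = ξ := HasRelDet.fdet_eq hw h (hξ.congr hE)

/-- A compression of `w` is an isomorphism `F × P ≃ F × Q` of modules of finite rank. -/
lemma rk_eq_of_isFred {M P Q : ProjMod R} [Module.Finite R P] [Module.Finite R Q]
    {w : (M.prod P) ≃ₗ[R] (M.prod Q)} (hw : IsFred w) : rk P = rk Q := by
  obtain ⟨F, _, p, s, h⟩ := hw.exists_good
  have h1 := rk_congr (cmp h)
  rw [rk_prod, rk_prod] at h1
  exact add_left_cancel h1

/-- Both isomorphisms can be compressed to one module `F`, and compression to `F` is
multiplicative. -/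
lemma fdet_comp {M P Q S : ProjMod R} [Module.Finite R P] [Module.Finite R Q] [Module.Finite R S]
    {w : (M.prod P) ≃ₗ[R] (M.prod Q)} {w' : (M.prod Q) ≃ₗ[R] (M.prod S)}
    {w'' : (M.prod P) ≃ₗ[R] (M.prod S)} (hw : IsFred w) (hw' : IsFred w')
    (hc : ∀ x, w'' x = w' (w x)) : fdet w'' = fdet w' ∘ₗ fdet w := by
  obtain rfl : w'' = w.trans w' := LinearEquiv.ext hc
  obtain ⟨T, hT, h⟩ := hw
  obtain ⟨T', hT', h'⟩ := hw'
  obtain ⟨F, _, p, s, hps⟩ := exists_factor M (hT.sup hT')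
  have hg : Good w p s := fun x => hps _ (Submodule.mem_sup_left (h x))
  have hg' : Good w' p s := fun x => hps _ (Submodule.mem_sup_right (h' x))
  have hg'' : Good (M := M) (P := P) (Q := S) (w.trans w') p s := fun x => hps _ (by
    have := Submodule.add_mem_sup (h x) (h' (w x))
    rw [add_comm, sub_add_sub_cancel] at this
    exact this)
  refine HasRelDet.fdet_eq (IsFred.trans ⟨T, hT, h⟩ ⟨T', hT', h'⟩) hg''
    (HasRelDet.comp (hasRelDet_cmp ⟨T, hT, h⟩ hg) (hasRelDet_cmp ⟨T', hT', h'⟩ hg') fun x => ?_)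
  exact (hg.cmpLin_cmpLin w' x).symm

/-- The determinant of an isomorphism that is the identity on `M` and `β` on the second summand. -/
lemma fdet_of_eq {M P Q : ProjMod R} [Module.Finite R P] [Module.Finite R Q]
    {w : (M.prod P) ≃ₗ[R] (M.prod Q)} (β : P ≃ₗ[R] Q) (h : ∀ x, w x = (x.1, β x.2)) :
    fdet w = detMap β := by
  have hw : IsFred w := IsFred.of_fst_eq fun x => by rw [h]
  let F : ProjMod R := ProjMod.zero R
  have hg : Good w (0 : M →ₗ[R] F) 0 := fun x => by rw [h]; simp
  refine HasRelDet.fdet_eq' hw hg (E := (LinearEquiv.refl R F).prodCongr β) (fun φ a => ?_)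
    fun x => ?_
  · rw [detMap_prodCongr_wedge, detMap_refl]
    rfl
  · refine Prod.ext (Subsingleton.elim (α := PUnit) _ _) ?_
    change β x.2 = (w (0, x.2)).2
    rw [h]

/-- `fdet` as an isomorphism. -/
def fdetEquiv {M P Q : ProjMod R} [Module.Finite R P] [Module.Finite R Q]
    {w : (M.prod P) ≃ₗ[R] (M.prod Q)} (hw : IsFred w) : detTop P ≃ₗ[R] detTop Q :=
  LinearEquiv.ofLinearMap (fdet w) (fdet (M := M) (P := Q) (Q := P) w.symm)
    (by
      rw [← fdet_comp (M := M) (P := Q) (Q := P) (S := Q) hw.symm hw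
        (w'' := LinearEquiv.refl R (M.prod Q)) fun x => (w.apply_symm_apply x).symm,
        fdet_of_eq (LinearEquiv.refl R Q) fun x => rfl, detMap_refl])
    (by
      rw [← fdet_comp (M := M) (P := P) (Q := Q) (S := P) hw hw.symm
        (w'' := LinearEquiv.refl R (M.prod P)) fun x => (w.symm_apply_apply x).symm,
        fdet_of_eq (LinearEquiv.refl R P) fun x => rfl, detMap_refl])

lemma fdetEquiv_apply {M P Q : ProjMod R} [Module.Finite R P] [Module.Finite R Q]
    {w : (M.prod P) ≃ₗ[R] (M.prod Q)} (hw : IsFred w) (a : detTop P) :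
    fdetEquiv hw a = fdet w a := rfl

/-- `w` extended by the identity of `C`. -/
lemma IsFred.stab {M P Q : ProjMod R} (C : ProjMod R) {w : (M.prod P) ≃ₗ[R] (M.prod Q)}
    {w' : (M.prod (P.prod C)) ≃ₗ[R] (M.prod (Q.prod C))} (hw : IsFred w)
    (h : ∀ m a c, w' (m, (a, c)) = ((w (m, a)).1, ((w (m, a)).2, c))) : IsFred w' := by
  obtain ⟨T, hT, hT'⟩ := hw
  exact ⟨T, hT, fun x => by rw [show x = (x.1, (x.2.1, x.2.2)) from rfl, h]; exact hT' (x.1, x.2.1)⟩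

lemma fdet_stab {M P Q : ProjMod R} [Module.Finite R P] [Module.Finite R Q] (C : ProjMod R)
    [Module.Finite R C] {w : (M.prod P) ≃ₗ[R] (M.prod Q)}
    {w' : (M.prod (P.prod C)) ≃ₗ[R] (M.prod (Q.prod C))} (hw : IsFred w)
    (h : ∀ m a c, w' (m, (a, c)) = ((w (m, a)).1, ((w (m, a)).2, c))) :
    fdet w' = rstab C (fdet w) := by
  obtain ⟨F, _, p, s, hg⟩ := hw.exists_good
  have hg' : Good w' p s := fun x => by
    rw [show x = (x.1, (x.2.1, x.2.2)) from rfl, h]; exact hg (x.1, x.2.1)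
  let E : (F.prod (P.prod C)) ≃ₗ[R] (F.prod (Q.prod C)) :=
    ((LinearEquiv.prodAssoc R F P C).symm.trans ((cmp hg).prodCongr (LinearEquiv.refl R C))).trans
      (LinearEquiv.prodAssoc R F Q C)
  refine HasRelDet.fdet_eq' (hw.stab C h) hg' (E := E) (fun φ a => ?_) fun x => ?_
  · induction a using wedge_induction with
    | hadd x y hx hy => rw [wedge_add_right, map_add, hx, hy, map_add, wedge_add_right]
    | h a c =>
      rw [detMap_comp_of_eq (A := F.prod (P.prod C)) (B := (F.prod P).prod C)
        (C := F.prod (Q.prod C)) (e := (LinearEquiv.prodAssoc R F P C).symm)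
        (e' := ((cmp hg).prodCongr (LinearEquiv.refl R C)).trans (LinearEquiv.prodAssoc R F Q C))
        (e'' := E) (fun x => rfl), detMap_prodAssoc_symm_wedge,
        detMap_comp_of_eq (A := (F.prod P).prod C) (B := (F.prod Q).prod C)
        (C := F.prod (Q.prod C)) (e := (cmp hg).prodCongr (LinearEquiv.refl R C))
        (e' := LinearEquiv.prodAssoc R F Q C)
        (e'' := ((cmp hg).prodCongr (LinearEquiv.refl R C)).trans (LinearEquiv.prodAssoc R F Q C))
        (fun x => rfl), detMap_prodCongr_wedge, hasRelDet_cmp hw hg, detMap_refl,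
        LinearMap.id_apply, detMap_prodAssoc_wedge, rstab_wedge]
  · rw [cmpLin_apply, show x = (x.1, (x.2.1, x.2.2)) from rfl, h]
    rfl

/-- Conjugation by an isomorphism `M ≃ M'`. -/
lemma IsFred.conj {M M' P Q : ProjMod R} {w : (M.prod P) ≃ₗ[R] (M.prod Q)}
    {w' : (M'.prod P) ≃ₗ[R] (M'.prod Q)} (hw : IsFred w) (ε : M ≃ₗ[R] M')
    (h : ∀ m a, w' (ε m, a) = (ε (w (m, a)).1, (w (m, a)).2)) : IsFred w' := by
  obtain ⟨T, hT, hT'⟩ := hw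
  refine ⟨T.map ε.toLinearMap, hT.map _, fun ⟨m, a⟩ => ?_⟩
  obtain ⟨m, rfl⟩ := ε.surjective m
  rw [h]
  exact ⟨_, hT' (m, a), by simp⟩

lemma fdet_conj {M M' P Q : ProjMod R} [Module.Finite R P] [Module.Finite R Q]
    {w : (M.prod P) ≃ₗ[R] (M.prod Q)} {w' : (M'.prod P) ≃ₗ[R] (M'.prod Q)} (hw : IsFred w)
    (ε : M ≃ₗ[R] M') (h : ∀ m a, w' (ε m, a) = (ε (w (m, a)).1, (w (m, a)).2)) :
    fdet w' = fdet w := by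
  obtain ⟨F, _, p, s, hg⟩ := hw.exists_good
  have hg' : Good w' (p ∘ₗ ε.symm.toLinearMap) (ε.toLinearMap ∘ₗ s) := fun ⟨m, a⟩ => by
    obtain ⟨m, rfl⟩ := ε.surjective m
    rw [h]
    have := congrArg ε (hg (m, a))
    simpa using this
  refine HasRelDet.fdet_eq' (hw.conj ε h) hg' (hasRelDet_cmp hw hg) fun x => ?_
  have := h (s x.1) x.2
  rw [cmp_apply, cmpLin_apply, cmpLin_apply]
  change _ = (x.1 + p (ε.symm ((w' (ε (s x.1), x.2)).1 - ε (s x.1))), (w' (ε (s x.1), x.2)).2)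
  rw [this]
  simp

/-- Enlarging `M` to `M × K`. -/
lemma IsFred.enlarge {M K P Q : ProjMod R} {w : (M.prod P) ≃ₗ[R] (M.prod Q)}
    {w' : ((M.prod K).prod P) ≃ₗ[R] ((M.prod K).prod Q)} (hw : IsFred w)
    (h : ∀ m k a, w' ((m, k), a) = (((w (m, a)).1, k), (w (m, a)).2)) : IsFred w' := by
  obtain ⟨T, hT, hT'⟩ := hw
  refine ⟨T.map (LinearMap.inl R M K), hT.map _, fun ⟨⟨m, k⟩, a⟩ => ?_⟩
  rw [h]
  exact ⟨_, hT' (m, a), by simp⟩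

lemma fdet_enlarge {M K P Q : ProjMod R} [Module.Finite R P] [Module.Finite R Q]
    {w : (M.prod P) ≃ₗ[R] (M.prod Q)} {w' : ((M.prod K).prod P) ≃ₗ[R] ((M.prod K).prod Q)}
    (hw : IsFred w) (h : ∀ m k a, w' ((m, k), a) = (((w (m, a)).1, k), (w (m, a)).2)) :
    fdet w' = fdet w := by
  obtain ⟨F, _, p, s, hg⟩ := hw.exists_good
  have hg' : Good w' (p ∘ₗ LinearMap.fst R M K) (LinearMap.inl R M K ∘ₗ s) := fun ⟨⟨m, k⟩, a⟩ => by
    rw [h]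
    have := hg (m, a)
    simpa using this
  refine HasRelDet.fdet_eq' (hw.enlarge h) hg' (hasRelDet_cmp hw hg) fun x => ?_
  have := h (s x.1) 0 x.2
  rw [cmp_apply, cmpLin_apply, cmpLin_apply]
  change _ = (x.1 + p ((w' ((s x.1, 0), x.2)).1 - (s x.1, 0)).1, (w' ((s x.1, 0), x.2)).2)
  rw [this]
  rfl

/-- A summand `B` of finite rank can be regarded as a part of the second module. -/
lemma IsFred.assoc {M B P Q : ProjMod R} {w : ((M.prod B).prod P) ≃ₗ[R] ((M.prod B).prod Q)}
    {w' : (M.prod (B.prod P)) ≃ₗ[R] (M.prod (B.prod Q))} (hw : IsFred w)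
    (h : ∀ m b a, w' (m, (b, a)) =
      ((w ((m, b), a)).1.1, ((w ((m, b), a)).1.2, (w ((m, b), a)).2))) : IsFred w' := by
  obtain ⟨T, hT, hT'⟩ := hw
  refine ⟨T.map (LinearMap.fst R M B), hT.map _, fun ⟨m, b, a⟩ => ?_⟩
  rw [h]
  exact ⟨_, hT' ((m, b), a), by simp⟩

/-- Regarding a summand `B` of finite rank as a part of the second module instead of the first one
tensors the determinant with the identity of `det B`. -/
lemma fdet_assoc {M B P Q : ProjMod R} [Module.Finite R B] [Module.Finite R P] [Module.Finite R Q]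
    {w : ((M.prod B).prod P) ≃ₗ[R] ((M.prod B).prod Q)}
    {w' : (M.prod (B.prod P)) ≃ₗ[R] (M.prod (B.prod Q))} (hw : IsFred w)
    (h : ∀ m b a, w' (m, (b, a)) =
      ((w ((m, b), a)).1.1, ((w ((m, b), a)).1.2, (w ((m, b), a)).2))) :
    fdet w' = lstab B (fdet w) := by
  have hw' := hw.assoc h
  obtain ⟨F, _, p, s, hg⟩ := hw'.exists_good
  have hg' : Good (F := F.prod B) w (p.prodMap LinearMap.id) (s.prodMap LinearMap.id) := by
    rintro ⟨⟨m, b⟩, a⟩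
    have h1 := hg (m, (b, a))
    rw [h] at h1
    exact Prod.ext h1 rfl
  have h1 := hasRelDet_cmp hw hg'
  refine HasRelDet.fdet_eq hw' hg fun φ a => ?_
  induction a using wedge_induction with
  | hadd x y hx hy => rw [wedge_add_right, map_add, hx, hy, map_add, wedge_add_right]
  | h b a =>
    have h2 := detMap_comp_eq_comp (A := (F.prod B).prod P) (B := F.prod (B.prod P))
      (B' := (F.prod B).prod Q) (C := F.prod (B.prod Q)) (e₁ := LinearEquiv.prodAssoc R F B P)
      (e₂ := cmp hg) (e₃ := cmp hg') (e₄ := LinearEquiv.prodAssoc R F B Q) (fun x => by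
        change cmpLin w' p s (x.1.1, (x.1.2, x.2)) = LinearEquiv.prodAssoc R F B Q (cmpLin w _ _ x)
        rw [cmpLin_apply, cmpLin_apply]
        have h3 := h (s x.1.1) x.1.2 x.2
        refine Prod.ext ?_ (Prod.ext ?_ ?_)
        · change x.1.1 + p ((w' (s x.1.1, (x.1.2, x.2))).1 - s x.1.1) =
            x.1.1 + p ((w ((s x.1.1, x.1.2), x.2)).1.1 - s x.1.1)
          rw [h3]
        · change (w' (s x.1.1, (x.1.2, x.2))).2.1 =
            x.1.2 + ((w ((s x.1.1, x.1.2), x.2)).1.2 - x.1.2)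
          rw [h3, add_sub_cancel]
        · change (w' (s x.1.1, (x.1.2, x.2))).2.2 = (w ((s x.1.1, x.1.2), x.2)).2
          rw [h3]) (wedge (wedge φ b) a)
    rw [detMap_prodAssoc_wedge, h1, detMap_prodAssoc_wedge] at h2
    rw [h2, lstab_wedge]

/-- For `M` of finite rank, `fdet w` is the usual determinant of `w`, up to the identity of
`det M`. -/
lemma hasRelDet_fdet {M P Q : ProjMod R} [Module.Finite R M] [Module.Finite R P]
    [Module.Finite R Q] (w : (M.prod P) ≃ₗ[R] (M.prod Q)) : HasRelDet w (fdet w) := by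
  have hw : IsFred w := ⟨⊤, Module.Finite.fg_top, fun _ => Submodule.mem_top⟩
  have hg : Good w LinearMap.id LinearMap.id := fun x => rfl
  refine (hasRelDet_cmp hw hg).congr fun x => ?_
  rw [cmp_apply, cmpLin_apply]
  exact Prod.ext (add_sub_cancel _ _) rfl

/-- Transport of `v : N × A' ≃ N × A` to `M × (B × A') ≃ M × (B × A)` along `e : N × C ≃ M × B`. -/
lemma exists_transport {N M A A' B C : ProjMod R} {v : (N.prod A') ≃ₗ[R] (N.prod A)}
    (hv : IsFred v) (e : (N.prod C) ≃ₗ[R] (M.prod B))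
    {u : (M.prod (B.prod A')) ≃ₗ[R] (M.prod (B.prod A))}
    (h : ∀ n c a, u ((e (n, c)).1, ((e (n, c)).2, a)) =
      ((e ((v (n, a)).1, c)).1, ((e ((v (n, a)).1, c)).2, (v (n, a)).2))) :
    ∃ v₂ : ((M.prod B).prod A') ≃ₗ[R] ((M.prod B).prod A), IsFred v₂ ∧
      (∀ m b a, u (m, (b, a)) =
        ((v₂ ((m, b), a)).1.1, ((v₂ ((m, b), a)).1.2, (v₂ ((m, b), a)).2))) ∧
      ∀ [Module.Finite R A] [Module.Finite R A'], fdet v₂ = fdet v := by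
  let v₂ : ((M.prod B).prod A') ≃ₗ[R] ((M.prod B).prod A) :=
    ((LinearEquiv.prodAssoc R M B A').trans u).trans (LinearEquiv.prodAssoc R M B A).symm
  let v₁ : ((N.prod C).prod A') ≃ₗ[R] ((N.prod C).prod A) :=
    ((e.prodCongr (LinearEquiv.refl R A')).trans v₂).trans (e.symm.prodCongr (LinearEquiv.refl R A))
  have h₁ : ∀ n c a, v₁ ((n, c), a) = (((v (n, a)).1, c), (v (n, a)).2) := fun n c a => by
    have h2 : v₁ ((n, c), a) = (e.symm ((u ((e (n, c)).1, ((e (n, c)).2, a))).1,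
      (u ((e (n, c)).1, ((e (n, c)).2, a))).2.1), (u ((e (n, c)).1, ((e (n, c)).2, a))).2.2) := rfl
    rw [h2, h]
    exact Prod.ext (e.symm_apply_apply _) rfl
  have h₂ : ∀ x a, v₂ (e x, a) = (e (v₁ (x, a)).1, (v₁ (x, a)).2) := fun x a =>
    (Prod.ext (e.apply_symm_apply (v₂ (e x, a)).1) rfl :
      (e (v₁ (x, a)).1, (v₁ (x, a)).2) = v₂ (e x, a)).symm
  have hv₁ : IsFred v₁ := hv.enlarge h₁
  have hv₂ : IsFred v₂ := hv₁.conj e h₂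
  refine ⟨v₂, hv₂, fun m b a => rfl, ?_⟩
  intro _ _
  rw [fdet_conj hv₁ e h₂, fdet_enlarge hv h₁]

/-- `v` and the identity of `C`, conjugated by `e : N × C ≃ M × B`, differ from the identity of `M`
by a map with image in a finitely generated submodule. -/
lemma IsFred.transport {N M A A' B C : ProjMod R} {v : (N.prod A') ≃ₗ[R] (N.prod A)}
    (hv : IsFred v) (e : (N.prod C) ≃ₗ[R] (M.prod B))
    {u : (M.prod (B.prod A')) ≃ₗ[R] (M.prod (B.prod A))}
    (h : ∀ n c a, u ((e (n, c)).1, ((e (n, c)).2, a)) =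
      ((e ((v (n, a)).1, c)).1, ((e ((v (n, a)).1, c)).2, (v (n, a)).2))) : IsFred u := by
  obtain ⟨v₂, hv₂, hu, -⟩ := exists_transport hv e h
  exact hv₂.assoc hu

/-- The conjugate of `v : N × A' ≃ N × A` and the identity of `C` by `e : N × C ≃ M × B` has the
determinant of `v`, tensored with the identity of `det B`. -/
lemma fdet_transport {N M A A' B C : ProjMod R} [Module.Finite R A] [Module.Finite R A']
    [Module.Finite R B] {v : (N.prod A') ≃ₗ[R] (N.prod A)}
    (hv : IsFred v) (e : (N.prod C) ≃ₗ[R] (M.prod B))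
    {u : (M.prod (B.prod A')) ≃ₗ[R] (M.prod (B.prod A))}
    (h : ∀ n c a, u ((e (n, c)).1, ((e (n, c)).2, a)) =
      ((e ((v (n, a)).1, c)).1, ((e ((v (n, a)).1, c)).2, (v (n, a)).2))) :
    fdet u = lstab B (fdet v) := by
  obtain ⟨v₂, hv₂, hu, hd⟩ := exists_transport hv e h
  rw [fdet_assoc hv₂ hu, hd]

end Fred

section BaseChange

variable {R : Type u} [CommRing R] (R' : Type u) [CommRing R'] [Algebra R R']

lemma baseChange_prod_induction {M P : ProjMod R}
    (S : Submodule R' ((M.baseChange R').prod (P.baseChange R')))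
    (h : ∀ (m : M) (a : P), ((1 : R') ⊗ₜ[R] m, (1 : R') ⊗ₜ[R] a) ∈ S) (x) : x ∈ S := by
  have h1 : ∀ y : R' ⊗[R] M, (y, (0 : R' ⊗[R] P)) ∈ S := fun y => by
    induction y using TensorProduct.induction_on with
    | zero => exact S.zero_mem
    | add y z hy hz => simpa using S.add_mem hy hz
    | tmul r m =>
      have h2 := S.smul_mem r (h m 0)
      rw [TensorProduct.tmul_zero] at h2
      simpa [TensorProduct.smul_tmul'] using h2
  have h2 : ∀ y : R' ⊗[R] P, ((0 : R' ⊗[R] M), y) ∈ S := fun y => by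
    induction y using TensorProduct.induction_on with
    | zero => exact S.zero_mem
    | add y z hy hz => simpa using S.add_mem hy hz
    | tmul r m =>
      have h2 := S.smul_mem r (h 0 m)
      rw [TensorProduct.tmul_zero] at h2
      simpa [TensorProduct.smul_tmul'] using h2
  have := S.add_mem (h1 x.1) (h2 x.2)
  simpa using this

lemma baseChange_prod_hom_ext {M P : ProjMod R} {V : Type*} [AddCommGroup V] [Module R' V]
    {f g : ((M.baseChange R').prod (P.baseChange R')) →ₗ[R'] V}
    (h : ∀ (m : M) (a : P), f ((1 : R') ⊗ₜ[R] m, (1 : R') ⊗ₜ[R] a) = g (1 ⊗ₜ m, 1 ⊗ₜ a)) : f = g :=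
  LinearMap.ext fun x => baseChange_prod_induction R' (LinearMap.eqLocus f g) h x

/-- The base change of an isomorphism of direct sums. -/
def bcIso {N A M B : ProjMod R} (e : (N.prod A) ≃ₗ[R] (M.prod B)) :
    ((N.baseChange R').prod (A.baseChange R')) ≃ₗ[R'] ((M.baseChange R').prod (B.baseChange R')) :=
  ((TensorProduct.prodRight R R' R' N A).symm.trans
    (e.baseChange R R' (N.prod A) (M.prod B))).trans (TensorProduct.prodRight R R' R' M B)

lemma bcIso_prodRight {N A M B : ProjMod R} (e : (N.prod A) ≃ₗ[R] (M.prod B))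
    (x : (N.prod A).baseChange R') : bcIso R' e (TensorProduct.prodRight R R' R' N A x) =
      TensorProduct.prodRight R R' R' M B (e.baseChange R R' (N.prod A) (M.prod B) x) :=
  congrArg (fun y => TensorProduct.prodRight R R' R' M B
    (e.baseChange R R' (N.prod A) (M.prod B) y))
    ((TensorProduct.prodRight R R' R' N A).symm_apply_apply x)

lemma bcIso_tmul {N A M B : ProjMod R} (e : (N.prod A) ≃ₗ[R] (M.prod B)) (n : N) (a : A) :
    bcIso R' e ((1 : R') ⊗ₜ[R] n, (1 : R') ⊗ₜ[R] a) =
      ((1 : R') ⊗ₜ[R] (e (n, a)).1, (1 : R') ⊗ₜ[R] (e (n, a)).2) := by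
  have h1 : TensorProduct.prodRight R R' R' N A ((1 : R') ⊗ₜ[R] (n, a)) =
      ((1 : R') ⊗ₜ[R] n, (1 : R') ⊗ₜ[R] a) := by simp
  rw [← h1]
  refine (bcIso_prodRight R' e _).trans ?_
  exact TensorProduct.prodRight_tmul ..

lemma IsFred.baseChange {M P Q : ProjMod R} {w : (M.prod P) ≃ₗ[R] (M.prod Q)} (hw : IsFred w) :
    IsFred (bcIso R' w) := by
  obtain ⟨T, hT, h⟩ := hw
  have hT' : (T.baseChange R').FG := by
    classical
    obtain ⟨S, rfl⟩ := hT
    exact ⟨S.image (TensorProduct.mk R R' M 1), by simp [Submodule.baseChange_span]⟩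
  refine ⟨T.baseChange R', hT', fun x => ?_⟩
  refine baseChange_prod_induction R' ((T.baseChange R').comap
    (LinearMap.fst R' (R' ⊗[R] M) (R' ⊗[R] Q) ∘ₗ (bcIso R' w).toLinearMap -
      LinearMap.fst R' (R' ⊗[R] M) (R' ⊗[R] P))) (fun m a => ?_) x
  change (bcIso R' w ((1 : R') ⊗ₜ[R] m, (1 : R') ⊗ₜ[R] a)).1 - (1 : R') ⊗ₜ[R] m ∈
    T.baseChange R'
  rw [bcIso_tmul, ← TensorProduct.tmul_sub]
  exact Submodule.tmul_mem_baseChange_of_mem _ (h (m, a))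

lemma bcDet_wedge_hom_ext {A B : ProjMod R} [Module.Finite R A] [Module.Finite R B] {V : Type*}
    [AddCommGroup V] [Module R' V]
    {f g : detTop ((A.baseChange R').prod (B.baseChange R')) →ₗ[R'] V}
    (h : ∀ a b, f (wedge (bcDet R' A a) (bcDet R' B b)) =
      g (wedge (bcDet R' A a) (bcDet R' B b))) : f = g := by
  refine detTop_hom_ext fun x y => ?_
  have h1 : ∀ a, f ∘ₗ wedgeLin (A.baseChange R') (B.baseChange R') ∘ₗ
      TensorProduct.mk R' _ _ (bcDet R' A a) = g ∘ₗ wedgeLin (A.baseChange R') (B.baseChange R') ∘ₗ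
      TensorProduct.mk R' _ _ (bcDet R' A a) := fun a => bcDet_hom_ext R' (h a)
  have h2 : f ∘ₗ wedgeLin (A.baseChange R') (B.baseChange R') ∘ₗ
      (TensorProduct.mk R' _ _).flip y = g ∘ₗ wedgeLin (A.baseChange R') (B.baseChange R') ∘ₗ
      (TensorProduct.mk R' _ _).flip y :=
    bcDet_hom_ext R' fun a => DFunLike.congr_fun (h1 a) y
  exact DFunLike.congr_fun h2 x

lemma detMap_bcIso_wedge {N A M B : ProjMod R} [Module.Finite R N] [Module.Finite R A]
    [Module.Finite R M] [Module.Finite R B] (e : (N.prod A) ≃ₗ[R] (M.prod B)) (n : detTop N)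
    (a : detTop A) : detMap (bcIso R' e) (wedge (bcDet R' N n) (bcDet R' A a)) =
      detMap (N := (M.prod B).baseChange R') (M := (M.baseChange R').prod (B.baseChange R'))
        (TensorProduct.prodRight R R' R' M B) (bcDet R' (M.prod B) (detMap e (wedge n a))) := by
  rw [← bcDet_wedge, bcDet_detMap]
  exact detMap_comp_eq_comp (A := (N.prod A).baseChange R')
    (B := (N.baseChange R').prod (A.baseChange R')) (B' := (M.prod B).baseChange R')
    (C := (M.baseChange R').prod (B.baseChange R')) (e₁ := TensorProduct.prodRight R R' R' N A)
    (e₂ := bcIso R' e) (e₃ := e.baseChange R R' (N.prod A) (M.prod B))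
    (e₄ := TensorProduct.prodRight R R' R' M B) (bcIso_prodRight R' e) _

lemma HasRelDet.baseChange {F P Q : ProjMod R} [Module.Finite R F] [Module.Finite R P]
    [Module.Finite R Q] {e : (F.prod P) ≃ₗ[R] (F.prod Q)} {ξ : detTop P →ₗ[R] detTop Q}
    (h : HasRelDet e ξ) : HasRelDet (bcIso R' e) (bcHom R' ξ) := by
  have h1 : detMap (bcIso R' e) = lstab (F.baseChange R') (bcHom R' ξ) :=
    bcDet_wedge_hom_ext R' fun φ a => by
      rw [detMap_bcIso_wedge, h, bcDet_wedge, lstab_wedge, bcHom_bcDet]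
  intro φ a
  rw [h1, lstab_wedge]

lemma fdet_bcIso {M P Q : ProjMod R} [Module.Finite R P] [Module.Finite R Q]
    {w : (M.prod P) ≃ₗ[R] (M.prod Q)} (hw : IsFred w) :
    fdet (bcIso R' w) = bcHom R' (fdet w) := by
  obtain ⟨F, _, p, s, hg⟩ := hw.exists_good
  have hg' : Good (F := F.baseChange R') (bcIso R' w) (p.baseChange R') (s.baseChange R') := by
    intro x
    refine baseChange_prod_induction R' (LinearMap.eqLocus
      (s.baseChange R' ∘ₗ p.baseChange R' ∘ₗ
        (LinearMap.fst R' (R' ⊗[R] M) (R' ⊗[R] Q) ∘ₗ (bcIso R' w).toLinearMap -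
          LinearMap.fst R' (R' ⊗[R] M) (R' ⊗[R] P)))
        (LinearMap.fst R' (R' ⊗[R] M) (R' ⊗[R] Q) ∘ₗ (bcIso R' w).toLinearMap -
          LinearMap.fst R' (R' ⊗[R] M) (R' ⊗[R] P))) (fun m a => ?_) x
    change (s.baseChange R') ((p.baseChange R') ((bcIso R' w (1 ⊗ₜ m, 1 ⊗ₜ a)).1 - 1 ⊗ₜ m)) =
      (bcIso R' w (1 ⊗ₜ m, 1 ⊗ₜ a)).1 - 1 ⊗ₜ m
    rw [bcIso_tmul, ← TensorProduct.tmul_sub, LinearMap.baseChange_tmul, LinearMap.baseChange_tmul]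
    exact congrArg _ (hg (m, a))
  refine HasRelDet.fdet_eq' (hw.baseChange R') hg' ((hasRelDet_cmp hw hg).baseChange R')
    fun x => ?_
  have h1 : (bcIso R' (cmp hg)).toLinearMap =
      cmpLin (bcIso R' w) (p.baseChange R') (s.baseChange R') := by
    refine baseChange_prod_hom_ext R' fun φ a => ?_
    rw [cmpLin_apply]
    change bcIso R' (cmp hg) (1 ⊗ₜ φ, 1 ⊗ₜ a) = (1 ⊗ₜ φ + p.baseChange R'
      ((bcIso R' w (s.baseChange R' (1 ⊗ₜ φ), 1 ⊗ₜ a)).1 - s.baseChange R' (1 ⊗ₜ φ)),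
        (bcIso R' w (s.baseChange R' (1 ⊗ₜ φ), 1 ⊗ₜ a)).2)
    rw [LinearMap.baseChange_tmul, bcIso_tmul, bcIso_tmul, ← TensorProduct.tmul_sub,
      LinearMap.baseChange_tmul, ← TensorProduct.tmul_add]
    rfl
  exact DFunLike.congr_fun h1 x

end BaseChange

/-! ### Resolutions and the relative determinant line -/

section Resolution

variable {R : Type u} [CommRing R]

/-- `e : N × A ≃ M × B`, for `A` and `B` of finite rank, resolves the asymptotic morphism `f` if its
component `N → M` represents `f`. -/
def IsRes {N M A B : ProjMod R} (f : AsympIso N M) (e : (N.prod A) ≃ₗ[R] (M.prod B)) : Prop :=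
  AsymHom.mk (LinearMap.fst R M B ∘ₗ e.toLinearMap ∘ₗ LinearMap.inl R N A) = f.hom

lemma AsymHom.mk_eq_of_sub_mem {N M : ProjMod R} {f g : N →ₗ[R] M} {T : Submodule R M} (hT : T.FG)
    (h : ∀ x, f x - g x ∈ T) : AsymHom.mk f = AsymHom.mk g :=
  AsymHom.mk_eq.2 ⟨T, hT, by rintro _ ⟨x, rfl⟩; exact h x⟩

lemma IsRes.of_sub_mem {N M A B A' B' : ProjMod R} {f : AsympIso N M}
    {e : (N.prod A) ≃ₗ[R] (M.prod B)} {e' : (N.prod A') ≃ₗ[R] (M.prod B')} (h : IsRes f e)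
    {T : Submodule R M} (hT : T.FG) (he : ∀ n, (e' (n, 0)).1 - (e (n, 0)).1 ∈ T) : IsRes f e' :=
  (AsymHom.mk_eq_of_sub_mem hT he).trans h

lemma IsRes.of_eq {N M A B A' B' : ProjMod R} {f : AsympIso N M}
    {e : (N.prod A) ≃ₗ[R] (M.prod B)} {e' : (N.prod A') ≃ₗ[R] (M.prod B')} (h : IsRes f e)
    (he : ∀ n, (e' (n, 0)).1 = (e (n, 0)).1) : IsRes f e' :=
  h.of_sub_mem Submodule.fg_bot fun n => by rw [he, sub_self]; exact Submodule.zero_mem _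

lemma isRes_ofEquiv {N M A B : ProjMod R} (e : N ≃ₗ[R] M) {E : (N.prod A) ≃ₗ[R] (M.prod B)}
    (h : ∀ n, (E (n, 0)).1 = e n) : IsRes (AsympIso.ofEquiv e) E :=
  congrArg AsymHom.mk (LinearMap.ext h)

/-- Isomorphisms that have a determinant are resolutions of the identity. -/
lemma IsFred.isRes {M P Q : ProjMod R} {w : (M.prod P) ≃ₗ[R] (M.prod Q)} (hw : IsFred w) :
    IsRes (AsympIso.ofEquiv (LinearEquiv.refl R M)) w := by
  obtain ⟨T, hT, h⟩ := hw
  exact AsymHom.mk_eq_of_sub_mem hT fun n => h (n, 0)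

/-- Composites of resolutions are resolutions: the difference of the two representatives factors
through the auxiliary module `B`. -/
lemma IsRes.comp {N M L A B C : ProjMod R} [Module.Finite R B] {f : AsympIso N M}
    {g : AsympIso M L} {e : (N.prod A) ≃ₗ[R] (M.prod B)} {e' : (M.prod B) ≃ₗ[R] (L.prod C)}
    {e'' : (N.prod A) ≃ₗ[R] (L.prod C)} (h : IsRes f e) (h' : IsRes g e')
    (hc : ∀ x, e'' x = e' (e x)) : IsRes (g.comp f) e'' := by
  change _ = g.hom.comp f.hom
  rw [← h, ← h']
  refine AsymHom.mk_eq_of_sub_mem (T := LinearMap.range (LinearMap.fst R L C ∘ₗ e'.toLinearMap ∘ₗ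
    LinearMap.inr R M B)) (Module.Finite.iff_fg.1 inferInstance) fun n => ?_
  change (e'' (n, 0)).1 - (e' ((e (n, 0)).1, 0)).1 ∈ _
  refine ⟨(e (n, 0)).2, ?_⟩
  change (e' (0, (e (n, 0)).2)).1 = _
  rw [hc, ← Prod.fst_sub, ← map_sub]
  congr 2
  refine Prod.ext ?_ ?_ <;> simp

lemma AsympIso.comp_refl {N M : ProjMod R} (f : AsympIso N M) :
    f.comp (AsympIso.ofEquiv (LinearEquiv.refl R N)) = f := by
  refine AsympIso.ext ?_
  change AsymHom.comp f.hom _ = f.hom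
  induction f.hom using Quotient.inductionOn
  rfl

lemma AsympIso.refl_comp {N M : ProjMod R} (f : AsympIso N M) :
    (AsympIso.ofEquiv (LinearEquiv.refl R M)).comp f = f :=
  AsympIso.ext (AsymHom.id_comp _)

lemma IsRes.fred_comp {N M A B C : ProjMod R} [Module.Finite R B] {f : AsympIso N M}
    {e : (N.prod A) ≃ₗ[R] (M.prod B)} {w : (M.prod B) ≃ₗ[R] (M.prod C)}
    {e' : (N.prod A) ≃ₗ[R] (M.prod C)} (h : IsRes f e) (hw : IsFred w)
    (hc : ∀ x, e' x = w (e x)) : IsRes f e' := by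
  rw [← f.refl_comp]
  exact h.comp hw.isRes hc

lemma IsRes.comp_fred {N M A A' B : ProjMod R} [Module.Finite R A] {f : AsympIso N M}
    {e : (N.prod A) ≃ₗ[R] (M.prod B)} {v : (N.prod A') ≃ₗ[R] (N.prod A)}
    {e' : (N.prod A') ≃ₗ[R] (M.prod B)} (h : IsRes f e) (hv : IsFred v)
    (hc : ∀ x, e' x = e (v x)) : IsRes f e' := by
  rw [← f.comp_refl]
  exact hv.isRes.comp h hc

/-- Two resolutions of `f` with the same source differ by an isomorphism that has a determinant. -/
lemma IsRes.isFred {N M A B B' : ProjMod R} [Module.Finite R A] {f : AsympIso N M}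
    {e : (N.prod A) ≃ₗ[R] (M.prod B)} {e' : (N.prod A) ≃ₗ[R] (M.prod B')}
    {w : (M.prod B) ≃ₗ[R] (M.prod B')} (h : IsRes f e) (h' : IsRes f e')
    (hw : ∀ x, w (e x) = e' x) : IsFred w := by
  obtain ⟨T, hT, hd⟩ := AsymHom.mk_eq.1 (h'.trans h.symm)
  let d : A →ₗ[R] M := LinearMap.fst R M B' ∘ₗ e'.toLinearMap ∘ₗ LinearMap.inr R N A -
    LinearMap.fst R M B ∘ₗ e.toLinearMap ∘ₗ LinearMap.inr R N A
  refine ⟨T ⊔ LinearMap.range d, hT.sup (Module.Finite.iff_fg.1 inferInstance), fun y => ?_⟩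
  obtain ⟨⟨n, a⟩, rfl⟩ := e.surjective y
  rw [hw]
  have h1 := Submodule.add_mem_sup (hd ⟨n, rfl⟩) (show d a ∈ LinearMap.range d from ⟨a, rfl⟩)
  have h2 : (e' (n, a)).1 - (e (n, a)).1 =
      ((e' (n, 0)).1 - (e (n, 0)).1) + ((e' (0, a)).1 - (e (0, a)).1) := by
    have h3 : ((n, a) : N.prod A) = (n, 0) + (0, a) := by simp
    rw [h3, map_add, map_add, Prod.fst_add, Prod.fst_add]
    abel
  rw [h2]
  exact h1

/-- Every invertible asymptotic morphism has a resolution. If `f'` represents `f`, the image of `f'`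
and finitely many elements generate `M`; this defines a surjection `N × Rⁿ → M`, which splits, and
its kernel is finitely generated because `f` has a left inverse. -/
lemma exists_isRes {N M : ProjMod R} (f : AsympIso N M) :
    ∃ (A B : ProjMod R) (_ : Module.Finite R A) (_ : Module.Finite R B)
      (e : (N.prod A) ≃ₗ[R] (M.prod B)), IsRes f e := by
  obtain ⟨f', hf'⟩ : ∃ f' : N →ₗ[R] M, AsymHom.mk f' = f.hom := Submodule.Quotient.mk_surjective _ _
  obtain ⟨g, hgf, hfg⟩ := f.exists_inv
  obtain ⟨g', rfl⟩ : ∃ g' : M →ₗ[R] N, AsymHom.mk g' = g := Submodule.Quotient.mk_surjective _ _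
  rw [← hf'] at hgf hfg
  obtain ⟨T', hT', hd'⟩ := AsymHom.mk_eq.1 (show AsymHom.mk (g' ∘ₗ f') = _ from hgf)
  obtain ⟨T, hT, hd⟩ := AsymHom.mk_eq.1 (show AsymHom.mk (f' ∘ₗ g') = _ from hfg)
  obtain ⟨n, t, rfl⟩ := Submodule.fg_iff_exists_fin_generating_family.1 hT
  let φ : (Fin n → R) →ₗ[R] M := Fintype.linearCombination R t
  have hφ : LinearMap.range φ = Submodule.span R (Set.range t) := Fintype.range_linearCombination R t
  rw [← hφ] at hd hT
  -- `N × Rⁿ → M` is onto, with projective kernel of finite rank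
  let h : (N × (Fin n → R)) →ₗ[R] M := f'.coprod φ
  have hh : Function.Surjective h := fun m => by
    obtain ⟨y, hy⟩ := hd ⟨m, rfl⟩
    refine ⟨(g' m, -y), ?_⟩
    change f' (g' m) + φ (-y) = m
    rw [map_neg, hy]
    simp
  obtain ⟨σ, hσ⟩ := Module.projective_lifting_property h LinearMap.id hh
  have hσ' : ∀ m, h (σ m) = m := fun m => DFunLike.congr_fun hσ m
  let π : (N × (Fin n → R)) →ₗ[R] LinearMap.ker h :=
    (LinearMap.id - σ ∘ₗ h).codRestrict _ fun x => by simp [hσ']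
  have hπ : ∀ x : LinearMap.ker h, π x = x := fun x => by
    ext1
    simp [π, LinearMap.mem_ker.1 x.2]
  have : Module.Projective R (LinearMap.ker h) :=
    Module.Projective.of_split (LinearMap.ker h).subtype π (LinearMap.ext hπ)
  -- a point `(x, y)` of the kernel has `x = -(g' (f' x) - x) + g' (φ (-y))`, and both terms range
  -- in finitely generated modules
  have hfin : Module.Finite R (LinearMap.ker h) := by
    refine Module.Finite.iff_fg.2 ?_
    have h1 : (T' ⊔ (LinearMap.range φ).map g').FG := hT'.sup (hT.map _)
    have h2 : LinearMap.ker h = (((T' ⊔ (LinearMap.range φ).map g').prod ⊤).map π).map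
        (LinearMap.ker h).subtype := by
      refine le_antisymm (fun x hx => ?_) ?_
      · refine ⟨_, ⟨x, ⟨?_, trivial⟩, rfl⟩, congrArg Subtype.val (hπ ⟨x, hx⟩)⟩
        have h3 : f' x.1 + φ x.2 = 0 := hx
        have h4 : x.1 = -(g' (f' x.1) - x.1) + g' (φ (-x.2)) := by
          rw [map_neg, ← eq_neg_of_add_eq_zero_left h3]
          abel
        rw [h4]
        exact Submodule.add_mem_sup (T'.neg_mem (hd' ⟨x.1, rfl⟩)) ⟨_, ⟨_, rfl⟩, rfl⟩
      · rintro _ ⟨y, -, rfl⟩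
        exact y.2
    rw [h2]
    exact ((h1.prod Module.Finite.fg_top).map _).map _
  refine ⟨freeMod R n, { carrier := LinearMap.ker h }, inferInstanceAs (Module.Finite R (Fin n → R)),
    hfin, LinearEquiv.ofLinearMap (h.prod π) (LinearMap.coprod σ (LinearMap.ker h).subtype) ?_ ?_, ?_⟩
  · refine LinearMap.ext fun x => Prod.ext ?_ ?_
    · change h (σ x.1 + x.2) = x.1
      rw [map_add, hσ', LinearMap.mem_ker.1 x.2.2, add_zero]
    · change π (σ x.1 + x.2) = x.2
      have : π (σ x.1) = 0 := by
        ext1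
        simp [π, hσ']
      rw [map_add, hπ, this, zero_add]
  · refine LinearMap.ext fun x => ?_
    change σ (h x) + (x - σ (h x)) = x
    abel
  · refine Eq.trans ?_ hf'
    refine congrArg AsymHom.mk (LinearMap.ext fun n => ?_)
    change f' n + φ 0 = f' n
    rw [map_zero, add_zero]

/-- A resolution of `f` by `A` and `B` extended by the identity of `C`. -/
def stab {N M A B : ProjMod R} (e : (N.prod A) ≃ₗ[R] (M.prod B)) (C : ProjMod R) :
    (N.prod (A.prod C)) ≃ₗ[R] (M.prod (B.prod C)) :=
  ((LinearEquiv.prodAssoc R N A C).symm.trans (e.prodCongr (LinearEquiv.refl R C))).trans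
    (LinearEquiv.prodAssoc R M B C)

lemma IsRes.stab {N M A B : ProjMod R} {f : AsympIso N M} {e : (N.prod A) ≃ₗ[R] (M.prod B)}
    (h : IsRes f e) (C : ProjMod R) : IsRes f (RelDet.stab e C) :=
  h.of_eq fun _ => rfl

/-- The isomorphism `M × (B × A') ≃ M × (B' × A)` comparing `e : N × A ≃ M × B` and
`e' : N × A' ≃ M × B'`. -/
def conn {N M A B A' B' : ProjMod R} (e : (N.prod A) ≃ₗ[R] (M.prod B))
    (e' : (N.prod A') ≃ₗ[R] (M.prod B')) : (M.prod (B.prod A')) ≃ₗ[R] (M.prod (B'.prod A)) :=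
  ((stab e A').symm.trans ((LinearEquiv.refl R N).prodCongr (LinearEquiv.prodComm R A A'))).trans
    (stab e' A)

lemma conn_stab {N M A B A' B' : ProjMod R} (e : (N.prod A) ≃ₗ[R] (M.prod B))
    (e' : (N.prod A') ≃ₗ[R] (M.prod B')) (x : N.prod (A.prod A')) :
    conn e e' (stab e A' x) = stab e' A (x.1, (x.2.2, x.2.1)) := by
  change stab e' A (((LinearEquiv.refl R N).prodCongr (LinearEquiv.prodComm R A A'))
    ((stab e A').symm (stab e A' x))) = _
  rw [LinearEquiv.symm_apply_apply]
  rfl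

lemma conn_apply {N M A B A' B' : ProjMod R} (e : (N.prod A) ≃ₗ[R] (M.prod B))
    (e' : (N.prod A') ≃ₗ[R] (M.prod B')) (n : N) (a : A) (a' : A') :
    conn e e' ((e (n, a)).1, ((e (n, a)).2, a')) = ((e' (n, a')).1, ((e' (n, a')).2, a)) :=
  conn_stab e e' (n, (a, a'))

/-- Any two resolutions of `f` are compared by an isomorphism that has a determinant. -/
lemma IsRes.isFred_conn {N M A B A' B' : ProjMod R} [Module.Finite R A] [Module.Finite R A']
    {f : AsympIso N M} {e : (N.prod A) ≃ₗ[R] (M.prod B)} {e' : (N.prod A') ≃ₗ[R] (M.prod B')}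
    (h : IsRes f e) (h' : IsRes f e') : IsFred (conn e e') := by
  refine (h.stab A').isFred (e' := ((LinearEquiv.refl R N).prodCongr
    (LinearEquiv.prodComm R A A')).trans (RelDet.stab e' A)) (h'.of_eq fun _ => rfl) (conn_stab e e')

/-- Quantification over `M × B` amounts to quantification over the images of pairs under an
isomorphism `e : N × A ≃ M × B`. -/
lemma forall_prod_iff {N M A B : ProjMod R} (e : (N.prod A) ≃ₗ[R] (M.prod B))
    {p : M → B → Prop} (h : ∀ n a, p (e (n, a)).1 (e (n, a)).2) (m : M) (b : B) : p m b := by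
  have := h (e.symm (m, b)).1 (e.symm (m, b)).2
  rwa [Prod.mk.eta, LinearEquiv.apply_symm_apply] at this

end Resolution

section FredLemmas

variable {R : Type u} [CommRing R]

lemma IsFred.perm {M P Q P' Q' : ProjMod R} {w : (M.prod P) ≃ₗ[R] (M.prod Q)} (hw : IsFred w)
    {w' : (M.prod P') ≃ₗ[R] (M.prod Q')} (α : P' ≃ₗ[R] P) (β : Q ≃ₗ[R] Q')
    (h : ∀ m x, w' (m, x) = ((w (m, α x)).1, β (w (m, α x)).2)) : IsFred w' := by
  obtain ⟨T, hT, hd⟩ := hw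
  exact ⟨T, hT, fun ⟨m, x⟩ => by rw [h]; exact hd (m, α x)⟩

lemma fdet_perm {M P Q P' Q' : ProjMod R} [Module.Finite R P] [Module.Finite R Q]
    [Module.Finite R P'] [Module.Finite R Q'] {w : (M.prod P) ≃ₗ[R] (M.prod Q)} (hw : IsFred w)
    {w' : (M.prod P') ≃ₗ[R] (M.prod Q')} (α : P' ≃ₗ[R] P) (β : Q ≃ₗ[R] Q')
    (h : ∀ m x, w' (m, x) = ((w (m, α x)).1, β (w (m, α x)).2)) :
    fdet w' = detMap β ∘ₗ fdet w ∘ₗ detMap α := by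
  let wα : (M.prod P') ≃ₗ[R] (M.prod P) := (LinearEquiv.refl R M).prodCongr α
  let wβ : (M.prod Q) ≃ₗ[R] (M.prod Q') := (LinearEquiv.refl R M).prodCongr β
  have hα : IsFred wα := IsFred.of_fst_eq fun _ => rfl
  have hβ : IsFred wβ := IsFred.of_fst_eq fun _ => rfl
  have h₁ : IsFred (M := M) (P := P') (Q := Q) (wα.trans w) := hα.trans hw
  rw [fdet_comp h₁ hβ (w'' := w') fun x => h x.1 x.2,
    fdet_comp hα hw (w'' := wα.trans w) fun x => rfl,
    fdet_of_eq (w := wα) α fun x => rfl, fdet_of_eq (w := wβ) β fun x => rfl]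

/-- The isomorphism `(A × B) × C ≃ (A × C) × B`. -/
def rightComm (A B C : ProjMod R) : ((A.prod B).prod C) ≃ₗ[R] ((A.prod C).prod B) :=
  ((LinearEquiv.prodAssoc R A B C).trans
    ((LinearEquiv.refl R A).prodCongr (LinearEquiv.prodComm R B C))).trans
      (LinearEquiv.prodAssoc R A C B).symm

lemma detMap_rightComm_wedge {A B C : ProjMod R} [Module.Finite R A] [Module.Finite R B]
    [Module.Finite R C] (a : detTop A) (b : detTop B) (c : detTop C) :
    detMap (rightComm A B C) (wedge (wedge a b) c) =
      sgn (rk B * rk C) • wedge (wedge a c) b := by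
  rw [detMap_comp_of_eq (A := (A.prod B).prod C) (B := A.prod (B.prod C)) (C := (A.prod C).prod B)
    (e := LinearEquiv.prodAssoc R A B C) (e' := ((LinearEquiv.refl R A).prodCongr
      (LinearEquiv.prodComm R B C)).trans (LinearEquiv.prodAssoc R A C B).symm)
    (e'' := rightComm A B C) (fun _ => rfl), detMap_prodAssoc_wedge,
    detMap_trans_apply (A := A.prod (B.prod C)) (B := A.prod (C.prod B)) (C := (A.prod C).prod B),
    detMap_prodCongr_wedge (B := B.prod C) (B' := C.prod B), detMap_refl, LinearMap.id_apply,
    detMap_prodComm_wedge, wedge_smul_right, map_smul, detMap_prodAssoc_symm_wedge]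

lemma rstab_rstab_rightComm {A B C D : ProjMod R} [Module.Finite R A] [Module.Finite R B]
    [Module.Finite R C] [Module.Finite R D] (ξ : detTop B →ₗ[R] detTop A)
    (z : detTop ((B.prod D).prod C)) :
    rstab D (rstab C ξ) (detMap (rightComm B D C) z) =
      detMap (rightComm A D C) (rstab C (rstab D ξ) z) := by
  have h : rstab D (rstab C ξ) ∘ₗ detMap (rightComm B D C) =
      detMap (rightComm A D C) ∘ₗ rstab C (rstab D ξ) := detTop_hom_ext fun z c => by
    induction z using wedge_induction with
    | hadd x y hx hy => rw [wedge_add_left, map_add, map_add, hx, hy]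
    | h b d =>
      rw [LinearMap.comp_apply, LinearMap.comp_apply, detMap_rightComm_wedge, map_smul, rstab_wedge,
        rstab_wedge, rstab_wedge, rstab_wedge, detMap_rightComm_wedge]
  exact DFunLike.congr_fun h z

end FredLemmas

section Ev

variable {R : Type u} [CommRing R]

/-- `ξ : det B → det A` and `ξ' : det B' → det A'` correspond to each other under the comparison of
the isomorphisms `e : N × A ≃ M × B` and `e' : N × A' ≃ M × B'`. -/
def Corr {N M A B A' B' : ProjMod R} [Module.Finite R A] [Module.Finite R B] [Module.Finite R A']
    [Module.Finite R B'] (e : (N.prod A) ≃ₗ[R] (M.prod B)) (e' : (N.prod A') ≃ₗ[R] (M.prod B'))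
    (ξ : detTop B →ₗ[R] detTop A) (ξ' : detTop B' →ₗ[R] detTop A') : Prop :=
  ∀ b a', rstab A ξ' (fdet (conn e e') (wedge b a')) =
    detMap (N := A.prod A') (M := A'.prod A) (LinearEquiv.prodComm R A A') (wedge (ξ b) a')

/-- The correspondence as an isomorphism. -/
def corrEquiv {N M A B A' B' : ProjMod R} [Module.Finite R A] [Module.Finite R B]
    [Module.Finite R A'] [Module.Finite R B'] {f : AsympIso N M} {e : (N.prod A) ≃ₗ[R] (M.prod B)}
    {e' : (N.prod A') ≃ₗ[R] (M.prod B')} (h : IsRes f e) (h' : IsRes f e') :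
    (detTop B →ₗ[R] detTop A) ≃ₗ[R] (detTop B' →ₗ[R] detTop A') :=
  ((rstab A').trans ((fdetEquiv (h.isFred_conn h')).arrowCongr
    (detCongr (A := A.prod A') (B := A'.prod A) (LinearEquiv.prodComm R A A')))).trans (rstab A).symm

lemma corr_iff {N M A B A' B' : ProjMod R} [Module.Finite R A] [Module.Finite R B]
    [Module.Finite R A'] [Module.Finite R B'] {f : AsympIso N M} {e : (N.prod A) ≃ₗ[R] (M.prod B)}
    {e' : (N.prod A') ≃ₗ[R] (M.prod B')} (h : IsRes f e) (h' : IsRes f e')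
    (ξ : detTop B →ₗ[R] detTop A) (ξ' : detTop B' →ₗ[R] detTop A') :
    Corr e e' ξ ξ' ↔ corrEquiv h h' ξ = ξ' := by
  have h1 : Corr e e' ξ ξ' ↔ rstab A ξ' ∘ₗ fdet (conn e e') =
      detMap (N := A.prod A') (M := A'.prod A) (LinearEquiv.prodComm R A A') ∘ₗ rstab A' ξ := by
    refine ⟨fun H => detTop_hom_ext fun b a' => ?_, fun H b a' => ?_⟩
    · rw [LinearMap.comp_apply, LinearMap.comp_apply, H, rstab_wedge]
    · rw [← rstab_wedge]
      exact DFunLike.congr_fun H _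
  rw [h1, corrEquiv, LinearEquiv.trans_apply, LinearEquiv.symm_apply_eq]
  refine ⟨fun H => LinearMap.ext fun z => ?_, fun H => LinearMap.ext fun y => ?_⟩
  · obtain ⟨y, rfl⟩ := (fdetEquiv (h.isFred_conn h')).surjective z
    rw [LinearEquiv.trans_apply, LinearEquiv.arrowCongr_apply, LinearEquiv.symm_apply_apply]
    exact (DFunLike.congr_fun H y).symm
  · rw [LinearMap.comp_apply, ← fdetEquiv_apply (h.isFred_conn h'), ← H, LinearEquiv.trans_apply,
      LinearEquiv.arrowCongr_apply, LinearEquiv.symm_apply_apply]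
    rfl

section Moves

variable {N M A₀ B₀ A B A' B' : ProjMod R} [Module.Finite R A₀] [Module.Finite R B₀]
  [Module.Finite R A] [Module.Finite R B] [Module.Finite R A'] [Module.Finite R B']
  {f : AsympIso N M} {e₀ : (N.prod A₀) ≃ₗ[R] (M.prod B₀)} {e : (N.prod A) ≃ₗ[R] (M.prod B)}

/-- The correspondence is compatible with stabilization of the second resolution. -/
lemma Corr.stab (h₀ : IsRes f e₀) (h : IsRes f e) (C : ProjMod R) [Module.Finite R C]
    {e' : (N.prod (A.prod C)) ≃ₗ[R] (M.prod (B.prod C))}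
    (he : ∀ n a c, e' (n, (a, c)) = ((e (n, a)).1, ((e (n, a)).2, c)))
    {x : detTop B₀ →ₗ[R] detTop A₀} {ξ : detTop B →ₗ[R] detTop A} (hx : Corr e₀ e x ξ) :
    Corr e₀ e' x (rstab C ξ) := by
  have hw := h₀.isFred_conn h
  have hw₁ := hw.stab (w' := RelDet.stab (conn e₀ e) C) C fun _ _ _ => rfl
  have hd₁ := fdet_stab (w' := RelDet.stab (conn e₀ e) C) C hw fun _ _ _ => rfl
  have hd₂ := fdet_perm hw₁ (w' := conn e₀ e') (LinearEquiv.prodAssoc R B₀ A C).symm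
    (rightComm B A₀ C) (fun m x => by
      obtain ⟨b, a, c⟩ := x
      revert m b
      refine forall_prod_iff e₀ fun n a₀ => ?_
      rw [conn_apply, he]
      change _ = ((conn e₀ e ((e₀ (n, a₀)).1, ((e₀ (n, a₀)).2, a))).1,
        rightComm B A₀ C ((conn e₀ e ((e₀ (n, a₀)).1, ((e₀ (n, a₀)).2, a))).2, c))
      rw [conn_apply]
      rfl)
  intro b y
  induction y using wedge_induction with
  | hadd y z hy hz =>
    rw [wedge_add_right, map_add, map_add, hy, hz, wedge_add_right, map_add]
  | h a c =>
    rw [hd₂, LinearMap.comp_apply, LinearMap.comp_apply, detMap_prodAssoc_symm_wedge, hd₁,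
      rstab_wedge, rstab_rstab_rightComm, rstab_wedge, hx]
    have h1 := detMap_comp_eq_comp (A := (A₀.prod A).prod C) (B := (A.prod A₀).prod C)
      (B' := A₀.prod (A.prod C)) (C := (A.prod C).prod A₀)
      (e₁ := (LinearEquiv.prodComm R A₀ A).prodCongr (LinearEquiv.refl R C))
      (e₂ := rightComm A A₀ C) (e₃ := LinearEquiv.prodAssoc R A₀ A C)
      (e₄ := LinearEquiv.prodComm R A₀ (A.prod C)) (fun _ => rfl) (wedge (wedge (x b) a) c)
    rw [detMap_prodCongr_wedge (A := A₀.prod A) (A' := A.prod A₀), detMap_refl, LinearMap.id_apply,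
      detMap_prodAssoc_wedge] at h1
    exact h1

/-- The correspondence is compatible with modifications on the side of `M`. -/
lemma Corr.fred (h₀ : IsRes f e₀) (h : IsRes f e) {w : (M.prod B) ≃ₗ[R] (M.prod B')}
    {e' : (N.prod A) ≃ₗ[R] (M.prod B')} (hw : IsFred w) (he : ∀ x, e' x = w (e x))
    {x : detTop B₀ →ₗ[R] detTop A₀} {ξ' : detTop B' →ₗ[R] detTop A} (hx : Corr e₀ e' x ξ') :
    Corr e₀ e x (ξ' ∘ₗ fdet w) := by
  have hd := fdet_comp (w' := RelDet.stab w A₀) (w'' := conn e₀ e') (h₀.isFred_conn h)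
    (hw.stab A₀ fun _ _ _ => rfl) (fun x => by
      obtain ⟨m, b, a⟩ := x
      revert m b
      refine forall_prod_iff e₀ fun n a₀ => ?_
      rw [conn_apply, conn_apply, he]
      rfl)
  intro b a
  rw [rstab_comp, LinearMap.comp_apply, ← hx, hd, LinearMap.comp_apply,
    fdet_stab (w' := RelDet.stab w A₀) A₀ hw fun _ _ _ => rfl]

/-- The correspondence is compatible with modifications on the side of `N`. -/
lemma Corr.comp_fred (h₀ : IsRes f e₀) (h : IsRes f e) {v : (N.prod A') ≃ₗ[R] (N.prod A)}
    {e' : (N.prod A') ≃ₗ[R] (M.prod B)} (hv : IsFred v) (he : ∀ x, e' x = e (v x))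
    {x : detTop B₀ →ₗ[R] detTop A₀} {ξ' : detTop B →ₗ[R] detTop A'} (hx : Corr e₀ e' x ξ') :
    Corr e₀ e x (fdet v ∘ₗ ξ') := by
  have h' : IsRes f e' := h.comp_fred hv he
  let u : (M.prod (B₀.prod A')) ≃ₗ[R] (M.prod (B₀.prod A)) := (conn e₀ e').trans (conn e₀ e).symm
  have hu : ∀ n a₀ a, u ((e₀ (n, a₀)).1, ((e₀ (n, a₀)).2, a)) = ((e₀ ((v (n, a)).1, a₀)).1,
      ((e₀ ((v (n, a)).1, a₀)).2, (v (n, a)).2)) := fun n a₀ a => by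
    change (conn e₀ e).symm (conn e₀ e' _) = _
    rw [LinearEquiv.symm_apply_eq, conn_apply, conn_apply, he]
  have hd₁ := fdet_transport hv e₀ hu
  have hd₂ := fdet_comp (w := u) (w' := conn e₀ e) (w'' := conn e₀ e') (hv.transport e₀ hu)
    (h₀.isFred_conn h) (fun x => ((conn e₀ e).apply_symm_apply _).symm)
  intro b a
  obtain ⟨a, rfl⟩ := (fdetEquiv hv).surjective a
  have h1 := hx b a
  rw [hd₂, hd₁, LinearMap.comp_apply, lstab_wedge, detMap_prodComm_wedge] at h1
  rw [rstab_comp, LinearMap.comp_apply, fdetEquiv_apply, h1, map_smul, rstab_wedge,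
    detMap_prodComm_wedge, rk_eq_of_isFred hv]

end Moves

/-- A chosen resolution. -/
structure Resolution {N M : ProjMod R} (f : AsympIso N M) where
  A : ProjMod R
  B : ProjMod R
  [finA : Module.Finite R A]
  [finB : Module.Finite R B]
  e : (N.prod A) ≃ₗ[R] (M.prod B)
  isRes : IsRes f e

attribute [instance] Resolution.finA Resolution.finB

instance {N M : ProjMod R} (f : AsympIso N M) : Nonempty (Resolution f) := by
  obtain ⟨A, B, _, _, e, h⟩ := exists_isRes f
  exact ⟨⟨A, B, e, h⟩⟩

/-- A resolution of `f`. -/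
def resOf {N M : ProjMod R} (f : AsympIso N M) : Resolution f := Classical.arbitrary _

/-- The relative determinant line of `f`: `det A / det B`, realized as `Hom (det B, det A)`, for a
chosen resolution `N × A ≃ M × B`. -/
def detLine {N M : ProjMod R} (f : AsympIso N M) : ZLine R where
  carrier := detTop (resOf f).B →ₗ[R] detTop (resOf f).A
  deg := rk (resOf f).A - rk (resOf f).B

/-- The identification of the relative determinant line of `f` with `Hom (det B, det A)`, for any
resolution `N × A ≃ M × B` of `f`. -/
def ev {N M A B : ProjMod R} [Module.Finite R A] [Module.Finite R B] {f : AsympIso N M}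
    {e : (N.prod A) ≃ₗ[R] (M.prod B)} (h : IsRes f e) :
    detLine f ≃ₗ[R] (detTop B →ₗ[R] detTop A) :=
  corrEquiv (resOf f).isRes h

variable {N M A B A' B' : ProjMod R} [Module.Finite R A] [Module.Finite R B] [Module.Finite R A']
    [Module.Finite R B'] {f : AsympIso N M} {e : (N.prod A) ≃ₗ[R] (M.prod B)}

lemma ev_eq_iff (h : IsRes f e) (x : detLine f) (ξ : detTop B →ₗ[R] detTop A) :
    ev h x = ξ ↔ Corr (resOf f).e e x ξ :=
  (corr_iff (resOf f).isRes h x ξ).symm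

lemma corr_ev (h : IsRes f e) (x : detLine f) : Corr (resOf f).e e x (ev h x) :=
  (ev_eq_iff h x _).1 rfl

lemma deg_detLine (h : IsRes f e) : (detLine f).deg = rk A - rk B := by
  have h1 := rk_eq_of_isFred ((resOf f).isRes.isFred_conn h)
  rw [rk_prod, rk_prod] at h1
  change rk (resOf f).A - rk (resOf f).B = _
  rw [sub_eq_sub_iff_add_eq_add, add_comm, ← h1, add_comm]

/-- Adding a module of finite rank to a resolution. -/
lemma ev_stab (C : ProjMod R) [Module.Finite R C]
    {e' : (N.prod (A.prod C)) ≃ₗ[R] (M.prod (B.prod C))}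
    (h : IsRes f e) (h' : IsRes f e')
    (he : ∀ n a c, e' (n, (a, c)) = ((e (n, a)).1, ((e (n, a)).2, c))) (x : detLine f) :
    ev h' x = rstab C (ev h x) :=
  (ev_eq_iff h' x _).2 ((corr_ev h x).stab (resOf f).isRes h C he)

/-- Modifying a resolution of `f : N → M` on the side of `M`. -/
lemma ev_fred {w : (M.prod B) ≃ₗ[R] (M.prod B')} {e' : (N.prod A) ≃ₗ[R] (M.prod B')}
    (h : IsRes f e) (h' : IsRes f e') (hw : IsFred w) (he : ∀ x, e' x = w (e x)) (x : detLine f) :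
    ev h x = ev h' x ∘ₗ fdet w :=
  (ev_eq_iff h x _).2 ((corr_ev h' x).fred (resOf f).isRes h hw he)

/-- Modifying a resolution of `f : N → M` on the side of `N`. -/
lemma ev_comp_fred {v : (N.prod A') ≃ₗ[R] (N.prod A)} {e' : (N.prod A') ≃ₗ[R] (M.prod B)}
    (h : IsRes f e) (h' : IsRes f e') (hv : IsFred v) (he : ∀ x, e' x = e (v x)) (x : detLine f) :
    ev h x = fdet v ∘ₗ ev h' x :=
  (ev_eq_iff h x _).2 ((corr_ev h' x).comp_fred (resOf f).isRes h hv he)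

/-- Replacing the auxiliary modules by isomorphic ones. -/
lemma ev_perm {e' : (N.prod A') ≃ₗ[R] (M.prod B')} (h : IsRes f e) (h' : IsRes f e')
    (α : A ≃ₗ[R] A') (β : B ≃ₗ[R] B')
    (he : ∀ n a, e' (n, α a) = ((e (n, a)).1, β (e (n, a)).2)) (x : detLine f) :
    ev h' x ∘ₗ detMap β = detMap α ∘ₗ ev h x := by
  let w : (M.prod B) ≃ₗ[R] (M.prod B') := (LinearEquiv.refl R M).prodCongr β
  let v : (N.prod A) ≃ₗ[R] (N.prod A') := (LinearEquiv.refl R N).prodCongr α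
  have hw : IsFred w := IsFred.of_fst_eq fun _ => rfl
  have hv : IsFred v := IsFred.of_fst_eq fun _ => rfl
  have h'' : IsRes f (A := A) (B := B') (e.trans w) := h.fred_comp hw fun _ => rfl
  have h1 := ev_fred h h'' hw (fun _ => rfl) x
  have h2 := ev_comp_fred h' h'' hv (fun x => (he x.1 x.2).symm) x
  rw [h1, h2, fdet_of_eq (w := w) β fun _ => rfl, fdet_of_eq (w := v) α fun _ => rfl]
  rfl

end Ev

section Connect

variable {R : Type u} [CommRing R]

/-- Any two resolutions of `f` are linked by stabilizations, modifications on the side of `M` by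
isomorphisms that have a determinant, and isomorphisms of the auxiliary module on the side of
`N`. -/
lemma res_connect {N M : ProjMod R} {f : AsympIso N M}
    (P : ∀ {A B : ProjMod R} [Module.Finite R A] [Module.Finite R B],
      ((N.prod A) ≃ₗ[R] (M.prod B)) → Prop)
    (hstab : ∀ {A B C : ProjMod R} [Module.Finite R A] [Module.Finite R B] [Module.Finite R C]
      (e : (N.prod A) ≃ₗ[R] (M.prod B)), IsRes f e → (P e ↔ P (stab e C)))
    (hfred : ∀ {A B B' : ProjMod R} [Module.Finite R A] [Module.Finite R B] [Module.Finite R B']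
      (e : (N.prod A) ≃ₗ[R] (M.prod B)) (e' : (N.prod A) ≃ₗ[R] (M.prod B'))
      (w : (M.prod B) ≃ₗ[R] (M.prod B')), IsRes f e → IsRes f e' → IsFred w →
      (∀ x, e' x = w (e x)) → P e → P e')
    (hperm : ∀ {A A' B : ProjMod R} [Module.Finite R A] [Module.Finite R A'] [Module.Finite R B]
      (e : (N.prod A) ≃ₗ[R] (M.prod B)) (e' : (N.prod A') ≃ₗ[R] (M.prod B)) (α : A ≃ₗ[R] A'),
      IsRes f e → IsRes f e' → (∀ n a, e' (n, α a) = e (n, a)) → P e → P e')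
    {A B A' B' : ProjMod R} [Module.Finite R A] [Module.Finite R B] [Module.Finite R A']
    [Module.Finite R B'] {e : (N.prod A) ≃ₗ[R] (M.prod B)} {e' : (N.prod A') ≃ₗ[R] (M.prod B')}
    (h : IsRes f e) (h' : IsRes f e') (hP : P e) : P e' := by
  let v : (N.prod (A.prod A')) ≃ₗ[R] (N.prod (A'.prod A)) :=
    (LinearEquiv.refl R N).prodCongr (LinearEquiv.prodComm R A A')
  have hv : IsFred v := IsFred.of_fst_eq fun _ => rfl
  let E : (N.prod (A.prod A')) ≃ₗ[R] (M.prod (B'.prod A)) := v.trans (stab e' A)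
  have hE : IsRes f E := (h'.stab A).comp_fred hv fun _ => rfl
  refine (hstab e' h').2 (hperm (A := A.prod A') (A' := A'.prod A) E (stab e' A)
    (LinearEquiv.prodComm R A A') hE (h'.stab A) (fun _ _ => rfl) ?_)
  exact hfred (stab e A') E (conn e e') (h.stab A') hE (h.isFred_conn h')
    (fun x => (conn_stab e e' x).symm) ((hstab e h).1 hP)

end Connect

/-! ### Trivialization and composition -/

section LineEquivs

variable {R : Type u} [CommRing R]

/-- Multiplication by a sign. -/
def sgnEquiv (V : Type u) [AddCommGroup V] [Module R V] (u : LocallyConstant (PrimeSpectrum R) ℤ) :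
    V ≃ₗ[R] V :=
  LinearEquiv.ofLinearMap (sgn u • LinearMap.id) (sgn u • LinearMap.id)
    (LinearMap.ext (sgn_smul_smul u)) (LinearMap.ext (sgn_smul_smul u))

/-- Scalars as endomorphisms of a line. -/
def scalarEquiv (L : Type u) [AddCommGroup L] [Module R L] [Module.Invertible R L] :
    R ≃ₗ[R] (L →ₗ[R] L) :=
  LinearEquiv.ofBijective (LinearMap.toSpanSingleton R _ LinearMap.id)
    (Module.Invertible.toModuleEnd_bijective R L)

lemma scalarEquiv_one (L : Type u) [AddCommGroup L] [Module R L] [Module.Invertible R L] :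
    scalarEquiv (R := R) L 1 = LinearMap.id := one_smul R _

/-- Composition of homomorphisms between lines, in the order in which determinants of resolutions
compose. -/
def lineCompEquiv (P Q S : Type u) [AddCommGroup P] [Module R P] [AddCommGroup Q] [Module R Q]
    [AddCommGroup S] [Module R S] [Module.Invertible R P] [Module.Invertible R Q]
    [Module.Invertible R S] : (Q →ₗ[R] S) ⊗[R] (P →ₗ[R] Q) ≃ₗ[R] (P →ₗ[R] S) :=
  LinearEquiv.ofBijective (lineComp P Q S) (lineComp_bijective P Q S)

/-- `lstab` as an isomorphism. -/
def lstabEquiv {A B : ProjMod R} [Module.Finite R A] [Module.Finite R B] (C : ProjMod R)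
    [Module.Finite R C] :
    (detTop B →ₗ[R] detTop A) ≃ₗ[R] (detTop (C.prod B) →ₗ[R] detTop (C.prod A)) :=
  LinearEquiv.ofBijective (lstab C) (lstab_bijective C)

instance detTop_prod_invertible (A B : ProjMod R) [Module.Finite R A] [Module.Finite R B] :
    Module.Invertible R (detTop (A.prod B)) := detTop_invertible (A.prod B)

/-- The external product of `det B₁ → det A₁` and `det B₂ → det A₂`, with the sign that makes it
the isomorphism `(det A₁ / det B₁) · (det A₂ / det B₂) ≅ det (A₁ ⊕ A₂) / det (B₁ ⊕ B₂)` of super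
lines. -/
def boxEquiv (A₁ B₁ A₂ B₂ : ProjMod R) [Module.Finite R A₁] [Module.Finite R B₁]
    [Module.Finite R A₂] [Module.Finite R B₂] :
    (detTop B₁ →ₗ[R] detTop A₁) ⊗[R] (detTop B₂ →ₗ[R] detTop A₂) ≃ₗ[R]
      (detTop (B₁.prod B₂) →ₗ[R] detTop (A₁.prod A₂)) :=
  ((TensorProduct.congr (rstab (A := A₁) (B := B₁) A₂) (lstabEquiv (A := A₂) (B := B₂) B₁)).trans
    (lineCompEquiv (detTop (B₁.prod B₂)) (detTop (B₁.prod A₂)) (detTop (A₁.prod A₂)))).trans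
    (sgnEquiv (detTop (B₁.prod B₂) →ₗ[R] detTop (A₁.prod A₂)) (rk A₁ * (rk A₂ - rk B₂)))

/-- The external product of `det B₁ → det A₁` and `det B₂ → det A₂`. -/
def box {A₁ B₁ A₂ B₂ : ProjMod R} [Module.Finite R A₁] [Module.Finite R B₁] [Module.Finite R A₂]
    [Module.Finite R B₂] (ξ : detTop B₁ →ₗ[R] detTop A₁) (η : detTop B₂ →ₗ[R] detTop A₂) :
    detTop (B₁.prod B₂) →ₗ[R] detTop (A₁.prod A₂) :=
  sgn (rk A₁ * (rk A₂ - rk B₂)) • (rstab A₂ ξ ∘ₗ lstab B₁ η)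

lemma box_wedge {A₁ B₁ A₂ B₂ : ProjMod R} [Module.Finite R A₁] [Module.Finite R B₁]
    [Module.Finite R A₂] [Module.Finite R B₂] (ξ : detTop B₁ →ₗ[R] detTop A₁)
    (η : detTop B₂ →ₗ[R] detTop A₂) (b₁ : detTop B₁) (b₂ : detTop B₂) :
    box ξ η (wedge b₁ b₂) = sgn (rk A₁ * (rk A₂ - rk B₂)) • wedge (ξ b₁) (η b₂) := by
  rw [box, LinearMap.smul_apply, LinearMap.comp_apply, lstab_wedge, rstab_wedge]

/-- Base change of maps between determinants. -/
def bcHomEquiv (R' : Type u) [CommRing R'] [Algebra R R'] (A B : ProjMod R)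
    [Module.Finite R A] [Module.Finite R B] : R' ⊗[R] (detTop B →ₗ[R] detTop A) ≃ₗ[R']
      (detTop (B.baseChange R') →ₗ[R'] detTop (A.baseChange R')) :=
  LinearEquiv.ofBijective ((bcHom R' (A := A) (B := B)).liftBaseChange R')
    (bcHom_lift_bijective R' A B)

lemma bcHomEquiv_tmul (R' : Type u) [CommRing R'] [Algebra R R'] {A B : ProjMod R}
    [Module.Finite R A] [Module.Finite R B] (ξ : detTop B →ₗ[R] detTop A) :
    bcHomEquiv R' A B (1 ⊗ₜ ξ) = bcHom R' ξ := one_smul R' _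

end LineEquivs

section Triv

variable {R : Type u} [CommRing R]

instance detTop_zero_invertible : Module.Invertible R (detTop (ProjMod.zero R)) :=
  detTop_invertible (ProjMod.zero R)

/-- The trivialization of the determinant line of an isomorphism `e`, by the resolution with
auxiliary modules `0`. -/
def detTriv {N M : ProjMod R} (e : N ≃ₗ[R] M) {f : AsympIso N M} (h : f = AsympIso.ofEquiv e) :
    ZLine.Iso (ZLine.unit R) (detLine f) :=
  have h' : IsRes (A := ProjMod.zero R) (B := ProjMod.zero R) f
      (e.prodCongr (LinearEquiv.refl R (ProjMod.zero R))) := h ▸ isRes_ofEquiv e fun _ => rfl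
  { toEquiv := (scalarEquiv (R := R) (detTop (ProjMod.zero R))).trans (ev h').symm
    deg_eq := by
      rw [deg_detLine h', sub_self] }

/-- In a resolution which is the sum of `e` and `β : A ≃ B`, the trivialization is the inverse of
the determinant of `β`. -/
lemma ev_detTriv {N M A B : ProjMod R} [Module.Finite R A] [Module.Finite R B] (e : N ≃ₗ[R] M)
    {f : AsympIso N M} (h : f = AsympIso.ofEquiv e) {E : (N.prod A) ≃ₗ[R] (M.prod B)}
    (hE : IsRes f E) (β : A ≃ₗ[R] B) (he : ∀ x, E x = (e x.1, β x.2)) :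
    ev hE (detTriv e h 1) = detMap β.symm := by
  have h₀ : IsRes (A := ProjMod.zero R) (B := ProjMod.zero R) f
      (e.prodCongr (LinearEquiv.refl R (ProjMod.zero R))) := h ▸ isRes_ofEquiv e fun _ => rfl
  have h₁ : ev h₀ (detTriv e h 1) = LinearMap.id := by
    change ev h₀ ((ev h₀).symm (scalarEquiv _ 1)) = _
    rw [LinearEquiv.apply_symm_apply, scalarEquiv_one]
  have hA := h₀.stab A
  have h₂ := ev_stab A h₀ hA (fun _ _ _ => rfl) (detTriv e h 1)
  rw [h₁, rstab_id] at h₂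
  let α : ((ProjMod.zero R).prod A) ≃ₗ[R] A := LinearEquiv.uniqueProd
  have h₃ := ev_perm hA hE α (α.trans β) (fun n a => he _) (detTriv e h 1)
  rw [h₂, LinearMap.comp_id] at h₃
  refine LinearMap.ext fun b => ?_
  obtain ⟨x, rfl⟩ := (detCongr (α.trans β)).surjective b
  refine (DFunLike.congr_fun h₃ x).trans ?_
  change detMap α x = detMap β.symm (detMap (α.trans β) x)
  rw [detMap_trans_apply, detMap_symm_apply_detMap]

end Triv

section Comp

variable {R : Type u} [CommRing R]

/-- After stabilizing a given resolution by `C`, there is a resolution of `g` whose source is its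
target. -/
lemma exists_chain_step {N M L C₀ C₁ : ProjMod R} [Module.Finite R C₀] [Module.Finite R C₁]
    (g : AsympIso M L) (_ : (N.prod C₀) ≃ₗ[R] (M.prod C₁)) :
    ∃ (C D : ProjMod R) (_ : Module.Finite R C) (_ : Module.Finite R D)
      (e' : (M.prod (C₁.prod C)) ≃ₗ[R] (L.prod D)), IsRes g e' := by
  obtain ⟨A, B, _, _, s, hs⟩ := exists_isRes g
  refine ⟨A, B.prod C₁, inferInstance, inferInstance,
    ((LinearEquiv.refl R M).prodCongr (LinearEquiv.prodComm R C₁ A)).trans (stab s C₁), ?_⟩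
  exact hs.of_eq fun _ => rfl

/-- Composable resolutions of `f : N → M` and `g : M → L`. -/
structure Chain {N M L : ProjMod R} (g : AsympIso M L) (f : AsympIso N M) where
  C₀ : ProjMod R
  C₁ : ProjMod R
  C₂ : ProjMod R
  [fin₀ : Module.Finite R C₀]
  [fin₁ : Module.Finite R C₁]
  [fin₂ : Module.Finite R C₂]
  e₁ : (N.prod C₀) ≃ₗ[R] (M.prod C₁)
  e₂ : (M.prod C₁) ≃ₗ[R] (L.prod C₂)
  isRes₁ : IsRes f e₁
  isRes₂ : IsRes g e₂

attribute [instance] Chain.fin₀ Chain.fin₁ Chain.fin₂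

instance {N M L : ProjMod R} (g : AsympIso M L) (f : AsympIso N M) : Nonempty (Chain g f) := by
  obtain ⟨C₀, C₁, _, _, e, he⟩ := exists_isRes f
  obtain ⟨C, D, _, _, e', he'⟩ := exists_chain_step g e
  exact ⟨⟨C₀.prod C, C₁.prod C, D, stab e C, e', he.stab C, he'⟩⟩

/-- A composable pair of resolutions. -/
def chainOf {N M L : ProjMod R} (g : AsympIso M L) (f : AsympIso N M) : Chain g f :=
  Classical.arbitrary _

lemma Chain.isRes {N M L : ProjMod R} {g : AsympIso M L} {f : AsympIso N M} (c : Chain g f)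
    {h : AsympIso N L} (hh : h = g.comp f) : IsRes h (A := c.C₀) (B := c.C₂) (c.e₁.trans c.e₂) :=
  hh ▸ c.isRes₁.comp c.isRes₂ fun _ => rfl

/-- The composition isomorphism of relative determinant lines. -/
def detComp {N M L : ProjMod R} {g : AsympIso M L} {f : AsympIso N M} {h : AsympIso N L}
    (hh : h = g.comp f) : ZLine.Iso ((detLine g).tensor (detLine f)) (detLine h) where
  toEquiv := ((TensorProduct.comm R (detLine g) (detLine f)).trans
    (TensorProduct.congr (ev (chainOf g f).isRes₁) (ev (chainOf g f).isRes₂))).trans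
      ((lineCompEquiv _ _ _).trans (ev ((chainOf g f).isRes hh)).symm)
  deg_eq := by
    rw [deg_detLine ((chainOf g f).isRes hh)]
    change (detLine g).deg + (detLine f).deg = _
    rw [deg_detLine (chainOf g f).isRes₁, deg_detLine (chainOf g f).isRes₂]
    abel

set_option maxRecDepth 4000 in
lemma detComp_tmul {N M L : ProjMod R} {g : AsympIso M L} {f : AsympIso N M} {h : AsympIso N L}
    (hh : h = g.comp f) (y : detLine g) (x : detLine f) :
    ev ((chainOf g f).isRes hh) (detComp hh (y ⊗ₜ x)) =
      ev (chainOf g f).isRes₁ x ∘ₗ ev (chainOf g f).isRes₂ y :=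
  (ev ((chainOf g f).isRes hh)).apply_symm_apply
    (ev (chainOf g f).isRes₁ x ∘ₗ ev (chainOf g f).isRes₂ y)

/-- The composition can be computed on any composable pair of resolutions. After stabilization, the
given pair and the chosen one are linked by isomorphisms `v` of `N × _`, `w` of `M × _` and `w₂` of
`L × _`, whose determinants cancel. -/
lemma ev_detComp {N M L C₀ C₁ C₂ : ProjMod R} [Module.Finite R C₀] [Module.Finite R C₁]
    [Module.Finite R C₂] {g : AsympIso M L} {f : AsympIso N M} {h : AsympIso N L}
    (hh : h = g.comp f) {e₁ : (N.prod C₀) ≃ₗ[R] (M.prod C₁)} {e₂ : (M.prod C₁) ≃ₗ[R] (L.prod C₂)}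
    {e : (N.prod C₀) ≃ₗ[R] (L.prod C₂)} (h₁ : IsRes f e₁) (h₂ : IsRes g e₂) (h₁₂ : IsRes h e)
    (he : ∀ x, e x = e₂ (e₁ x)) (y : detLine g) (x : detLine f) :
    ev h₁₂ (detComp hh (y ⊗ₜ x)) = ev h₁ x ∘ₗ ev h₂ y := by
  have hc := detComp_tmul hh y x
  generalize detComp hh (y ⊗ₜ x) = z at hc ⊢
  generalize chainOf g f = c at hc
  -- stabilize both chains to the same module over `N`
  let v : (N.prod (c.C₀.prod C₀)) ≃ₗ[R] (N.prod (C₀.prod c.C₀)) :=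
    (LinearEquiv.refl R N).prodCongr (LinearEquiv.prodComm R c.C₀ C₀)
  have hv : IsFred v := IsFred.of_fst_eq fun _ => rfl
  let w := conn c.e₁ e₁
  have hw : IsFred w := c.isRes₁.isFred_conn h₁
  let E₁ : (N.prod (c.C₀.prod C₀)) ≃ₗ[R] (M.prod (C₁.prod c.C₀)) := v.trans (stab e₁ c.C₀)
  let E₂ : (M.prod (c.C₁.prod C₀)) ≃ₗ[R] (L.prod (C₂.prod c.C₀)) := w.trans (stab e₂ c.C₀)
  let w₂ : (L.prod (c.C₂.prod C₀)) ≃ₗ[R] (L.prod (C₂.prod c.C₀)) := (stab c.e₂ C₀).symm.trans E₂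
  have hE₁ : IsRes f E₁ := (h₁.stab c.C₀).comp_fred hv fun _ => rfl
  have hE₂ : IsRes g E₂ := (h₂.stab c.C₀).comp_fred hw fun _ => rfl
  have hs₂ : ∀ x, E₂ x = w₂ (stab c.e₂ C₀ x) := fun x => by
    change E₂ x = E₂ ((stab c.e₂ C₀).symm (stab c.e₂ C₀ x))
    rw [LinearEquiv.symm_apply_apply]
  have hw₂ : IsFred w₂ := (c.isRes₂.stab C₀).isFred hE₂ fun x => (hs₂ x).symm
  have hwE : ∀ x, E₁ x = w (stab c.e₁ C₀ x) := fun x => (conn_stab c.e₁ e₁ x).symm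
  -- the composites
  let E : (N.prod (c.C₀.prod C₀)) ≃ₗ[R] (L.prod (C₂.prod c.C₀)) := v.trans (stab e c.C₀)
  have hE : IsRes h E := (h₁₂.stab c.C₀).comp_fred hv fun _ => rfl
  have hEw : ∀ x, E x = w₂ (stab (N := N) (A := c.C₀) (M := L) (B := c.C₂) (c.e₁.trans c.e₂) C₀ x) :=
    fun x => by
      have h1 : stab (N := N) (A := c.C₀) (M := L) (B := c.C₂) (c.e₁.trans c.e₂) C₀ x =
        stab c.e₂ C₀ (stab c.e₁ C₀ x) := rfl
      rw [h1, ← hs₂]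
      change _ = stab e₂ c.C₀ (w (stab c.e₁ C₀ x))
      rw [← hwE]
      change ((e (x.1, x.2.2)).1, ((e (x.1, x.2.2)).2, x.2.1)) = _
      rw [he]
      rfl
  have k₁ := ev_stab c.C₀ h₁₂ (h₁₂.stab c.C₀) (fun _ _ _ => rfl) z
  have k₂ := ev_comp_fred (h₁₂.stab c.C₀) hE hv (fun _ => rfl) z
  have k₃ := ev_fred ((c.isRes hh).stab C₀) hE hw₂ hEw z
  have k₄ := ev_stab C₀ (c.isRes hh) ((c.isRes hh).stab C₀) (fun _ _ _ => rfl) z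
  have l₁ := ev_stab c.C₀ h₁ (h₁.stab c.C₀) (fun _ _ _ => rfl) x
  have l₂ := ev_comp_fred (h₁.stab c.C₀) hE₁ hv (fun _ => rfl) x
  have l₃ := ev_fred (c.isRes₁.stab C₀) hE₁ hw hwE x
  have l₄ := ev_stab C₀ c.isRes₁ (c.isRes₁.stab C₀) (fun _ _ _ => rfl) x
  have m₁ := ev_stab c.C₀ h₂ (h₂.stab c.C₀) (fun _ _ _ => rfl) y
  have m₂ := ev_comp_fred (h₂.stab c.C₀) hE₂ hw (fun _ => rfl) y
  have m₃ := ev_fred (c.isRes₂.stab C₀) hE₂ hw₂ hs₂ y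
  have m₄ := ev_stab C₀ c.isRes₂ (c.isRes₂.stab C₀) (fun _ _ _ => rfl) y
  apply (rstab c.C₀).injective
  rw [rstab_comp, ← k₁, k₂, ← l₁, l₂, ← m₁, m₂]
  refine LinearMap.ext fun b => ?_
  obtain ⟨b, rfl⟩ := (fdetEquiv hw₂).surjective b
  have n₁ := DFunLike.congr_fun k₃ b
  have n₂ := DFunLike.congr_fun m₃ b
  rw [k₄, hc, rstab_comp, ← l₄, ← m₄, l₃, m₃] at n₁
  exact congrArg (fdet v) n₁.symm

end Comp

/-! ### External products -/

section Sum

variable {R : Type u} [CommRing R]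

/-- The direct sum of two resolutions. -/
def sumE {N₁ A₁ M₁ B₁ N₂ A₂ M₂ B₂ : ProjMod R} (e₁ : (N₁.prod A₁) ≃ₗ[R] (M₁.prod B₁))
    (e₂ : (N₂.prod A₂) ≃ₗ[R] (M₂.prod B₂)) :
    ((N₁.prod N₂).prod (A₁.prod A₂)) ≃ₗ[R] ((M₁.prod M₂).prod (B₁.prod B₂)) :=
  ((LinearEquiv.prodProdProdComm R N₁ N₂ A₁ A₂).trans (e₁.prodCongr e₂)).trans
    (LinearEquiv.prodProdProdComm R M₁ B₁ M₂ B₂)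

lemma sumE_apply {N₁ A₁ M₁ B₁ N₂ A₂ M₂ B₂ : ProjMod R} (e₁ : (N₁.prod A₁) ≃ₗ[R] (M₁.prod B₁))
    (e₂ : (N₂.prod A₂) ≃ₗ[R] (M₂.prod B₂)) (n₁ : N₁) (n₂ : N₂) (a₁ : A₁) (a₂ : A₂) :
    sumE e₁ e₂ ((n₁, n₂), (a₁, a₂)) = (((e₁ (n₁, a₁)).1, (e₂ (n₂, a₂)).1),
      ((e₁ (n₁, a₁)).2, (e₂ (n₂, a₂)).2)) := rfl

lemma IsRes.sumE {N₁ A₁ M₁ B₁ N₂ A₂ M₂ B₂ : ProjMod R} {f₁ : AsympIso N₁ M₁} {f₂ : AsympIso N₂ M₂}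
    {e₁ : (N₁.prod A₁) ≃ₗ[R] (M₁.prod B₁)} {e₂ : (N₂.prod A₂) ≃ₗ[R] (M₂.prod B₂)}
    (h₁ : IsRes f₁ e₁) (h₂ : IsRes f₂ e₂) : IsRes (f₁.prod f₂) (RelDet.sumE e₁ e₂) := by
  change _ = f₁.hom.prod f₂.hom
  rw [← h₁, ← h₂]
  rfl

/-- The sum of `w` on `M₁ × B₁` and the identity on `M₂ × B₂`. -/
lemma fred_sum_left {M₁ M₂ B₁ B₁' : ProjMod R} (B₂ : ProjMod R)
    {w : (M₁.prod B₁) ≃ₗ[R] (M₁.prod B₁')} (hw : IsFred w) :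
    IsFred (sumE w (LinearEquiv.refl R (M₂.prod B₂))) ∧
      ∀ [Module.Finite R B₁] [Module.Finite R B₁'] [Module.Finite R B₂],
        fdet (sumE w (LinearEquiv.refl R (M₂.prod B₂))) = rstab B₂ (fdet w) := by
  let u : ((M₁.prod M₂).prod B₁) ≃ₗ[R] ((M₁.prod M₂).prod B₁') :=
    ((rightComm M₁ M₂ B₁).trans (w.prodCongr (LinearEquiv.refl R M₂))).trans (rightComm M₁ B₁' M₂)
  have hu : ∀ m k a, u ((m, k), a) = (((w (m, a)).1, k), (w (m, a)).2) := fun _ _ _ => rfl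
  have h₁ := hw.enlarge hu
  refine ⟨h₁.stab B₂ fun _ _ _ => rfl, ?_⟩
  intro _ _ _
  rw [fdet_stab B₂ h₁ fun _ _ _ => rfl, fdet_enlarge hw hu]

lemma rstab_conj_prodComm {A B C : ProjMod R} [Module.Finite R A] [Module.Finite R B]
    [Module.Finite R C] (ξ : detTop B →ₗ[R] detTop A) (hr : rk A = rk B) :
    detMap (N := A.prod C) (M := C.prod A) (LinearEquiv.prodComm R A C) ∘ₗ rstab C ξ ∘ₗ
      detMap (N := C.prod B) (M := B.prod C) (LinearEquiv.prodComm R C B) = lstab C ξ :=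
  detTop_hom_ext fun c b => by
    rw [LinearMap.comp_apply, LinearMap.comp_apply, detMap_prodComm_wedge, map_smul, map_smul,
      rstab_wedge, detMap_prodComm_wedge, lstab_wedge, hr, mul_comm (rk B), detTop_sgn_smul_smul]

/-- The sum of the identity on `M₁ × B₁` and `w` on `M₂ × B₂`. -/
lemma fred_sum_right {M₁ M₂ B₂ B₂' : ProjMod R} (B₁ : ProjMod R)
    {w : (M₂.prod B₂) ≃ₗ[R] (M₂.prod B₂')} (hw : IsFred w) :
    IsFred (sumE (LinearEquiv.refl R (M₁.prod B₁)) w) ∧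
      ∀ [Module.Finite R B₁] [Module.Finite R B₂] [Module.Finite R B₂'],
        fdet (sumE (LinearEquiv.refl R (M₁.prod B₁)) w) = lstab B₁ (fdet w) := by
  obtain ⟨h₁, hd₁⟩ := fred_sum_left (M₂ := M₁) B₁ hw
  let u : ((M₁.prod M₂).prod (B₂.prod B₁)) ≃ₗ[R] ((M₁.prod M₂).prod (B₂'.prod B₁)) :=
    (((LinearEquiv.prodComm R M₁ M₂).prodCongr (LinearEquiv.refl R (B₂ × B₁))).trans
      (sumE w (LinearEquiv.refl R (M₁.prod B₁)))).trans
        ((LinearEquiv.prodComm R M₂ M₁).prodCongr (LinearEquiv.refl R (B₂' × B₁)))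
  have h₂ := h₁.conj (w' := u) (M' := M₁.prod M₂) (LinearEquiv.prodComm R M₂ M₁) fun _ _ => rfl
  refine ⟨h₂.perm (LinearEquiv.prodComm R B₁ B₂) (LinearEquiv.prodComm R B₂' B₁) fun _ _ => rfl, ?_⟩
  intro _ _ _
  rw [fdet_perm h₂ (P' := B₁.prod B₂) (Q' := B₁.prod B₂') (LinearEquiv.prodComm R B₁ B₂)
    (LinearEquiv.prodComm R B₂' B₁) fun _ _ => rfl,
    fdet_conj h₁ (w' := u) (M' := M₁.prod M₂) (LinearEquiv.prodComm R M₂ M₁) fun _ _ => rfl, hd₁]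
  exact rstab_conj_prodComm _ (rk_eq_of_isFred hw).symm

lemma sgn_eq_sgn {u v w : LocallyConstant (PrimeSpectrum R) ℤ} (h : u + v = w + w) :
    sgn u = sgn v := by
  have h1 : sgn u * sgn v = 1 := by rw [← sgn_add, h, sgn_add, sgn_mul_self]
  calc sgn u = sgn u * (sgn v * sgn v) := by rw [sgn_mul_self, mul_one]
    _ = sgn v := by rw [← mul_assoc, h1, one_mul]

/-- Two products of two signs agree if their exponents have the same parity. -/
lemma sgn_smul_congr {V : Type*} [AddCommGroup V] [Module R V]
    {u v u' v' w : LocallyConstant (PrimeSpectrum R) ℤ} (h : u + v + (u' + v') = w + w) (x : V) :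
    sgn u • sgn v • x = sgn u' • sgn v' • x := by
  rw [smul_smul, smul_smul, ← sgn_add, ← sgn_add, sgn_eq_sgn h]

variable {A₁ B₁ A₂ B₂ : ProjMod R} [Module.Finite R A₁] [Module.Finite R B₁] [Module.Finite R A₂]
  [Module.Finite R B₂]

lemma box_rstab_rightComm (C : ProjMod R) [Module.Finite R C] (ξ : detTop B₁ →ₗ[R] detTop A₁)
    (η : detTop B₂ →ₗ[R] detTop A₂) :
    box (rstab C ξ) η ∘ₗ detMap (rightComm B₁ B₂ C) =
      detMap (rightComm A₁ A₂ C) ∘ₗ rstab C (box ξ η) := detTop_hom_ext fun z c => by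
  induction z using wedge_induction with
  | hadd x y hx hy => rw [wedge_add_left, map_add, map_add, hx, hy]
  | h b₁ b₂ =>
    rw [LinearMap.comp_apply, LinearMap.comp_apply, detMap_rightComm_wedge, map_smul, box_wedge,
      rstab_wedge, rstab_wedge, box_wedge, wedge_smul_left, map_smul, detMap_rightComm_wedge, rk_prod]
    refine sgn_smul_congr (V := detTop ((A₁.prod C).prod A₂))
      (w := rk A₁ * (rk A₂ - rk B₂) + rk C * rk A₂) ?_ _
    ring

lemma box_comp_left {B₁' : ProjMod R} [Module.Finite R B₁'] (ξ : detTop B₁' →ₗ[R] detTop A₁)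
    (ζ : detTop B₁ →ₗ[R] detTop B₁') (η : detTop B₂ →ₗ[R] detTop A₂) :
    box (ξ ∘ₗ ζ) η = box ξ η ∘ₗ rstab B₂ ζ := detTop_hom_ext fun b₁ b₂ => by
  rw [box_wedge, LinearMap.comp_apply, LinearMap.comp_apply, rstab_wedge, box_wedge]

lemma box_comp_right {B₂' : ProjMod R} [Module.Finite R B₂'] (ξ : detTop B₁ →ₗ[R] detTop A₁)
    (η : detTop B₂' →ₗ[R] detTop A₂) (ζ : detTop B₂ →ₗ[R] detTop B₂') (h : rk B₂ = rk B₂') :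
    box ξ (η ∘ₗ ζ) = box ξ η ∘ₗ lstab B₁ ζ := detTop_hom_ext fun b₁ b₂ => by
  rw [box_wedge, LinearMap.comp_apply, LinearMap.comp_apply, lstab_wedge, box_wedge, h]

lemma detMap_comp_box {A₁' A₂' : ProjMod R} [Module.Finite R A₁'] [Module.Finite R A₂']
    (ξ : detTop B₁ →ₗ[R] detTop A₁) (η : detTop B₂ →ₗ[R] detTop A₂) (α₁ : A₁ ≃ₗ[R] A₁')
    (α₂ : A₂ ≃ₗ[R] A₂') :
    box (detMap α₁ ∘ₗ ξ) (detMap α₂ ∘ₗ η) =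
      detMap (N := A₁.prod A₂) (M := A₁'.prod A₂') (α₁.prodCongr α₂) ∘ₗ box ξ η :=
  detTop_hom_ext fun b₁ b₂ => by
    rw [box_wedge, LinearMap.comp_apply, LinearMap.comp_apply, LinearMap.comp_apply, box_wedge,
      map_smul, detMap_prodCongr_wedge, rk_congr α₁, rk_congr α₂]

lemma box_assoc {A₃ B₃ : ProjMod R} [Module.Finite R A₃] [Module.Finite R B₃]
    (ξ : detTop B₁ →ₗ[R] detTop A₁) (η : detTop B₂ →ₗ[R] detTop A₂)
    (ζ : detTop B₃ →ₗ[R] detTop A₃) :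
    box ξ (box η ζ) ∘ₗ detMap (N := (B₁.prod B₂).prod B₃) (M := B₁.prod (B₂.prod B₃))
      (LinearEquiv.prodAssoc R B₁ B₂ B₃) =
    detMap (N := (A₁.prod A₂).prod A₃) (M := A₁.prod (A₂.prod A₃))
      (LinearEquiv.prodAssoc R A₁ A₂ A₃) ∘ₗ box (box ξ η) ζ := detTop_hom_ext fun z b₃ => by
  induction z using wedge_induction with
  | hadd x y hx hy => rw [wedge_add_left, map_add, map_add, hx, hy]
  | h b₁ b₂ =>
    rw [LinearMap.comp_apply, LinearMap.comp_apply, detMap_prodAssoc_wedge, box_wedge, box_wedge,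
      box_wedge, box_wedge, wedge_smul_left, map_smul, map_smul, detMap_prodAssoc_wedge,
      wedge_smul_right, rk_prod, rk_prod, rk_prod]
    refine sgn_smul_congr (V := detTop (A₁.prod (A₂.prod A₃)))
      (w := rk A₁ * (rk A₂ - rk B₂) + (rk A₁ + rk A₂) * (rk A₃ - rk B₃)) ?_ _
    ring

lemma box_assoc_rstab (C : ProjMod R) [Module.Finite R C] (ξ : detTop B₁ →ₗ[R] detTop A₁)
    (η : detTop B₂ →ₗ[R] detTop A₂) :
    box ξ (rstab C η) ∘ₗ detMap (N := (B₁.prod B₂).prod C) (M := B₁.prod (B₂.prod C))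
      (LinearEquiv.prodAssoc R B₁ B₂ C) =
    detMap (N := (A₁.prod A₂).prod C) (M := A₁.prod (A₂.prod C))
      (LinearEquiv.prodAssoc R A₁ A₂ C) ∘ₗ rstab C (box ξ η) := detTop_hom_ext fun z c => by
  induction z using wedge_induction with
  | hadd x y hx hy => rw [wedge_add_left, map_add, map_add, hx, hy]
  | h b₁ b₂ =>
    rw [LinearMap.comp_apply, LinearMap.comp_apply, detMap_prodAssoc_wedge, box_wedge, rstab_wedge,
      rstab_wedge, box_wedge, wedge_smul_left, map_smul, detMap_prodAssoc_wedge, rk_prod, rk_prod,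
      add_sub_add_right_eq_sub]

lemma box_comm (ξ : detTop B₁ →ₗ[R] detTop A₁) (η : detTop B₂ →ₗ[R] detTop A₂) :
    sgn ((rk A₁ - rk B₁) * (rk A₂ - rk B₂)) • (box η ξ ∘ₗ
      detMap (N := B₁.prod B₂) (M := B₂.prod B₁) (LinearEquiv.prodComm R B₁ B₂)) =
    detMap (N := A₁.prod A₂) (M := A₂.prod A₁) (LinearEquiv.prodComm R A₁ A₂) ∘ₗ box ξ η :=
  detTop_hom_ext fun b₁ b₂ => by
    rw [LinearMap.smul_apply, LinearMap.comp_apply, LinearMap.comp_apply, detMap_prodComm_wedge,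
      map_smul, box_wedge, box_wedge, map_smul, detMap_prodComm_wedge]
    rw [smul_smul (sgn (rk B₁ * rk B₂)), ← sgn_add]
    refine sgn_smul_congr (V := detTop (A₂.prod A₁))
      (w := 2 * (rk A₁ * rk A₂) - rk A₁ * rk B₂ - rk A₂ * rk B₁ + rk B₁ * rk B₂) ?_ _
    ring

lemma box_comp {C₁ C₂ : ProjMod R} [Module.Finite R C₁] [Module.Finite R C₂]
    (ξ₁ : detTop B₁ →ₗ[R] detTop A₁) (ξ₂ : detTop B₂ →ₗ[R] detTop A₂)
    (η₁ : detTop C₁ →ₗ[R] detTop B₁) (η₂ : detTop C₂ →ₗ[R] detTop B₂) :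
    box ξ₁ ξ₂ ∘ₗ box η₁ η₂ = sgn ((rk B₂ - rk C₂) * (rk A₁ - rk B₁)) •
      box (ξ₁ ∘ₗ η₁) (ξ₂ ∘ₗ η₂) := detTop_hom_ext fun c₁ c₂ => by
  rw [LinearMap.smul_apply, LinearMap.comp_apply, box_wedge, map_smul, box_wedge, box_wedge]
  refine sgn_smul_congr (V := detTop (A₁.prod A₂))
    (w := rk A₁ * (rk A₂ - rk C₂)) ?_ _
  ring

/-- The isomorphism of relative determinant lines for direct sums. -/
def detSum {N₁ M₁ N₂ M₂ : ProjMod R} (f₁ : AsympIso N₁ M₁) (f₂ : AsympIso N₂ M₂) :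
    ZLine.Iso ((detLine f₁).tensor (detLine f₂)) (detLine (f₁.prod f₂)) where
  toEquiv := (TensorProduct.congr (ev (resOf f₁).isRes) (ev (resOf f₂).isRes)).trans
    ((boxEquiv _ _ _ _).trans (ev ((resOf f₁).isRes.sumE (resOf f₂).isRes)).symm)
  deg_eq := by
    rw [deg_detLine ((resOf f₁).isRes.sumE (resOf f₂).isRes)]
    change (detLine f₁).deg + (detLine f₂).deg = _
    rw [deg_detLine (resOf f₁).isRes, deg_detLine (resOf f₂).isRes, rk_prod, rk_prod]
    abel

end Sum

/-! ### Direct sums of relative determinants -/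

section Cancel

variable {R : Type u} [CommRing R]

lemma detMap_right_cancel {A B : ProjMod R} [Module.Finite R A] [Module.Finite R B]
    {V : Type*} [AddCommGroup V] [Module R V] (e : A ≃ₗ[R] B) {ξ η : detTop B →ₗ[R] V}
    (h : ξ ∘ₗ detMap e = η ∘ₗ detMap e) : ξ = η :=
  (LinearMap.cancel_right (detCongr e).surjective).1 h

lemma detMap_left_cancel {A B : ProjMod R} [Module.Finite R A] [Module.Finite R B]
    {V : Type*} [AddCommGroup V] [Module R V] (e : A ≃ₗ[R] B) {ξ η : V →ₗ[R] detTop A}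
    (h : detMap e ∘ₗ ξ = detMap e ∘ₗ η) : ξ = η :=
  (LinearMap.cancel_left (detCongr e).injective).1 h

lemma fdet_right_cancel {M P Q : ProjMod R} [Module.Finite R P] [Module.Finite R Q]
    {w : (M.prod P) ≃ₗ[R] (M.prod Q)} (hw : IsFred w) {V : Type*} [AddCommGroup V] [Module R V]
    {ξ η : detTop Q →ₗ[R] V} (h : ξ ∘ₗ fdet w = η ∘ₗ fdet w) : ξ = η :=
  LinearMap.ext fun x => by
    obtain ⟨x, rfl⟩ := (fdetEquiv hw).surjective x
    exact DFunLike.congr_fun h x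

end Cancel

section EvSum

variable {R : Type u} [CommRing R]

lemma ev_perm_left {N M A A' B : ProjMod R} [Module.Finite R A] [Module.Finite R A']
    [Module.Finite R B] {f : AsympIso N M} {e : (N.prod A) ≃ₗ[R] (M.prod B)}
    {e' : (N.prod A') ≃ₗ[R] (M.prod B)} (h : IsRes f e) (h' : IsRes f e') (α : A ≃ₗ[R] A')
    (he : ∀ n a, e' (n, α a) = e (n, a)) (x : detLine f) : ev h' x = detMap α ∘ₗ ev h x := by
  rw [← ev_perm h h' α (LinearEquiv.refl R B) he, detMap_refl, LinearMap.comp_id]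

variable {N₁ M₁ N₂ M₂ : ProjMod R} {f₁ : AsympIso N₁ M₁}
  {f₂ : AsympIso N₂ M₂} {s : detLine (f₁.prod f₂)} {x : detLine f₁} {y : detLine f₂}

/-- If an element of the line of a direct sum is the external product of `x` and `y` in one
resolution of `f₁`, it is so in all of them. -/
lemma ev_sum_left {A₁ B₁ A₁' B₁' A₂ B₂ : ProjMod R} [Module.Finite R A₁] [Module.Finite R B₁]
    [Module.Finite R A₁'] [Module.Finite R B₁'] [Module.Finite R A₂] [Module.Finite R B₂]
    {e₁ : (N₁.prod A₁) ≃ₗ[R] (M₁.prod B₁)} {e₁' : (N₁.prod A₁') ≃ₗ[R] (M₁.prod B₁')}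
    {e₂ : (N₂.prod A₂) ≃ₗ[R] (M₂.prod B₂)} (h₁ : IsRes f₁ e₁) (h₁' : IsRes f₁ e₁')
    (h₂ : IsRes f₂ e₂) (hs : ev (h₁.sumE h₂) s = box (ev h₁ x) (ev h₂ y)) :
    ev (h₁'.sumE h₂) s = box (ev h₁' x) (ev h₂ y) := by
  refine res_connect (f := f₁)
    (fun {A B} _ _ e => ∀ h : IsRes f₁ e, ev (h.sumE h₂) s = box (ev h x) (ev h₂ y))
    ?_ ?_ ?_ h₁ h₁' (fun _ => hs) h₁'
  · intro A B C _ _ _ e h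
    have h1 := ev_perm ((h.sumE h₂).stab C) ((h.stab C).sumE h₂) (rightComm A A₂ C)
      (rightComm B B₂ C) (fun n a => rfl) s
    rw [ev_stab C (h.sumE h₂) _ (fun _ _ _ => rfl) s] at h1
    have h2 := ev_stab C h (h.stab C) (fun _ _ _ => rfl) x
    refine ⟨fun H _ => ?_, fun H _ => ?_⟩
    · refine detMap_right_cancel (rightComm B B₂ C) ?_
      rw [h1, h2, box_rstab_rightComm, H h]
    · apply (rstab C).injective
      refine detMap_left_cancel (rightComm A A₂ C) ?_
      rw [← h1, H (h.stab C), h2, box_rstab_rightComm]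
  · intro A B B' _ _ _ e e' w h h' hw he H _
    obtain ⟨k, hk⟩ := fred_sum_left (M₂ := M₂) B₂ hw
    have h1 := ev_fred (h.sumE h₂) (h'.sumE h₂) k (fun z => by
      obtain ⟨⟨n₁, n₂⟩, a₁, a₂⟩ := z
      change (((e' (n₁, a₁)).1, (e₂ (n₂, a₂)).1), ((e' (n₁, a₁)).2, (e₂ (n₂, a₂)).2)) = _
      rw [he]
      rfl) s
    refine fdet_right_cancel k ?_
    rw [← h1, H h, hk, ← box_comp_left, ← ev_fred h h' hw he]
  · intro A A' B _ _ _ e e' α h h' he H _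
    have h1 := ev_perm_left (h.sumE h₂) (h'.sumE h₂) (α.prodCongr (LinearEquiv.refl R A₂))
      (fun n a => by
        change (((e' (n.1, α a.1)).1, (e₂ (n.2, a.2)).1), ((e' (n.1, α a.1)).2, _)) = _
        rw [he]; rfl) s
    have h2 := detMap_comp_box (ev h x) (ev h₂ y) α (LinearEquiv.refl R A₂)
    rw [detMap_refl, LinearMap.id_comp] at h2
    rw [h1, H h, ← h2, ← ev_perm_left h h' α he]

/-- If an element of the line of a direct sum is the external product of `x` and `y` in one
resolution of `f₂`, it is so in all of them. -/
lemma ev_sum_right {A₁ B₁ A₂ B₂ A₂' B₂' : ProjMod R} [Module.Finite R A₁] [Module.Finite R B₁]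
    [Module.Finite R A₂'] [Module.Finite R B₂'] [Module.Finite R A₂] [Module.Finite R B₂]
    {e₁ : (N₁.prod A₁) ≃ₗ[R] (M₁.prod B₁)} {e₂ : (N₂.prod A₂) ≃ₗ[R] (M₂.prod B₂)}
    {e₂' : (N₂.prod A₂') ≃ₗ[R] (M₂.prod B₂')} (h₁ : IsRes f₁ e₁) (h₂ : IsRes f₂ e₂)
    (h₂' : IsRes f₂ e₂') (hs : ev (h₁.sumE h₂) s = box (ev h₁ x) (ev h₂ y)) :
    ev (h₁.sumE h₂') s = box (ev h₁ x) (ev h₂' y) := by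
  refine res_connect (f := f₂)
    (fun {A B} _ _ e => ∀ h : IsRes f₂ e, ev (h₁.sumE h) s = box (ev h₁ x) (ev h y))
    ?_ ?_ ?_ h₂ h₂' (fun _ => hs) h₂'
  · intro A B C _ _ _ e h
    have h1 := ev_perm (A := (A₁.prod A).prod C) (B := (B₁.prod B).prod C)
      (A' := A₁.prod (A.prod C)) (B' := B₁.prod (B.prod C)) ((h₁.sumE h).stab C)
      (h₁.sumE (h.stab C)) (LinearEquiv.prodAssoc R A₁ A C)
      (LinearEquiv.prodAssoc R B₁ B C) (fun n a => rfl) s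
    rw [ev_stab C (h₁.sumE h) _ (fun _ _ _ => rfl) s] at h1
    have h2 := ev_stab C h (h.stab C) (fun _ _ _ => rfl) y
    refine ⟨fun H _ => ?_, fun H _ => ?_⟩
    · refine detMap_right_cancel (A := (B₁.prod B).prod C) (B := B₁.prod (B.prod C))
        (LinearEquiv.prodAssoc R B₁ B C) ?_
      rw [h1, h2, box_assoc_rstab, H h]
    · apply (rstab C).injective
      refine detMap_left_cancel (A := (A₁.prod A).prod C) (B := A₁.prod (A.prod C))
        (LinearEquiv.prodAssoc R A₁ A C) ?_
      rw [← h1, H (h.stab C), h2, box_assoc_rstab]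
  · intro A B B' _ _ _ e e' w h h' hw he H _
    obtain ⟨k, hk⟩ := fred_sum_right (M₁ := M₁) B₁ hw
    have h1 := ev_fred (h₁.sumE h) (h₁.sumE h') k (fun z => by
      obtain ⟨⟨n₁, n₂⟩, a₁, a₂⟩ := z
      change (((e₁ (n₁, a₁)).1, (e' (n₂, a₂)).1), ((e₁ (n₁, a₁)).2, (e' (n₂, a₂)).2)) = _
      rw [he]
      rfl) s
    refine fdet_right_cancel k ?_
    rw [← h1, H h, hk, ← box_comp_right _ _ _ (rk_eq_of_isFred hw), ← ev_fred h h' hw he]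
  · intro A A' B _ _ _ e e' α h h' he H _
    have h1 := ev_perm_left (h₁.sumE h) (h₁.sumE h') ((LinearEquiv.refl R A₁).prodCongr α)
      (fun n a => by
        change ((_, (e' (n.2, α a.2)).1), (_, (e' (n.2, α a.2)).2)) = _
        rw [he]; rfl) s
    have h2 := detMap_comp_box (ev h₁ x) (ev h y) (LinearEquiv.refl R A₁) α
    rw [detMap_refl, LinearMap.id_comp] at h2
    rw [h1, H h, ← h2, ← ev_perm_left h h' α he]

set_option maxRecDepth 4000 in
lemma detSum_tmul (x : detLine f₁) (y : detLine f₂) :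
    ev ((resOf f₁).isRes.sumE (resOf f₂).isRes) (detSum f₁ f₂ (x ⊗ₜ y)) =
      box (ev (resOf f₁).isRes x) (ev (resOf f₂).isRes y) :=
  (ev ((resOf f₁).isRes.sumE (resOf f₂).isRes)).apply_symm_apply
    (box (ev (resOf f₁).isRes x) (ev (resOf f₂).isRes y))

/-- The sum can be computed on any two resolutions. -/
lemma ev_detSum {A₁ B₁ A₂ B₂ : ProjMod R} [Module.Finite R A₁] [Module.Finite R B₁]
    [Module.Finite R A₂] [Module.Finite R B₂] {e₁ : (N₁.prod A₁) ≃ₗ[R] (M₁.prod B₁)}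
    {e₂ : (N₂.prod A₂) ≃ₗ[R] (M₂.prod B₂)} (h₁ : IsRes f₁ e₁) (h₂ : IsRes f₂ e₂)
    (x : detLine f₁) (y : detLine f₂) :
    ev (h₁.sumE h₂) (detSum f₁ f₂ (x ⊗ₜ y)) = box (ev h₁ x) (ev h₂ y) :=
  ev_sum_left (resOf f₁).isRes h₁ h₂
    (ev_sum_right (resOf f₁).isRes (resOf f₂).isRes h₂ (detSum_tmul x y))

end EvSum

/-! ### Comparison in finite rank -/

section MiddleFour

variable {R : Type u} [CommRing R]

lemma detMap_prodProdProdComm_wedge {A B C D : ProjMod R} [Module.Finite R A] [Module.Finite R B]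
    [Module.Finite R C] [Module.Finite R D] (a : detTop A) (b : detTop B) (c : detTop C)
    (d : detTop D) :
    detMap (N := (A.prod B).prod (C.prod D)) (M := (A.prod C).prod (B.prod D))
      (LinearEquiv.prodProdProdComm R A B C D) (wedge (wedge a b) (wedge c d)) =
      sgn (rk B * rk C) • wedge (wedge a c) (wedge b d) := by
  rw [detMap_comp_of_eq (A := (A.prod B).prod (C.prod D)) (B := ((A.prod B).prod C).prod D)
    (C := (A.prod C).prod (B.prod D)) (e := (LinearEquiv.prodAssoc R (A × B) C D).symm)
    (e' := ((rightComm A B C).prodCongr (LinearEquiv.refl R D)).trans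
      (LinearEquiv.prodAssoc R (A × C) B D))
    (e'' := LinearEquiv.prodProdProdComm R A B C D) (fun _ => rfl),
    detMap_prodAssoc_symm_wedge (A := A.prod B), detMap_trans_apply (A := ((A.prod B).prod C).prod D)
    (B := ((A.prod C).prod B).prod D) (C := (A.prod C).prod (B.prod D)),
    detMap_prodCongr_wedge (A := (A.prod B).prod C) (A' := (A.prod C).prod B), detMap_rightComm_wedge,
    detMap_refl, LinearMap.id_apply, wedge_smul_left, map_smul,
    detMap_prodAssoc_wedge (A := A.prod C)]

end MiddleFour

section Fin

variable {R : Type u} [CommRing R]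

/-- The function `n ↦ n (n - 1) / 2`. It is a quadratic refinement of the product, which makes signs
given by it compatible with sums. -/
def tri (v : LocallyConstant (PrimeSpectrum R) ℤ) : LocallyConstant (PrimeSpectrum R) ℤ :=
  v.map fun n => n * (n - 1) / 2

lemma tri_add (u v : LocallyConstant (PrimeSpectrum R) ℤ) :
    tri (u + v) = tri u + tri v + u * v := by
  have h : ∀ n : ℤ, 2 * (n * (n - 1) / 2) = n * (n - 1) := fun n =>
    Int.mul_ediv_cancel' (Int.even_mul_pred_self n).two_dvd
  ext p
  change (u p + v p) * (u p + v p - 1) / 2 = u p * (u p - 1) / 2 + v p * (v p - 1) / 2 + u p * v p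
  have h1 := h (u p + v p)
  have h2 := h (u p)
  have h3 := h (v p)
  have h4 : (u p + v p) * (u p + v p - 1) = u p * (u p - 1) + v p * (v p - 1) + 2 * (u p * v p) := by
    ring
  omega

/-- The sign in the comparison of `det M / det N` with the determinant line computed from a
resolution `N × A ≃ M × B`. It offsets the signs that arise, for direct sums, from moving the
determinants of `A` and `B` past those of `N` and `M`. -/
def finSgn (N M : ProjMod R) [Module.Finite R N] [Module.Finite R M] :
    LocallyConstant (PrimeSpectrum R) ℤ := tri (rk M) - tri (rk N)

/-- For `N` and `M` of finite rank and `e : N × A ≃ M × B`, the identification of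
`Hom (det B, det A)` with `Hom (det N, det M)`. -/
def finHomEquiv {N M A B : ProjMod R} [Module.Finite R N] [Module.Finite R M] [Module.Finite R A]
    [Module.Finite R B] (e : (N.prod A) ≃ₗ[R] (M.prod B)) :
    (detTop B →ₗ[R] detTop A) ≃ₗ[R] (detTop N →ₗ[R] detTop M) :=
  ((lstabEquiv (A := A) (B := B) N).trans (LinearEquiv.arrowCongr
    (LinearEquiv.refl R (detTop (N.prod B))) (detCongr (A := N.prod A) (B := M.prod B) e))).trans
    ((sgnEquiv (detTop (N.prod B) →ₗ[R] detTop (M.prod B)) (finSgn N M)).trans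
      (rstab (A := M) (B := N) B).symm)

lemma finHomEquiv_eq_iff {N M A B : ProjMod R} [Module.Finite R N] [Module.Finite R M]
    [Module.Finite R A] [Module.Finite R B] (e : (N.prod A) ≃ₗ[R] (M.prod B))
    (ξ : detTop B →ₗ[R] detTop A) (X : detTop N →ₗ[R] detTop M) :
    finHomEquiv e ξ = X ↔ ∀ n b, detMap (N := N.prod A) (M := M.prod B) e (wedge n (ξ b)) =
      sgn (finSgn N M) • wedge (X n) b := by
  have h1 : finHomEquiv e ξ = X ↔ sgn (finSgn N M) •
      (detMap (N := N.prod A) (M := M.prod B) e ∘ₗ lstab N ξ) = rstab B X :=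
    LinearEquiv.symm_apply_eq (rstab (A := M) (B := N) B)
  rw [h1]
  refine ⟨fun H n b => ?_, fun H => detTop_hom_ext fun n b => ?_⟩
  · have h2 := DFunLike.congr_fun H (wedge n b)
    rw [rstab_wedge, LinearMap.smul_apply, LinearMap.comp_apply, lstab_wedge] at h2
    rw [← h2, detTop_sgn_smul_smul]
  · rw [rstab_wedge, LinearMap.smul_apply, LinearMap.comp_apply, lstab_wedge, H,
      detTop_sgn_smul_smul]

/-- The comparison of the relative determinant line with `Hom (det N, det M)`, for modules of finite
rank. -/
def finHom {N M : ProjMod R} [Module.Finite R N] [Module.Finite R M] (f : AsympIso N M) :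
    detLine f ≃ₗ[R] (detTop N →ₗ[R] detTop M) :=
  (ev (resOf f).isRes).trans (finHomEquiv (resOf f).e)

/-- In any resolution, the comparison in finite rank is given by the determinant of the resolution
as an isomorphism of modules of finite rank. -/
lemma finHom_spec {N M A B : ProjMod R} [Module.Finite R N] [Module.Finite R M] [Module.Finite R A]
    [Module.Finite R B] {f : AsympIso N M} {e : (N.prod A) ≃ₗ[R] (M.prod B)} (h : IsRes f e)
    (x : detLine f) (n : detTop N) (b : detTop B) :
    detMap (N := N.prod A) (M := M.prod B) e (wedge n (ev h x b)) =
      sgn (finSgn N M) • wedge (finHom f x n) b := by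
  have h₀ := (finHomEquiv_eq_iff (resOf f).e (ev (resOf f).isRes x) (finHom f x)).1 rfl
  generalize finHom f x = X at h₀ ⊢
  revert n b
  refine res_connect (f := f)
    (fun {A B} _ _ e => ∀ h : IsRes f e, ∀ (n : detTop N) (b : detTop B),
      detMap (N := N.prod A) (M := M.prod B) e (wedge n (ev h x b)) =
        sgn (finSgn N M) • wedge (X n) b)
    ?_ ?_ ?_ (resOf f).isRes h (fun _ => h₀) h
  · intro A B C _ _ _ e h
    have h1 := ev_stab C h (h.stab C) (fun _ _ _ => rfl) x
    have h2 : ∀ (n : detTop N) (b : detTop B) (c : detTop C),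
        detMap (N := N.prod (A.prod C)) (M := M.prod (B.prod C)) (stab e C)
          (wedge n (ev (h.stab C) x (wedge b c))) = detMap (N := (M.prod B).prod C)
            (M := M.prod (B.prod C)) (LinearEquiv.prodAssoc R M B C)
            (wedge (detMap (N := N.prod A) (M := M.prod B) e (wedge n (ev h x b))) c) :=
      fun n b c => by
        rw [h1, rstab_wedge, ← detMap_prodAssoc_wedge]
        have h3 := detMap_comp_eq_comp (A := (N.prod A).prod C) (B := (M.prod B).prod C)
          (B' := N.prod (A.prod C)) (C := M.prod (B.prod C))
          (e₁ := e.prodCongr (LinearEquiv.refl R C)) (e₂ := LinearEquiv.prodAssoc R M B C)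
          (e₃ := LinearEquiv.prodAssoc R N A C) (e₄ := stab e C) (fun _ => rfl)
          (wedge (wedge n (ev h x b)) c)
        rw [← h3, detMap_prodCongr_wedge (A := N.prod A) (A' := M.prod B), detMap_refl,
          LinearMap.id_apply]
    refine ⟨fun H _ n z => ?_, fun H _ n b => ?_⟩
    · induction z using wedge_induction with
      | hadd y z hy hz => rw [map_add, wedge_add_right, map_add, hy, hz, wedge_add_right, smul_add]
      | h b c => rw [h2, H h, wedge_smul_left, map_smul, detMap_prodAssoc_wedge]
    · refine wedge_right_cancel (B := C) fun c => ?_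
      refine (detCongr (A := (M.prod B).prod C) (B := M.prod (B.prod C))
        (LinearEquiv.prodAssoc R M B C)).injective ?_
      refine (h2 n b c).symm.trans ?_
      rw [H (h.stab C)]
      change _ = detMap (N := (M.prod B).prod C) (M := M.prod (B.prod C))
        (LinearEquiv.prodAssoc R M B C) _
      rw [wedge_smul_left, map_smul, detMap_prodAssoc_wedge]
  · intro A B B' _ _ _ e e' w h h' hw he H _ n b
    obtain ⟨b, rfl⟩ := (fdetEquiv hw).surjective b
    have h1 := DFunLike.congr_fun (ev_fred h h' hw he x) b
    have h2 := H h n b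
    rw [h1] at h2
    rw [detMap_comp_of_eq (A := N.prod A) (B := M.prod B) (C := M.prod B') he]
    rw [fdetEquiv_apply]
    refine (congrArg (detMap (N := M.prod B) (M := M.prod B') w) h2).trans ?_
    rw [map_smul, (hasRelDet_fdet w : HasRelDet w (fdet w)) (X n) b]
  · intro A A' B _ _ _ e e' α h h' he H _ n b
    have h1 := DFunLike.congr_fun (ev_perm_left h h' α he x) b
    rw [h1, ← H h, detMap_comp_of_eq (A := N.prod A) (B := N.prod A') (C := M.prod B)
      (e := (LinearEquiv.refl R N).prodCongr α) (e' := e') (e'' := e) (fun x => (he x.1 x.2).symm),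
      detMap_prodCongr_wedge, detMap_refl, LinearMap.id_apply, LinearMap.comp_apply]

lemma finHom_eq {N M A B : ProjMod R} [Module.Finite R N] [Module.Finite R M] [Module.Finite R A]
    [Module.Finite R B] {f : AsympIso N M} {e : (N.prod A) ≃ₗ[R] (M.prod B)} (h : IsRes f e)
    (x : detLine f) (X : detTop N →ₗ[R] detTop M)
    (hX : ∀ n b, detMap (N := N.prod A) (M := M.prod B) e (wedge n (ev h x b)) =
      sgn (finSgn N M) • wedge (X n) b) : finHom f x = X :=
  ((finHomEquiv_eq_iff e (ev h x) (finHom f x)).2 (finHom_spec h x)).symm.trans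
    ((finHomEquiv_eq_iff e (ev h x) X).2 hX)

lemma finHom_detComp {N M L : ProjMod R} [Module.Finite R N] [Module.Finite R M]
    [Module.Finite R L] (g : AsympIso M L) (f : AsympIso N M) (y : detLine g) (x : detLine f) :
    finHom (g.comp f) (detComp rfl (y ⊗ₜ x)) = finHom g y ∘ₗ finHom f x := by
  obtain ⟨c⟩ := (inferInstance : Nonempty (Chain g f))
  refine finHom_eq (c.isRes rfl) _ _ fun n b => ?_
  rw [ev_detComp rfl c.isRes₁ c.isRes₂ (c.isRes rfl) (fun _ => rfl), LinearMap.comp_apply,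
    detMap_trans_apply (A := N.prod c.C₀) (B := M.prod c.C₁) (C := L.prod c.C₂), finHom_spec,
    map_smul, finHom_spec, smul_smul, ← sgn_add]
  congr 2
  rw [finSgn, finSgn, finSgn]
  abel

lemma finHom_detTriv {N M : ProjMod R} [Module.Finite R N] [Module.Finite R M] (e : N ≃ₗ[R] M) :
    finHom (AsympIso.ofEquiv e) (detTriv e rfl 1) = detMap e := by
  have h : IsRes (A := ProjMod.zero R) (B := ProjMod.zero R) (AsympIso.ofEquiv e)
      (e.prodCongr (LinearEquiv.refl R (ProjMod.zero R))) := isRes_ofEquiv e fun _ => rfl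
  refine finHom_eq h _ _ fun n b => ?_
  rw [ev_detTriv e rfl h (LinearEquiv.refl R (ProjMod.zero R)) fun _ => rfl,
    detMap_prodCongr_wedge (B := ProjMod.zero R) (B' := ProjMod.zero R), finSgn, rk_congr e, sub_self,
    sgn_zero, one_smul, LinearEquiv.refl_symm, detMap_refl, LinearMap.id_apply, LinearMap.id_apply]

lemma finHom_detSum_wedge {N₁ M₁ N₂ M₂ : ProjMod R} [Module.Finite R N₁] [Module.Finite R M₁]
    [Module.Finite R N₂] [Module.Finite R M₂] (f₁ : AsympIso N₁ M₁) (f₂ : AsympIso N₂ M₂)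
    (x : detLine f₁) (y : detLine f₂) (n₁ : detTop N₁) (n₂ : detTop N₂) :
    finHom (f₁.prod f₂) (detSum f₁ f₂ (x ⊗ₜ y)) (wedge n₁ n₂) =
      sgn ((rk M₂ - rk N₂) * rk N₁) • wedge (finHom f₁ x n₁) (finHom f₂ y n₂) := by
  obtain ⟨A₁, B₁, _, _, e₁, h₁⟩ := exists_isRes f₁
  obtain ⟨A₂, B₂, _, _, e₂, h₂⟩ := exists_isRes f₂
  have hr₁ : rk N₁ + rk A₁ = rk M₁ + rk B₁ := by
    rw [← rk_prod, ← rk_prod, rk_congr (A := N₁.prod A₁) (B := M₁.prod B₁) e₁]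
  have hr₂ : rk N₂ + rk A₂ = rk M₂ + rk B₂ := by
    rw [← rk_prod, ← rk_prod, rk_congr (A := N₂.prod A₂) (B := M₂.prod B₂) e₂]
  refine wedge_right_cancel (B := B₁.prod B₂) fun b => ?_
  have h := finHom_spec (h₁.sumE h₂) (detSum f₁ f₂ (x ⊗ₜ y)) (wedge n₁ n₂) b
  rw [ev_detSum h₁ h₂] at h
  rw [← detTop_sgn_smul_smul (finSgn (N₁.prod N₂) (M₁.prod M₂)) (wedge _ b), ← h]
  clear h
  induction b using wedge_induction with
  | hadd b b' hb hb' =>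
    rw [map_add, wedge_add_right, map_add, smul_add, hb, hb', wedge_add_right]
  | h b₁ b₂ =>
    rw [box_wedge, wedge_smul_right, map_smul,
      detMap_comp_of_eq (A := (N₁.prod N₂).prod (A₁.prod A₂)) (B := (N₁.prod A₁).prod (N₂.prod A₂))
        (C := (M₁.prod M₂).prod (B₁.prod B₂)) (e := LinearEquiv.prodProdProdComm R N₁ N₂ A₁ A₂)
        (e' := (e₁.prodCongr e₂).trans (LinearEquiv.prodProdProdComm R M₁ B₁ M₂ B₂))
        (e'' := sumE e₁ e₂) (fun _ => rfl), detMap_prodProdProdComm_wedge, map_smul,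
      detMap_trans_apply (A := (N₁.prod A₁).prod (N₂.prod A₂))
        (B := (M₁.prod B₁).prod (M₂.prod B₂)) (C := (M₁.prod M₂).prod (B₁.prod B₂)),
      detMap_prodCongr_wedge (A := N₁.prod A₁) (A' := M₁.prod B₁) (B := N₂.prod A₂)
        (B' := M₂.prod B₂), finHom_spec, finHom_spec, wedge_smul_left, wedge_smul_right, map_smul,
      map_smul, detMap_prodProdProdComm_wedge, wedge_smul_left]
    simp only [smul_smul, ← sgn_add]
    congr 1
    -- the two exponents have the same parity: their sum is twice `w`
    have hA₁ : rk A₁ = rk M₁ + rk B₁ - rk N₁ := eq_sub_of_add_eq' hr₁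
    have hA₂ : rk A₂ = rk M₂ + rk B₂ - rk N₂ := eq_sub_of_add_eq' hr₂
    rw [hA₁, hA₂, finSgn, finSgn, finSgn, rk_prod, rk_prod, tri_add, tri_add]
    refine sgn_eq_sgn (w := tri (rk M₁) + tri (rk M₂) - tri (rk N₁) - tri (rk N₂) + rk M₁ * rk M₂ -
      rk N₁ * rk N₂ + rk B₁ * rk M₂) ?_
    ring

lemma rk_sub_rk_of_isRes {N M A B : ProjMod R} [Module.Finite R N] [Module.Finite R M]
    [Module.Finite R A] [Module.Finite R B] (e : (N.prod A) ≃ₗ[R] (M.prod B)) :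
    rk A - rk B = rk M - rk N := by
  have h := rk_congr (A := N.prod A) (B := M.prod B) e
  rw [rk_prod, rk_prod] at h
  rw [sub_eq_sub_iff_add_eq_add, add_comm, h]

end Fin

/-! ### Base change of relative determinants -/

section BaseChange

variable {R : Type u} [CommRing R] (R' : Type u) [CommRing R'] [Algebra R R']

lemma bcHom_comp {A B C : ProjMod R} [Module.Finite R A] [Module.Finite R B] [Module.Finite R C]
    (ξ : detTop B →ₗ[R] detTop A) (η : detTop C →ₗ[R] detTop B) :
    bcHom R' (ξ ∘ₗ η) = bcHom R' ξ ∘ₗ bcHom R' η :=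
  bcDet_hom_ext R' fun c => by
    rw [bcHom_bcDet, LinearMap.comp_apply, LinearMap.comp_apply, bcHom_bcDet, bcHom_bcDet]

lemma bcHom_id (A : ProjMod R) [Module.Finite R A] :
    bcHom R' (LinearMap.id : detTop A →ₗ[R] detTop A) = LinearMap.id :=
  bcDet_hom_ext R' fun c => by
    rw [bcHom_bcDet, LinearMap.id_apply, LinearMap.id_apply]

lemma bcHom_detMap {A B : ProjMod R} [Module.Finite R A] [Module.Finite R B] (e : A ≃ₗ[R] B) :
    bcHom R' (detMap e) = detMap (N := A.baseChange R') (M := B.baseChange R')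
      (e.baseChange R R' A B) :=
  bcDet_hom_ext R' fun c => by rw [bcHom_bcDet, bcDet_detMap]

lemma bcHom_rstab {A B : ProjMod R} [Module.Finite R A] [Module.Finite R B] (C : ProjMod R)
    [Module.Finite R C] (ξ : detTop B →ₗ[R] detTop A) :
    rstab (C.baseChange R') (bcHom R' ξ) ∘ₗ detMap (N := (B.prod C).baseChange R')
        (M := (B.baseChange R').prod (C.baseChange R')) (TensorProduct.prodRight R R' R' B C) =
      detMap (N := (A.prod C).baseChange R') (M := (A.baseChange R').prod (C.baseChange R'))
        (TensorProduct.prodRight R R' R' A C) ∘ₗ bcHom R' (rstab C ξ) :=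
  bcDet_hom_ext R' fun z => by
    rw [LinearMap.comp_apply, LinearMap.comp_apply, bcHom_bcDet]
    induction z using wedge_induction with
    | hadd x y hx hy => simp only [map_add, hx, hy]
    | h b c => rw [bcDet_wedge, rstab_wedge, rstab_wedge, bcDet_wedge, bcHom_bcDet]

lemma bcDet_sgn_smul {A : ProjMod R} [Module.Finite R A]
    (v : LocallyConstant (PrimeSpectrum R) ℤ) (a : detTop A) :
    bcDet R' A (sgn v • a) = sgn (pullback R' v) • bcDet R' A a := by
  rw [map_smul, ← algebraMap_sgn, algebraMap_smul]

lemma bcHom_box {A₁ B₁ A₂ B₂ : ProjMod R} [Module.Finite R A₁] [Module.Finite R B₁]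
    [Module.Finite R A₂] [Module.Finite R B₂] (ξ : detTop B₁ →ₗ[R] detTop A₁)
    (η : detTop B₂ →ₗ[R] detTop A₂) :
    box (bcHom R' ξ) (bcHom R' η) ∘ₗ detMap (N := (B₁.prod B₂).baseChange R')
        (M := (B₁.baseChange R').prod (B₂.baseChange R')) (TensorProduct.prodRight R R' R' B₁ B₂) =
      detMap (N := (A₁.prod A₂).baseChange R') (M := (A₁.baseChange R').prod (A₂.baseChange R'))
        (TensorProduct.prodRight R R' R' A₁ A₂) ∘ₗ bcHom R' (box ξ η) :=
  bcDet_hom_ext R' fun z => by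
    rw [LinearMap.comp_apply, LinearMap.comp_apply, bcHom_bcDet]
    induction z using wedge_induction with
    | hadd x y hx hy => simp only [map_add, hx, hy]
    | h b c =>
      rw [bcDet_wedge, box_wedge, box_wedge, bcDet_sgn_smul, map_smul, bcDet_wedge, bcHom_bcDet,
        bcHom_bcDet, rk_baseChange, rk_baseChange, rk_baseChange]
      rfl

lemma IsRes.baseChange {N M A B : ProjMod R} {f : AsympIso N M}
    {e : (N.prod A) ≃ₗ[R] (M.prod B)} (h : IsRes f e) : IsRes (f.baseChange R') (bcIso R' e) := by
  change _ = f.hom.baseChange R'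
  rw [← h]
  refine congrArg AsymHom.mk (TensorProduct.AlgebraTensorModule.ext fun r n => ?_)
  have h1 : (r ⊗ₜ[R] n, (0 : R' ⊗[R] A)) = r • ((1 : R') ⊗ₜ[R] n, (1 : R') ⊗ₜ[R] (0 : A)) := by
    rw [TensorProduct.tmul_zero, Prod.smul_mk, smul_zero, TensorProduct.smul_tmul', smul_eq_mul,
      mul_one]
  change (bcIso R' e (r ⊗ₜ[R] n, (0 : R' ⊗[R] A))).1 = r ⊗ₜ[R] (e (n, 0)).1
  rw [h1, map_smul]
  change r • (bcIso R' e ((1 : R') ⊗ₜ[R] n, (1 : R') ⊗ₜ[R] (0 : A))).1 = _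
  rw [bcIso_tmul, TensorProduct.smul_tmul', smul_eq_mul, mul_one]

/-- The base change isomorphism of relative determinant lines. -/
def detBC {N M : ProjMod R} (f : AsympIso N M) :
    ZLine.Iso ((detLine f).baseChange R') (detLine (f.baseChange R')) where
  toEquiv := ((ev (resOf f).isRes).baseChange R R' _ _).trans
    ((bcHomEquiv R' (resOf f).A (resOf f).B).trans (ev ((resOf f).isRes.baseChange R')).symm)
  deg_eq := by
    rw [deg_detLine ((resOf f).isRes.baseChange R')]
    change pullback R' (detLine f).deg = _
    rw [deg_detLine (resOf f).isRes, rk_baseChange, rk_baseChange]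
    rfl

set_option maxRecDepth 4000 in
lemma ev_detBC_resOf {N M : ProjMod R} (f : AsympIso N M) (x : detLine f) :
    ev ((resOf f).isRes.baseChange R') (detBC R' f (1 ⊗ₜ x)) = bcHom R' (ev (resOf f).isRes x) :=
  ((ev ((resOf f).isRes.baseChange R')).apply_symm_apply
    (bcHomEquiv R' (resOf f).A (resOf f).B (1 ⊗ₜ (ev (resOf f).isRes x)))).trans
      (bcHomEquiv_tmul R' _)

/-- Maps out of `R' ⊗ N × R' ⊗ (A × C)` agree if they do so on the obvious generators. -/
lemma baseChange_prod_prod_hom_ext {N A C : ProjMod R} {V : Type*} [AddCommGroup V] [Module R' V]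
    {f g : ((N.baseChange R').prod ((A.prod C).baseChange R')) →ₗ[R'] V}
    (h : ∀ (n : N) (a : A) (c : C), f ((1 : R') ⊗ₜ[R] n, (1 : R') ⊗ₜ[R] (a, c)) =
      g ((1 : R') ⊗ₜ[R] n, (1 : R') ⊗ₜ[R] (a, c))) : f = g :=
  baseChange_prod_hom_ext (M := N) (P := A.prod C) R' fun n a => h n a.1 a.2

/-- The base change can be computed on any resolution. -/
lemma ev_detBC {N M A B : ProjMod R} [Module.Finite R A] [Module.Finite R B] {f : AsympIso N M}
    {e : (N.prod A) ≃ₗ[R] (M.prod B)} (h : IsRes f e) (x : detLine f) :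
    ev (h.baseChange R') (detBC R' f (1 ⊗ₜ x)) = bcHom R' (ev h x) := by
  have h₀ := ev_detBC_resOf R' f x
  generalize detBC R' f (1 ⊗ₜ x) = z at h₀ ⊢
  refine res_connect (f := f)
    (fun {A B} _ _ e => ∀ h : IsRes f e, ev (h.baseChange R') z = bcHom R' (ev h x))
    ?_ ?_ ?_ (resOf f).isRes h (fun _ => h₀) h
  · intro A B C _ _ _ e h
    have h1 := ev_perm (A := (A.prod C).baseChange R')
      (A' := (A.baseChange R').prod (C.baseChange R')) (B := (B.prod C).baseChange R')
      (B' := (B.baseChange R').prod (C.baseChange R'))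
      ((h.stab C).baseChange R') ((h.baseChange R').stab (C.baseChange R'))
      (TensorProduct.prodRight R R' R' A C) (TensorProduct.prodRight R R' R' B C) (fun n a => by
        let g₁ := (stab (bcIso R' e) (C.baseChange R')).toLinearMap ∘ₗ
          LinearMap.prodMap LinearMap.id (TensorProduct.prodRight R R' R' A C).toLinearMap
        let g₂ := LinearMap.prodMap LinearMap.id
          (TensorProduct.prodRight R R' R' B C).toLinearMap ∘ₗ (bcIso R' (stab e C)).toLinearMap
        have hg : g₁ = g₂ := baseChange_prod_prod_hom_ext R' fun n a c => by
          change stab (bcIso R' e) (C.baseChange R') (1 ⊗ₜ n,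
            TensorProduct.prodRight R R' R' A C (1 ⊗ₜ (a, c))) =
              ((bcIso R' (stab e C) (1 ⊗ₜ n, 1 ⊗ₜ (a, c))).1,
                TensorProduct.prodRight R R' R' B C (bcIso R' (stab e C) (1 ⊗ₜ n, 1 ⊗ₜ (a, c))).2)
          rw [bcIso_tmul R' (stab e C) n (a, c), TensorProduct.prodRight_tmul]
          change ((bcIso R' e (1 ⊗ₜ n, 1 ⊗ₜ a)).1, ((bcIso R' e (1 ⊗ₜ n, 1 ⊗ₜ a)).2, 1 ⊗ₜ c)) =
            ((1 : R') ⊗ₜ (e (n, a)).1, TensorProduct.prodRight R R' R' B C (1 ⊗ₜ ((e (n, a)).2, c)))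
          rw [bcIso_tmul, TensorProduct.prodRight_tmul]
        exact DFunLike.congr_fun hg (n, a)) z
    rw [ev_stab (C.baseChange R') (h.baseChange R') _ (fun _ _ _ => rfl)] at h1
    have h2 := ev_stab C h (h.stab C) (fun _ _ _ => rfl) x
    refine ⟨fun H _ => ?_, fun H _ => ?_⟩
    · refine detMap_left_cancel (A := (A.prod C).baseChange R')
        (B := (A.baseChange R').prod (C.baseChange R')) (TensorProduct.prodRight R R' R' A C) ?_
      rw [← h1, H h, h2, bcHom_rstab]
    · apply (rstab (C.baseChange R')).injective
      refine detMap_right_cancel (A := (B.prod C).baseChange R')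
        (B := (B.baseChange R').prod (C.baseChange R')) (TensorProduct.prodRight R R' R' B C) ?_
      rw [h1, H (h.stab C), h2, bcHom_rstab]
  · intro A B B' _ _ _ e e' w h h' hw he H _
    have h1 := ev_fred (h.baseChange R') (h'.baseChange R') (hw.baseChange R') (fun x => by
      have hg : (bcIso R' e').toLinearMap = (bcIso R' w).toLinearMap ∘ₗ (bcIso R' e).toLinearMap :=
        baseChange_prod_hom_ext R' fun n a => by
          change bcIso R' e' (1 ⊗ₜ n, 1 ⊗ₜ a) = bcIso R' w (bcIso R' e (1 ⊗ₜ n, 1 ⊗ₜ a))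
          rw [bcIso_tmul, bcIso_tmul, bcIso_tmul, he]
      exact DFunLike.congr_fun hg x) z
    refine fdet_right_cancel (hw.baseChange R') ?_
    rw [← h1, H h, ev_fred h h' hw he, bcHom_comp, fdet_bcIso R' hw]
  · intro A A' B _ _ _ e e' α h h' he H _
    have h1 := ev_perm_left (A := A.baseChange R') (A' := A'.baseChange R')
      (h.baseChange R') (h'.baseChange R') (α.baseChange R R' A A') (fun n a => by
        have hg : (bcIso R' e').toLinearMap ∘ₗ
          LinearMap.prodMap LinearMap.id (α.baseChange R R' A A').toLinearMap =
            (bcIso R' e).toLinearMap := baseChange_prod_hom_ext R' fun n a => by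
          change bcIso R' e' (1 ⊗ₜ n, 1 ⊗ₜ α a) = bcIso R' e (1 ⊗ₜ n, 1 ⊗ₜ a)
          rw [bcIso_tmul, bcIso_tmul, he]
        exact DFunLike.congr_fun hg (n, a)) z
    rw [h1, H h, ev_perm_left h h' α he, bcHom_comp, bcHom_detMap]

lemma finSgn_baseChange (N M : ProjMod R) [Module.Finite R N] [Module.Finite R M] :
    finSgn (N.baseChange R') (M.baseChange R') = pullback R' (finSgn N M) := by
  rw [finSgn, rk_baseChange, rk_baseChange]
  rfl

lemma finHom_detBC {N M : ProjMod R} [Module.Finite R N] [Module.Finite R M] (f : AsympIso N M)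
    (x : detLine f) : finHom (f.baseChange R') (detBC R' f (1 ⊗ₜ x)) = bcHom R' (finHom f x) := by
  obtain ⟨A, B, _, _, e, h⟩ := exists_isRes f
  refine finHom_eq (h.baseChange R') _ _ ?_
  rw [ev_detBC R' h]
  have h1 : detMap (bcIso R' e) ∘ₗ lstab (N.baseChange R') (bcHom R' (ev h x)) =
      sgn (finSgn (N.baseChange R') (M.baseChange R')) •
        rstab (B.baseChange R') (bcHom R' (finHom f x)) :=
    bcDet_wedge_hom_ext R' fun n b => by
      rw [LinearMap.comp_apply, lstab_wedge, bcHom_bcDet, detMap_bcIso_wedge, finHom_spec,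
        LinearMap.smul_apply, rstab_wedge, bcHom_bcDet, bcDet_sgn_smul, map_smul, bcDet_wedge,
        finSgn_baseChange]
  intro n b
  have h2 := DFunLike.congr_fun h1 (wedge n b)
  rwa [LinearMap.comp_apply, lstab_wedge, LinearMap.smul_apply, rstab_wedge] at h2

end BaseChange

/-! ### Existence of a theory of determinant lines -/

/-- The relative determinant lines computed from resolutions. -/
def detData : DetData.{u} where
  line f := detLine f
  comp h := detComp h
  triv e _ h := detTriv e h
  sum f₁ f₂ := detSum f₁ f₂
  fin {_ _ N M} _ _ f := (finHom f).trans (contractEquiv (detTop M) (detTop N)).symm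
  fin_deg f := by
    rw [deg_detLine (resOf f).isRes, rk_sub_rk_of_isRes (resOf f).e]
  baseChange R' _ _ _ _ f := detBC R' f

section Compatibilities

variable {R : Type u} [CommRing R]

/-- The finite rank comparison of `detData` is `finHom` under the identification of `det M / det N`
with `Hom (det N, det M)`. -/
lemma contract_fin {N M : ProjMod R} [Module.Finite R N] [Module.Finite R M] (f : AsympIso N M)
    (x : detData.line f) : contract (detData.fin f x) = finHom f x := by
  rw [← contractEquiv_apply]
  exact (contractEquiv (detTop M) (detTop N)).apply_symm_apply (finHom f x)

/-- Compatible isomorphisms of resolutions transport elements of determinant lines. -/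
lemma transports_of_res {N M A B N' M' A' B' : ProjMod R} [Module.Finite R A] [Module.Finite R B]
    [Module.Finite R A'] [Module.Finite R B'] {f : AsympIso N M} {f' : AsympIso N' M'}
    {e : (N.prod A) ≃ₗ[R] (M.prod B)} {e' : (N'.prod A') ≃ₗ[R] (M'.prod B')} (h : IsRes f e)
    (h' : IsRes f' e') (α : M ≃ₗ[R] M') (β : N ≃ₗ[R] N') (γ : A ≃ₗ[R] A') (δ : B ≃ₗ[R] B')
    (he : ∀ n a, e' (β n, γ a) = (α (e (n, a)).1, δ (e (n, a)).2)) {x : detLine f}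
    {x' : detLine f'} (hx : ev h' x' ∘ₗ detMap δ = detMap γ ∘ₗ ev h x) :
    detData.Transports α β x x' := by
  have hα : IsRes (A := B) (B := B') (AsympIso.ofEquiv α) (α.prodCongr δ) :=
    isRes_ofEquiv α fun _ => rfl
  have hβ : IsRes (A := A) (B := A') (AsympIso.ofEquiv β) (β.prodCongr γ) :=
    isRes_ofEquiv β fun _ => rfl
  let E : (N.prod A) ≃ₗ[R] (M'.prod B') := e.trans (α.prodCongr δ)
  have hE : ∀ x, E x = e' ((β.prodCongr γ) x) := fun x => (he x.1 x.2).symm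
  have h₁ : IsRes ((AsympIso.ofEquiv α).comp f) E := h.comp hα fun _ => rfl
  have h₂ : IsRes (f'.comp (AsympIso.ofEquiv β)) E := hβ.comp h' hE
  have hc : (AsympIso.ofEquiv α).comp f = f'.comp (AsympIso.ofEquiv β) :=
    AsympIso.ext (h₁.symm.trans h₂)
  refine ⟨hc, ?_⟩
  apply (ev h₁).injective
  refine (ev_detComp rfl h hα h₁ (fun _ => rfl) (detTriv α rfl 1) x).trans
    (Eq.trans ?_ (ev_detComp hc hβ h' h₁ hE x' (detTriv β rfl 1)).symm)
  rw [ev_detTriv α rfl hα δ fun _ => rfl, ev_detTriv β rfl hβ γ fun _ => rfl]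
  refine detMap_right_cancel δ (detMap_left_cancel γ ?_)
  refine LinearMap.ext fun b => ?_
  have h3 := DFunLike.congr_fun hx b
  change detMap γ (ev h x (detMap δ.symm (detMap δ b))) =
    detMap γ (detMap γ.symm (ev h' x' (detMap δ b)))
  rw [detMap_symm_apply_detMap, detMap_detMap_symm_apply]
  exact h3.symm

/-- The determinant of `A × 0 ≃ A`: elements of `det 0` are scalars. -/
lemma detMap_prodUnique_wedge {A : ProjMod R} [Module.Finite R A] (a : detTop A)
    (o : detTop (ProjMod.zero R)) :
    detMap (N := A.prod (ProjMod.zero R)) (M := A) LinearEquiv.prodUnique (wedge a o) =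
      ExteriorAlgebra.algebraMapInv o.1 • a := by
  ext1
  have h1 : ∀ y : ExteriorAlgebra R (ProjMod.zero R), ExteriorAlgebra.map
      ((LinearEquiv.prodUnique (R := R) (M := A) (M₂ := ProjMod.zero R)).toLinearMap ∘ₗ
        LinearMap.inr R A (ProjMod.zero R)) y =
      algebraMap R _ (ExteriorAlgebra.algebraMapInv y) := fun y => by
    have h2 : ExteriorAlgebra.map
      ((LinearEquiv.prodUnique (R := R) (M := A) (M₂ := ProjMod.zero R)).toLinearMap ∘ₗ
        LinearMap.inr R A (ProjMod.zero R)) =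
        (Algebra.ofId R (ExteriorAlgebra R A)).comp ExteriorAlgebra.algebraMapInv := by
      refine ExteriorAlgebra.hom_ext (LinearMap.ext fun m => ?_)
      have hm : m = 0 := Subsingleton.elim _ _
      rw [hm, map_zero, map_zero]
    exact DFunLike.congr_fun h2 y
  have h3 : (LinearEquiv.prodUnique (R := R) (M := A) (M₂ := ProjMod.zero R)).toLinearMap ∘ₗ
      LinearMap.inl R A (ProjMod.zero R) = LinearMap.id := rfl
  rw [detMap_coe, coe_wedge, map_mul, extMap_comp, extMap_comp, h1, h3, ExteriorAlgebra.map_id,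
    AlgHom.id_apply, ← Algebra.commutes, ← Algebra.smul_def]
  rfl

/-- External multiplication with the identity of `det 0` does nothing. -/
lemma box_id_zero {A B : ProjMod R} [Module.Finite R A] [Module.Finite R B]
    (ξ : detTop B →ₗ[R] detTop A) :
    ξ ∘ₗ detMap (N := B.prod (ProjMod.zero R)) (M := B) LinearEquiv.prodUnique =
      detMap (N := A.prod (ProjMod.zero R)) (M := A) LinearEquiv.prodUnique ∘ₗ
        box ξ (LinearMap.id : detTop (ProjMod.zero R) →ₗ[R] detTop (ProjMod.zero R)) :=
  detTop_hom_ext fun b o => by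
    rw [LinearMap.comp_apply, LinearMap.comp_apply, box_wedge, sub_self, mul_zero, sgn_zero,
      one_smul, detMap_prodUnique_wedge, LinearMap.id_apply, detMap_prodUnique_wedge, map_smul]

lemma box_id_id (A B : ProjMod R) [Module.Finite R A] [Module.Finite R B] :
    box (LinearMap.id : detTop A →ₗ[R] detTop A) (LinearMap.id : detTop B →ₗ[R] detTop B) =
      LinearMap.id :=
  detTop_hom_ext fun b o => by
    rw [box_wedge, sub_self, mul_zero, sgn_zero, one_smul]
    rfl

/-- The determinant of an isomorphism `e`, in the resolution of `e` by `0`. -/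
lemma ev_detTriv_refl {N M : ProjMod R} (A : ProjMod R) [Module.Finite R A] (e : N ≃ₗ[R] M)
    {f : AsympIso N M} (h : f = AsympIso.ofEquiv e) {E : (N.prod A) ≃ₗ[R] (M.prod A)}
    (hE : IsRes f E) (he : ∀ x, E x = (e x.1, x.2)) : ev hE (detTriv e h 1) = LinearMap.id := by
  rw [ev_detTriv e h hE (LinearEquiv.refl R A) he, LinearEquiv.refl_symm, detMap_refl]

lemma detData_comp_assoc {N M L K : ProjMod R} (h : AsympIso L K) (g : AsympIso M L)
    (f : AsympIso N M) (z : detLine h) (y : detLine g) (x : detLine f) :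
    detComp (AsympIso.comp_assoc h g f) (detComp rfl (z ⊗ₜ y) ⊗ₜ x) =
      detComp rfl (z ⊗ₜ detComp rfl (y ⊗ₜ x)) := by
  obtain ⟨A, B, _, _, e₁, h₁⟩ := exists_isRes f
  obtain ⟨C, D, _, _, e₂, h₂⟩ := exists_chain_step g e₁
  obtain ⟨C', D', _, _, e₃, h₃⟩ := exists_chain_step h e₂
  have k₁ := (h₁.stab C).stab C'
  have k₂ := h₂.stab C'
  let e₁₂ : (N.prod ((A.prod C).prod C')) ≃ₗ[R] (L.prod (D.prod C')) :=
    (stab (stab e₁ C) C').trans (stab e₂ C')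
  let e₂₃ : (M.prod ((B.prod C).prod C')) ≃ₗ[R] (K.prod D') := (stab e₂ C').trans e₃
  let e : (N.prod ((A.prod C).prod C')) ≃ₗ[R] (K.prod D') := (stab (stab e₁ C) C').trans e₂₃
  have k₁₂ : IsRes (g.comp f) e₁₂ := k₁.comp k₂ fun _ => rfl
  have k₂₃ : IsRes (h.comp g) e₂₃ := k₂.comp h₃ fun _ => rfl
  have k : IsRes (h.comp (g.comp f)) e := k₁₂.comp h₃ fun _ => rfl
  apply (ev k).injective
  rw [ev_detComp _ k₁ k₂₃ k fun _ => rfl, ev_detComp _ k₁₂ h₃ k fun _ => rfl,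
    ev_detComp _ k₁ k₂ k₁₂ fun _ => rfl, ev_detComp _ k₂ h₃ k₂₃ fun _ => rfl]
  rfl

lemma detData_sum_comp {N₁ M₁ L₁ N₂ M₂ L₂ : ProjMod R} (g₁ : AsympIso M₁ L₁)
    (f₁ : AsympIso N₁ M₁) (g₂ : AsympIso M₂ L₂) (f₂ : AsympIso N₂ M₂)
    (y₁ : detLine g₁) (x₁ : detLine f₁) (y₂ : detLine g₂) (x₂ : detLine f₂) :
    detComp (AsympIso.prod_comp g₁ f₁ g₂ f₂) (detSum g₁ g₂ (y₁ ⊗ₜ y₂) ⊗ₜ detSum f₁ f₂ (x₁ ⊗ₜ x₂)) =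
      sgn ((detLine g₂).deg * (detLine f₁).deg) •
        detSum (g₁.comp f₁) (g₂.comp f₂) (detComp rfl (y₁ ⊗ₜ x₁) ⊗ₜ detComp rfl (y₂ ⊗ₜ x₂)) := by
  obtain ⟨c₁⟩ := (inferInstance : Nonempty (Chain g₁ f₁))
  obtain ⟨c₂⟩ := (inferInstance : Nonempty (Chain g₂ f₂))
  have k₁ := c₁.isRes rfl
  have k₂ := c₂.isRes rfl
  apply (ev (k₁.sumE k₂)).injective
  rw [map_smul, ev_detSum k₁ k₂, ev_detComp _ c₁.isRes₁ c₁.isRes₂ k₁ fun _ => rfl,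
    ev_detComp _ c₂.isRes₁ c₂.isRes₂ k₂ fun _ => rfl, deg_detLine c₂.isRes₂, deg_detLine c₁.isRes₁]
  refine (ev_detComp _ (c₁.isRes₁.sumE c₂.isRes₁) (c₁.isRes₂.sumE c₂.isRes₂) (k₁.sumE k₂)
    (fun _ => rfl) _ _).trans ?_
  rw [ev_detSum, ev_detSum, box_comp]

lemma detData_sum_triv {N₁ M₁ N₂ M₂ : ProjMod R} (e₁ : N₁ ≃ₗ[R] M₁) (e₂ : N₂ ≃ₗ[R] M₂) :
    detSum (AsympIso.ofEquiv e₁) (AsympIso.ofEquiv e₂) (detTriv e₁ rfl 1 ⊗ₜ detTriv e₂ rfl 1) =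
      detTriv (N := N₁.prod N₂) (M := M₁.prod M₂) (e₁.prodCongr e₂)
        (AsympIso.prod_ofEquiv e₁ e₂) 1 := by
  have h₁ : IsRes (A := ProjMod.zero R) (B := ProjMod.zero R) (AsympIso.ofEquiv e₁)
      (e₁.prodCongr (LinearEquiv.refl R (ProjMod.zero R))) := isRes_ofEquiv e₁ fun _ => rfl
  have h₂ : IsRes (A := ProjMod.zero R) (B := ProjMod.zero R) (AsympIso.ofEquiv e₂)
      (e₂.prodCongr (LinearEquiv.refl R (ProjMod.zero R))) := isRes_ofEquiv e₂ fun _ => rfl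
  apply (ev (h₁.sumE h₂)).injective
  rw [ev_detSum h₁ h₂, ev_detTriv_refl _ e₁ rfl h₁ fun _ => rfl, ev_detTriv_refl _ e₂ rfl h₂ fun _ => rfl,
    ev_detTriv_refl _ _ _ (h₁.sumE h₂) fun _ => rfl, box_id_id]

section BaseChange

variable (R' : Type u) [CommRing R'] [Algebra R R']

lemma detData_baseChange_comp {N M L : ProjMod R} (g : AsympIso M L) (f : AsympIso N M)
    (y : detLine g) (x : detLine f) :
    detBC R' (g.comp f) (1 ⊗ₜ detComp rfl (y ⊗ₜ x)) =
      detComp (AsympIso.baseChange_comp R' g f) (detBC R' g (1 ⊗ₜ y) ⊗ₜ detBC R' f (1 ⊗ₜ x)) := by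
  obtain ⟨c⟩ := (inferInstance : Nonempty (Chain g f))
  have k := c.isRes rfl
  apply (ev (k.baseChange R')).injective
  rw [ev_detBC R' k, ev_detComp _ c.isRes₁ c.isRes₂ k fun _ => rfl, ev_detComp _
    (c.isRes₁.baseChange R') (c.isRes₂.baseChange R') (k.baseChange R'), ev_detBC, ev_detBC,
    bcHom_comp]
  refine DFunLike.congr_fun (show (bcIso R' (c.e₁.trans c.e₂)).toLinearMap =
    (bcIso R' c.e₂).toLinearMap ∘ₗ (bcIso R' c.e₁).toLinearMap from
      baseChange_prod_hom_ext R' fun n a => ?_)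
  change bcIso R' (c.e₁.trans c.e₂) (1 ⊗ₜ n, 1 ⊗ₜ a) =
    bcIso R' c.e₂ (bcIso R' c.e₁ (1 ⊗ₜ n, 1 ⊗ₜ a))
  rw [bcIso_tmul, bcIso_tmul, bcIso_tmul]
  rfl

lemma detData_baseChange_triv {N M : ProjMod R} (e : N ≃ₗ[R] M) :
    detBC R' (AsympIso.ofEquiv e) (1 ⊗ₜ detTriv e rfl 1) =
      detTriv (N := N.baseChange R') (M := M.baseChange R') (e.baseChange R R' N M)
        (AsympIso.baseChange_ofEquiv R' e) 1 := by
  have h : IsRes (A := ProjMod.zero R) (B := ProjMod.zero R) (AsympIso.ofEquiv e)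
      (e.prodCongr (LinearEquiv.refl R (ProjMod.zero R))) := isRes_ofEquiv e fun _ => rfl
  apply (ev (h.baseChange R')).injective
  rw [ev_detBC R' h, ev_detTriv_refl _ e rfl h fun _ => rfl, bcHom_id,
    ev_detTriv_refl _ _ _ (h.baseChange R')]
  refine DFunLike.congr_fun (show (bcIso R' _).toLinearMap =
    LinearMap.prodMap (e.baseChange R R' N M).toLinearMap LinearMap.id from
      baseChange_prod_hom_ext R' fun n a => ?_)
  exact bcIso_tmul R' _ n a

lemma detData_baseChange_sum {N₁ M₁ N₂ M₂ : ProjMod R} (f₁ : AsympIso N₁ M₁)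
    (f₂ : AsympIso N₂ M₂) (x : detLine f₁) (y : detLine f₂) :
    detData.Transports (M := (M₁.prod M₂).baseChange R')
      (M' := (M₁.baseChange R').prod (M₂.baseChange R'))
      (N := (N₁.prod N₂).baseChange R') (N' := (N₁.baseChange R').prod (N₂.baseChange R'))
      (TensorProduct.prodRight R R' R' M₁ M₂) (TensorProduct.prodRight R R' R' N₁ N₂)
      (f := (f₁.prod f₂).baseChange R') (f' := (f₁.baseChange R').prod (f₂.baseChange R'))
      (detBC R' (f₁.prod f₂) (1 ⊗ₜ detSum f₁ f₂ (x ⊗ₜ y)))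
      (detSum (f₁.baseChange R') (f₂.baseChange R')
        (detBC R' f₁ (1 ⊗ₜ x) ⊗ₜ detBC R' f₂ (1 ⊗ₜ y))) := by
  obtain ⟨A₁, B₁, _, _, e₁, h₁⟩ := exists_isRes f₁
  obtain ⟨A₂, B₂, _, _, e₂, h₂⟩ := exists_isRes f₂
  refine transports_of_res ((h₁.sumE h₂).baseChange R')
    ((h₁.baseChange R').sumE (h₂.baseChange R')) (A := (A₁.prod A₂).baseChange R')
    (B := (B₁.prod B₂).baseChange R') (A' := (A₁.baseChange R').prod (A₂.baseChange R'))
    (B' := (B₁.baseChange R').prod (B₂.baseChange R')) _ _ (TensorProduct.prodRight R R' R' A₁ A₂)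
    (TensorProduct.prodRight R R' R' B₁ B₂) (fun n a => ?_) ?_
  · let g₁ := (sumE (bcIso R' e₁) (bcIso R' e₂)).toLinearMap ∘ₗ
      LinearMap.prodMap (TensorProduct.prodRight R R' R' N₁ N₂).toLinearMap
        (TensorProduct.prodRight R R' R' A₁ A₂).toLinearMap
    let g₂ := LinearMap.prodMap (TensorProduct.prodRight R R' R' M₁ M₂).toLinearMap
      (TensorProduct.prodRight R R' R' B₁ B₂).toLinearMap ∘ₗ (bcIso R' (sumE e₁ e₂)).toLinearMap
    have hg : g₁ = g₂ := baseChange_prod_hom_ext (M := N₁.prod N₂) (P := A₁.prod A₂) R'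
      fun n a => by
        obtain ⟨n₁, n₂⟩ := n
        obtain ⟨a₁, a₂⟩ := a
        change sumE (bcIso R' e₁) (bcIso R' e₂) (TensorProduct.prodRight R R' R' N₁ N₂
          (1 ⊗ₜ (n₁, n₂)), TensorProduct.prodRight R R' R' A₁ A₂ (1 ⊗ₜ (a₁, a₂))) =
          (TensorProduct.prodRight R R' R' M₁ M₂
            (bcIso R' (sumE e₁ e₂) (1 ⊗ₜ (n₁, n₂), 1 ⊗ₜ (a₁, a₂))).1,
          TensorProduct.prodRight R R' R' B₁ B₂
            (bcIso R' (sumE e₁ e₂) (1 ⊗ₜ (n₁, n₂), 1 ⊗ₜ (a₁, a₂))).2)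
        rw [bcIso_tmul R' (sumE e₁ e₂) (n₁, n₂) (a₁, a₂), TensorProduct.prodRight_tmul,
          TensorProduct.prodRight_tmul, sumE_apply, sumE_apply, bcIso_tmul, bcIso_tmul]
        exact Prod.ext (TensorProduct.prodRight_tmul R R' R' M₁ M₂ 1 ((e₁ (n₁, a₁)).1, (e₂ (n₂, a₂)).1)).symm
          (TensorProduct.prodRight_tmul R R' R' B₁ B₂ 1 ((e₁ (n₁, a₁)).2, (e₂ (n₂, a₂)).2)).symm
    exact DFunLike.congr_fun hg (n, a)
  · rw [ev_detSum (h₁.baseChange R') (h₂.baseChange R'), ev_detBC R' h₁, ev_detBC R' h₂,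
      ev_detBC R' (h₁.sumE h₂), ev_detSum h₁ h₂]
    exact bcHom_box R' (ev h₁ x) (ev h₂ y)

lemma detData_baseChange_trans (R'' : Type u) [CommRing R''] [Algebra R R''] [Algebra R' R'']
    [IsScalarTower R R' R''] {N M : ProjMod R} (f : AsympIso N M) (x : detLine f) :
    detData.Transports (M := (M.baseChange R').baseChange R'') (M' := M.baseChange R'')
      (N := (N.baseChange R').baseChange R'') (N' := N.baseChange R'')
      (f := (f.baseChange R').baseChange R'') (f' := f.baseChange R'')
      (TensorProduct.AlgebraTensorModule.cancelBaseChange R R' R'' R'' M)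
      (TensorProduct.AlgebraTensorModule.cancelBaseChange R R' R'' R'' N)
      (detBC R'' (f.baseChange R') (1 ⊗ₜ detBC R' f (1 ⊗ₜ x)))
      (detBC R'' f (1 ⊗ₜ x)) := by
  obtain ⟨A, B, _, _, e, h⟩ := exists_isRes f
  refine transports_of_res ((h.baseChange R').baseChange R'') (h.baseChange R'')
    (A := (A.baseChange R').baseChange R'') (A' := A.baseChange R'')
    (B := (B.baseChange R').baseChange R'') (B' := B.baseChange R'') _ _
    (TensorProduct.AlgebraTensorModule.cancelBaseChange R R' R'' R'' A)
    (TensorProduct.AlgebraTensorModule.cancelBaseChange R R' R'' R'' B) (fun n a => ?_) ?_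
  · let g₁ := (bcIso R'' e).toLinearMap ∘ₗ LinearMap.prodMap
      (TensorProduct.AlgebraTensorModule.cancelBaseChange R R' R'' R'' N).toLinearMap
      (TensorProduct.AlgebraTensorModule.cancelBaseChange R R' R'' R'' A).toLinearMap
    let g₂ := LinearMap.prodMap
      (TensorProduct.AlgebraTensorModule.cancelBaseChange R R' R'' R'' M).toLinearMap
      (TensorProduct.AlgebraTensorModule.cancelBaseChange R R' R'' R'' B).toLinearMap ∘ₗ
        (bcIso R'' (bcIso R' e)).toLinearMap
    have hg : g₁ = g₂ := baseChange_prod_hom_ext (M := N.baseChange R') (P := A.baseChange R') R''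
      fun n a => by
        let k₁ := g₁.restrictScalars R' ∘ₗ LinearMap.prodMap
          (TensorProduct.mk R' R'' (R' ⊗[R] N) 1) (TensorProduct.mk R' R'' (R' ⊗[R] A) 1)
        let k₂ := g₂.restrictScalars R' ∘ₗ LinearMap.prodMap
          (TensorProduct.mk R' R'' (R' ⊗[R] N) 1) (TensorProduct.mk R' R'' (R' ⊗[R] A) 1)
        have hk : k₁ = k₂ := baseChange_prod_hom_ext (M := N) (P := A) R' fun n a => by
          change bcIso R'' e
            (TensorProduct.AlgebraTensorModule.cancelBaseChange R R' R'' R'' N (1 ⊗ₜ (1 ⊗ₜ n)),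
              TensorProduct.AlgebraTensorModule.cancelBaseChange R R' R'' R'' A (1 ⊗ₜ (1 ⊗ₜ a))) =
            (TensorProduct.AlgebraTensorModule.cancelBaseChange R R' R'' R'' M
              (bcIso R'' (bcIso R' e) (1 ⊗ₜ (1 ⊗ₜ n), 1 ⊗ₜ (1 ⊗ₜ a))).1,
              TensorProduct.AlgebraTensorModule.cancelBaseChange R R' R'' R'' B
              (bcIso R'' (bcIso R' e) (1 ⊗ₜ (1 ⊗ₜ n), 1 ⊗ₜ (1 ⊗ₜ a))).2)
          rw [bcIso_tmul R'' (bcIso R' e), bcIso_tmul R' e]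
          simp only [TensorProduct.AlgebraTensorModule.cancelBaseChange_tmul, one_smul]
          rw [bcIso_tmul]
        exact DFunLike.congr_fun hk (n, a)
    exact DFunLike.congr_fun hg (n, a)
  · rw [ev_detBC R'' h, ev_detBC R'' (h.baseChange R'), ev_detBC R' h]
    refine bcDet_hom_ext R'' fun b => ?_
    rw [LinearMap.comp_apply, LinearMap.comp_apply, bcHom_bcDet]
    generalize ev h x = ξ
    let k₁ := ((bcHom R'' ξ ∘ₗ detMap (N := (B.baseChange R').baseChange R'')
      (M := B.baseChange R'')
      (TensorProduct.AlgebraTensorModule.cancelBaseChange R R' R'' R'' B)).restrictScalars R') ∘ₗ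
        bcDet R'' (B.baseChange R')
    let k₂ := ((detMap (N := (A.baseChange R').baseChange R'') (M := A.baseChange R'')
      (TensorProduct.AlgebraTensorModule.cancelBaseChange R R' R'' R'' A)).restrictScalars R') ∘ₗ
        bcDet R'' (A.baseChange R') ∘ₗ bcHom R' ξ
    have hk : k₁ = k₂ := bcDet_hom_ext R' fun b => by
      change bcHom R'' ξ (detMap (N := (B.baseChange R').baseChange R'') (M := B.baseChange R'')
        (TensorProduct.AlgebraTensorModule.cancelBaseChange R R' R'' R'' B)
          (bcDet R'' (B.baseChange R') (bcDet R' B b))) =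
        detMap (N := (A.baseChange R').baseChange R'') (M := A.baseChange R'')
          (TensorProduct.AlgebraTensorModule.cancelBaseChange R R' R'' R'' A)
            (bcDet R'' (A.baseChange R') (bcHom R' ξ (bcDet R' B b)))
      rw [bcDet_trans, bcHom_bcDet, bcHom_bcDet, bcDet_trans]
    exact DFunLike.congr_fun hk b

end BaseChange

lemma detData_comp_triv {N M L : ProjMod R} (e : N ≃ₗ[R] M) (e' : M ≃ₗ[R] L) :
    detComp (AsympIso.ofEquiv_trans e e') (detTriv e' rfl 1 ⊗ₜ detTriv e rfl 1) =
      detTriv (e.trans e') rfl 1 := by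
  have h : IsRes (A := ProjMod.zero R) (B := ProjMod.zero R) (AsympIso.ofEquiv e)
    (e.prodCongr (LinearEquiv.refl R (ProjMod.zero R))) := isRes_ofEquiv e fun _ => rfl
  have h' : IsRes (A := ProjMod.zero R) (B := ProjMod.zero R) (AsympIso.ofEquiv e')
    (e'.prodCongr (LinearEquiv.refl R (ProjMod.zero R))) := isRes_ofEquiv e' fun _ => rfl
  have h'' : IsRes (A := ProjMod.zero R) (B := ProjMod.zero R) (AsympIso.ofEquiv (e.trans e'))
    ((e.trans e').prodCongr (LinearEquiv.refl R (ProjMod.zero R))) :=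
      isRes_ofEquiv (e.trans e') fun _ => rfl
  apply (ev h'').injective
  refine (ev_detComp (AsympIso.ofEquiv_trans e e') h h' h'' (fun _ => rfl) (detTriv e' rfl 1)
    (detTriv e rfl 1)).trans ?_
  rw [ev_detTriv_refl _ e rfl h fun _ => rfl, ev_detTriv_refl _ e' rfl h' fun _ => rfl]
  exact (ev_detTriv_refl _ (e.trans e') rfl h'' fun _ => rfl).symm

lemma detData_sum_assoc {N₁ M₁ N₂ M₂ N₃ M₃ : ProjMod R} (f₁ : AsympIso N₁ M₁)
    (f₂ : AsympIso N₂ M₂) (f₃ : AsympIso N₃ M₃) (x : detLine f₁) (y : detLine f₂)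
    (z : detLine f₃) :
    detData.Transports (M := (M₁.prod M₂).prod M₃) (M' := M₁.prod (M₂.prod M₃))
      (N := (N₁.prod N₂).prod N₃) (N' := N₁.prod (N₂.prod N₃))
      (f := (f₁.prod f₂).prod f₃) (f' := f₁.prod (f₂.prod f₃))
      (LinearEquiv.prodAssoc R M₁ M₂ M₃) (LinearEquiv.prodAssoc R N₁ N₂ N₃)
      (detSum (f₁.prod f₂) f₃ (detSum f₁ f₂ (x ⊗ₜ y) ⊗ₜ z))
      (detSum f₁ (f₂.prod f₃) (x ⊗ₜ detSum f₂ f₃ (y ⊗ₜ z))) := by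
  obtain ⟨A₁, B₁, _, _, e₁, h₁⟩ := exists_isRes f₁
  obtain ⟨A₂, B₂, _, _, e₂, h₂⟩ := exists_isRes f₂
  obtain ⟨A₃, B₃, _, _, e₃, h₃⟩ := exists_isRes f₃
  refine transports_of_res ((h₁.sumE h₂).sumE h₃) (h₁.sumE (h₂.sumE h₃))
    (A := (A₁.prod A₂).prod A₃) (A' := A₁.prod (A₂.prod A₃)) (B := (B₁.prod B₂).prod B₃)
    (B' := B₁.prod (B₂.prod B₃)) _ _ (LinearEquiv.prodAssoc _ A₁ A₂ A₃)
    (LinearEquiv.prodAssoc _ B₁ B₂ B₃) (fun _ _ => rfl) ?_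
  have k₁ := ev_detSum (h₁.sumE h₂) h₃ (detSum f₁ f₂ (x ⊗ₜ y)) z
  have k₂ := ev_detSum h₁ (h₂.sumE h₃) x (detSum f₂ f₃ (y ⊗ₜ z))
  rw [ev_detSum h₁ h₂] at k₁
  rw [ev_detSum h₂ h₃] at k₂
  refine (congrArg (fun ξ => ξ ∘ₗ detMap (N := (B₁.prod B₂).prod B₃) (M := B₁.prod (B₂.prod B₃))
    (LinearEquiv.prodAssoc _ B₁ B₂ B₃)) k₂).trans ((box_assoc _ _ _).trans
      (congrArg (fun ξ => detMap (N := (A₁.prod A₂).prod A₃) (M := A₁.prod (A₂.prod A₃))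
    (LinearEquiv.prodAssoc _ A₁ A₂ A₃) ∘ₗ ξ) k₁.symm))

lemma detData_sum_comm {N₁ M₁ N₂ M₂ : ProjMod R} (f₁ : AsympIso N₁ M₁)
    (f₂ : AsympIso N₂ M₂) (x : detLine f₁) (y : detLine f₂) :
    detData.Transports (M := M₁.prod M₂) (M' := M₂.prod M₁) (N := N₁.prod N₂) (N' := N₂.prod N₁)
      (f := f₁.prod f₂) (f' := f₂.prod f₁)
      (LinearEquiv.prodComm R M₁ M₂) (LinearEquiv.prodComm R N₁ N₂)
      (detSum f₁ f₂ (x ⊗ₜ y))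
      (sgn ((detLine f₁).deg * (detLine f₂).deg) • detSum f₂ f₁ (y ⊗ₜ x)) := by
  obtain ⟨A₁, B₁, _, _, e₁, h₁⟩ := exists_isRes f₁
  obtain ⟨A₂, B₂, _, _, e₂, h₂⟩ := exists_isRes f₂
  refine transports_of_res (h₁.sumE h₂) (h₂.sumE h₁) (A := A₁.prod A₂) (A' := A₂.prod A₁)
    (B := B₁.prod B₂) (B' := B₂.prod B₁) _ _ (LinearEquiv.prodComm _ A₁ A₂)
    (LinearEquiv.prodComm _ B₁ B₂) (fun _ _ => rfl) ?_
  rw [map_smul, ev_detSum h₁ h₂, ev_detSum h₂ h₁, deg_detLine h₁, deg_detLine h₂, ← box_comm,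
    LinearMap.smul_comp]

lemma detData_sum_zero {N M : ProjMod R} (f : AsympIso N M) (x : detLine f) :
    detData.Transports (M := M.prod (ProjMod.zero R)) (M' := M) (N := N.prod (ProjMod.zero R))
      (N' := N) (f := f.prod (AsympIso.ofEquiv (LinearEquiv.refl R (ProjMod.zero R)))) (f' := f)
      LinearEquiv.prodUnique LinearEquiv.prodUnique
      (detSum f (AsympIso.ofEquiv (LinearEquiv.refl R (ProjMod.zero R)))
        (x ⊗ₜ detTriv (LinearEquiv.refl R (ProjMod.zero R)) rfl 1))
      x := by
  obtain ⟨A, B, _, _, e, h⟩ := exists_isRes f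
  have h₀ : IsRes (A := ProjMod.zero R) (B := ProjMod.zero R)
    (AsympIso.ofEquiv (LinearEquiv.refl R (ProjMod.zero R)))
    ((LinearEquiv.refl R (ProjMod.zero R)).prodCongr (LinearEquiv.refl R (ProjMod.zero R))) :=
      isRes_ofEquiv _ fun _ => rfl
  refine transports_of_res (h.sumE h₀) h (A := A.prod (ProjMod.zero R))
    (B := B.prod (ProjMod.zero R)) _ _ LinearEquiv.prodUnique LinearEquiv.prodUnique
      (fun _ _ => rfl) ?_
  refine (box_id_zero _).trans ?_
  rw [← ev_detTriv_refl (ProjMod.zero R) _ rfl h₀ fun _ => rfl, ← ev_detSum h h₀]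

set_option maxRecDepth 4000 in
/-- The relative determinant lines computed from resolutions have all the required
compatibilities. -/
lemma isDet_detData : detData.{u}.IsDet where
  comp_assoc h g f z y x := detData_comp_assoc h g f z y x
  comp_triv e e' := detData_comp_triv e e'
  sum_assoc f₁ f₂ f₃ x y z := detData_sum_assoc f₁ f₂ f₃ x y z
  sum_comm f₁ f₂ x y := detData_sum_comm f₁ f₂ x y
  sum_zero f x := detData_sum_zero f x
  sum_comp g₁ f₁ g₂ f₂ y₁ x₁ y₂ x₂ := detData_sum_comp g₁ f₁ g₂ f₂ y₁ x₁ y₂ x₂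
  sum_triv e₁ e₂ := detData_sum_triv e₁ e₂
  fin_comp g f y x := by
    rw [contract_fin, contract_fin, contract_fin]
    exact finHom_detComp g f y x
  fin_triv e := by
    rw [contract_fin]
    exact finHom_detTriv e
  fin_sum f₁ f₂ x y a b := by
    rw [contract_fin, contract_fin, contract_fin]
    exact finHom_detSum_wedge f₁ f₂ x y a b
  baseChange_comp R' _ _ _ _ _ g f y x := detData_baseChange_comp R' g f y x
  baseChange_triv R' _ _ _ _ e := detData_baseChange_triv R' e
  baseChange_sum R' _ _ _ _ _ _ f₁ f₂ x y := detData_baseChange_sum R' f₁ f₂ x y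
  baseChange_fin R' _ _ N M _ _ f x a := by
    have h := (contract_fin (f.baseChange R') (detBC R' f (1 ⊗ₜ x))).trans (finHom_detBC R' f x)
    rw [← contract_fin] at h
    exact (DFunLike.congr_fun h (bcDet R' N a)).trans (bcHom_bcDet R' _ a)
  baseChange_trans R' _ _ R'' _ _ _ _ _ _ f x := detData_baseChange_trans R' R'' f x

end Compatibilities

/-! ### Elements of determinant lines as morphisms -/

/-- An invertible asymptotic morphism together with an element of its relative determinant line.
These are the morphisms of a category with direct sums, in which compositions do not depend on
choices of proofs that asymptotic morphisms agree. -/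
structure Mor (D : DetData.{u}) {R : Type u} [CommRing R] (N M : ProjMod R) where
  hom : AsympIso N M
  val : D.line hom

namespace Mor

variable {D : DetData.{u}} {R : Type u} [CommRing R] {N M L K : ProjMod R}

lemma mk_inj {f : AsympIso N M} {x x' : D.line f} (h : (⟨f, x⟩ : Mor D N M) = ⟨f, x'⟩) : x = x' := by
  cases h
  rfl

lemma exists_eq (X : Mor D N M) {f : AsympIso N M} (h : X.hom = f) : ∃ x, X = ⟨f, x⟩ := by
  subst h
  exact ⟨X.val, rfl⟩

/-- The degree of the determinant line in which `X` lies. -/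
def deg (X : Mor D N M) : LocallyConstant (PrimeSpectrum R) ℤ := (D.line X.hom).deg

instance : SMul R (Mor D N M) := ⟨fun r X => ⟨X.hom, r • X.val⟩⟩

lemma smul_mk (r : R) (f : AsympIso N M) (x : D.line f) :
    r • (⟨f, x⟩ : Mor D N M) = ⟨f, r • x⟩ := rfl

instance : MulAction R (Mor D N M) where
  one_smul := fun ⟨f, x⟩ => by rw [smul_mk, one_smul]
  mul_smul := fun r s ⟨f, x⟩ => by rw [smul_mk, smul_mk, smul_mk, mul_smul]

/-- Composition. -/
def comp (Y : Mor D M L) (X : Mor D N M) : Mor D N L :=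
  ⟨Y.hom.comp X.hom, D.comp rfl (Y.val ⊗ₜ X.val)⟩

/-- Direct sum. -/
def sum {N₁ M₁ N₂ M₂ : ProjMod R} (X : Mor D N₁ M₁) (Y : Mor D N₂ M₂) :
    Mor D (N₁.prod N₂) (M₁.prod M₂) :=
  ⟨X.hom.prod Y.hom, D.sum X.hom Y.hom (X.val ⊗ₜ Y.val)⟩

variable (D) in
/-- The determinant of an isomorphism. -/
def triv (e : N ≃ₗ[R] M) : Mor D N M := ⟨AsympIso.ofEquiv e, D.triv e rfl 1⟩

variable (D N) in
/-- The identity. -/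
def one : Mor D N N := triv D (LinearEquiv.refl R N)

lemma comp_mk {g : AsympIso M L} {f : AsympIso N M} {h : AsympIso N L} (hh : h = g.comp f)
    (y : D.line g) (x : D.line f) :
    (⟨h, D.comp hh (y ⊗ₜ x)⟩ : Mor D N L) = comp ⟨g, y⟩ ⟨f, x⟩ := by
  subst hh
  rfl

lemma triv_mk (e : N ≃ₗ[R] M) {f : AsympIso N M} (h : f = AsympIso.ofEquiv e) :
    (⟨f, D.triv e h 1⟩ : Mor D N M) = triv D e := by
  subst h
  rfl

lemma deg_comp (Y : Mor D M L) (X : Mor D N M) : (Y.comp X).deg = Y.deg + X.deg :=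
  (D.comp (rfl : Y.hom.comp X.hom = _)).deg_eq.symm

lemma deg_sum {N₁ M₁ N₂ M₂ : ProjMod R} (X : Mor D N₁ M₁) (Y : Mor D N₂ M₂) :
    (X.sum Y).deg = X.deg + Y.deg :=
  (D.sum X.hom Y.hom).deg_eq.symm

lemma deg_triv (e : N ≃ₗ[R] M) : (triv D e).deg = 0 :=
  (D.triv e (rfl : AsympIso.ofEquiv e = _)).deg_eq.symm

lemma deg_one : (one D N).deg = 0 := deg_triv _

lemma smul_comp (r : R) (Y : Mor D M L) (X : Mor D N M) : (r • Y).comp X = r • Y.comp X := by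
  change (⟨_, D.comp rfl ((r • Y.val) ⊗ₜ X.val)⟩ : Mor D N L) = ⟨_, r • D.comp rfl (Y.val ⊗ₜ X.val)⟩
  rw [← TensorProduct.smul_tmul', map_smul]

lemma comp_smul (r : R) (Y : Mor D M L) (X : Mor D N M) : Y.comp (r • X) = r • Y.comp X := by
  change (⟨_, D.comp rfl (Y.val ⊗ₜ (r • X.val))⟩ : Mor D N L) = ⟨_, r • D.comp rfl (Y.val ⊗ₜ X.val)⟩
  rw [TensorProduct.tmul_smul, map_smul]

lemma smul_sum (r : R) {N₁ M₁ N₂ M₂ : ProjMod R} (X : Mor D N₁ M₁) (Y : Mor D N₂ M₂) :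
    (r • X).sum Y = r • X.sum Y := by
  change (⟨_, D.sum _ _ ((r • X.val) ⊗ₜ Y.val)⟩ : Mor D _ _) = ⟨_, r • D.sum _ _ (X.val ⊗ₜ Y.val)⟩
  rw [← TensorProduct.smul_tmul', map_smul]

lemma sum_smul (r : R) {N₁ M₁ N₂ M₂ : ProjMod R} (X : Mor D N₁ M₁) (Y : Mor D N₂ M₂) :
    X.sum (r • Y) = r • X.sum Y := by
  change (⟨_, D.sum _ _ (X.val ⊗ₜ (r • Y.val))⟩ : Mor D _ _) = ⟨_, r • D.sum _ _ (X.val ⊗ₜ Y.val)⟩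
  rw [TensorProduct.tmul_smul, map_smul]

/-- Every element of the line of an isomorphism is a unique multiple of its determinant. -/
lemma existsUnique_smul_triv (e : N ≃ₗ[R] M) {X : Mor D N M} (h : X.hom = AsympIso.ofEquiv e) :
    ∃! r : R, X = r • triv D e := by
  obtain ⟨x, rfl⟩ := X.exists_eq h
  obtain ⟨r, rfl⟩ := (D.triv e rfl).toEquiv.surjective x
  have h1 : ∀ s : R, s • triv D e = ⟨AsympIso.ofEquiv e, D.triv e rfl s⟩ := fun s => by
    rw [triv, smul_mk, ← map_smul, smul_eq_mul, mul_one]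
  refine ⟨r, (h1 r).symm, fun s hs => ?_⟩
  replace hs := hs.trans (h1 s)
  exact ((D.triv e rfl).toEquiv.injective (mk_inj hs)).symm

variable (D) in
/-- Multiplication on the right with the determinant of an isomorphism. -/
def tmulTriv (e : N ≃ₗ[R] M) (V : Type u) [AddCommGroup V] [Module R V] :
    V ≃ₗ[R] V ⊗[R] D.line (AsympIso.ofEquiv e) :=
  (TensorProduct.rid R V).symm.trans
    (TensorProduct.congr (LinearEquiv.refl R V) (D.triv e rfl).toEquiv)

variable (D) in
/-- Multiplication on the left with the determinant of an isomorphism. -/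
def trivTmul (e : N ≃ₗ[R] M) (V : Type u) [AddCommGroup V] [Module R V] :
    V ≃ₗ[R] D.line (AsympIso.ofEquiv e) ⊗[R] V :=
  (TensorProduct.lid R V).symm.trans
    (TensorProduct.congr (D.triv e rfl).toEquiv (LinearEquiv.refl R V))

lemma triv_tmul_cancel (e : N ≃ₗ[R] M) {V : Type u} [AddCommGroup V] [Module R V] {y y' : V}
    (h : (triv D e).val ⊗ₜ[R] y = (triv D e).val ⊗ₜ y') : y = y' :=
  (trivTmul D e V).injective h

lemma tmul_triv_cancel (e : N ≃ₗ[R] M) {V : Type u} [AddCommGroup V] [Module R V] {y y' : V}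
    (h : y ⊗ₜ[R] (triv D e).val = y' ⊗ₜ (triv D e).val) : y = y' :=
  (tmulTriv D e V).injective h

lemma sum_triv_cancel {A B : ProjMod R} (e : A ≃ₗ[R] B) {X X' : Mor D N M} (hX : X.hom = X'.hom)
    (h : X.sum (triv D e) = X'.sum (triv D e)) : X = X' := by
  obtain ⟨f, x⟩ := X
  obtain ⟨f', x'⟩ := X'
  obtain rfl : f = f' := hX
  exact congrArg (Mor.mk f) (tmul_triv_cancel e ((D.sum _ _).toEquiv.injective (mk_inj h)))

section Laws

variable (hD : D.IsDet)
include hD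

lemma comp_assoc (Z : Mor D L K) (Y : Mor D M L) (X : Mor D N M) :
    (Z.comp Y).comp X = Z.comp (Y.comp X) := by
  have h := hD.comp_assoc Z.hom Y.hom X.hom Z.val Y.val X.val
  have h1 := comp_mk (AsympIso.comp_assoc Z.hom Y.hom X.hom) (Z.comp Y).val X.val
  change _ = (Z.comp Y).comp X at h1
  rw [← h1]
  exact congrArg (Mor.mk _) h

lemma triv_comp_triv (e' : M ≃ₗ[R] L) (e : N ≃ₗ[R] M) :
    (triv D e').comp (triv D e) = triv D (e.trans e') :=
  congrArg (Mor.mk _) (hD.comp_triv e e')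

lemma one_comp (X : Mor D N M) : (one D M).comp X = X := by
  obtain ⟨x', hx'⟩ := ((one D M).comp X).exists_eq (f := X.hom) X.hom.refl_comp
  have h1 : (one D M).comp ⟨X.hom, x'⟩ = (one D M).comp X := by
    rw [← hx', ← comp_assoc hD, one, triv_comp_triv hD]
    rfl
  have h2 : x' = X.val := triv_tmul_cancel _ ((D.comp rfl).toEquiv.injective (mk_inj h1))
  rw [hx', h2]

lemma comp_one (X : Mor D N M) : X.comp (one D N) = X := by
  obtain ⟨x', hx'⟩ := (X.comp (one D N)).exists_eq (f := X.hom) X.hom.comp_refl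
  have h1 : comp ⟨X.hom, x'⟩ (one D N) = X.comp (one D N) := by
    rw [← hx', comp_assoc hD, one, triv_comp_triv hD]
    rfl
  have h2 : x' = X.val := tmul_triv_cancel _ ((D.comp rfl).toEquiv.injective (mk_inj h1))
  rw [hx', h2]

lemma triv_comp_triv_symm (e : N ≃ₗ[R] M) : (triv D e).comp (triv D e.symm) = one D M := by
  rw [triv_comp_triv hD, LinearEquiv.symm_trans_self, one]

lemma triv_symm_comp_triv (e : N ≃ₗ[R] M) : (triv D e.symm).comp (triv D e) = one D N := by
  rw [triv_comp_triv hD, LinearEquiv.self_trans_symm, one]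

lemma sum_comp_sum {N₁ M₁ L₁ N₂ M₂ L₂ : ProjMod R} (Y₁ : Mor D M₁ L₁) (X₁ : Mor D N₁ M₁)
    (Y₂ : Mor D M₂ L₂) (X₂ : Mor D N₂ M₂) :
    (Y₁.sum Y₂).comp (X₁.sum X₂) = sgn (Y₂.deg * X₁.deg) • (Y₁.comp X₁).sum (Y₂.comp X₂) := by
  have h := hD.sum_comp Y₁.hom X₁.hom Y₂.hom X₂.hom Y₁.val X₁.val Y₂.val X₂.val
  exact (comp_mk (AsympIso.prod_comp _ _ _ _) (Y₁.sum Y₂).val (X₁.sum X₂).val).symm.trans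
    (congrArg (Mor.mk _) h)

lemma sum_comp_sum_of_left {N₁ M₁ L₁ N₂ M₂ L₂ : ProjMod R} (Y₁ : Mor D M₁ L₁) (X₁ : Mor D N₁ M₁)
    {Y₂ : Mor D M₂ L₂} (X₂ : Mor D N₂ M₂) (h : Y₂.deg = 0) :
    (Y₁.sum Y₂).comp (X₁.sum X₂) = (Y₁.comp X₁).sum (Y₂.comp X₂) := by
  rw [sum_comp_sum hD, h, zero_mul, sgn_zero, one_smul]

lemma sum_comp_sum_of_right {N₁ M₁ L₁ N₂ M₂ L₂ : ProjMod R} (Y₁ : Mor D M₁ L₁) {X₁ : Mor D N₁ M₁}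
    (Y₂ : Mor D M₂ L₂) (X₂ : Mor D N₂ M₂) (h : X₁.deg = 0) :
    (Y₁.sum Y₂).comp (X₁.sum X₂) = (Y₁.comp X₁).sum (Y₂.comp X₂) := by
  rw [sum_comp_sum hD, h, mul_zero, sgn_zero, one_smul]

lemma triv_sum_triv {N₁ M₁ N₂ M₂ : ProjMod R} (e₁ : N₁ ≃ₗ[R] M₁) (e₂ : N₂ ≃ₗ[R] M₂) :
    (triv D e₁).sum (triv D e₂) =
      triv D (N := N₁.prod N₂) (M := M₁.prod M₂) (e₁.prodCongr e₂) :=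
  congrArg (Mor.mk _) (hD.sum_triv e₁ e₂)

lemma one_sum_one : (one D N).sum (one D M) = one D (N.prod M) := triv_sum_triv hD _ _

end Laws

/-- `X` and `X'` correspond to each other under isomorphisms `α`, `β` of their targets and
sources. -/
def Sim {N M N' M' : ProjMod R} (α : M ≃ₗ[R] M') (β : N ≃ₗ[R] N') (X : Mor D N M)
    (X' : Mor D N' M') : Prop :=
  (triv D α).comp X = X'.comp (triv D β)

lemma Sim.of_transports {N M N' M' : ProjMod R} {α : M ≃ₗ[R] M'} {β : N ≃ₗ[R] N'}
    {f : AsympIso N M} {f' : AsympIso N' M'} {x : D.line f} {x' : D.line f'}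
    (h : D.Transports α β x x') : Sim α β (⟨f, x⟩ : Mor D N M) ⟨f', x'⟩ := by
  obtain ⟨h, hx⟩ := h
  exact (congrArg (Mor.mk _) hx).trans (comp_mk h _ _)

lemma Sim.smul {N M N' M' : ProjMod R} {α : M ≃ₗ[R] M'} {β : N ≃ₗ[R] N'} {X : Mor D N M}
    {X' : Mor D N' M'} (r : R) (h : Sim α β X X') : Sim α β (r • X) (r • X') := by
  change _ = _
  rw [comp_smul, h, smul_comp]

section SimLaws

variable (hD : D.IsDet) {N' M' N'' M'' : ProjMod R} {α : M ≃ₗ[R] M'} {β : N ≃ₗ[R] N'}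
  {X : Mor D N M} {X' : Mor D N' M'}
include hD

lemma Sim.symm (h : Sim α β X X') : Sim α.symm β.symm X' X := by
  have h1 : (triv D α.symm).comp (((triv D α).comp X).comp (triv D β.symm)) =
      (triv D α.symm).comp ((X'.comp (triv D β)).comp (triv D β.symm)) := by rw [h]
  rw [comp_assoc hD, ← comp_assoc hD, triv_symm_comp_triv hD, one_comp hD, comp_assoc hD,
    triv_comp_triv_symm hD, comp_one hD] at h1
  exact h1.symm

lemma Sim.trans {α' : M' ≃ₗ[R] M''} {β' : N' ≃ₗ[R] N''} {X'' : Mor D N'' M''} (h : Sim α β X X')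
    (h' : Sim α' β' X' X'') : Sim (α.trans α') (β.trans β') X X'' := by
  change _ = _
  rw [← triv_comp_triv hD, comp_assoc hD, h, ← comp_assoc hD, h', comp_assoc hD, triv_comp_triv hD]

lemma Sim.sum {N₂ M₂ N₂' M₂' : ProjMod R} {α₂ : M₂ ≃ₗ[R] M₂'} {β₂ : N₂ ≃ₗ[R] N₂'}
    {X₂ : Mor D N₂ M₂} {X₂' : Mor D N₂' M₂'} (h : Sim α β X X') (h₂ : Sim α₂ β₂ X₂ X₂') :
    Sim (M := M.prod M₂) (M' := M'.prod M₂') (N := N.prod N₂) (N' := N'.prod N₂')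
      (α.prodCongr α₂) (β.prodCongr β₂) (X.sum X₂) (X'.sum X₂') := by
  change _ = _
  rw [← triv_sum_triv hD, ← triv_sum_triv hD, sum_comp_sum_of_left hD _ _ _ (deg_triv _), h, h₂,
    sum_comp_sum_of_right hD _ _ _ (deg_triv _)]

lemma Sim.refl (X : Mor D N M) : Sim (LinearEquiv.refl R M) (LinearEquiv.refl R N) X X :=
  (one_comp hD X).trans (comp_one hD X).symm

/-- Elements that correspond to each other under isomorphisms are conjugate by the determinants of
these isomorphisms. -/
lemma Sim.eq (h : Sim α β X X') : X' = ((triv D α).comp X).comp (triv D β.symm) := by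
  rw [h, comp_assoc hD, triv_comp_triv_symm hD, comp_one hD]

lemma sim_triv (e : N ≃ₗ[R] M) {e' : N' ≃ₗ[R] M'} (h : ∀ x, α (e x) = e' (β x)) :
    Sim α β (triv D e) (triv D e') := by
  change _ = _
  rw [triv_comp_triv hD, triv_comp_triv hD]
  congr 1
  exact LinearEquiv.ext h

variable {N₁ M₁ N₂ M₂ N₃ M₃ N₄ M₄ : ProjMod R}

lemma sim_assoc (X : Mor D N₁ M₁) (Y : Mor D N₂ M₂) (Z : Mor D N₃ M₃) :
    Sim (M := (M₁.prod M₂).prod M₃) (M' := M₁.prod (M₂.prod M₃))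
      (N := (N₁.prod N₂).prod N₃) (N' := N₁.prod (N₂.prod N₃)) (LinearEquiv.prodAssoc R M₁ M₂ M₃)
      (LinearEquiv.prodAssoc R N₁ N₂ N₃) ((X.sum Y).sum Z) (X.sum (Y.sum Z)) :=
  .of_transports (hD.sum_assoc _ _ _ X.val Y.val Z.val)

lemma sim_comm (X : Mor D N₁ M₁) (Y : Mor D N₂ M₂) :
    Sim (M := M₁.prod M₂) (M' := M₂.prod M₁) (N := N₁.prod N₂) (N' := N₂.prod N₁)
      (LinearEquiv.prodComm R M₁ M₂) (LinearEquiv.prodComm R N₁ N₂) (X.sum Y)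
      (sgn (X.deg * Y.deg) • Y.sum X) :=
  .of_transports (hD.sum_comm _ _ X.val Y.val)

lemma sim_rightComm (X : Mor D N₁ M₁) (Y : Mor D N₂ M₂) (Z : Mor D N₃ M₃) :
    Sim (rightComm M₁ M₂ M₃) (rightComm N₁ N₂ N₃) ((X.sum Y).sum Z)
      (sgn (Y.deg * Z.deg) • (X.sum Z).sum Y) := by
  have h := ((sim_assoc hD X Y Z).trans hD ((Sim.refl hD X).sum hD (sim_comm hD Y Z))).trans hD
    (M'' := (M₁.prod M₃).prod M₂) (N'' := (N₁.prod N₃).prod N₂)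
    (X'' := sgn (Y.deg * Z.deg) • (X.sum Z).sum Y)
    (α' := (LinearEquiv.prodAssoc R M₁ M₃ M₂).symm)
    (β' := (LinearEquiv.prodAssoc R N₁ N₃ N₂).symm) (by
      rw [sum_smul]
      exact ((sim_assoc hD X Z Y).symm hD).smul _)
  exact h

lemma sim_middleFour (X : Mor D N₁ M₁) (Y : Mor D N₂ M₂) (Z : Mor D N₃ M₃) (W : Mor D N₄ M₄) :
    Sim (M := (M₁.prod M₂).prod (M₃.prod M₄)) (M' := (M₁.prod M₃).prod (M₂.prod M₄))
      (N := (N₁.prod N₂).prod (N₃.prod N₄)) (N' := (N₁.prod N₃).prod (N₂.prod N₄))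
      (LinearEquiv.prodProdProdComm R M₁ M₂ M₃ M₄) (LinearEquiv.prodProdProdComm R N₁ N₂ N₃ N₄)
      ((X.sum Y).sum (Z.sum W)) (sgn (Y.deg * Z.deg) • (X.sum Z).sum (Y.sum W)) := by
  have h := (((sim_assoc hD (X.sum Y) Z W).symm hD).trans hD
    ((sim_rightComm hD X Y Z).sum hD (Sim.refl hD W))).trans hD
    (M'' := (M₁.prod M₃).prod (M₂.prod M₄)) (N'' := (N₁.prod N₃).prod (N₂.prod N₄))
    (X'' := sgn (Y.deg * Z.deg) • (X.sum Z).sum (Y.sum W))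
    (α' := LinearEquiv.prodAssoc R (M₁ × M₃) M₂ M₄)
    (β' := LinearEquiv.prodAssoc R (N₁ × N₃) N₂ N₄) (by
      rw [smul_sum]
      exact (sim_assoc hD (X.sum Z) Y W).smul _)
  exact h

end SimLaws

end Mor

/-! ### The correspondence defined by a resolution -/

section ZeroIso

variable {R : Type u} [CommRing R]

/-- All asymptotic morphisms into a module of finite rank agree. -/
lemma AsympIso.eq_of_finite {N M : ProjMod R} [Module.Finite R M] (f g : AsympIso N M) : f = g := by
  refine AsympIso.ext ?_
  obtain ⟨f', hf⟩ : ∃ f' : N →ₗ[R] M, AsymHom.mk f' = f.hom := Submodule.Quotient.mk_surjective _ _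
  obtain ⟨g', hg⟩ : ∃ g' : N →ₗ[R] M, AsymHom.mk g' = g.hom := Submodule.Quotient.mk_surjective _ _
  rw [← hf, ← hg]
  exact AsymHom.mk_eq_of_sub_mem Module.Finite.fg_top fun _ => Submodule.mem_top

/-- The zero map between modules of finite rank is an invertible asymptotic morphism. -/
def zeroIso (N M : ProjMod R) [Module.Finite R N] [Module.Finite R M] : AsympIso N M where
  hom := AsymHom.mk 0
  exists_inv := ⟨AsymHom.mk 0,
    AsymHom.mk_eq_of_sub_mem Module.Finite.fg_top fun _ => Submodule.mem_top,
    AsymHom.mk_eq_of_sub_mem Module.Finite.fg_top fun _ => Submodule.mem_top⟩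

/-- A resolution `e` of `f` identifies `f ⊕ 1_A` with the composite of `e` and `1_M ⊕ 0`, for the
zero map from `B` to `A`. -/
lemma IsRes.prod_one {N M A B : ProjMod R} [Module.Finite R A] [Module.Finite R B]
    {f : AsympIso N M} {e : (N.prod A) ≃ₗ[R] (M.prod B)} (h : IsRes f e) :
    f.prod (AsympIso.ofEquiv (LinearEquiv.refl R A)) =
      ((AsympIso.ofEquiv (LinearEquiv.refl R M)).prod (zeroIso B A)).comp (AsympIso.ofEquiv e) := by
  refine AsympIso.ext ?_
  change f.hom.prod _ = _
  rw [← h]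
  let t : A →ₗ[R] M × A :=
    (-(LinearMap.fst R M B ∘ₗ e.toLinearMap ∘ₗ LinearMap.inr R N A)).prod LinearMap.id
  refine AsymHom.mk_eq_of_sub_mem (N := N.prod A) (M := M.prod A) (T := LinearMap.range t)
    (Module.Finite.iff_fg.1 inferInstance) fun x => ⟨x.2, ?_⟩
  change (-(e (0, x.2)).1, x.2) = ((e (x.1, 0)).1 - (e x).1, x.2 - 0)
  have h3 : x = (x.1, 0) + (0, x.2) := by simp
  rw [sub_zero]
  conv_rhs => rw [h3, map_add]
  simp

end ZeroIso

namespace Mor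

variable {D : DetData.{u}} {R : Type u} [CommRing R]

section Finite

variable {N M L : ProjMod R} [Module.Finite R N] [Module.Finite R M] [Module.Finite R L]

/-- The map `det N → det M` corresponding to an element of the determinant line, in finite rank. -/
def finVal (X : Mor D N M) : detTop N →ₗ[R] detTop M := contract (D.fin X.hom X.val)

variable (D) in
/-- The element of the determinant line corresponding to a map `det N → det M`. -/
def finMor (ξ : detTop N →ₗ[R] detTop M) : Mor D N M :=
  ⟨zeroIso N M, (D.fin (zeroIso N M)).symm ((contractEquiv (detTop M) (detTop N)).symm ξ)⟩

lemma finVal_finMor (ξ : detTop N →ₗ[R] detTop M) : (finMor D ξ).finVal = ξ := by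
  change contract (D.fin (zeroIso N M) ((D.fin (zeroIso N M)).symm _)) = ξ
  rw [LinearEquiv.apply_symm_apply, ← contractEquiv_apply, LinearEquiv.apply_symm_apply]

lemma finVal_injective {X X' : Mor D N M} (h : X.finVal = X'.finVal) : X = X' := by
  obtain ⟨f, x⟩ := X
  obtain ⟨f', x'⟩ := X'
  obtain rfl := AsympIso.eq_of_finite f f'
  have h1 := (contractEquiv (detTop M) (detTop N)).injective
    ((contractEquiv_apply _).trans (h.trans (contractEquiv_apply _).symm))
  exact congrArg (Mor.mk f) ((D.fin f).injective h1)

lemma eq_finMor_iff {X : Mor D N M} {ξ : detTop N →ₗ[R] detTop M} :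
    X = finMor D ξ ↔ X.finVal = ξ :=
  ⟨fun h => by rw [h, finVal_finMor], fun h => finVal_injective (by rw [finVal_finMor, h])⟩

lemma deg_of_finite (X : Mor D N M) : X.deg = rk M - rk N := D.fin_deg X.hom

lemma finVal_smul (r : R) (X : Mor D N M) : (r • X).finVal = r • X.finVal := by
  change contract (D.fin X.hom (r • X.val)) = _
  rw [map_smul, map_smul]
  rfl

lemma finMor_smul (r : R) (ξ : detTop N →ₗ[R] detTop M) : finMor D (r • ξ) = r • finMor D ξ := by
  rw [eq_comm, eq_finMor_iff, finVal_smul, finVal_finMor]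

variable (hD : D.IsDet)
include hD

lemma finVal_comp (Y : Mor D M L) (X : Mor D N M) :
    (Y.comp X).finVal = Y.finVal ∘ₗ X.finVal := hD.fin_comp Y.hom X.hom Y.val X.val

lemma finVal_triv (e : N ≃ₗ[R] M) : (triv D e).finVal = detMap e := hD.fin_triv e

lemma finVal_one : (one D N).finVal = LinearMap.id := by
  rw [one, finVal_triv hD, detMap_refl]

lemma finVal_sum_wedge {N₂ M₂ : ProjMod R} [Module.Finite R N₂] [Module.Finite R M₂]
    (X : Mor D N M) (Y : Mor D N₂ M₂) (a : detTop N) (b : detTop N₂) :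
    (X.sum Y).finVal (wedge a b) =
      sgn ((rk M₂ - rk N₂) * rk N) • wedge (X.finVal a) (Y.finVal b) :=
  hD.fin_sum X.hom Y.hom X.val Y.val a b

lemma finMor_comp (ξ : detTop M →ₗ[R] detTop L) (η : detTop N →ₗ[R] detTop M) :
    finMor D (ξ ∘ₗ η) = (finMor D ξ).comp (finMor D η) := by
  rw [eq_comm, eq_finMor_iff, finVal_comp hD, finVal_finMor, finVal_finMor]

lemma finMor_detMap (e : N ≃ₗ[R] M) : finMor D (detMap e) = triv D e := by
  rw [eq_comm, eq_finMor_iff, finVal_triv hD]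

lemma finMor_id : finMor D (LinearMap.id : detTop N →ₗ[R] detTop N) = one D N := by
  rw [eq_comm, eq_finMor_iff, finVal_one hD]

lemma finVal_sum_one (X : Mor D N M) (C : ProjMod R) [Module.Finite R C] :
    (X.sum (one D C)).finVal = rstab C X.finVal :=
  detTop_hom_ext fun a c => by
    rw [finVal_sum_wedge hD, sub_self, zero_mul, sgn_zero, one_smul, rstab_wedge, finVal_one hD,
      LinearMap.id_apply]

lemma finMor_sum_one (ξ : detTop N →ₗ[R] detTop M) (C : ProjMod R) [Module.Finite R C] :
    (finMor D ξ).sum (one D C) = finMor D (rstab C ξ) := by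
  rw [eq_finMor_iff, finVal_sum_one hD, finVal_finMor]

lemma one_sum_finMor_of_rk_eq (ξ : detTop N →ₗ[R] detTop M) (C : ProjMod R) [Module.Finite R C]
    (h : rk M = rk N) : (one D C).sum (finMor D ξ) = finMor D (lstab C ξ) := by
  rw [eq_finMor_iff]
  refine detTop_hom_ext fun c a => ?_
  rw [finVal_sum_wedge hD, h, sub_self, zero_mul, sgn_zero, one_smul, finVal_finMor, lstab_wedge,
    finVal_one hD, LinearMap.id_apply]

/-- The sum of elements in finite rank, in terms of the external product `box`. The sign passes from
the degree convention of the theory to that of `box`. -/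
lemma finMor_sum_finMor {N₂ M₂ : ProjMod R} [Module.Finite R N₂] [Module.Finite R M₂]
    (ξ : detTop N →ₗ[R] detTop M) (η : detTop N₂ →ₗ[R] detTop M₂) :
    (finMor D ξ).sum (finMor D η) =
      finMor D (sgn ((rk M₂ - rk N₂) * (rk N + rk M)) • box ξ η) := by
  rw [eq_finMor_iff]
  refine detTop_hom_ext fun a b => ?_
  rw [finVal_sum_wedge hD, LinearMap.smul_apply, box_wedge, finVal_finMor, finVal_finMor,
    smul_smul, ← sgn_add]
  congr 1
  refine sgn_eq_sgn (w := (rk M₂ - rk N₂) * (rk N + rk M)) ?_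
  ring

end Finite

section Rel

variable {N M A B : ProjMod R} [Module.Finite R A] [Module.Finite R B]

/-- The element `X` of `det (M, N, f)` corresponds to `ξ : det B → det A` under the resolution
`e : N × A ≃ M × B`. -/
def Rel (e : (N.prod A) ≃ₗ[R] (M.prod B)) (X : Mor D N M) (ξ : detTop B →ₗ[R] detTop A) : Prop :=
  X.sum (one D A) = ((one D M).sum (finMor D ξ)).comp (triv D e)

variable (D) in
/-- The correspondence defined by a resolution, as an isomorphism: summing with `1_A`, and composing
the sum of `1_M` and an element of `det A / det B` with `det e`, are bijective. -/
def relEquiv {f : AsympIso N M} {e : (N.prod A) ≃ₗ[R] (M.prod B)} (h : IsRes f e) :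
    D.line f ≃ₗ[R] (detTop B →ₗ[R] detTop A) :=
  let S := (tmulTriv D (LinearEquiv.refl R A) (D.line f)).trans (D.sum _ _).toEquiv
  let T₁ := (contractEquiv (detTop A) (detTop B)).symm.trans (D.fin (zeroIso B A)).symm
  let T₂ := (trivTmul D (LinearEquiv.refl R M) (D.line (zeroIso B A))).trans (D.sum _ _).toEquiv
  let T₃ := (tmulTriv D (M := M.prod B) e (D.line _)).trans (D.comp h.prod_one).toEquiv
  S.trans (T₁.trans (T₂.trans T₃)).symm

lemma rel_iff {f : AsympIso N M} {e : (N.prod A) ≃ₗ[R] (M.prod B)} (h : IsRes f e) (x : D.line f)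
    (ξ : detTop B →ₗ[R] detTop A) : Rel e (⟨f, x⟩ : Mor D N M) ξ ↔ relEquiv D h x = ξ := by
  rw [relEquiv, LinearEquiv.trans_apply, LinearEquiv.symm_apply_eq]
  have h1 := comp_mk h.prod_one ((one D M).sum (finMor D ξ)).val (triv D (M := M.prod B) e).val
  change _ = ((one D M).sum (finMor D ξ)).comp (triv D e) at h1
  rw [Rel, ← h1]
  exact ⟨fun H => mk_inj H, fun H => congrArg (Mor.mk _) H⟩

lemma exists_rel {f : AsympIso N M} {e : (N.prod A) ≃ₗ[R] (M.prod B)} (h : IsRes f e)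
    (x : D.line f) : ∃ ξ, Rel e (⟨f, x⟩ : Mor D N M) ξ := ⟨_, (rel_iff h x _).2 rfl⟩

lemma exists_rel' {f : AsympIso N M} {e : (N.prod A) ≃ₗ[R] (M.prod B)} (h : IsRes f e)
    (ξ : detTop B →ₗ[R] detTop A) : ∃ x, Rel e (⟨f, x⟩ : Mor D N M) ξ :=
  ⟨(relEquiv D h).symm ξ, (rel_iff h _ _).2 ((relEquiv D h).apply_symm_apply ξ)⟩

lemma Rel.unique {f : AsympIso N M} {e : (N.prod A) ≃ₗ[R] (M.prod B)} (h : IsRes f e)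
    {x x' : D.line f} {ξ : detTop B →ₗ[R] detTop A} (hx : Rel e (⟨f, x⟩ : Mor D N M) ξ)
    (hx' : Rel e (⟨f, x'⟩ : Mor D N M) ξ) : x = x' :=
  (relEquiv D h).injective (((rel_iff h x ξ).1 hx).trans ((rel_iff h x' ξ).1 hx').symm)

lemma deg_line_of_isRes {f : AsympIso N M} {e : (N.prod A) ≃ₗ[R] (M.prod B)} (h : IsRes f e) :
    (D.line f).deg = rk A - rk B := by
  obtain ⟨x, hx⟩ := exists_rel' (D := D) h 0
  have h1 := congrArg deg hx
  rw [deg_sum, deg_comp, deg_sum, deg_one, deg_one, deg_triv, add_zero, add_zero, zero_add] at h1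
  exact h1.trans (deg_of_finite (finMor D (0 : detTop B →ₗ[R] detTop A)))

end Rel

section Moves

variable {N M A B : ProjMod R} [Module.Finite R A] [Module.Finite R B]
  {e : (N.prod A) ≃ₗ[R] (M.prod B)} {X : Mor D N M} (hD : D.IsDet)
include hD

/-- Adding the identity of `C` to a resolution. -/
lemma Rel.stab (C : ProjMod R) [Module.Finite R C] {ξ : detTop B →ₗ[R] detTop A}
    (hX : Rel e X ξ) : Rel (RelDet.stab e C) X (rstab C ξ) := by
  have h1 := sim_assoc hD X (one D A) (one D C)
  have h2 := sim_assoc hD (one D M) (finMor D ξ) (one D C)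
  rw [hX] at h1
  rw [finMor_sum_one hD] at h2
  have h3 : (((one D M).sum (finMor D ξ)).comp (triv D e)).sum (one D C) =
      (((one D M).sum (finMor D ξ)).sum (one D C)).comp ((triv D e).sum (one D C)) := by
    rw [sum_comp_sum_of_left hD _ _ _ deg_one, one_comp hD]
  change _ = _
  have h4 : (triv D e).sum (one D C) = triv D (N := (N.prod A).prod C) (M := (M.prod B).prod C)
      (e.prodCongr (LinearEquiv.refl R C)) := triv_sum_triv hD _ _
  rw [one_sum_one hD] at h1
  rw [h1.eq hD, h3, ← comp_assoc hD, h2, comp_assoc hD, comp_assoc hD, h4, triv_comp_triv hD,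
    triv_comp_triv hD]
  rfl

lemma Rel.of_stab (C : ProjMod R) [Module.Finite R C] {ξ : detTop B →ₗ[R] detTop A}
    (h : IsRes X.hom e) (hX : Rel (RelDet.stab e C) X (rstab C ξ)) : Rel e X ξ := by
  obtain ⟨x, hx⟩ := exists_rel' (D := D) h ξ
  have h1 : x = X.val := Rel.unique (h.stab C) (hx.stab hD C) hX
  rwa [h1] at hx

/-- Replacing the auxiliary module on the side of `N` by an isomorphic one. -/
lemma Rel.perm {A' : ProjMod R} [Module.Finite R A'] {e' : (N.prod A') ≃ₗ[R] (M.prod B)}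
    {ξ : detTop B →ₗ[R] detTop A} (α : A ≃ₗ[R] A') (he : ∀ n a, e' (n, α a) = e (n, a))
    (hX : Rel e X ξ) : Rel e' X (detMap α ∘ₗ ξ) := by
  have h1 : Sim (M := M.prod A) (M' := M.prod A') (N := N.prod A) (N' := N.prod A')
      ((LinearEquiv.refl R M).prodCongr α) ((LinearEquiv.refl R N).prodCongr α)
      (X.sum (one D A)) (X.sum (one D A')) :=
    (Sim.refl hD X).sum hD (sim_triv hD (LinearEquiv.refl R A) (e' := LinearEquiv.refl R A')
      fun _ => rfl)
  change _ = _
  rw [h1.eq hD, hX, finMor_comp hD, finMor_detMap hD, ← triv_sum_triv hD, ← comp_assoc hD,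
    sum_comp_sum_of_left hD _ _ _ (deg_triv _), comp_assoc hD, triv_comp_triv hD]
  congr 2
  · exact one_comp hD _
  · refine LinearEquiv.ext fun x => ?_
    change e (x.1, α.symm x.2) = e' x
    rw [← he, LinearEquiv.apply_symm_apply]

/-- Composition corresponds to composition of maps of determinants, up to the sign of exchanging `Y`
with the element `ξ`. -/
lemma Rel.comp {L C : ProjMod R} [Module.Finite R C] {e₂ : (M.prod B) ≃ₗ[R] (L.prod C)}
    {e' : (N.prod A) ≃ₗ[R] (L.prod C)} {Y : Mor D M L} {ξ : detTop B →ₗ[R] detTop A}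
    {η : detTop C →ₗ[R] detTop B} (he : ∀ x, e' x = e₂ (e x)) (hX : Rel e X ξ) (hY : Rel e₂ Y η) :
    Rel e' (Y.comp X) (sgn ((rk A - rk B) * Y.deg) • (ξ ∘ₗ η)) := by
  have h1 : (Y.sum (one D A)).comp ((one D M).sum (finMor D ξ)) = sgn ((rk A - rk B) * Y.deg) •
      ((one D L).sum (finMor D ξ)).comp (Y.sum (one D B)) := by
    rw [sum_comp_sum_of_left hD _ _ _ deg_one, sum_comp_sum hD, deg_of_finite (finMor D ξ),
      smul_smul, sgn_mul_self, one_smul, comp_one hD, one_comp hD, one_comp hD, comp_one hD]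
  have h2 : triv D (N := N.prod A) (M := L.prod C) e' = (triv D e₂).comp (triv D e) := by
    rw [triv_comp_triv hD]
    congr 1
    exact LinearEquiv.ext he
  change _ = _
  have h3 : (Y.comp X).sum (one D A) = (Y.sum (one D A)).comp (X.sum (one D A)) := by
    rw [sum_comp_sum_of_left hD _ _ _ deg_one, one_comp hD]
  have h4 : (Y.sum (one D B)).comp (triv D e) =
      ((one D L).sum (finMor D η)).comp (triv D (N := N.prod A) (M := L.prod C) e') := by
    rw [h2, ← comp_assoc hD, ← hY]
  rw [h3, hX, ← comp_assoc hD, h1, smul_comp, comp_assoc hD, h4, ← comp_assoc hD,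
    sum_comp_sum_of_right hD _ _ _ deg_one, one_comp hD, finMor_smul, sum_smul, smul_comp,
    finMor_comp hD]

/-- The determinant of an isomorphism corresponds to the identity. -/
lemma rel_triv (e : N ≃ₗ[R] M) (A : ProjMod R) [Module.Finite R A] :
    Rel (A := A) (B := A) (e.prodCongr (LinearEquiv.refl R A)) (triv D e) LinearMap.id := by
  change _ = _
  rw [finMor_id hD, one_sum_one hD, one_comp hD]
  exact triv_sum_triv hD _ _

end Moves

end Mor

/-! ### Determinants of shears and of isomorphisms close to the identity -/

section ShearDeterminants

variable {R : Type u} [CommRing R]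

/-- The automorphism `(m, k) ↦ (m, k + t m)` of `M × K`. -/
def shear {M K : ProjMod R} (t : M →ₗ[R] K) : (M.prod K) ≃ₗ[R] (M.prod K) :=
  (LinearEquiv.refl R M).skewProd (LinearEquiv.refl R K) t

namespace Mor

variable {D : DetData.{u}} (hD : D.IsDet)

section Shear

/-- As an asymptotic morphism a shear is the identity, so its determinant is a multiple of the
trivial one. -/
lemma exists_triv_shear {M K : ProjMod R} [Module.Finite R K] (t : M →ₗ[R] K) :
    ∃ r : R, triv D (shear t) = r • one D (M.prod K) := by
  have h : AsympIso.ofEquiv (N := M.prod K) (M := M.prod K) (shear t) =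
      AsympIso.ofEquiv (N := M.prod K) (M := M.prod K) (LinearEquiv.refl R (M × K)) := by
    refine AsympIso.ext ?_
    refine AsymHom.mk_eq_of_sub_mem (N := M.prod K) (M := M.prod K)
      (T := LinearMap.range (LinearMap.inr R M K)) (Module.Finite.iff_fg.1 inferInstance)
      fun x => ⟨t x.1, ?_⟩
    change (0, t x.1) = (x.1 - x.1, x.2 + t x.1 - x.2)
    rw [sub_self, add_sub_cancel_left]
  exact (existsUnique_smul_triv (X := triv D (shear t)) (LinearEquiv.refl R (M.prod K)) h).exists

include hD

lemma triv_conj {X Y : ProjMod R} {w : X ≃ₗ[R] X} {w' : Y ≃ₗ[R] Y} (v : X ≃ₗ[R] Y)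
    (h : ∀ x, w' (v x) = v (w x)) {r : R} (hr : triv D w = r • one D X) :
    triv D w' = r • one D Y := by
  have h1 : w' = (v.symm.trans w).trans v := LinearEquiv.ext fun y => by
    obtain ⟨x, rfl⟩ := v.surjective y
    rw [h, LinearEquiv.trans_apply, LinearEquiv.trans_apply, LinearEquiv.symm_apply_apply]
  rw [h1, ← triv_comp_triv hD, ← triv_comp_triv hD, hr, smul_comp, one_comp hD, comp_smul,
    triv_comp_triv_symm hD]

lemma triv_shear_of_equiv {M K K' : ProjMod R} {t : M →ₗ[R] K} {t' : M →ₗ[R] K'} (α : K ≃ₗ[R] K')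
    (h : ∀ m, t' m = α (t m)) {r : R} (hr : triv D (shear t) = r • one D (M.prod K)) :
    triv D (shear t') = r • one D (M.prod K') :=
  triv_conj hD (X := M.prod K) (Y := M.prod K') ((LinearEquiv.refl R M).prodCongr α) (fun x =>
    Prod.ext rfl (by
      change α x.2 + t' x.1 = α (x.2 + t x.1)
      rw [h, map_add])) hr

lemma triv_shear_prod_zero {M K K' : ProjMod R} {t : M →ₗ[R] K} {r : R}
    (hr : triv D (shear t) = r • one D (M.prod K)) :
    triv D (shear (K := K.prod K') (t.prod 0)) = r • one D (M.prod (K.prod K')) := by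
  refine triv_conj hD (X := (M.prod K).prod K') (Y := M.prod (K.prod K'))
    (LinearEquiv.prodAssoc R M K K')
    (w := (shear t).prodCongr (LinearEquiv.refl R K')) (fun x => ?_) ?_
  · change (x.1.1, (x.1.2, x.2) + (t x.1.1, (0 : K'))) = (x.1.1, (x.1.2 + t x.1.1, x.2))
    rw [Prod.mk_add_mk, add_zero]
  · rw [← triv_sum_triv hD, hr, smul_sum]
    exact congrArg (r • ·) (one_sum_one hD)

/-- Shears into a module of finite rank have determinant `1`. For the shears by `(t, 0)`, `(0, t)`
and `(t, t)` into `K × K` are conjugate, and the last is the composition of the others. -/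
lemma triv_shear {M K : ProjMod R} [Module.Finite R K] (t : M →ₗ[R] K) :
    triv D (shear t) = one D (M.prod K) := by
  obtain ⟨r, hr⟩ := exists_triv_shear (D := D) t
  have h1 := triv_shear_prod_zero hD (K' := K) hr
  have h2 := triv_shear_of_equiv hD (K' := K.prod K) (t' := (0 : M →ₗ[R] K).prod t)
    (LinearEquiv.prodComm R K K) (fun m => rfl) h1
  let α : (K.prod K) ≃ₗ[R] (K.prod K) := shear LinearMap.id
  have h3 := triv_shear_of_equiv hD (K := K.prod K) (K' := K.prod K) (t := t.prod 0)
    (t' := t.prod t) α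
    (fun m => Prod.ext (α := K) (β := K) rfl (zero_add (t m)).symm) h1
  have h4 : triv D (shear (K := K.prod K) (t.prod t)) =
      (triv D (shear (K := K.prod K) (t.prod 0))).comp
        (triv D (shear (K := K.prod K) ((0 : M →ₗ[R] K).prod t))) := by
    rw [triv_comp_triv hD]
    congr 1
    refine LinearEquiv.ext fun x => ?_
    change (x.1, x.2 + (t x.1, t x.1)) = (x.1, x.2 + ((0 : K), t x.1) + (t x.1, (0 : K)))
    rw [add_assoc, Prod.mk_add_mk (0 : K), zero_add, add_zero]
  rw [h1, h2, h3, smul_comp, one_comp hD, smul_smul] at h4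
  -- an idempotent among the invertible elements of the line is trivial
  have h5 : r = r * r := (existsUnique_smul_triv (D := D) (X := r • one D (M.prod (K.prod K)))
    (LinearEquiv.refl R _) rfl).unique rfl h4
  have h6 : (triv D (shear t)).comp (triv D (shear t)) = triv D (shear t) := by
    rw [hr, smul_comp, one_comp hD, smul_smul, ← h5]
  rw [← comp_one hD (triv D (shear t)), ← triv_comp_triv_symm hD (shear t), ← comp_assoc hD, h6]

end Shear

section Fred

variable {M P Q : ProjMod R} [Module.Finite R P] [Module.Finite R Q]
  {w : (M.prod P) ≃ₗ[R] (M.prod Q)}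

/-- As an asymptotic morphism, `w` is the sum of the identity of `M` and the zero map from `P` to
`Q`. -/
lemma ofEquiv_eq_of_isFred (hw : IsFred w) : AsympIso.ofEquiv (N := M.prod P) (M := M.prod Q) w =
    (AsympIso.ofEquiv (LinearEquiv.refl R M)).prod (zeroIso P Q) := by
  obtain ⟨T, hT, h⟩ := hw
  refine AsympIso.ext ?_
  have hQ : (⊤ : Submodule R Q).FG := Module.Finite.fg_top
  refine AsymHom.mk_eq_of_sub_mem (N := M.prod P) (M := M.prod Q) (hT.prod hQ)
    fun x => ⟨h x, trivial⟩

include hD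

/-- The determinant of a compression, which is an isomorphism of modules of finite rank. -/
lemma triv_cmp (hw : IsFred w) {F : ProjMod R} [Module.Finite R F] {p : M →ₗ[R] F}
    {s : F →ₗ[R] M} (h : Good w p s) :
    triv D (N := F.prod P) (M := F.prod Q) (cmp h) = (one D F).sum (finMor D (fdet w)) := by
  rw [one_sum_finMor_of_rk_eq hD _ _ (rk_eq_of_isFred hw).symm, ← finMor_detMap hD]
  congr 1
  refine detTop_hom_ext fun φ a => ?_
  rw [hasRelDet_cmp hw h, lstab_wedge]

/-- The determinant of an isomorphism that differs from the identity of `M` by a map with image in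
a finitely generated submodule. Enlarging `M` by a module `F` through which this difference
factors, it is conjugate to the product of a shear and the compression of `w` to `F`. -/
lemma triv_eq_of_isFred (hw : IsFred w) :
    triv D (N := M.prod P) (M := M.prod Q) w = (one D M).sum (finMor D (fdet w)) := by
  obtain ⟨F, _, p, s, h⟩ := hw.exists_good
  have hdeg : (finMor D (fdet w)).deg = 0 := by
    rw [deg_of_finite (finMor D (fdet w)), rk_eq_of_isFred hw, sub_self]
  -- `U` is the shear by `s : F → M` followed by the shear by `-p : M → F`. It conjugates the sum
  -- `W` of `w` and the identity of `F` into `V`, the compression of `w` followed by the shear by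
  -- `τ`.
  let U : (M.prod F) ≃ₗ[R] (M.prod F) := (((LinearEquiv.prodComm R M F).trans
    ((LinearEquiv.refl R F).skewProd (LinearEquiv.refl R M) s)).trans
      (LinearEquiv.prodComm R F M)).trans (shear (-p))
  have hU : ∀ m φ, U (m, φ) = (m + s φ, φ - p (m + s φ)) := fun m φ =>
    Prod.ext rfl (sub_eq_add_neg _ _).symm
  let W : ((M.prod F).prod P) ≃ₗ[R] ((M.prod F).prod Q) :=
    ((rightComm M P F).symm.trans (w.prodCongr (LinearEquiv.refl R F))).trans (rightComm M Q F)
  let τ : M →ₗ[R] F × Q := (p ∘ₗ (LinearMap.fst R M Q ∘ₗ w.toLinearMap ∘ₗ LinearMap.inl R M P -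
    LinearMap.id)).prod (LinearMap.snd R M Q ∘ₗ w.toLinearMap ∘ₗ LinearMap.inl R M P)
  let V : (M.prod (F.prod P)) ≃ₗ[R] (M.prod (F.prod Q)) :=
    ((LinearEquiv.refl R M).prodCongr (cmp h)).trans (shear (K := F.prod Q) τ)
  have hV : triv D (N := M.prod (F.prod P)) (M := M.prod (F.prod Q)) V =
      (one D M).sum ((one D F).sum (finMor D (fdet w))) := by
    have h1 := triv_comp_triv (D := D) hD (N := M.prod (F.prod P)) (M := M.prod (F.prod Q))
      (L := M.prod (F.prod Q)) (shear (K := F.prod Q) τ)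
      ((LinearEquiv.refl R M).prodCongr (cmp h))
    rw [triv_shear hD, one_comp hD] at h1
    rw [← triv_cmp hD hw h]
    exact h1.symm.trans (triv_sum_triv hD _ _).symm
  let V' : ((M.prod F).prod P) ≃ₗ[R] ((M.prod F).prod Q) :=
    ((LinearEquiv.prodAssoc R M F P).trans V).trans (LinearEquiv.prodAssoc R M F Q).symm
  have hV' : triv D (N := (M.prod F).prod P) (M := (M.prod F).prod Q) V' =
      (one D (M.prod F)).sum (finMor D (fdet w)) := by
    rw [← triv_comp_triv hD (M := M.prod (F.prod Q)) (N := (M.prod F).prod P)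
        (L := (M.prod F).prod Q), ← triv_comp_triv hD (M := M.prod (F.prod P))
        (N := (M.prod F).prod P) (L := M.prod (F.prod Q)), hV,
      ← one_sum_one hD,
      ((sim_assoc hD (one D M) (one D F) (finMor D (fdet w))).symm hD).eq hD, comp_assoc hD]
    rfl
  -- the difference `w - 1` is fixed by `s ∘ p`, which gives `W U = U V`
  have hUV : ∀ x, W (U.prodCongr (LinearEquiv.refl R P) x) =
      U.prodCongr (LinearEquiv.refl R Q) (V' x) := by
    rintro ⟨⟨m, φ⟩, a⟩
    have h1 : w (m + s φ, a) = w (m, 0) + w (s φ, a) := by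
      rw [← map_add, Prod.mk_add_mk, zero_add]
    have h2 := h (m + s φ, a)
    change (((w ((U (m, φ)).1, a)).1, (U (m, φ)).2), (w ((U (m, φ)).1, a)).2) =
      (U (m, φ + p ((w (s φ, a)).1 - s φ) + p ((w (m, 0)).1 - m)),
        (w (s φ, a)).2 + (w (m, 0)).2)
    have h3 : φ + p ((w (s φ, a)).1 - s φ) + p ((w (m, 0)).1 - m) =
        φ + p ((w (m + s φ, a)).1 - (m + s φ)) := by
      rw [h1, add_assoc, ← map_add]
      congr 2
      change _ = (w (m, 0)).1 + (w (s φ, a)).1 - (m + s φ)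
      abel
    have h4 : m + s (φ + p ((w (m + s φ, a)).1 - (m + s φ))) = (w (m + s φ, a)).1 := by
      rw [map_add, h2]
      change m + (s φ + ((w (m + s φ, a)).1 - (m + s φ))) = _
      abel
    rw [h3, hU, hU, h4]
    refine Prod.ext (Prod.ext rfl ?_) ?_
    · change φ - p (m + s φ) = φ + p ((w (m + s φ, a)).1 - (m + s φ)) - p (w (m + s φ, a)).1
      rw [map_sub]
      abel
    · change (w (m + s φ, a)).2 = _
      rw [h1]
      exact add_comm _ _
  have hW : triv D (N := (M.prod F).prod P) (M := (M.prod F).prod Q) W =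
      (one D (M.prod F)).sum (finMor D (fdet w)) := by
    have h1 : (triv D W).comp ((triv D U).sum (one D P)) =
        ((one D (M.prod F)).sum (finMor D (fdet w))).comp ((triv D U).sum (one D P)) := by
      rw [sum_comp_sum_of_left hD _ _ _ hdeg, one_comp hD, comp_one hD]
      have h2 : ((triv D U).sum (one D Q)).comp ((one D (M.prod F)).sum (finMor D (fdet w))) =
          (triv D U).sum (finMor D (fdet w)) := by
        rw [sum_comp_sum_of_left hD _ _ _ deg_one, one_comp hD, comp_one hD]
      rw [← h2, ← hV', one, one, triv_sum_triv hD, triv_sum_triv hD, triv_comp_triv hD,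
        triv_comp_triv hD]
      congr 1
      exact LinearEquiv.ext hUV
    rw [one, triv_sum_triv hD] at h1
    have h3 := congrArg (fun X => X.comp (triv D (N := (M.prod F).prod P) (M := (M.prod F).prod P)
      (U.prodCongr (LinearEquiv.refl R P)).symm)) h1
    dsimp only at h3
    rwa [comp_assoc hD, comp_assoc hD, triv_comp_triv_symm hD, comp_one hD, comp_one hD] at h3
  -- summing with the identity of `F` loses no information
  refine sum_triv_cancel (LinearEquiv.refl R F) (ofEquiv_eq_of_isFred hw) ?_
  have h1 := sim_rightComm hD (one D M) (finMor D (fdet w)) (one D F)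
  rw [deg_one, mul_zero, sgn_zero, one_smul, one_sum_one hD, ← hW] at h1
  have h2 : Sim (rightComm M Q F) (rightComm M P F) ((triv D w).sum (one D F)) (triv D W) := by
    rw [one, triv_sum_triv hD]
    exact sim_triv hD _ fun x => by
      change _ = rightComm M Q F (w.prodCongr (LinearEquiv.refl R F)
        ((rightComm M P F).symm (rightComm M P F x)))
      rw [LinearEquiv.symm_apply_apply]
  exact ((h2.symm hD).eq hD).trans ((h1.symm hD).eq hD).symm

end Fred

end Mor

end ShearDeterminants

/-! ### Compatibilities of the correspondence -/

namespace Mor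

section Unique

variable {D : DetData.{u}} {R : Type u} [CommRing R] {N M A B : ProjMod R} [Module.Finite R A]
  [Module.Finite R B]

lemma Rel.right_unique {f : AsympIso N M} {e : (N.prod A) ≃ₗ[R] (M.prod B)} (h : IsRes f e)
    {x : D.line f} {ξ ξ' : detTop B →ₗ[R] detTop A} (hx : Rel e (⟨f, x⟩ : Mor D N M) ξ)
    (hx' : Rel e (⟨f, x⟩ : Mor D N M) ξ') : ξ = ξ' :=
  ((rel_iff h x ξ).1 hx).symm.trans ((rel_iff h x ξ').1 hx')

variable (hD : D.IsDet)
include hD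

/-- Modifying a resolution on the side of `M` by an isomorphism that has a determinant. -/
lemma Rel.fred {B' : ProjMod R} [Module.Finite R B'] {X : Mor D N M}
    {e : (N.prod A) ≃ₗ[R] (M.prod B)} {e' : (N.prod A) ≃ₗ[R] (M.prod B')}
    {w : (M.prod B) ≃ₗ[R] (M.prod B')} (hw : IsFred w) (he : ∀ x, e' x = w (e x))
    {ξ : detTop B' →ₗ[R] detTop A} (h : Rel e' X ξ) : Rel e X (ξ ∘ₗ fdet w) := by
  have h1 : triv D (N := N.prod A) (M := M.prod B') e' = (triv D w).comp (triv D e) := by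
    rw [triv_comp_triv hD]
    congr 1
    exact LinearEquiv.ext he
  change _ = _
  rw [h, h1, triv_eq_of_isFred hD hw, ← comp_assoc hD, sum_comp_sum_of_right hD _ _ _ deg_one,
    one_comp hD, finMor_comp hD]

/-- Direct sums correspond to external products, up to the sign of `finMor_sum_finMor`. -/
lemma Rel.sum {N₂ M₂ A₂ B₂ : ProjMod R} [Module.Finite R A₂] [Module.Finite R B₂]
    {X : Mor D N M} {X₂ : Mor D N₂ M₂} {e : (N.prod A) ≃ₗ[R] (M.prod B)}
    {e₂ : (N₂.prod A₂) ≃ₗ[R] (M₂.prod B₂)} {ξ : detTop B →ₗ[R] detTop A}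
    {ξ₂ : detTop B₂ →ₗ[R] detTop A₂} (h : Rel e X ξ) (h₂ : Rel e₂ X₂ ξ₂) :
    Rel (sumE e e₂) (X.sum X₂) (sgn ((rk A₂ - rk B₂) * (rk B + rk A)) • box ξ ξ₂) := by
  have h3 := sim_middleFour hD X X₂ (one D A) (one D A₂)
  rw [deg_one, mul_zero, sgn_zero, one_smul, h, h₂, ← sum_comp_sum_of_right hD _ _ _ (deg_triv e),
    triv_sum_triv hD] at h3
  have h4 := sim_middleFour hD (one D M) (finMor D ξ) (one D M₂) (finMor D ξ₂)
  rw [deg_one, mul_zero, sgn_zero, one_smul] at h4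
  change _ = _
  rw [← finMor_sum_finMor hD, ← one_sum_one hD, ← one_sum_one hD, (h3.symm hD).eq hD,
    ← comp_assoc hD]
  have h5 : ((triv D (N := (M.prod A).prod (M₂.prod A₂)) (M := (M.prod M₂).prod (A.prod A₂))
      (LinearEquiv.prodProdProdComm R M M₂ A A₂).symm)).comp _ = _ := h4
  rw [h5, comp_assoc hD, comp_assoc hD, triv_comp_triv hD, triv_comp_triv hD]
  rfl

lemma Rel.rstab_finVal [Module.Finite R N] [Module.Finite R M] {X : Mor D N M}
    {e : (N.prod A) ≃ₗ[R] (M.prod B)} {ξ : detTop B →ₗ[R] detTop A} (h : Rel e X ξ) :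
    rstab A X.finVal = ((one D M).sum (finMor D ξ)).finVal ∘ₗ detMap e := by
  rw [← finVal_sum_one hD, h, finVal_comp hD, finVal_triv hD]

/-- In finite rank, an element of a determinant line is determined by its image under a resolution,
independently of the theory of determinant lines. -/
lemma Rel.finVal_eq {D' : DetData.{u}} (hD' : D'.IsDet) [Module.Finite R N] [Module.Finite R M]
    {X : Mor D N M} {X' : Mor D' N M} {e : (N.prod A) ≃ₗ[R] (M.prod B)}
    {ξ : detTop B →ₗ[R] detTop A} (h : Rel e X ξ) (h' : Rel e X' ξ) : X.finVal = X'.finVal := by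
  refine (rstab (A := M) (B := N) A).injective ?_
  rw [h.rstab_finVal hD, h'.rstab_finVal hD']
  congr 1
  refine detTop_hom_ext fun a b => ?_
  rw [finVal_sum_wedge hD, finVal_sum_wedge hD', finVal_one hD, finVal_one hD', finVal_finMor,
    finVal_finMor]

end Unique

section BaseChange

variable {D : DetData.{u}} {R : Type u} [CommRing R] (R' : Type u) [CommRing R'] [Algebra R R']
  {N M A B : ProjMod R}

/-- Base change of elements of determinant lines. -/
def bc (X : Mor D N M) : Mor D (N.baseChange R') (M.baseChange R') :=
  ⟨X.hom.baseChange R', D.baseChange R' X.hom (1 ⊗ₜ X.val)⟩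

variable (hD : D.IsDet)
include hD

lemma bc_comp {L : ProjMod R} (Y : Mor D M L) (X : Mor D N M) :
    (Y.comp X).bc R' = (Y.bc R').comp (X.bc R') :=
  (congrArg (Mor.mk _) (hD.baseChange_comp R' Y.hom X.hom Y.val X.val)).trans
    (comp_mk (AsympIso.baseChange_comp R' _ _) (Y.bc R').val (X.bc R').val)

lemma bc_triv (e : N ≃ₗ[R] M) : (triv D e).bc R' =
    triv D (N := N.baseChange R') (M := M.baseChange R') (e.baseChange R R' N M) :=
  (congrArg (Mor.mk _) (hD.baseChange_triv R' e)).trans (triv_mk _ _)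

lemma bc_one : (one D N).bc R' = one D (N.baseChange R') := by
  rw [one, bc_triv R' hD, one]
  congr 1
  exact LinearEquiv.toLinearMap_injective LinearMap.baseChange_id

lemma sim_bc_sum {N₂ M₂ : ProjMod R} (X : Mor D N M) (Y : Mor D N₂ M₂) :
    Sim (M := (M.prod M₂).baseChange R') (M' := (M.baseChange R').prod (M₂.baseChange R'))
      (N := (N.prod N₂).baseChange R') (N' := (N.baseChange R').prod (N₂.baseChange R'))
      (TensorProduct.prodRight R R' R' M M₂) (TensorProduct.prodRight R R' R' N N₂)
      ((X.sum Y).bc R') ((X.bc R').sum (Y.bc R')) :=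
  .of_transports (hD.baseChange_sum R' _ _ X.val Y.val)

variable [Module.Finite R A] [Module.Finite R B]

lemma bc_finMor (ξ : detTop B →ₗ[R] detTop A) : (finMor D ξ).bc R' = finMor D (bcHom R' ξ) := by
  rw [eq_finMor_iff]
  refine bcDet_hom_ext R' fun b => ?_
  rw [bcHom_bcDet]
  refine (hD.baseChange_fin R' _ (finMor D ξ).val b).trans ?_
  exact congrArg (fun η : detTop B →ₗ[R] detTop A => bcDet R' A (η b)) (finVal_finMor ξ)

lemma Rel.baseChange {X : Mor D N M} {e : (N.prod A) ≃ₗ[R] (M.prod B)}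
    {ξ : detTop B →ₗ[R] detTop A} (h : Rel e X ξ) : Rel (bcIso R' e) (X.bc R') (bcHom R' ξ) := by
  have h1 := sim_bc_sum R' hD X (one D A)
  have h2 := sim_bc_sum R' hD (one D M) (finMor D ξ)
  rw [h, bc_comp R' hD, bc_triv R' hD, bc_one R' hD] at h1
  rw [bc_one R' hD, bc_finMor R' hD] at h2
  change _ = _
  rw [h1.eq hD, ← comp_assoc hD, h2, comp_assoc hD, comp_assoc hD, triv_comp_triv hD,
    triv_comp_triv hD]
  rfl

end BaseChange

end Mor

/-! ### Comparison of two theories -/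

namespace DetData

open Mor

section Comparison

variable {D D' : DetData.{u}}

/-- The isomorphism between the determinant lines of two theories, defined by a resolution. -/
def compare (D D' : DetData.{u}) {R : Type u} [CommRing R] {N M : ProjMod R} (f : AsympIso N M) :
    ZLine.Iso (D.line f) (D'.line f) where
  toEquiv := (relEquiv D (resOf f).isRes).trans (relEquiv D' (resOf f).isRes).symm
  deg_eq := by rw [deg_line_of_isRes (resOf f).isRes, deg_line_of_isRes (resOf f).isRes]

variable (hD : D.IsDet) (hD' : D'.IsDet)
include hD hD'

set_option maxRecDepth 4000 in
/-- The isomorphism can be computed on any resolution: the correspondence is compatible, in both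
theories in the same way, with the moves which link two resolutions. -/
lemma rel_compare {R : Type u} [CommRing R] {N M A B : ProjMod R} [Module.Finite R A]
    [Module.Finite R B] {f : AsympIso N M} {e : (N.prod A) ≃ₗ[R] (M.prod B)} (h : IsRes f e)
    {x : D.line f} {ξ : detTop B →ₗ[R] detTop A} (hx : Rel e (⟨f, x⟩ : Mor D N M) ξ) :
    Rel e (⟨f, compare D D' f x⟩ : Mor D' N M) ξ := by
  refine res_connect (f := f) (fun {A B} _ _ e => ∀ ξ : detTop B →ₗ[R] detTop A,
    Rel e (⟨f, x⟩ : Mor D N M) ξ → Rel e (⟨f, compare D D' f x⟩ : Mor D' N M) ξ)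
    ?_ ?_ ?_ (resOf f).isRes h ?_ ξ hx
  · intro A B C _ _ _ e he
    refine ⟨fun H ξ hξ => ?_, fun H ξ hξ => (H _ (hξ.stab hD C)).of_stab hD' C he⟩
    obtain ⟨η, hη⟩ := exists_rel he x
    rw [hξ.right_unique (he.stab C) (hη.stab hD C)]
    exact (H η hη).stab hD' C
  · intro A B B' _ _ _ e e' w he he' hw hee H ξ hξ
    obtain ⟨η, hη⟩ := exists_rel he' (compare D D' f x)
    have h1 := (H _ (hξ.fred hD hw hee)).right_unique he (hη.fred hD' hw hee)
    have h2 : ξ = η := LinearMap.ext fun b => by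
      obtain ⟨a, rfl⟩ := (fdetEquiv hw).surjective b
      exact DFunLike.congr_fun h1 a
    rwa [h2]
  · intro A A' B _ _ _ e e' α he he' hee H ξ hξ
    have h1 := (H _ (hξ.perm hD α.symm (e' := e) fun n a => by
      rw [← hee, LinearEquiv.apply_symm_apply])).perm hD' α hee
    have h2 : detMap α ∘ₗ detMap α.symm ∘ₗ ξ = ξ :=
      LinearMap.ext fun b => detMap_detMap_symm_apply α (ξ b)
    rwa [h2] at h1
  · intro ξ hξ
    refine (rel_iff (resOf f).isRes _ ξ).2 ?_
    rw [← (rel_iff (resOf f).isRes x ξ).1 hξ]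
    exact (relEquiv D' (resOf f).isRes).apply_symm_apply _

lemma compare_eq_iff {R : Type u} [CommRing R] {N M A B : ProjMod R} [Module.Finite R A]
    [Module.Finite R B] {f : AsympIso N M} {e : (N.prod A) ≃ₗ[R] (M.prod B)} (h : IsRes f e)
    {x : D.line f} {y : D'.line f} {ξ : detTop B →ₗ[R] detTop A}
    (hx : Rel e (⟨f, x⟩ : Mor D N M) ξ) (hy : Rel e (⟨f, y⟩ : Mor D' N M) ξ) :
    compare D D' f x = y :=
  (rel_compare hD hD' h hx).unique h hy

/-- Any two theories of relative determinant lines are isomorphic. -/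
def compareIso : D.Iso D' where
  iso f := compare D D' f
  iso_comp {R _ N M L} g f y x := by
    let c := chainOf g f
    obtain ⟨ξ, hξ⟩ := exists_rel c.isRes₁ x
    obtain ⟨η, hη⟩ := exists_rel c.isRes₂ y
    have h1 := Rel.comp hD (e' := c.e₁.trans c.e₂) (fun _ => rfl) hξ hη
    have h2 := Rel.comp hD' (e' := c.e₁.trans c.e₂) (fun _ => rfl)
      (rel_compare hD hD' c.isRes₁ hξ) (rel_compare hD hD' c.isRes₂ hη)
    have h3 : (⟨g, compare D D' g y⟩ : Mor D' M L).deg = (⟨g, y⟩ : Mor D M L).deg :=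
      (compare D D' g).deg_eq.symm
    rw [h3] at h2
    exact compare_eq_iff hD hD' (c.isRes rfl) h1 h2
  iso_triv {R _ N M} e :=
    compare_eq_iff hD hD' (A := ProjMod.zero R) (B := ProjMod.zero R)
      (isRes_ofEquiv e fun _ => rfl) (rel_triv hD e (ProjMod.zero R))
      (rel_triv hD' e (ProjMod.zero R))
  iso_sum {R _ N₁ M₁ N₂ M₂} f₁ f₂ x y := by
    obtain ⟨ξ, hξ⟩ := exists_rel (resOf f₁).isRes x
    obtain ⟨η, hη⟩ := exists_rel (resOf f₂).isRes y
    exact compare_eq_iff hD hD' ((resOf f₁).isRes.sumE (resOf f₂).isRes) (hξ.sum hD hη)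
      ((rel_compare hD hD' (resOf f₁).isRes hξ).sum hD'
        (rel_compare hD hD' (resOf f₂).isRes hη))
  iso_fin {R _ N M _ _} f x := by
    obtain ⟨ξ, hξ⟩ := exists_rel (resOf f).isRes x
    have h1 := hξ.finVal_eq hD hD' (rel_compare hD hD' (resOf f).isRes hξ)
    exact (contractEquiv (detTop M) (detTop N)).injective h1.symm
  iso_baseChange {R _} R' {_ _ N M} f x := by
    obtain ⟨ξ, hξ⟩ := exists_rel (resOf f).isRes x
    exact compare_eq_iff hD hD' ((resOf f).isRes.baseChange R') (hξ.baseChange R' hD)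
      ((rel_compare hD hD' (resOf f).isRes hξ).baseChange R' hD')

end Comparison

namespace Iso

variable {D D' : DetData.{u}}

lemma ext_of_apply {θ θ' : D.Iso D'} (h : ∀ {R : Type u} [CommRing R] {N M : ProjMod R}
    (f : AsympIso N M) (x : D.line f), θ.iso f x = θ'.iso f x) : θ = θ' := by
  obtain ⟨i, _, _, _, _, _⟩ := θ
  obtain ⟨i', _, _, _, _, _⟩ := θ'
  congr 1
  funext R _ N M f
  exact ZLine.Iso.ext (LinearEquiv.ext (h f))

variable (θ : D.Iso D') {R : Type u} [CommRing R] {N M : ProjMod R}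

/-- The action of an isomorphism of theories on elements of determinant lines. -/
def map (X : Mor D N M) : Mor D' N M := ⟨X.hom, θ.iso X.hom X.val⟩

lemma map_comp {L : ProjMod R} (Y : Mor D M L) (X : Mor D N M) :
    θ.map (Y.comp X) = (θ.map Y).comp (θ.map X) :=
  congrArg (Mor.mk _) (θ.iso_comp _ _ Y.val X.val)

lemma map_sum {N₂ M₂ : ProjMod R} (X : Mor D N M) (Y : Mor D N₂ M₂) :
    θ.map (X.sum Y) = (θ.map X).sum (θ.map Y) :=
  congrArg (Mor.mk _) (θ.iso_sum _ _ X.val Y.val)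

lemma map_triv (e : N ≃ₗ[R] M) : θ.map (Mor.triv D e) = Mor.triv D' e :=
  congrArg (Mor.mk _) (θ.iso_triv e)

variable {A B : ProjMod R} [Module.Finite R A] [Module.Finite R B]

lemma map_finMor (ξ : detTop B →ₗ[R] detTop A) : θ.map (finMor D ξ) = finMor D' ξ := by
  rw [eq_finMor_iff]
  exact (congrArg (fun z => contract z) (θ.iso_fin _ (finMor D ξ).val)).trans (finVal_finMor ξ)

/-- Isomorphisms of theories preserve the correspondence `Rel`. -/
lemma rel_map {X : Mor D N M} {e : (N.prod A) ≃ₗ[R] (M.prod B)} {ξ : detTop B →ₗ[R] detTop A}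
    (h : Rel e X ξ) : Rel e (θ.map X) ξ := by
  have h1 := congrArg θ.map h
  rw [map_sum, map_comp, map_sum, map_triv, map_finMor] at h1
  change (θ.map X).sum (θ.map (Mor.triv D _)) = ((θ.map (Mor.triv D _)).sum _).comp _ at h1
  rwa [map_triv, map_triv] at h1

end Iso

/-- The isomorphism is unique, as the correspondence `Rel` is formulated in terms of the structure
that isomorphisms of theories preserve. -/
lemma eq_compareIso {D D' : DetData.{u}} (hD : D.IsDet) (hD' : D'.IsDet) (θ : D.Iso D') :
    θ = compareIso hD hD' :=
  Iso.ext_of_apply fun f x => by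
    obtain ⟨ξ, hξ⟩ := exists_rel (resOf f).isRes x
    exact (compare_eq_iff hD hD' (resOf f).isRes hξ (θ.rel_map hξ)).symm

end DetData

end RelDet

end

theorem proposition2p7 :
    (∃ D : RelDet.DetData.{u}, D.IsDet) ∧
      ∀ D D' : RelDet.DetData.{u}, D.IsDet → D'.IsDet →
        ∃ θ : D.Iso D', ∀ θ' : D.Iso D', θ' = θ := by
  exact ⟨⟨RelDet.detData, RelDet.isDet_detData⟩, fun D D' hD hD' =>
    ⟨RelDet.DetData.compareIso hD hD', RelDet.DetData.eq_compareIso hD hD'⟩⟩
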